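/- **Setting.** Let $\overline\Omega\subset\mathbb R^3$ be the union of a finite conforming family of closed tetrahedra (macro-elements). Some edges of macro-elements are marked as (parts of) singular edges and some vertices as singular vertices, such that each macro-element $K$ has at most one singular edge and at most one singular vertex, and the vertex lies on the edge if $K$ has both. To each $K$ belong grading parameters $\mu_K,\nu_K\in(0,1]$. If $K$ has a singular edge, denote it by $ab$, where $a$ is the singular vertex of $K$ if there is one, and let $cd$ be the opposite edge. Let $x_1,x_2,x_3$ be a Cartesian coordinate system whose $x_3$-axis contains $ab$, with origin $a$ if $a$ is a singular vertex, and put $r=(x_1^2+x_2^2)^{1/2}$, $R=|x|$, $\theta=r/R$. For an open set $U$, $$\|v\|_{V^{1,2}_{\beta,\delta}(U)}^2=\int_U|R^{\beta-1}\theta^{\delta-1}v|^2+\sum_{j=1}^3\int_U|R^{\beta}\theta^{\delta}\partial_jv|^2$$ with weak derivatives, and $V^{1,2}_{\beta,\delta}(U)$ is the space of the functions for which this is defined and finite. **Meshes.** Let $\mathcal T_h$ be a conforming tetrahedral mesh of $\overline\Omega$, each element of which lies in one macro-element. In a macro-element $K$ with a singular edge the mesh has the following form, with positive integers $N_K,n_K$: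 the planes $p_k$, $k=0,\dots,N_K$, contain $cd$ and the point $s_k=a+t_k(b-a)$, where $t_k=k/N_K$ if $K$ has no singular vertex and $t_k=(k/N_K)^{1/\nu_K}$ otherwise; in the triangle $s_kcd$ the nodes are $s_k+\rho_{ij}\frac i{n_K}(c-s_k)+\rho_{ij}\frac j{n_K}(d-s_k)$, $\rho_{ij}=\big(\frac{i+j}{n_K}\big)^{1/\mu_K-1}$, $i+j\le n_K$ (a coordinate transformation of the uniform triangulation); the corresponding triangles in consecutive planes are joined to (possibly degenerate) prisms, and these are cut into tetrahedra without additional nodes. For an element $T\subset K$ let $h_{3,T}$ be the length of its edge $e_{3,T}$ parallel to $ab$ and $h_{1,T}=h_{2,T}$ the mean length of two edges of $T$ that intersect $e_{3,T}$ and are each contained in one of the planes $p_k$. **Interpolant.** Let $\mathcal N$ be the set of nodes of $\mathcal T_h$, $\mathcal N_c$ the set of vertices of macro-elements (coupling nodes), and $\mathcal N_s$ the set of nodes on singular edges. To each $n\in\mathcal N\setminus(\mathcal N_c\cup\mathcal N_s)$ an edge $\sigma_n$ of the mesh with endpoint $n$ is associated such that: $\sigma_n$ lies in every closed macro-element and in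 every face and edge of a macro-element that contains $n$; if $n$ belongs to a macro-element $K$ with a singular edge, then $\sigma_n$ lies in one of the planes $p_k$ of $K$; and if two such nodes of $K$ have the same orthogonal projection along $ab$, then so do their edges. With the piecewise linear nodal basis functions $\phi_n$ and the $L^2(\sigma_n)$-projection $\Pi_{\sigma_n}$ onto the polynomials of degree at most one, $$D_hu=\sum_{n\in\mathcal N\setminus(\mathcal N_c\cup\mathcal N_s)}(\Pi_{\sigma_n}u)(n)\,\phi_n .$$ For an element $T\subset K$, $K$ having a singular edge, the patch $S_T\subset K$ is the interior of a union of prisms lying between the two consecutive planes of $K$ that enclose $T$, containing $T$, connected through common faces, with $\sigma_n\subset\overline{S_T}$ for all nodes $n\in\mathcal N\setminus(\mathcal N_c\cup\mathcal N_s)$ of $T$, and consisting of the least possible number of prisms. **Statement.** Fix the macro-partition, the grading parameters and $C_0$. 1. Let $\delta\in[0,1)$. There is a constant $C>0$, depending only on the macro-partition, the grading parameters, $C_0$ and $\delta$, such that the following holds for all such meshes, all admissible choices of the edges $\sigma_n$, all macro-elements $K$ with a singular edge and all $T\subset K$ with $h_{1,T}=h_{2,T}\le C_0h_{3,T}$ whose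 patch $S_T$ has zero distance to the singular edge. If $u$ is continuous on $\overline{S_T}$, vanishes on the part of the singular edge in $\overline{S_T}$, has a weak gradient in $S_T$, and $\partial_1u,\partial_2u\in V^{1,2}_{\delta,\delta}(S_T)$, $\partial_3u\in V^{1,2}_{0,0}(S_T)$, then $$|u-D_hu|_{H^1(T)}\le C\,h_{1,T}^{1-\delta}\sum_{i=1}^2\|\partial_iu\|_{V^{1,2}_{\delta,\delta}(S_T)}+C\,h_{3,T}\|\partial_3u\|_{V^{1,2}_{0,0}(S_T)}.$$ 2. Let $\beta,\delta\in[0,1)$ with $\beta+\delta<1$. There is a constant $C>0$, depending only on the macro-partition, the grading parameters, $C_0$, $\beta$ and $\delta$, such that the following holds for all meshes, edges $\sigma_n$, $K$ and $T$ as in 1 for which $S_T$ has zero distance also to the singular vertex $a$ of $K$. If $u$ is continuous on $\overline{S_T}\setminus\{a\}$, vanishes on the part of the singular edge in $\overline{S_T}\setminus\{a\}$, has a weak gradient in $S_T$, and $\partial_1u,\partial_2u\in V^{1,2}_{\beta,\delta}(S_T)$, $\partial_3u\in V^{1,2}_{\beta,0}(S_T)$, then $$|u-D_hu|_{H^1(T)}\le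 C\,h_{1,T}^{1-\beta-\delta}h_{3,T}^{\delta}\sum_{i=1}^2\|\partial_iu\|_{V^{1,2}_{\beta,\delta}(S_T)}+C\,h_{1,T}^{-\beta}h_{3,T}\|\partial_3u\|_{V^{1,2}_{\beta,0}(S_T)}.$$ -/

import Mathlib

open MeasureTheory Set
open scoped ContDiff

noncomputable section

/-- Three-dimensional Euclidean space. -/
abbrev E3 : Type := EuclideanSpace ℝ (Fin 3)

/-- A nondegenerate tetrahedron, given by its four (labelled) vertices. -/
abbrev Tet : Type := Affine.Simplex ℝ E3 3

namespace Tet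

/-- The set of the vertices. -/
def verts (T : Tet) : Set E3 := Set.range T.points

/-- The closed tetrahedron. -/
def closed (T : Tet) : Set E3 := convexHull ℝ T.verts

/-- The open tetrahedron. -/
def opened (T : Tet) : Set E3 := interior T.closed

/-- The vertices form an affine basis of the space. -/
def basis (T : Tet) : AffineBasis (Fin 4) ℝ E3 :=
  ⟨T.points, T.independent, by
    rw [T.independent.affineSpan_eq_top_iff_card_eq_finrank_add_one]
    simp⟩

/-- The affine function that is `1` at the vertex `n` and `0` at the other vertices of `T`
(it is `0` if `n` is not a vertex of `T`). -/
def hat (T : Tet) (n x : E3) : ℝ :=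
  open Classical in ∑ i : Fin 4, if T.points i = n then T.basis.coord i x else 0

end Tet

/-! ### Triangulations, macro-elements -/

/-- A finite conforming family of tetrahedra: two closed elements intersect in the convex hull of
their common vertices (a common face, edge or vertex, or nothing), and distinct elements have
distinct vertex sets. -/
structure Triangulation where
  elems : Finset Tet
  conforming : ∀ S ∈ elems, ∀ T ∈ elems,
    S.closed ∩ T.closed = convexHull ℝ (S.verts ∩ T.verts)
  distinct : ∀ S ∈ elems, ∀ T ∈ elems, S.verts = T.verts → S = T

namespace Triangulation

/-- The union of the closed elements. -/
def region (M : Triangulation) : Set E3 := ⋃ T ∈ M.elems, T.closed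

/-- The set of the nodes. -/
def nodes (M : Triangulation) : Finset E3 :=
  open Classical in M.elems.biUnion fun T => Finset.univ.image T.points

/-- The piecewise linear nodal basis function of the node `n` (well defined on `M.region`, because
the triangulation is conforming; `0` outside). -/
def nodalBasis (M : Triangulation) (n x : E3) : ℝ :=
  open Classical in if h : ∃ T ∈ M.elems, x ∈ T.closed then h.choose.hat n x else 0

end Triangulation

/-- A partition of (the closure of) a polyhedral domain into macro-elements, with the set of those
edges of macro-elements which are (part of) a singular edge, each given as the set of its two
endpoints, and the set of the singular vertices. A macro-element has at most one singular edge and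
at most one singular vertex, and if it has both, then the vertex is an endpoint of the edge. -/
structure MacroPartition extends Triangulation where
  sEdges : Set (Set E3)
  sVerts : Set E3
  sEdges_edge : ∀ e ∈ sEdges, ∃ K ∈ elems, ∃ i j : Fin 4, i ≠ j ∧ e = {K.points i, K.points j}
  sVerts_vertex : ∀ v ∈ sVerts, ∃ K ∈ elems, v ∈ K.verts
  sEdge_unique : ∀ K ∈ elems, ∀ e ∈ sEdges, ∀ e' ∈ sEdges,
    e ⊆ K.verts → e' ⊆ K.verts → e = e'
  sVert_unique : ∀ K ∈ elems, ∀ v ∈ sVerts, ∀ v' ∈ sVerts,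
    v ∈ K.verts → v' ∈ K.verts → v = v'
  sVert_mem_sEdge : ∀ K ∈ elems, ∀ e ∈ sEdges, ∀ v ∈ sVerts,
    e ⊆ K.verts → v ∈ K.verts → v ∈ e

/-- `K` is a macro-element with a singular edge, labelled such that the singular edge is `ab`, the
opposite edge is `cd`, and the singular vertex of `K`, if there is one, is `a`. -/
structure EdgeLabel (P : MacroPartition) (K : Tet) (a b c d : E3) : Prop where
  mem : K ∈ P.elems
  verts_eq : K.verts = {a, b, c, d}
  edge : {a, b} ∈ P.sEdges
  vertex : ∀ v ∈ P.sVerts, v ∈ K.verts → v = a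

/-! ### Graded meshes in the macro-elements with a singular edge -/

/-- The relative position on the segment `ab` of its intersection with the `k`-th of the planes
`0, …, N`: equidistant if there is no singular vertex, graded towards `a` with the parameter `ν`
if `a` is a singular vertex. -/
def gradePos (P : MacroPartition) (ν : ℝ) (N : ℕ) (a : E3) (k : ℕ) : ℝ :=
  open Classical in if a ∈ P.sVerts then ((k : ℝ) / N) ^ (1 / ν) else (k : ℝ) / N

/-- The intersection of the segment `ab` with the `k`-th plane. -/
def edgePoint (P : MacroPartition) (ν : ℝ) (N : ℕ) (a b : E3) (k : ℕ) : E3 :=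
  a + gradePos P ν N a k • (b - a)

/-- The `k`-th plane; it contains the edge `cd` and is transversal to `ab`. -/
def gradePlane (P : MacroPartition) (ν : ℝ) (N : ℕ) (a b c d : E3) (k : ℕ) : AffineSubspace ℝ E3 :=
  affineSpan ℝ {edgePoint P ν N a b k, c, d}

/-- The node in the `k`-th plane with the index `p = (i, j)`, `i + j ≤ n`: in the triangle with the
vertices `s = edgePoint k`, `c`, `d`, the node of the uniform lattice with barycentric coordinates
`i/n`, `j/n` (with respect to `c`, `d`) is moved by the coordinate transformation that multiplies
these two coordinates by `((i+j)/n)^(1/μ - 1)`. -/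
def gradeNode (P : MacroPartition) (μ ν : ℝ) (N n : ℕ) (a b c d : E3) (k : ℕ) (p : ℕ × ℕ) : E3 :=
  edgePoint P ν N a b k
    + ((((p.1 : ℝ) + p.2) / n) ^ (1 / μ - 1) * ((p.1 : ℝ) / n)) • (c - edgePoint P ν N a b k)
    + ((((p.1 : ℝ) + p.2) / n) ^ (1 / μ - 1) * ((p.2 : ℝ) / n)) • (d - edgePoint P ν N a b k)

/-- The index triples of the `n²` triangles of the uniform triangulation of a triangle. -/
def IsLatticeTriangle (n : ℕ) (τ : Finset (ℕ × ℕ)) : Prop :=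
  ∃ i j : ℕ, (i + j + 1 ≤ n ∧ τ = {(i, j), (i + 1, j), (i, j + 1)}) ∨
    (i + j + 2 ≤ n ∧ τ = {(i + 1, j), (i, j + 1), (i + 1, j + 1)})

/-- The six (or fewer, at the opposite edge) vertices of the prism between the planes `k` and
`k + 1` over the triangle `τ`. -/
def prismVerts (P : MacroPartition) (μ ν : ℝ) (N n : ℕ) (a b c d : E3) (k : ℕ)
    (τ : Finset (ℕ × ℕ)) : Set E3 :=
  (gradeNode P μ ν N n a b c d k '' τ) ∪ (gradeNode P μ ν N n a b c d (k + 1) '' τ)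

/-- The closed prism between the planes `k` and `k + 1` over the triangle `τ`; its faces other than
top and bottom are parallel to the edge `ab`. -/
def prism (P : MacroPartition) (μ ν : ℝ) (N n : ℕ) (a b c d : E3) (k : ℕ)
    (τ : Finset (ℕ × ℕ)) : Set E3 :=
  convexHull ℝ (prismVerts P μ ν N n a b c d k τ)

/-- A mesh of the domain which matches the macro-partition `P` and is, in each macro-element `K`
with a singular edge, anisotropically graded with the parameters `μ K`, `ν K`: it is obtained from
`strips K` strips between consecutive planes and from `layers K` subdivisions in each of the planes
by cutting the resulting prisms into tetrahedra without further nodes. -/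
structure GradedMesh (P : MacroPartition) (μ ν : Tet → ℝ) extends Triangulation where
  region_eq : toTriangulation.region = P.region
  matching : ∀ T ∈ elems, ∃ K ∈ P.elems, T.closed ⊆ K.closed
  strips : Tet → ℕ
  layers : Tet → ℕ
  strips_pos : ∀ K ∈ P.elems, 0 < strips K
  layers_pos : ∀ K ∈ P.elems, 0 < layers K
  graded : ∀ K a b c d, EdgeLabel P K a b c d → ∀ T ∈ elems, T.closed ⊆ K.closed →
    ∃ k < strips K, ∃ τ, IsLatticeTriangle (layers K) τ ∧
      T.verts ⊆ prismVerts P (μ K) (ν K) (strips K) (layers K) a b c d k τ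

/-- The characteristic lengths of the element `T` in a macro-element labelled `a b c d`: `h₃` is the
length of the edge `e₃` of `T` parallel to the singular edge, and `h₁ = h₂` is the mean length of
two edges of `T` which intersect `e₃` and are each contained in some plane of the macro-element. -/
def IsLengths (P : MacroPartition) (ν : ℝ) (N : ℕ) (a b c d : E3) (T : Tet) (h₁ h₃ : ℝ) : Prop :=
  ∃ i j p q p' q' : Fin 4,
    i ≠ j ∧ (∃ s : ℝ, T.points j - T.points i = s • (b - a)) ∧
    h₃ = dist (T.points i) (T.points j) ∧
    (p = i ∨ p = j) ∧ q ≠ i ∧ q ≠ j ∧ (p' = i ∨ p' = j) ∧ q' ≠ i ∧ q' ≠ j ∧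
    (p, q) ≠ (p', q') ∧
    (∃ k ≤ N, T.points p ∈ gradePlane P ν N a b c d k ∧ T.points q ∈ gradePlane P ν N a b c d k) ∧
    (∃ k ≤ N, T.points p' ∈ gradePlane P ν N a b c d k ∧
      T.points q' ∈ gradePlane P ν N a b c d k) ∧
    h₁ = (dist (T.points p) (T.points q) + dist (T.points p') (T.points q')) / 2

/-! ### The quasi-interpolation operator -/

/-- The coupling nodes (the vertices of the macro-elements) and the nodes on the singular edges:
the nodes which are not used in the definition of the interpolant. -/
def excludedNodes (P : MacroPartition) : Set E3 :=
  {n | ∃ K ∈ P.elems, n ∈ K.verts} ∪ {n | ∃ e ∈ P.sEdges, n ∈ convexHull ℝ e}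

/-- Admissible choice of the edges `σₙ`; `σ n` is the other endpoint of the edge `σₙ`. -/
structure EdgeSelection {P : MacroPartition} {μ ν : Tet → ℝ} (M : GradedMesh P μ ν)
    (σ : E3 → E3) : Prop where
  /-- `σₙ` is an edge of the mesh with the endpoint `n`. -/
  edge : ∀ n ∈ M.nodes, n ∉ excludedNodes P →
    σ n ≠ n ∧ ∃ T ∈ M.elems, n ∈ T.verts ∧ σ n ∈ T.verts
  /-- `σₙ` belongs to the macro-elements, and to the faces and edges of macro-elements,
  to which `n` belongs. -/
  face : ∀ n ∈ M.nodes, n ∉ excludedNodes P → ∀ K ∈ P.elems, ∀ s ⊆ K.verts,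
    n ∈ convexHull ℝ s → segment ℝ n (σ n) ⊆ convexHull ℝ s
  /-- At a macro-element with a singular edge, `σₙ` is contained in one of the planes. -/
  plane : ∀ n ∈ M.nodes, n ∉ excludedNodes P → ∀ K a b c d, EdgeLabel P K a b c d → n ∈ K.closed →
    ∃ k ≤ M.strips K, n ∈ gradePlane P (ν K) (M.strips K) a b c d k ∧
      σ n ∈ gradePlane P (ν K) (M.strips K) a b c d k
  /-- Nodes with the same projection along the singular edge have edges with the same
  projection. -/
  projection : ∀ n ∈ M.nodes, n ∉ excludedNodes P → ∀ m ∈ M.nodes, m ∉ excludedNodes P →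
    ∀ K a b c d, EdgeLabel P K a b c d → n ∈ K.closed → m ∈ K.closed →
    (∃ s : ℝ, n - m = s • (b - a)) → ∃ s : ℝ, σ n - σ m = s • (b - a)

/-- The value at the endpoint `n` of the `L²`-projection of `u` onto the polynomials of degree at
most one on the edge from `n` to `m`; see `edgeProj_eq_of_orthogonal`. -/
def edgeProj (u : E3 → ℝ) (n m : E3) : ℝ :=
  ∫ t in (0 : ℝ)..1, (4 - 6 * t) * u (n + t • (m - n))

/-- If `t ↦ α + β t` is the `L²`-projection of `u` on the edge from `n` to `m`, that is,
if the error is orthogonal to all polynomials of degree at most one, then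
`edgeProj u n m` is its value `α` at `n`. -/
theorem edgeProj_eq_of_orthogonal (u : E3 → ℝ) (n m : E3)
    (hu : IntervalIntegrable (fun t : ℝ => u (n + t • (m - n))) volume 0 1) (α β : ℝ)
    (h : ∀ q r : ℝ, ∫ t in (0 : ℝ)..1, (u (n + t • (m - n)) - (α + β * t)) * (q + r * t) = 0) :
    edgeProj u n m = α := by
  have h1 := h 4 (-6)
  have e1 : IntervalIntegrable (fun t : ℝ => (4 - 6 * t) * u (n + t • (m - n))) volume 0 1 :=
    hu.continuousOn_mul (by fun_prop)
  have e2 : IntervalIntegrable (fun t : ℝ => (α + β * t) * (4 - 6 * t)) volume 0 1 :=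
    Continuous.intervalIntegrable (by fun_prop) _ _
  have e3 : ∫ t in (0 : ℝ)..1, (α + β * t) * (4 - 6 * t) = α := by
    have : ∀ t : ℝ, HasDerivAt
        (fun t : ℝ => 4 * α * t + (4 * β - 6 * α) * t ^ 2 / 2 - 2 * β * t ^ 3)
        ((α + β * t) * (4 - 6 * t)) t := by
      intro t
      have := (((hasDerivAt_id t).const_mul (4 * α)).add
        (((hasDerivAt_pow 2 t).const_mul (4 * β - 6 * α)).div_const 2)).sub
        ((hasDerivAt_pow 3 t).const_mul (2 * β))
      convert! this using 1
      norm_num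
      ring
    rw [intervalIntegral.integral_eq_sub_of_hasDerivAt (fun t _ => this t) e2]
    ring
  have e4 : (fun t : ℝ => (u (n + t • (m - n)) - (α + β * t)) * (4 + -6 * t))
      = fun t : ℝ => (4 - 6 * t) * u (n + t • (m - n)) - (α + β * t) * (4 - 6 * t) := by
    funext t; ring
  rw [e4, intervalIntegral.integral_sub e1 e2, e3] at h1
  unfold edgeProj
  linarith

/-- The quasi-interpolant of `u`. -/
def quasiInterp {P : MacroPartition} {μ ν : Tet → ℝ} (M : GradedMesh P μ ν) (σ : E3 → E3)
    (u : E3 → ℝ) (x : E3) : ℝ :=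
  open Classical in ∑ n ∈ M.nodes.filter (· ∉ excludedNodes P),
    edgeProj u n (σ n) * M.toTriangulation.nodalBasis n x

/-! ### The patch of an element -/

/-- The open prismatic domain between the planes `k` and `k + 1` over a set `B` of triangles. -/
def patchDomain (P : MacroPartition) (μ ν : ℝ) (N n : ℕ) (a b c d : E3) (k : ℕ)
    (B : Finset (Finset (ℕ × ℕ))) : Set E3 :=
  interior (⋃ τ ∈ B, prism P μ ν N n a b c d k τ)

/-- `B` and the strip number `k` describe a prismatic domain that is admissible as a patch of `T`:
it is a union of elements containing `T`, it is connected (through common faces), it is contained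
in the macro-element `K`, its top and bottom are contained in two planes of `K`, and its closure
contains `σₙ` for all nodes `n` of `T` that have such an edge. -/
structure IsAdmissiblePatch {P : MacroPartition} {μ ν : Tet → ℝ} (M : GradedMesh P μ ν)
    (σ : E3 → E3) (K : Tet) (a b c d : E3) (T : Tet) (k : ℕ) (B : Finset (Finset (ℕ × ℕ))) :
    Prop where
  strip : k < M.strips K
  lattice : ∀ τ ∈ B, IsLatticeTriangle (M.layers K) τ
  contains : ∃ τ ∈ B, T.closed ⊆ prism P (μ K) (ν K) (M.strips K) (M.layers K) a b c d k τ
  connected : ∀ τ ∈ B, ∀ τ' ∈ B,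
    Relation.ReflTransGen (fun s t => s ∈ B ∧ t ∈ B ∧ (s ∩ t).card = 2) τ τ'
  edges : ∀ n ∈ T.verts, n ∉ excludedNodes P → segment ℝ n (σ n) ⊆
    closure (patchDomain P (μ K) (ν K) (M.strips K) (M.layers K) a b c d k B)

/-- `B` and `k` describe a patch `S_T`: an admissible domain that is as small as possible. -/
structure IsPatch {P : MacroPartition} {μ ν : Tet → ℝ} (M : GradedMesh P μ ν)
    (σ : E3 → E3) (K : Tet) (a b c d : E3) (T : Tet) (k : ℕ) (B : Finset (Finset (ℕ × ℕ))) :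
    Prop where
  admissible : IsAdmissiblePatch M σ K a b c d T k B
  minimal : ∀ k' B', IsAdmissiblePatch M σ K a b c d T k' B' → B.card ≤ B'.card

/-- `T` is an element of the mesh `M` in the macro-element `K` (labelled `a b c d`) with a singular
edge, with the characteristic lengths `h₁ = h₂ ≤ C₀ h₃` and `h₃`, and `S` is its patch, which has
zero distance to the singular edge `ab`. -/
structure NeedleAtEdge {P : MacroPartition} {μ ν : Tet → ℝ} (M : GradedMesh P μ ν)
    (σ : E3 → E3) (C₀ : ℝ) (K : Tet) (a b c d : E3) (T : Tet) (S : Set E3) (h₁ h₃ : ℝ) :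
    Prop where
  selection : EdgeSelection M σ
  label : EdgeLabel P K a b c d
  mem : T ∈ M.elems
  subset : T.closed ⊆ K.closed
  lengths : IsLengths P (ν K) (M.strips K) a b c d T h₁ h₃
  needle : h₁ ≤ C₀ * h₃
  patch : ∃ k B, IsPatch M σ K a b c d T k B ∧
    S = patchDomain P (μ K) (ν K) (M.strips K) (M.layers K) a b c d k B
  touches : (closure S ∩ segment ℝ a b).Nonempty

/-! ### Weak derivatives and weighted norms -/

/-- `W` is the weak gradient of `v` in the open set `U`. -/
def HasWeakGradient (U : Set E3) (v : E3 → ℝ) (W : E3 → E3) : Prop :=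
  LocallyIntegrableOn v U ∧ LocallyIntegrableOn W U ∧
    ∀ φ : E3 → ℝ, ContDiff ℝ ∞ φ → HasCompactSupport φ → tsupport φ ⊆ U →
      ∫ x in U, v x • gradient φ x = -∫ x in U, φ x • W x

/-- The `H¹(U)`-seminorm; `∞` if `v` has no weak gradient (which is unique almost everywhere) or
if the weak gradient is not square integrable. -/
def h1Seminorm (U : Set E3) (v : E3 → ℝ) : ENNReal :=
  ⨅ (W : E3 → E3) (_ : HasWeakGradient U v W), (∫⁻ x in U, ‖W x‖ₑ ^ 2) ^ (1 / 2 : ℝ)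

/-- A Cartesian coordinate system whose third axis contains the edge `ab` and whose origin is `a`
if `a` is a singular vertex. -/
structure IsFrame (P : MacroPartition) (a b o : E3) (e : OrthonormalBasis (Fin 3) ℝ E3) :
    Prop where
  axis : ∃ s : ℝ, b - a = s • e 2
  origin : o ∈ affineSpan ℝ {a, b}
  vertex : a ∈ P.sVerts → o = a

/-- The distance to the third axis. -/
def axisDist (o : E3) (e : OrthonormalBasis (Fin 3) ℝ E3) (x : E3) : ℝ :=
  Real.sqrt (inner ℝ (e 0) (x - o) ^ 2 + inner ℝ (e 1) (x - o) ^ 2)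

/-- The weight `R ^ β * θ ^ δ`, where `R` is the distance to the origin and `θ = r / R` is the
angular distance from the third axis. -/
def weight (o : E3) (e : OrthonormalBasis (Fin 3) ℝ E3) (β δ : ℝ) (x : E3) : ℝ :=
  dist x o ^ β * (axisDist o e x / dist x o) ^ δ

/-- The norm in the weighted Sobolev space `V^{1,2}_{β,δ}(U)`; `∞` if `v` does not belong to this
space. -/
def vNorm (o : E3) (e : OrthonormalBasis (Fin 3) ℝ E3) (β δ : ℝ) (U : Set E3) (v : E3 → ℝ) :
    ENNReal :=
  ⨅ (G : E3 → E3) (_ : HasWeakGradient U v G),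
    ((∫⁻ x in U, ‖weight o e (β - 1) (δ - 1) x * v x‖ₑ ^ 2) +
      ∫⁻ x in U, ‖weight o e β δ x • G x‖ₑ ^ 2) ^ (1 / 2 : ℝ)

/-- The partial derivative in the direction of the `i`-th axis, from the gradient `W`. -/
def partialOf (e : OrthonormalBasis (Fin 3) ℝ E3) (W : E3 → E3) (i : Fin 3) (x : E3) : ℝ :=
  inner ℝ (e i) (W x)

end

/-! No polynomial approximation is involved. The patch touches the singular edge, where `u`
vanishes, so `u` and `D_h u` can be bounded separately: |u - D_h u| ≤ |u| + |D_h u| in the seminorm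
on T. Let λ and D be the transversal and the longitudinal size of the layer near the edge. They are
comparable with h₁ and h₃, and the needle condition gives λ ≤ C D.

The term |u|: the weighted norm controls w ∂ᵢu / r, with r the distance from the edge. If r^s ≤ A w,
then r ≤ C λ on the patch gives ‖∂ᵢu‖ ≤ C A λ^(1-s) times the weighted norm
(`exists_direct_constant`).

The term |D_h u|: on T the interpolant is affine and its vertex values are 0 or edge functionals of
`u`. If these are at most m, the gradient is at most C m / λ, and the volume of T is at most C λ² D.
Hence a bound of the functionals by D^(-1/2) times the right-hand side is needed. An edge functional
is bounded by the L¹-norm of `u` on the edge. A trace estimate (`lintegral_edge_le`) bounds this by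
the mean over a prism of |u|, of first derivatives and of one mixed second derivative, which has at
least one direction in a plane of the mesh. The second derivative taken twice in the long direction
never occurs; it would cost D² where only λ D is available. The mean of |u| over the prism at the
axis is bounded by a Hardy inequality, as `u` vanishes there (`lintegral_axis_prism_le`); a Poincaré
inequality on boxes across common faces carries the bound from prism to prism
(`lintegral_neighbour_le`). The L¹-norms of the derivatives are estimated by Cauchy-Schwarz against
r^(-s), which is square integrable in the plane exactly for s < 1 (`exists_weight_constant`).

The constants are uniform because the grading is a power law: near the edge the nodes are λ times a
fixed lattice, whatever the number of layers. Minimality bounds the number of prisms in a patch by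
72 (`card_patch_le`), and a patch touching the edge contains the prism at the edge
(`corner_mem_of_touches`). So its lattice indices are bounded and, up to affine maps, only finitely
many configurations occur.

In statement 1, w = r^δ and s = δ. In statement 2, s = max β δ, and A is a power of D, because the
patch lies within distance C D of the vertex. -/

noncomputable section

/-! ### Weak directional derivatives and mollification. -/

open Metric Filter Topology in
/-- `g` is the weak derivative of `f` in the direction `e` in the open set `U`. -/
def WeakDir (U : Set E3) (f : E3 → ℝ) (e : E3) (g : E3 → ℝ) : Prop :=
  LocallyIntegrableOn f U ∧ LocallyIntegrableOn g U ∧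
    ∀ φ : E3 → ℝ, ContDiff ℝ ∞ φ → HasCompactSupport φ → tsupport φ ⊆ U →
      ∫ x in U, f x * fderiv ℝ φ x e = -∫ x in U, φ x * g x

/-- Mollification. -/
def mollify (φ : ContDiffBump (0 : E3)) (f : E3 → ℝ) : E3 → ℝ :=
  convolution (φ.normed volume) f (ContinuousLinearMap.lsmul ℝ ℝ) volume

/-- Mollification of extended nonnegative functions. -/
def averaged (φ : ContDiffBump (0 : E3)) (F : E3 → ENNReal) (x : E3) : ENNReal :=
  ∫⁻ t, ENNReal.ofReal (φ.normed volume t) * F (x - t)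

theorem mollify_apply (φ : ContDiffBump (0 : E3)) (f : E3 → ℝ) (x : E3) :
    mollify φ f x = ∫ t, φ.normed volume t * f (x - t) := rfl

theorem contDiff_mollify (φ : ContDiffBump (0 : E3)) {f : E3 → ℝ} (hf : Integrable f) :
    ContDiff ℝ ∞ (mollify φ f) :=
  φ.hasCompactSupport_normed.contDiff_convolution_left _ φ.contDiff_normed hf.locallyIntegrable

theorem enorm_mollify_le (φ : ContDiffBump (0 : E3)) (f : E3 → ℝ) (x : E3) :
    ‖mollify φ f x‖ₑ ≤ averaged φ (fun y => ‖f y‖ₑ) x := by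
  rw [mollify_apply]
  refine (enorm_integral_le_lintegral_enorm _).trans (le_of_eq ?_)
  refine lintegral_congr fun t => ?_
  rw [enorm_mul, Real.enorm_eq_ofReal (φ.nonneg_normed t)]

theorem averaged_mono (φ : ContDiffBump (0 : E3)) {F G : E3 → ENNReal} (x : E3)
    (h : ∀ y, dist y x ≤ φ.rOut → F y ≤ G y) : averaged φ F x ≤ averaged φ G x := by
  refine lintegral_mono fun t => ?_
  by_cases ht : t ∈ Function.support (φ.normed volume)
  · rw [φ.support_normed_eq, mem_ball_zero_iff] at ht
    exact mul_le_mul_right (h _ (by simpa [dist_eq_norm] using ht.le)) _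
  · rw [Function.notMem_support] at ht
    simp [ht]

theorem lintegral_ofReal_normed (φ : ContDiffBump (0 : E3)) :
    ∫⁻ t, ENNReal.ofReal (φ.normed volume t) = 1 := by
  rw [← ofReal_integral_eq_lintegral_ofReal φ.integrable_normed
    (Filter.Eventually.of_forall φ.nonneg_normed), φ.integral_normed, ENNReal.ofReal_one]

/-- Young's inequality. -/
theorem lintegral_averaged_le (φ : ContDiffBump (0 : E3)) {F : E3 → ENNReal}
    (hF : AEMeasurable F) : ∫⁻ x, averaged φ F x ≤ ∫⁻ x, F x := by
  unfold averaged
  rw [lintegral_lintegral_swap]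
  · have : ∀ t, ∫⁻ x, ENNReal.ofReal (φ.normed volume t) * F (x - t)
        = ENNReal.ofReal (φ.normed volume t) * ∫⁻ x, F x := by
      intro t
      rw [lintegral_const_mul' _ _ ENNReal.ofReal_ne_top, lintegral_sub_right_eq_self]
    simp_rw [this]
    rw [lintegral_mul_const'' _ (φ.continuous_normed.measurable.ennreal_ofReal).aemeasurable,
      lintegral_ofReal_normed, one_mul]
  · refine AEMeasurable.mul ?_ ?_
    · exact ((φ.continuous_normed.comp continuous_snd).measurable.ennreal_ofReal).aemeasurable
    · exact hF.comp_quasiMeasurePreserving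
        (quasiMeasurePreserving_sub_of_right_invariant volume volume)

open Metric Filter Topology in
/-- On a compact set well inside `U`, mollification commutes with differentiation. -/
theorem WeakDir.fderiv_mollify {U : Set E3} {f g : E3 → ℝ} {e : E3} (h : WeakDir U f e g)
    {K : Set E3} (hK : IsCompact K) (hKU : K ⊆ U) (φ : ContDiffBump (0 : E3)) {x : E3}
    (hx : closedBall x φ.rOut ⊆ K) :
    fderiv ℝ (mollify φ (K.indicator f)) x e = mollify φ (K.indicator g) x := by
  have hf : Integrable (K.indicator f) :=
    (h.1.integrableOn_compact_subset hKU hK).integrable_indicator hK.measurableSet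
  have h1 := φ.hasCompactSupport_normed.hasFDerivAt_convolution_left
    (ContinuousLinearMap.lsmul ℝ ℝ) (φ.contDiff_normed (μ := volume) (n := 1))
    hf.locallyIntegrable x
  unfold mollify
  rw [h1.fderiv]
  have hcd : ContDiff ℝ ∞ (φ.normed (volume : Measure E3)) := φ.contDiff_normed
  have hsupp : Function.support (fun t : E3 => (fderiv ℝ (φ.normed volume) t) e)
      ⊆ closedBall 0 φ.rOut := by
    intro t ht
    by_contra hn
    rw [← φ.tsupport_normed_eq (μ := volume)] at hn
    have : fderiv ℝ (φ.normed volume) t = 0 := by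
      by_contra h0
      exact hn (support_fderiv_subset ℝ h0)
    simp [this] at ht
  have hci : ConvolutionExistsAt (fderiv ℝ (φ.normed volume)) (K.indicator f) x
      ((ContinuousLinearMap.lsmul ℝ ℝ : ℝ →L[ℝ] ℝ →L[ℝ] ℝ).precompL E3) volume :=
    (φ.hasCompactSupport_normed.fderiv ℝ).convolutionExists_left _
      (hcd.continuous_fderiv (by simp)) hf.locallyIntegrable x
  have e1 : (convolution (fderiv ℝ (φ.normed volume)) (K.indicator f)
      ((ContinuousLinearMap.lsmul ℝ ℝ : ℝ →L[ℝ] ℝ →L[ℝ] ℝ).precompL E3) volume x) e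
      = ∫ t, fderiv ℝ (φ.normed volume) t e * K.indicator f (x - t) := by
    rw [convolution_def, ContinuousLinearMap.integral_apply hci]
    rfl
  -- Reflecting the variable on both sides moves the dependence on `x` into the kernel, which then
  -- serves as test function.
  rw [e1, ← integral_sub_left_eq_self _ volume x]
  change _ = mollify φ (K.indicator g) x
  rw [mollify_apply, ← integral_sub_left_eq_self (fun t => φ.normed volume t * _) volume x]
  simp only [sub_sub_cancel]
  -- The support of `Φ` is in the ball of radius `φ.rOut` about `x`, hence in `K ⊆ U`. So `Φ` is
  -- admissible, and cutting off outside `K` changes nothing.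
  set Φ : E3 → ℝ := fun y => φ.normed volume (x - y) with hΦ
  have hΦd : ∀ y, fderiv ℝ Φ y e = -fderiv ℝ (φ.normed volume) (x - y) e := by
    intro y
    have h2 : HasFDerivAt (fun y : E3 => x - y) (-ContinuousLinearMap.id ℝ E3) y :=
      (hasFDerivAt_id y).const_sub x
    have h3 : HasFDerivAt (φ.normed (volume : Measure E3))
      (fderiv ℝ (φ.normed volume) (x - y)) (x - y) :=
      (hcd.differentiable (by simp) _).hasFDerivAt
    have h4 : HasFDerivAt Φ _ y := h3.comp y h2
    rw [h4.fderiv]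
    simp
  have hΦs : tsupport Φ ⊆ closedBall x φ.rOut := by
    refine closure_minimal ?_ isClosed_closedBall
    intro y hy
    have : x - y ∈ Function.support (φ.normed (volume : Measure E3)) := hy
    rw [φ.support_normed_eq, mem_ball_zero_iff] at this
    rw [mem_closedBall, dist_comm, dist_eq_norm]
    exact this.le
  have hΦc : HasCompactSupport Φ :=
    HasCompactSupport.intro' (isCompact_closedBall x φ.rOut) isClosed_closedBall
      fun y hy => by
        by_contra h0
        exact hy (hΦs (subset_tsupport _ h0))
  have key := h.2.2 Φ (hcd.comp (contDiff_const.sub contDiff_id)) hΦc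
    ((hΦs.trans hx).trans hKU)
  have hΦ0 : ∀ y, y ∉ K → Φ y = 0 ∧ fderiv ℝ Φ y e = 0 := by
    intro y hy
    have hn : y ∉ tsupport Φ := fun h0 => hy (hx (hΦs h0))
    refine ⟨image_eq_zero_of_notMem_tsupport hn, ?_⟩
    have : fderiv ℝ Φ y = 0 := by
      by_contra h0
      exact hn (support_fderiv_subset ℝ h0)
    simp [this]
  have l1 : (fun y => fderiv ℝ (φ.normed volume) (x - y) e * K.indicator f y)
      = fun y => -(f y * fderiv ℝ Φ y e) := by
    funext y
    by_cases hy : y ∈ K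
    · rw [indicator_of_mem hy, hΦd]; ring
    · rw [indicator_of_notMem hy, (hΦ0 y hy).2]; ring
  have l2 : (fun y => φ.normed volume (x - y) * K.indicator g y) = fun y => Φ y * g y := by
    funext y
    by_cases hy : y ∈ K
    · rw [indicator_of_mem hy]
    · rw [indicator_of_notMem hy, (hΦ0 y hy).1]; ring
  rw [l1, l2, integral_neg,
    ← setIntegral_eq_integral_of_forall_compl_eq_zero (s := U) (f := fun y => f y * _),
    ← setIntegral_eq_integral_of_forall_compl_eq_zero (s := U) (f := fun y => Φ y * _), key,
    neg_neg]
  · intro y hy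
    rw [(hΦ0 y fun h0 => hy (hKU h0)).1, zero_mul]
  · intro y hy
    rw [(hΦ0 y fun h0 => hy (hKU h0)).2, mul_zero]

open Metric Filter Topology in
theorem tendsto_mollify {ι : Type*} {l : Filter ι} {φ : ι → ContDiffBump (0 : E3)}
    (hφ : Tendsto (fun i => (φ i).rOut) l (𝓝 0)) {K : Set E3} (hK : IsCompact K) {f : E3 → ℝ}
    (hf : ContinuousOn f K) {x : E3} (hx : K ∈ 𝓝 x) :
    Tendsto (fun i => mollify (φ i) (K.indicator f) x) l (𝓝 (f x)) := by
  refine ContDiffBump.convolution_tendsto_right (g := fun _ => K.indicator f) hφ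
    (Eventually.of_forall fun _ => ?_) ?_ tendsto_const_nhds
  · exact (aestronglyMeasurable_indicator_iff hK.measurableSet).2
      (hf.aestronglyMeasurable hK.measurableSet)
  · have h1 : Tendsto (K.indicator f) (𝓝 x) (𝓝 (f x)) := by
      refine ((hf x (mem_of_mem_nhds hx)).continuousAt hx).tendsto.congr' ?_
      filter_upwards [hx] with y hy using (indicator_of_mem hy f).symm
    exact h1.comp tendsto_snd

open Metric Filter Topology in
/-- Bump functions with radii tending to zero. -/
theorem exists_bumps : ∃ φ : ℕ → ContDiffBump (0 : E3),
    Tendsto (fun i => (φ i).rOut) atTop (𝓝 0) := by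
  refine ⟨fun i => ⟨(1 / (i + 1)) / 2, 1 / (i + 1), by positivity, by
    have : (0 : ℝ) < 1 / (i + 1) := by positivity
    linarith⟩, ?_⟩
  exact tendsto_one_div_add_atTop_nhds_zero_nat

theorem integrable_mul_of_compact_subset {U : Set E3} {f χ : E3 → ℝ}
    (hf : LocallyIntegrableOn f U) (hχ : Continuous χ) (h1 : HasCompactSupport χ)
    (h2 : tsupport χ ⊆ U) : Integrable (fun x => χ x * f x) := by
  rw [← integrableOn_iff_integrable_of_support_subset (s := tsupport χ)]
  · exact (hf.integrableOn_compact_subset h2 h1).continuousOn_mul hχ.continuousOn h1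
  · exact (Function.support_mul_subset_left _ _).trans (subset_tsupport _)

theorem HasWeakGradient.weakDir {U : Set E3} {v : E3 → ℝ} {W : E3 → E3}
    (h : HasWeakGradient U v W) (e : E3) : WeakDir U v e (fun x => inner ℝ e (W x)) := by
  obtain ⟨h1, h2, h3⟩ := h
  have h4 : LocallyIntegrableOn (fun x => inner ℝ e (W x)) U := by
    intro x hx
    obtain ⟨s, hs, hi⟩ := h2 x hx
    exact ⟨s, hs, (innerSL ℝ e).integrable_comp hi⟩
  refine ⟨h1, h4, fun φ c1 c2 c3 => ?_⟩
  have hgc : Continuous (gradient φ) :=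
    (InnerProductSpace.toDual ℝ E3).symm.continuous.comp (c1.continuous_fderiv (by simp))
  have i1 : IntegrableOn (fun x => v x • gradient φ x) U := by
    refine Integrable.integrableOn ?_
    rw [← integrableOn_iff_integrable_of_support_subset (s := tsupport φ)]
    · exact (h1.integrableOn_compact_subset c3 c2).smul_continuousOn hgc.continuousOn c2
    · intro x hx
      by_contra hn
      have : fderiv ℝ φ x = 0 := by
        by_contra h0
        exact hn (support_fderiv_subset ℝ h0)
      simp [gradient, this] at hx
  have i2 : IntegrableOn (fun x => φ x • W x) U := by
    refine Integrable.integrableOn ?_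
    rw [← integrableOn_iff_integrable_of_support_subset (s := tsupport φ)]
    · exact (h2.integrableOn_compact_subset c3 c2).continuousOn_smul c1.continuous.continuousOn c2
    · intro x hx
      by_contra hn
      simp [image_eq_zero_of_notMem_tsupport hn] at hx
  have := congrArg (innerSL ℝ e) (h3 φ c1 c2 c3)
  rw [map_neg, ← ContinuousLinearMap.integral_comp_comm _ i1,
    ← ContinuousLinearMap.integral_comp_comm _ i2] at this
  simpa [inner_smul_right, inner_gradient_right] using this

theorem fderiv_apply_eq_zero_of_notMem {φ : E3 → ℝ} {x : E3} (e : E3) (h : x ∉ tsupport φ) :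
    fderiv ℝ φ x e = 0 := by
  have : fderiv ℝ φ x = 0 := by
    by_contra h0
    exact h (support_fderiv_subset ℝ h0)
  simp [this]

theorem integrable_mul_fderiv {U : Set E3} {f φ : E3 → ℝ} (e : E3)
    (hf : LocallyIntegrableOn f U) (c1 : ContDiff ℝ ∞ φ) (c2 : HasCompactSupport φ)
    (c3 : tsupport φ ⊆ U) : Integrable (fun x => f x * fderiv ℝ φ x e) := by
  rw [← integrableOn_iff_integrable_of_support_subset (s := tsupport φ)]
  · exact (hf.integrableOn_compact_subset c3 c2).mul_continuousOn
      ((c1.continuous_fderiv (by simp)).clm_apply continuous_const).continuousOn c2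
  · intro x hx
    by_contra hn
    simp [fderiv_apply_eq_zero_of_notMem e hn] at hx

/-- Test functions vanish outside `U`, so the integrals may run over the whole space. In this form
restriction to subsets and linear combinations are immediate. -/
theorem weakDir_iff_integral {U : Set E3} {f g : E3 → ℝ} {e : E3} :
    WeakDir U f e g ↔ LocallyIntegrableOn f U ∧ LocallyIntegrableOn g U ∧
      ∀ φ : E3 → ℝ, ContDiff ℝ ∞ φ → HasCompactSupport φ → tsupport φ ⊆ U →
        ∫ x, f x * fderiv ℝ φ x e = -∫ x, φ x * g x := by
  refine and_congr_right fun _ => and_congr_right fun _ => forall_congr' fun φ =>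
    forall_congr' fun _ => forall_congr' fun _ => forall_congr' fun c3 => ?_
  rw [setIntegral_eq_integral_of_forall_compl_eq_zero,
    setIntegral_eq_integral_of_forall_compl_eq_zero]
  · intro x hx
    rw [image_eq_zero_of_notMem_tsupport fun h => hx (c3 h), zero_mul]
  · intro x hx
    rw [fderiv_apply_eq_zero_of_notMem e fun h => hx (c3 h), mul_zero]

theorem WeakDir.mono {U V : Set E3} {f g : E3 → ℝ} {e : E3} (h : WeakDir U f e g) (hV : V ⊆ U) :
    WeakDir V f e g := by
  rw [weakDir_iff_integral] at h ⊢
  exact ⟨h.1.mono_set hV, h.2.1.mono_set hV, fun φ c1 c2 c3 => h.2.2 φ c1 c2 (c3.trans hV)⟩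

theorem WeakDir.add {U : Set E3} {f g f' g' : E3 → ℝ} {e : E3} (h : WeakDir U f e g)
    (h' : WeakDir U f' e g') : WeakDir U (fun x => f x + f' x) e (fun x => g x + g' x) := by
  rw [weakDir_iff_integral] at h h' ⊢
  refine ⟨h.1.add h'.1, h.2.1.add h'.2.1, fun φ c1 c2 c3 => ?_⟩
  simp_rw [add_mul, mul_add]
  rw [integral_add (integrable_mul_fderiv e h.1 c1 c2 c3) (integrable_mul_fderiv e h'.1 c1 c2 c3),
    integral_add (integrable_mul_of_compact_subset h.2.1 c1.continuous c2 c3)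
      (integrable_mul_of_compact_subset h'.2.1 c1.continuous c2 c3), h.2.2 φ c1 c2 c3,
    h'.2.2 φ c1 c2 c3]
  ring

theorem WeakDir.const_mul {U : Set E3} {f g : E3 → ℝ} {e : E3} (h : WeakDir U f e g) (c : ℝ) :
    WeakDir U (fun x => c * f x) e (fun x => c * g x) := by
  rw [weakDir_iff_integral] at h ⊢
  refine ⟨h.1.smul c, h.2.1.smul c, fun φ c1 c2 c3 => ?_⟩
  have e1 : ∀ x, φ x * (c * g x) = c * (φ x * g x) := fun x => by ring
  simp_rw [mul_assoc, e1, integral_const_mul]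
  rw [h.2.2 φ c1 c2 c3]
  ring


theorem aemeasurable_indicator_enorm {U K : Set E3} {f : E3 → ℝ} (hf : LocallyIntegrableOn f U)
    (hK : IsCompact K) (hKU : K ⊆ U) : AEMeasurable (fun x => ‖K.indicator f x‖ₑ) :=
  ((hf.integrableOn_compact_subset hKU hK).integrable_indicator
    hK.measurableSet).aestronglyMeasurable.enorm

theorem enorm_indicator_le {K U : Set E3} (hKU : K ⊆ U) (f : E3 → ℝ) (x : E3) :
    ‖K.indicator f x‖ₑ ≤ U.indicator (fun x => ‖f x‖ₑ) x := by
  by_cases hx : x ∈ K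
  · rw [indicator_of_mem hx, indicator_of_mem (hKU hx)]
  · simp [indicator_of_notMem hx]

theorem lintegral_enorm_mollify_le {U K : Set E3} {f : E3 → ℝ} (hU : IsOpen U)
    (hf : LocallyIntegrableOn f U)
    (hK : IsCompact K) (hKU : K ⊆ U) (φ : ContDiffBump (0 : E3)) :
    ∫⁻ x, ‖mollify φ (K.indicator f) x‖ₑ ≤ ∫⁻ x in U, ‖f x‖ₑ := by
  refine (lintegral_mono (enorm_mollify_le φ _)).trans ?_
  refine (lintegral_averaged_le φ (aemeasurable_indicator_enorm hf hK hKU)).trans ?_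
  rw [← lintegral_indicator hU.measurableSet]
  exact lintegral_mono fun x => enorm_indicator_le hKU f x

/-- Young's inequality with a weight. The weight at `x` may be pulled under the average because it
varies at most by the factor 2 over the support of the bump. -/
theorem lintegral_enorm_mollify_mul_le {U K A : Set E3} {f : E3 → ℝ} (hU : IsOpen U)
    (hf : LocallyIntegrableOn f U) (hK : IsCompact K) (hKU : K ⊆ U) (φ : ContDiffBump (0 : E3))
    {wt : E3 → ENNReal} (hwt : Measurable wt) (hA : MeasurableSet A)
    (h : ∀ x ∈ A, ∀ y, dist y x ≤ φ.rOut → wt x ≤ 2 * wt y) :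
    ∫⁻ x in A, ‖mollify φ (K.indicator f) x‖ₑ * wt x ≤ 2 * ∫⁻ x in U, ‖f x‖ₑ * wt x := by
  have h1 : ∀ x ∈ A, ‖mollify φ (K.indicator f) x‖ₑ * wt x ≤
      averaged φ (fun y => ‖K.indicator f y‖ₑ * (2 * wt y)) x := by
    intro x hx
    refine (mul_le_mul_left (enorm_mollify_le φ _ x) _).trans ?_
    refine le_trans ?_ (averaged_mono φ (F := fun y => ‖K.indicator f y‖ₑ * wt x) x
      fun y hy => mul_le_mul_right (h x hx y hy) _)
    refine (lintegral_mul_const_le _ _).trans (lintegral_mono fun t => ?_)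
    rw [mul_assoc]
  refine (setLIntegral_mono' hA h1).trans ((setLIntegral_le_lintegral _ _).trans ?_)
  refine (lintegral_averaged_le φ ((aemeasurable_indicator_enorm hf hK hKU).mul
    (hwt.const_mul 2).aemeasurable)).trans ?_
  rw [← lintegral_indicator hU.measurableSet, ← lintegral_const_mul' _ _ ENNReal.ofNat_ne_top]
  refine lintegral_mono fun x => ?_
  by_cases hx : x ∈ K
  · simp only [Pi.mul_apply]
    rw [indicator_of_mem hx, indicator_of_mem (hKU hx)]
    exact le_of_eq (by ring)
  · simp [indicator_of_notMem hx]

-- A function that is only locally integrable in `U` is cut off outside `K'` before it is mollified;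
-- at the points of the neighbourhood `O` of `K` the bumps do not see the cut-off.
open Metric Filter Topology in
theorem exists_compact_bumps {U K : Set E3} (hU : IsOpen U) (hK : IsCompact K) (hKU : K ⊆ U) :
    ∃ K' O : Set E3, IsCompact K' ∧ K' ⊆ U ∧ IsOpen O ∧ K ⊆ O ∧ O ⊆ K' ∧
      ∃ φ : ℕ → ContDiffBump (0 : E3), Tendsto (fun i => (φ i).rOut) atTop (𝓝 0) ∧
        ∀ i, ∀ x ∈ O, closedBall x (φ i).rOut ⊆ K' := by
  obtain ⟨δ, hδ, h⟩ := hK.exists_cthickening_subset_open hU hKU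
  obtain ⟨φ, hφ⟩ := exists_bumps
  have h1 : ∀ᶠ i in atTop, (φ i).rOut < δ / 2 := hφ.eventually (gt_mem_nhds (by positivity))
  obtain ⟨N, hN⟩ := eventually_atTop.1 h1
  refine ⟨cthickening δ K, thickening (δ / 2) K, hK.cthickening, h, isOpen_thickening,
    self_subset_thickening (by positivity) K, ?_, fun i => φ (i + N),
    hφ.comp (tendsto_add_atTop_nat N), fun i x hx y hy => ?_⟩
  · exact (thickening_mono (by linarith) K).trans (thickening_subset_cthickening δ K)
  · obtain ⟨z, hz, hxz⟩ := mem_thickening_iff.1 hx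
    refine thickening_subset_cthickening δ K (mem_thickening_iff.2 ⟨z, hz, ?_⟩)
    have := hN (i + N) (by omega)
    have h2 := dist_triangle y x z
    rw [mem_closedBall] at hy
    linarith

/-! ### A Poincaré inequality on convex sets. -/

theorem enorm_sub_le_lintegral_fderiv {v : E3 → ℝ} (hv : ContDiff ℝ ∞ v) (y e : E3) {s t : ℝ}
    (hst : s ≤ t) : ‖v (y + t • e) - v (y + s • e)‖ₑ ≤
      ∫⁻ r in Ioc s t, ‖fderiv ℝ v (y + r • e) e‖ₑ := by
  have h1 : ∀ r : ℝ, HasDerivAt (fun r : ℝ => v (y + r • e)) (fderiv ℝ v (y + r • e) e) r := by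
    intro r
    have h2 : HasDerivAt (fun r : ℝ => y + r • e) e r := by
      simpa using ((hasDerivAt_id r).smul_const e).const_add y
    exact ((hv.differentiable (by simp) _).hasFDerivAt).comp_hasDerivAt r h2
  have hc : Continuous fun r : ℝ => fderiv ℝ v (y + r • e) e :=
    ((hv.continuous_fderiv (by simp)).comp (by fun_prop)).clm_apply continuous_const
  rw [← intervalIntegral.integral_eq_sub_of_hasDerivAt (fun r _ => h1 r)
    (hc.intervalIntegrable _ _), intervalIntegral.integral_of_le hst]
  exact enorm_integral_le_lintegral_enorm _

theorem averaged_congr_ae (φ : ContDiffBump (0 : E3)) {F G : E3 → ENNReal} (h : F =ᵐ[volume] G) :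
    averaged φ F = averaged φ G := by
  funext x
  refine lintegral_congr_ae ?_
  have := (Measure.measurePreserving_sub_left volume x).quasiMeasurePreserving.ae h
  filter_upwards [this] with t ht
  rw [ht]

theorem measurable_averaged (φ : ContDiffBump (0 : E3)) {F : E3 → ENNReal} (h : AEMeasurable F) :
    Measurable (averaged φ F) := by
  rw [averaged_congr_ae φ h.ae_eq_mk]
  unfold averaged
  refine Measurable.lintegral_prod_right' (f := fun p : E3 × E3 =>
    ENNReal.ofReal (φ.normed volume p.2) * h.mk F (p.1 - p.2)) ?_
  exact ((φ.continuous_normed.comp continuous_snd).measurable.ennreal_ofReal).mul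
    (h.measurable_mk.comp (measurable_fst.sub measurable_snd))

/-- The Jacobian factor is s⁻³ ≤ 2³ = 8. -/
theorem lintegral_comp_smul_add {F : E3 → ENNReal} (hF : Measurable F) {s : ℝ} (hs : 1 / 2 ≤ s)
    (y : E3) : ∫⁻ x, F (s • x + y) ≤ 8 * ∫⁻ x, F x := by
  have hs0 : s ≠ 0 := by linarith
  have h1 : ∫⁻ x, F (s • x + y) = ∫⁻ x, F (x + y) ∂(Measure.map (s • ·) volume) := by
    rw [lintegral_map (f := fun x => F (x + y)) (hF.comp (measurable_id.add_const y))
      (measurable_const_smul s)]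
  rw [h1, Measure.map_addHaar_smul volume hs0, lintegral_smul_measure,
    lintegral_add_right_eq_self]
  refine mul_le_mul_left ?_ _
  refine (ENNReal.ofReal_le_ofReal (q := 8) ?_).trans (le_of_eq (ENNReal.ofReal_ofNat 8))
  simp only [finrank_euclideanSpace, Fintype.card_fin]
  rw [abs_inv, abs_of_pos (by positivity : 0 < s ^ 3)]
  have : (1 / 2 : ℝ) ^ 3 ≤ s ^ 3 := by gcongr
  calc (s ^ 3)⁻¹ ≤ ((1 / 2 : ℝ) ^ 3)⁻¹ := by gcongr
    _ = 8 := by norm_num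

/-- For each `s` one of `s` and `1 - s` is at least 1/2. Integrating first over the endpoint with
that coefficient keeps the Jacobian bounded; the other endpoint contributes `volume K`. -/
theorem lintegral_lintegral_segment_le {K : Set E3} {F : E3 → ENNReal} (hF : Measurable F) :
    ∫⁻ p in K ×ˢ K, ∫⁻ s in Ioc (0 : ℝ) 1, F (p.2 + s • (p.1 - p.2))
      ≤ 8 * volume K * ∫⁻ x, F x := by
  have hm : Measurable fun q : (E3 × E3) × ℝ => F (q.1.2 + q.2 • (q.1.1 - q.1.2)) :=
    hF.comp (by fun_prop)
  rw [lintegral_lintegral_swap hm.aemeasurable]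
  have h1 : ∀ s ∈ Ioc (0 : ℝ) 1, ∫⁻ p in K ×ˢ K, F (p.2 + s • (p.1 - p.2))
      ≤ 8 * volume K * ∫⁻ x, F x := by
    intro s hs
    have hm' : Measurable fun p : E3 × E3 => F (p.2 + s • (p.1 - p.2)) := hF.comp (by fun_prop)
    rw [Measure.volume_eq_prod, ← Measure.prod_restrict]
    rcases le_total (1 / 2) s with h | h
    · rw [lintegral_prod_symm' _ hm']
      have : ∀ y : E3, ∫⁻ x in K, F (y + s • (x - y)) ≤ 8 * ∫⁻ x, F x := by
        intro y
        refine (setLIntegral_le_lintegral _ _).trans ?_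
        refine le_trans (le_of_eq ?_) (lintegral_comp_smul_add hF h (y - s • y))
        refine lintegral_congr fun x => ?_
        congr 1; module
      refine (lintegral_mono this).trans (le_of_eq ?_)
      rw [lintegral_const, Measure.restrict_apply_univ]; ring
    · rw [lintegral_prod _ hm'.aemeasurable]
      have : ∀ x : E3, ∫⁻ y in K, F (y + s • (x - y)) ≤ 8 * ∫⁻ x, F x := by
        intro x
        refine (setLIntegral_le_lintegral _ _).trans ?_
        refine le_trans (le_of_eq ?_)
          (lintegral_comp_smul_add hF (by linarith : 1 / 2 ≤ 1 - s) (s • x))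
        refine lintegral_congr fun y => ?_
        congr 1; module
      refine (lintegral_mono this).trans (le_of_eq ?_)
      rw [lintegral_const, Measure.restrict_apply_univ]; ring
  refine (setLIntegral_mono' measurableSet_Ioc h1).trans (le_of_eq ?_)
  simp

-- The fundamental theorem of calculus along the segments in `K`, for the mollified functions,
-- followed by Fatou's lemma. The majorant `H` bounds the derivatives in the directions `x - y` of
-- chords only, not the whole gradient, so the inequality is not spoiled by the anisotropy of `U`.
open Metric Filter Topology in
theorem lintegral_enorm_sub_compact_le {U K : Set E3} (hU : IsOpen U) (hK : IsCompact K)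
    (hKc : Convex ℝ K) (hKU : K ⊆ U) {u : E3 → ℝ} (hu : ContinuousOn u U) {g : E3 → E3 → ℝ}
    (hW : ∀ e, WeakDir U u e (g e)) {H : E3 → ENNReal}
    (hH : AEMeasurable H (volume.restrict U))
    (hgH : ∀ x ∈ U, ∀ y ∈ U, ∀ z ∈ U, ‖g (x - y) z‖ₑ ≤ H z) :
    ∫⁻ p in K ×ˢ K, ‖u p.1 - u p.2‖ₑ ≤ 8 * volume K * ∫⁻ x in U, H x := by
  obtain ⟨K', O, hK', hK'U, hO, hKO, hOK', φ, hφ, hb⟩ := exists_compact_bumps hU hK hKU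
  have hF : AEMeasurable (U.indicator H) := (aemeasurable_indicator_iff hU.measurableSet).2 hH
  set v : ℕ → E3 → ℝ := fun i => mollify (φ i) (K'.indicator u) with hv
  have hvs : ∀ i, ContDiff ℝ ∞ (v i) := fun i => contDiff_mollify _
    (((hW 0).1.integrableOn_compact_subset hK'U hK').integrable_indicator hK'.measurableSet)
  have hlim : ∀ x ∈ K, Tendsto (fun i => v i x) atTop (𝓝 (u x)) := fun x hx =>
    tendsto_mollify hφ hK' (hu.mono hK'U) (mem_of_superset (hO.mem_nhds (hKO hx)) hOK')
  have hfd : ∀ i, ∀ x ∈ K, ∀ y ∈ K, ∀ z ∈ K,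
      ‖fderiv ℝ (v i) z (x - y)‖ₑ ≤ averaged (φ i) (U.indicator H) z := by
    intro i x hx y hy z hz
    rw [hv, (hW (x - y)).fderiv_mollify hK' hK'U (φ i) (hb i z (hKO hz))]
    refine (enorm_mollify_le _ _ _).trans (averaged_mono _ _ fun w _ => ?_)
    by_cases hw : w ∈ K'
    · rw [indicator_of_mem hw, indicator_of_mem (hK'U hw)]
      exact hgH x (hKU hx) y (hKU hy) w (hK'U hw)
    · simp [indicator_of_notMem hw]
  have hi : ∀ i, ∫⁻ p in K ×ˢ K, ‖v i p.1 - v i p.2‖ₑ ≤ 8 * volume K * ∫⁻ x in U, H x := by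
    intro i
    have hA := measurable_averaged (φ i) hF
    calc ∫⁻ p in K ×ˢ K, ‖v i p.1 - v i p.2‖ₑ
        ≤ ∫⁻ p in K ×ˢ K, ∫⁻ s in Ioc (0 : ℝ) 1,
            averaged (φ i) (U.indicator H) (p.2 + s • (p.1 - p.2)) := by
          refine setLIntegral_mono' (hK.measurableSet.prod hK.measurableSet) fun p hp => ?_
          have := enorm_sub_le_lintegral_fderiv (hvs i) p.2 (p.1 - p.2) zero_le_one
          simp only [one_smul, zero_smul, add_zero, add_sub_cancel] at this
          refine this.trans (setLIntegral_mono' measurableSet_Ioc fun s hs => ?_)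
          exact hfd i _ hp.1 _ hp.2 _ (hKc.add_smul_sub_mem hp.2 hp.1 ⟨hs.1.le, hs.2⟩)
      _ ≤ 8 * volume K * ∫⁻ x, averaged (φ i) (U.indicator H) x :=
          lintegral_lintegral_segment_le hA
      _ ≤ 8 * volume K * ∫⁻ x in U, H x := by
          rw [← lintegral_indicator hU.measurableSet]
          exact mul_le_mul_right (lintegral_averaged_le _ hF) _
  calc ∫⁻ p in K ×ˢ K, ‖u p.1 - u p.2‖ₑ
      = ∫⁻ p in K ×ˢ K, liminf (fun i => ‖v i p.1 - v i p.2‖ₑ) atTop := by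
        refine setLIntegral_congr_fun (hK.measurableSet.prod hK.measurableSet) fun p hp => ?_
        exact (((hlim _ hp.1).sub (hlim _ hp.2)).enorm.liminf_eq).symm
    _ ≤ liminf (fun i => ∫⁻ p in K ×ˢ K, ‖v i p.1 - v i p.2‖ₑ) atTop := by
        refine lintegral_liminf_le fun i => ?_
        have := (hvs i).continuous
        exact (by fun_prop : Continuous fun p : E3 × E3 => v i p.1 - v i p.2).measurable.enorm
    _ ≤ 8 * volume K * ∫⁻ x in U, H x := by
        refine liminf_le_of_le (by isBoundedDefault) fun b hb => ?_
        obtain ⟨i, hi'⟩ := hb.exists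
        exact hi'.trans (hi i)

open Metric Filter Topology in
/-- A Poincaré inequality in a bounded open convex set. -/
theorem lintegral_enorm_sub_le {U : Set E3} (hU : IsOpen U) (hc : Convex ℝ U)
    (hbd : Bornology.IsBounded U) {u : E3 → ℝ} (hu : ContinuousOn u U) {g : E3 → E3 → ℝ}
    (hW : ∀ e, WeakDir U u e (g e)) {H : E3 → ENNReal}
    (hH : AEMeasurable H (volume.restrict U))
    (hgH : ∀ x ∈ U, ∀ y ∈ U, ∀ z ∈ U, ‖g (x - y) z‖ₑ ≤ H z) :
    ∫⁻ p in U ×ˢ U, ‖u p.1 - u p.2‖ₑ ≤ 8 * volume U * ∫⁻ x in U, H x := by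
  rcases U.eq_empty_or_nonempty with rfl | ⟨z, hz⟩
  · simp
  -- Contractions of `closure U` towards the interior point `z` are compact, convex, contained in
  -- `U`, and exhaust `U`.
  set κ : ℕ → ℝ := fun i => 1 - 1 / ((i : ℝ) + 2) with hκ
  have hκ0 : ∀ i, 0 < κ i ∧ κ i < 1 := by
    intro i
    have h1 : (0 : ℝ) < 1 / ((i : ℝ) + 2) := by positivity
    have h2 : 1 / ((i : ℝ) + 2) < 1 := by
      rw [div_lt_one (by positivity)]; linarith [(Nat.cast_nonneg i : (0 : ℝ) ≤ i)]
    exact ⟨by simp only [hκ]; linarith, by simp only [hκ]; linarith⟩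
  have hκ1 : Tendsto κ atTop (𝓝 1) := by
    have : Tendsto (fun i : ℕ => 1 / ((i : ℝ) + 2)) atTop (𝓝 0) := by
      refine Tendsto.div_atTop tendsto_const_nhds ?_
      exact tendsto_atTop_add_const_right _ _ tendsto_natCast_atTop_atTop
    simpa only [sub_zero] using this.const_sub 1
  set K : ℕ → Set E3 := fun i => AffineMap.homothety z (κ i) '' closure U with hKd
  have hKc : ∀ i, IsCompact (K i) := fun i =>
    (Metric.isCompact_of_isClosed_isBounded isClosed_closure hbd.closure).image
      (AffineMap.continuous_of_finiteDimensional _)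
  have hKU : ∀ i, K i ⊆ U := by
    rintro i _ ⟨x, hx, rfl⟩
    have := hc.combo_interior_closure_subset_interior (a := 1 - κ i) (b := κ i)
      (by linarith [(hκ0 i).2]) (hκ0 i).1.le (by ring)
      (Set.add_mem_add (Set.smul_mem_smul_set (by rwa [hU.interior_eq] : z ∈ interior U))
        (Set.smul_mem_smul_set hx))
    rw [hU.interior_eq] at this
    convert this using 1
    simp [AffineMap.homothety_apply]; module
  have hmem : ∀ x ∈ U, ∀ᶠ i in atTop, x ∈ K i := by
    intro x hx
    have ht : Tendsto (fun i => z + (κ i)⁻¹ • (x - z)) atTop (𝓝 x) := by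
      have := ((hκ1.inv₀ one_ne_zero).smul_const (x - z)).const_add z
      simpa using this
    filter_upwards [ht.eventually (hU.mem_nhds hx)] with i hi
    refine ⟨_, subset_closure hi, ?_⟩
    simp [AffineMap.homothety_apply, smul_smul, (hκ0 i).1.ne']
  have hi : ∀ i, ∫⁻ p in U ×ˢ U, (K i ×ˢ K i).indicator (fun p => ‖u p.1 - u p.2‖ₑ) p
      ≤ 8 * volume U * ∫⁻ x in U, H x := by
    intro i
    rw [lintegral_indicator ((hKc i).measurableSet.prod (hKc i).measurableSet),
      Measure.restrict_restrict_of_subset (Set.prod_mono (hKU i) (hKU i))]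
    refine (lintegral_enorm_sub_compact_le hU (hKc i) (hc.closure.affine_image _) (hKU i) hu hW hH
      hgH).trans ?_
    gcongr
    exact hKU i
  -- Every pair of points is eventually in `K i ×ˢ K i`, so the integrand is the limit of its
  -- truncations and Fatou's lemma applies.
  calc ∫⁻ p in U ×ˢ U, ‖u p.1 - u p.2‖ₑ
      = ∫⁻ p in U ×ˢ U, liminf (fun i => (K i ×ˢ K i).indicator
          (fun p => ‖u p.1 - u p.2‖ₑ) p) atTop := by
        refine setLIntegral_congr_fun (hU.measurableSet.prod hU.measurableSet) fun p hp => ?_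
        refine (Tendsto.liminf_eq ?_).symm
        refine tendsto_const_nhds.congr' ?_
        filter_upwards [hmem _ hp.1, hmem _ hp.2] with i h1 h2
        exact (indicator_of_mem (s := K i ×ˢ K i) (a := p) ⟨h1, h2⟩
          (fun p => ‖u p.1 - u p.2‖ₑ)).symm
    _ ≤ liminf (fun i => ∫⁻ p in U ×ˢ U, (K i ×ˢ K i).indicator
          (fun p => ‖u p.1 - u p.2‖ₑ) p) atTop := by
        refine lintegral_liminf_le' fun i => ?_
        have h1 : ContinuousOn (fun p : E3 × E3 => ‖u p.1 - u p.2‖ₑ) (U ×ˢ U) :=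
          ((hu.comp continuousOn_fst fun p hp => hp.1).sub
            (hu.comp continuousOn_snd fun p hp => hp.2)).enorm
        exact (h1.aemeasurable (hU.measurableSet.prod hU.measurableSet)).indicator
          ((hKc i).measurableSet.prod (hKc i).measurableSet)
    _ ≤ 8 * volume U * ∫⁻ x in U, H x := by
        refine liminf_le_of_le (by isBoundedDefault) fun b hb => ?_
        obtain ⟨i, hi'⟩ := hb.exists
        exact hi'.trans (hi i)

/-- Integrate |u(x)| ≤ |u(y)| + |u(x) - u(y)| over x in `U` and y in `A`. No mean value is
subtracted: smallness of `u` on the part `A` is what propagates. -/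
theorem volume_mul_lintegral_enorm_le {U A : Set E3} (hU : IsOpen U) (hc : Convex ℝ U)
    (hbd : Bornology.IsBounded U) {u : E3 → ℝ} (hu : ContinuousOn u U) {g : E3 → E3 → ℝ}
    (hW : ∀ e, WeakDir U u e (g e)) {H : E3 → ENNReal}
    (hH : AEMeasurable H (volume.restrict U))
    (hgH : ∀ x ∈ U, ∀ y ∈ U, ∀ z ∈ U, ‖g (x - y) z‖ₑ ≤ H z) (hA : A ⊆ U) :
    volume A * ∫⁻ x in U, ‖u x‖ₑ ≤
      volume U * (∫⁻ x in A, ‖u x‖ₑ) + 8 * volume U * ∫⁻ x in U, H x := by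
  have hum : AEMeasurable u (volume.restrict U) := hu.aemeasurable hU.measurableSet
  have humA : AEMeasurable u (volume.restrict A) :=
    hum.mono_measure (Measure.restrict_mono_set _ hA)
  have m2 : AEMeasurable (fun p : E3 × E3 => ‖u p.2‖ₑ)
      ((volume.restrict U).prod (volume.restrict A)) :=
    (humA.comp_quasiMeasurePreserving Measure.quasiMeasurePreserving_snd).enorm
  have m1 : AEMeasurable (fun p : E3 × E3 => ‖u p.1‖ₑ)
      ((volume.restrict U).prod (volume.restrict A)) :=
    (hum.comp_quasiMeasurePreserving Measure.quasiMeasurePreserving_fst).enorm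
  have h1 : volume A * ∫⁻ x in U, ‖u x‖ₑ = ∫⁻ p in U ×ˢ A, ‖u p.1‖ₑ := by
    rw [Measure.volume_eq_prod, ← Measure.prod_restrict, lintegral_prod _ m1]
    simp only [lintegral_const, Measure.restrict_apply_univ]
    rw [lintegral_mul_const'' _ hum.enorm, mul_comm]
  have h2 : volume U * ∫⁻ x in A, ‖u x‖ₑ = ∫⁻ p in U ×ˢ A, ‖u p.2‖ₑ := by
    rw [Measure.volume_eq_prod, ← Measure.prod_restrict, lintegral_prod _ m2]
    simp only [lintegral_const, Measure.restrict_apply_univ]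
    rw [mul_comm]
  rw [h1, h2]
  calc ∫⁻ p in U ×ˢ A, ‖u p.1‖ₑ ≤ ∫⁻ p in U ×ˢ A, (‖u p.2‖ₑ + ‖u p.1 - u p.2‖ₑ) := by
        refine lintegral_mono fun p => ?_
        calc ‖u p.1‖ₑ = ‖u p.2 + (u p.1 - u p.2)‖ₑ := by congr 1; ring
          _ ≤ _ := enorm_add_le _ _
    _ = (∫⁻ p in U ×ˢ A, ‖u p.2‖ₑ) + ∫⁻ p in U ×ˢ A, ‖u p.1 - u p.2‖ₑ := by
        refine lintegral_add_left' ?_ _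
        rw [Measure.volume_eq_prod, ← Measure.prod_restrict]
        exact m2
    _ ≤ _ := by
        gcongr
        refine le_trans (lintegral_mono_set (Set.prod_mono subset_rfl hA)) ?_
        exact lintegral_enorm_sub_le hU hc hbd hu hW hH hgH

/-! ### Parallelepipeds and the trace on an edge. -/

/-- The affine map with the given origin and the given edge vectors. -/
def boxMap (A p v w : E3) (q : ℝ × ℝ × ℝ) : E3 := A + q.1 • p + q.2.1 • v + q.2.2 • w

/-- The determinant of three vectors. -/
def det3 (p v w : E3) : ℝ := Matrix.det (Matrix.of fun i j => (![p, v, w] j) i)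

theorem continuous_boxMap (A p v w : E3) : Continuous (boxMap A p v w) := by
  unfold boxMap; fun_prop

theorem map_boxMap (A : E3) {p v w : E3} (h : det3 p v w ≠ 0) :
    Measure.map (boxMap A p v w) volume = ENNReal.ofReal |det3 p v w|⁻¹ • volume := by
  set e2 := (MeasurableEquiv.piFinTwo fun _ : Fin 2 => ℝ).symm with he2
  set e3 := (MeasurableEquiv.piFinSuccAbove (fun _ : Fin 3 => ℝ) 0).symm with he3
  have m2 : MeasurePreserving e2 volume volume :=
    (volume_preserving_piFinTwo fun _ : Fin 2 => ℝ).symm _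
  have m3 : MeasurePreserving e3 volume volume :=
    (volume_preserving_piFinSuccAbove (fun _ : Fin 3 => ℝ) 0).symm _
  have m4 : MeasurePreserving (fun q : ℝ × ℝ × ℝ => e3 (q.1, e2 q.2)) volume volume :=
    m3.comp ((MeasurePreserving.id volume).prod m2)
  set M : Matrix (Fin 3) (Fin 3) ℝ := Matrix.of fun i j => (![p, v, w] j) i with hM
  have m5 : MeasurePreserving (WithLp.toLp 2 : (Fin 3 → ℝ) → E3) volume volume :=
    PiLp.volume_preserving_toLp (Fin 3)
  have hL : Measurable (Matrix.toLin' M) :=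
    (LinearMap.continuous_of_finiteDimensional (Matrix.toLin' M)).measurable
  have e : boxMap A p v w = (fun x => A + x) ∘ (WithLp.toLp 2 : (Fin 3 → ℝ) → E3) ∘
      (Matrix.toLin' M) ∘ (fun q : ℝ × ℝ × ℝ => e3 (q.1, e2 q.2)) := by
    funext q
    ext i
    simp only [boxMap, Function.comp_apply, PiLp.add_apply, PiLp.smul_apply, smul_eq_mul,
      Matrix.toLin'_apply, Matrix.mulVec, dotProduct, Fin.sum_univ_three, hM, Matrix.of_apply]
    simp [he2, he3, MeasurableEquiv.piFinSuccAbove, MeasurableEquiv.piFinTwo,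
      Fin.insertNthEquiv]
    ring_nf
  rw [e, ← Measure.map_map (measurable_const_add A) (m5.measurable.comp (hL.comp m4.measurable)),
    ← Measure.map_map m5.measurable (hL.comp m4.measurable),
    ← Measure.map_map hL m4.measurable, m4.map_eq,
    Real.map_matrix_volume_pi_eq_smul_volume_pi h, Measure.map_smul, m5.map_eq, Measure.map_smul,
    map_add_left_eq_self, abs_inv]
  rfl

theorem lintegral_comp_boxMap (A : E3) {p v w : E3} (h : det3 p v w ≠ 0) {F : E3 → ENNReal}
    (hF : Measurable F) :
    ∫⁻ q, F (boxMap A p v w q) = ENNReal.ofReal |det3 p v w|⁻¹ * ∫⁻ x, F x := by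
  rw [← lintegral_map hF (continuous_boxMap A p v w).measurable, map_boxMap A h,
    lintegral_smul_measure, smul_eq_mul]

theorem lintegral_add_four {X : Type*} [MeasurableSpace X] {m : Measure X}
    {a b c d : X → ENNReal} (ha : AEMeasurable a m) (hb : AEMeasurable b m)
    (hc : AEMeasurable c m) : ∫⁻ x, ((a x + b x) + (c x + d x)) ∂m =
      ((∫⁻ x, a x ∂m) + ∫⁻ x, b x ∂m) + ((∫⁻ x, c x ∂m) + ∫⁻ x, d x ∂m) := by
  rw [lintegral_add_left' (f := fun x => a x + b x) (ha.add hb), lintegral_add_left' ha,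
    lintegral_add_left' hc]

/-- The fundamental theorem of calculus from η to r, averaged over r. The interval has length
between 1/2 and 1, which gives the factor 2. -/
theorem enorm_le_lintegral_line {f : E3 → ℝ} (hf : ContDiff ℝ ∞ f) (y e : E3) {η : ℝ}
    (h0 : 0 ≤ η) (h1 : η ≤ 1 / 4) :
    ‖f (y + η • e)‖ₑ ≤
      2 * ∫⁻ r in Ioc η (1 - η), (‖f (y + r • e)‖ₑ + ‖fderiv ℝ f (y + r • e) e‖ₑ) := by
  set I := Ioc η (1 - η) with hI
  set B := ∫⁻ r in I, ‖fderiv ℝ f (y + r • e) e‖ₑ with hB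
  have hv : volume I = ENNReal.ofReal (1 - η - η) := Real.volume_Ioc
  have hv1 : volume I ≤ 1 := by
    rw [hv]; exact ENNReal.ofReal_le_one.2 (by linarith)
  have hv2 : 1 ≤ 2 * volume I := by
    rw [hv, ← ENNReal.ofReal_ofNat, ← ENNReal.ofReal_mul (by norm_num)]
    exact ENNReal.one_le_ofReal.2 (by linarith)
  have hp : ∀ r ∈ I, ‖f (y + η • e)‖ₑ ≤ ‖f (y + r • e)‖ₑ + B := by
    intro r hr
    have h2 := enorm_sub_le_lintegral_fderiv hf y e hr.1.le
    calc ‖f (y + η • e)‖ₑ = ‖f (y + r • e) - (f (y + r • e) - f (y + η • e))‖ₑ := by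
          congr 1; ring
      _ ≤ ‖f (y + r • e)‖ₑ + ‖f (y + r • e) - f (y + η • e)‖ₑ := enorm_sub_le
      _ ≤ _ := by
          gcongr
          exact h2.trans (lintegral_mono_set (Ioc_subset_Ioc_right hr.2))
  have hc : Continuous f := hf.continuous
  have hm : Measurable fun r : ℝ => ‖f (y + r • e)‖ₑ :=
    (hc.comp (by fun_prop : Continuous fun r : ℝ => y + r • e)).measurable.enorm
  have h3 := setLIntegral_mono' (μ := volume) measurableSet_Ioc hp
  rw [setLIntegral_const, lintegral_add_left hm, setLIntegral_const] at h3
  rw [lintegral_add_left hm]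
  calc ‖f (y + η • e)‖ₑ ≤ (2 * volume I) * ‖f (y + η • e)‖ₑ := le_mul_of_one_le_left' hv2
    _ = 2 * (‖f (y + η • e)‖ₑ * volume I) := by ring
    _ ≤ 2 * ((∫⁻ r in I, ‖f (y + r • e)‖ₑ) + B * volume I) := by gcongr
    _ ≤ 2 * ((∫⁻ r in I, ‖f (y + r • e)‖ₑ) + B) := by
        gcongr; exact mul_le_of_le_one_right' hv1

/-- The one-dimensional trace estimate is used in the direction `w` for `f`, then in the direction
`v` for `f` and its `w`-derivative. This produces the mixed second derivative but no pure one. The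
edge is shifted inwards by η, so that only a compact part of the open box is involved. -/
theorem lintegral_edge_smooth_le {f : E3 → ℝ} (hf : ContDiff ℝ ∞ f) (A p v w : E3) {η : ℝ}
    (h0 : 0 ≤ η) (h1 : η ≤ 1 / 4) :
    ∫⁻ α in Ioc η (1 - η), ‖f (boxMap A p v w (α, η, η))‖ₑ ≤
      4 * ∫⁻ q in Ioc η (1 - η) ×ˢ Ioc η (1 - η) ×ˢ Ioc η (1 - η),
        ((‖f (boxMap A p v w q)‖ₑ + ‖fderiv ℝ f (boxMap A p v w q) v‖ₑ) +
          (‖fderiv ℝ f (boxMap A p v w q) w‖ₑ +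
            ‖fderiv ℝ (fun x => fderiv ℝ f x w) (boxMap A p v w q) v‖ₑ)) := by
  set I := Ioc η (1 - η) with hI
  have hfw : ContDiff ℝ ∞ (fun x => fderiv ℝ f x w) :=
    (hf.fderiv_right (m := ∞) (by simp)).clm_apply contDiff_const
  have c1 : Continuous f := hf.continuous
  have c2 : Continuous fun x => fderiv ℝ f x v :=
    (hf.continuous_fderiv (by simp)).clm_apply continuous_const
  have c3 : Continuous fun x => fderiv ℝ f x w := hfw.continuous
  have c4 : Continuous fun x => fderiv ℝ (fun x => fderiv ℝ f x w) x v :=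
    (hfw.continuous_fderiv (by simp)).clm_apply continuous_const
  set Ψ : E3 → ENNReal := fun x => (‖f x‖ₑ + ‖fderiv ℝ f x v‖ₑ) +
    (‖fderiv ℝ f x w‖ₑ + ‖fderiv ℝ (fun x => fderiv ℝ f x w) x v‖ₑ) with hΨ
  have hΨm : Measurable fun q => Ψ (boxMap A p v w q) := by
    have : Continuous Ψ := by fun_prop
    exact (this.comp (continuous_boxMap A p v w)).measurable
  have key : ∀ α, ‖f (boxMap A p v w (α, η, η))‖ₑ ≤
      4 * ∫⁻ γ in I, ∫⁻ β in I, Ψ (boxMap A p v w (α, β, γ)) := by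
    intro α
    have e1 : ∀ β γ, boxMap A p v w (α, β, γ) = (A + α • p + β • v) + γ • w := fun β γ => rfl
    have e2 : ∀ β γ, boxMap A p v w (α, β, γ) = (A + α • p + γ • w) + β • v := fun β γ => by
      simp only [boxMap]; abel
    have s1 := enorm_le_lintegral_line hf (A + α • p + η • v) w h0 h1
    simp only [← e1] at s1
    refine s1.trans ?_
    have e4 : (4 : ENNReal) = 2 * 2 := by norm_num
    rw [e4, mul_assoc]
    refine mul_le_mul_right ?_ 2
    rw [← lintegral_const_mul' _ _ ENNReal.ofNat_ne_top]
    refine lintegral_mono fun γ => ?_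
    have s2 := enorm_le_lintegral_line hf (A + α • p + γ • w) v h0 h1
    have s3 := enorm_le_lintegral_line hfw (A + α • p + γ • w) v h0 h1
    simp only [← e2] at s2 s3
    refine (add_le_add s2 s3).trans (le_of_eq ?_)
    rw [← mul_add, ← lintegral_add_left]
    exact ((c1.comp ((continuous_boxMap A p v w).comp (by fun_prop))).enorm.add
      (c2.comp ((continuous_boxMap A p v w).comp (by fun_prop))).enorm).measurable
  refine (lintegral_mono key).trans ?_
  rw [lintegral_const_mul' _ _ ENNReal.ofNat_ne_top]
  refine mul_le_mul_right (le_of_eq ?_) 4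
  rw [Measure.volume_eq_prod, ← Measure.prod_restrict, lintegral_prod _ hΨm.aemeasurable]
  refine lintegral_congr fun α => ?_
  rw [Measure.volume_eq_prod, ← Measure.prod_restrict,
    lintegral_prod_symm' (fun y => Ψ (boxMap A p v w (α, y))) (hΨm.comp measurable_prodMk_left)]

open Metric Filter Topology in
/-- The trace on an edge of a parallelepiped. -/
theorem lintegral_edge_le {U : Set E3} (hU : IsOpen U) {u gv gw gwv : E3 → ℝ}
    (hu : ContinuousOn u U) {A p v w : E3} (hv : WeakDir U u v gv) (hw : WeakDir U u w gw)
    (hwv : WeakDir U gw v gwv) (hdet : det3 p v w ≠ 0)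
    (hbox : ∀ q ∈ Ioo (0 : ℝ) 1 ×ˢ Ioo (0 : ℝ) 1 ×ˢ Ioo (0 : ℝ) 1, boxMap A p v w q ∈ U)
    (hlim : ∀ α ∈ Ioo (0 : ℝ) 1,
      Tendsto (fun s => u (boxMap A p v w (α, s, s))) (𝓝[>] 0) (𝓝 (u (A + α • p)))) :
    ∫⁻ α in Ioo (0 : ℝ) 1, ‖u (A + α • p)‖ₑ ≤ 4 * (ENNReal.ofReal |det3 p v w|⁻¹ *
      ∫⁻ x in U, ((‖u x‖ₑ + ‖gv x‖ₑ) + (‖gw x‖ₑ + ‖gwv x‖ₑ))) := by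
  set Z := ENNReal.ofReal |det3 p v w|⁻¹ *
    ∫⁻ x in U, ((‖u x‖ₑ + ‖gv x‖ₑ) + (‖gw x‖ₑ + ‖gwv x‖ₑ)) with hZ
  -- On a shifted edge the smooth estimate passes to `u` by mollification and Fatou's lemma. A
  -- second application of Fatou's lemma, as η → 0, reaches the edge itself; there `hlim` replaces
  -- continuity inside `U`.
  have step1 : ∀ η : ℝ, 0 < η → η ≤ 1 / 4 →
      ∫⁻ α in Ioc η (1 - η), ‖u (boxMap A p v w (α, η, η))‖ₑ ≤ 4 * Z := by
    intro η h0 h1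
    set I := Ioc η (1 - η) with hI
    have hIsub : Icc η (1 - η) ⊆ Ioo (0 : ℝ) 1 := fun x hx =>
      ⟨lt_of_lt_of_le h0 hx.1, lt_of_le_of_lt hx.2 (by linarith)⟩
    set K := boxMap A p v w '' (Icc η (1 - η) ×ˢ Icc η (1 - η) ×ˢ Icc η (1 - η)) with hKd
    have hK : IsCompact K :=
      (isCompact_Icc.prod (isCompact_Icc.prod isCompact_Icc)).image (continuous_boxMap A p v w)
    have hKU : K ⊆ U := by
      rintro _ ⟨q, ⟨h2, h3, h4⟩, rfl⟩
      exact hbox q ⟨hIsub h2, hIsub h3, hIsub h4⟩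
    obtain ⟨K', O, hK', hK'U, hO, hKO, hOK', φ, hφ, hb⟩ := exists_compact_bumps hU hK hKU
    set V : ℕ → E3 → ℝ := fun i => mollify (φ i) (K'.indicator u) with hV
    have hint : ∀ {f : E3 → ℝ}, LocallyIntegrableOn f U → Integrable (K'.indicator f) :=
      fun hf => (hf.integrableOn_compact_subset hK'U hK').integrable_indicator hK'.measurableSet
    have hVs : ∀ i, ContDiff ℝ ∞ (V i) := fun i => contDiff_mollify _ (hint hv.1)
    have hc : ∀ {f : E3 → ℝ}, LocallyIntegrableOn f U → ∀ i,
        Measurable fun x => ‖mollify (φ i) (K'.indicator f) x‖ₑ :=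
      fun hf i => (contDiff_mollify _ (hint hf)).continuous.measurable.enorm
    have hi : ∀ i, ∫⁻ α in I, ‖V i (boxMap A p v w (α, η, η))‖ₑ ≤ 4 * Z := by
      intro i
      refine (lintegral_edge_smooth_le (hVs i) A p v w h0.le h1).trans (mul_le_mul_right ?_ 4)
      calc _ ≤ ∫⁻ q in I ×ˢ I ×ˢ I, (fun x => (‖mollify (φ i) (K'.indicator u) x‖ₑ +
              ‖mollify (φ i) (K'.indicator gv) x‖ₑ) + (‖mollify (φ i) (K'.indicator gw) x‖ₑ +
              ‖mollify (φ i) (K'.indicator gwv) x‖ₑ)) (boxMap A p v w q) := by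
            refine setLIntegral_mono' (measurableSet_Ioc.prod
              (measurableSet_Ioc.prod measurableSet_Ioc)) fun q hq => ?_
            have hq' : boxMap A p v w q ∈ O := hKO ⟨q, ⟨Ioc_subset_Icc_self hq.1,
              Ioc_subset_Icc_self hq.2.1, Ioc_subset_Icc_self hq.2.2⟩, rfl⟩
            have d1 := hv.fderiv_mollify hK' hK'U (φ i) (hb i _ hq')
            have d2 := hw.fderiv_mollify hK' hK'U (φ i) (hb i _ hq')
            have d3 : (fun x => fderiv ℝ (V i) x w) =ᶠ[𝓝 (boxMap A p v w q)]
                mollify (φ i) (K'.indicator gw) := by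
              filter_upwards [hO.mem_nhds hq'] with x hx using
                hw.fderiv_mollify hK' hK'U (φ i) (hb i _ hx)
            have d4 := hwv.fderiv_mollify hK' hK'U (φ i) (hb i _ hq')
            rw [d3.fderiv_eq, d4, hV, d1, d2]
        _ ≤ ENNReal.ofReal |det3 p v w|⁻¹ * ∫⁻ x, ((‖mollify (φ i) (K'.indicator u) x‖ₑ +
              ‖mollify (φ i) (K'.indicator gv) x‖ₑ) + (‖mollify (φ i) (K'.indicator gw) x‖ₑ +
              ‖mollify (φ i) (K'.indicator gwv) x‖ₑ)) := by
            refine (setLIntegral_le_lintegral _ _).trans (le_of_eq ?_)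
            exact lintegral_comp_boxMap A hdet (((hc hv.1 i).add (hc hv.2.1 i)).add
              ((hc hw.2.1 i).add (hc hwv.2.1 i)))
        _ ≤ Z := by
            refine mul_le_mul_right ?_ _
            have am : ∀ {f : E3 → ℝ}, LocallyIntegrableOn f U →
                AEMeasurable (fun x => ‖f x‖ₑ) (volume.restrict U) := fun hf =>
              hf.aestronglyMeasurable.enorm
            rw [lintegral_add_four (hc hv.1 i).aemeasurable (hc hv.2.1 i).aemeasurable
              (hc hw.2.1 i).aemeasurable, lintegral_add_four (am hv.1) (am hv.2.1) (am hw.2.1)]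
            exact add_le_add (add_le_add (lintegral_enorm_mollify_le hU hv.1 hK' hK'U _)
              (lintegral_enorm_mollify_le hU hv.2.1 hK' hK'U _))
              (add_le_add (lintegral_enorm_mollify_le hU hw.2.1 hK' hK'U _)
              (lintegral_enorm_mollify_le hU hwv.2.1 hK' hK'U _))
    calc ∫⁻ α in I, ‖u (boxMap A p v w (α, η, η))‖ₑ
        = ∫⁻ α in I, liminf (fun i => ‖V i (boxMap A p v w (α, η, η))‖ₑ) atTop := by
          refine setLIntegral_congr_fun measurableSet_Ioc fun α hα => ?_
          have hx : boxMap A p v w (α, η, η) ∈ K :=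
            ⟨_, ⟨Ioc_subset_Icc_self hα, ⟨le_rfl, by linarith⟩, ⟨le_rfl, by linarith⟩⟩, rfl⟩
          exact (tendsto_mollify hφ hK' (hu.mono hK'U)
            (mem_of_superset (hO.mem_nhds (hKO hx)) hOK')).enorm.liminf_eq.symm
      _ ≤ liminf (fun i => ∫⁻ α in I, ‖V i (boxMap A p v w (α, η, η))‖ₑ) atTop := by
          refine lintegral_liminf_le fun i => ?_
          exact ((hVs i).continuous.comp
            ((continuous_boxMap A p v w).comp (by fun_prop))).measurable.enorm
      _ ≤ 4 * Z := by
          refine liminf_le_of_le (by isBoundedDefault) fun b hb => ?_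
          obtain ⟨i, hi'⟩ := hb.exists
          exact hi'.trans (hi i)
  set η : ℕ → ℝ := fun j => 1 / ((j : ℝ) + 4) with hη
  have hη0 : ∀ j, 0 < η j ∧ η j ≤ 1 / 4 := fun j => by
    refine ⟨by positivity, ?_⟩
    simp only [hη]
    gcongr
    linarith [(Nat.cast_nonneg j : (0 : ℝ) ≤ j)]
  have hηl : Tendsto η atTop (𝓝 0) :=
    Tendsto.div_atTop tendsto_const_nhds
      (tendsto_atTop_add_const_right _ _ tendsto_natCast_atTop_atTop)
  have hηl' : Tendsto η atTop (𝓝[>] 0) :=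
    tendsto_nhdsWithin_iff.2 ⟨hηl, Eventually.of_forall fun j => (hη0 j).1⟩
  calc ∫⁻ α in Ioo (0 : ℝ) 1, ‖u (A + α • p)‖ₑ
      = ∫⁻ α in Ioo (0 : ℝ) 1, liminf (fun j => (Ioc (η j) (1 - η j)).indicator
          (fun α => ‖u (boxMap A p v w (α, η j, η j))‖ₑ) α) atTop := by
        refine setLIntegral_congr_fun measurableSet_Ioo fun α hα => ?_
        refine (Tendsto.liminf_eq ?_).symm
        refine Tendsto.congr' ?_ ((hlim α hα).comp hηl').enorm
        have t1 := hηl.eventually (gt_mem_nhds hα.1)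
        have t2 := hηl.eventually (gt_mem_nhds (sub_pos.2 hα.2))
        filter_upwards [t1, t2] with j h1 h2
        have h3 : α ∈ Ioc (η j) (1 - η j) := ⟨h1, by linarith⟩
        exact (indicator_of_mem h3 (fun α => ‖u (boxMap A p v w (α, η j, η j))‖ₑ)).symm
    _ ≤ liminf (fun j => ∫⁻ α in Ioo (0 : ℝ) 1, (Ioc (η j) (1 - η j)).indicator
          (fun α => ‖u (boxMap A p v w (α, η j, η j))‖ₑ) α) atTop := by
        refine lintegral_liminf_le' fun j => ?_
        refine AEMeasurable.mono_measure ?_ Measure.restrict_le_self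
        rw [aemeasurable_indicator_iff measurableSet_Ioc]
        refine ContinuousOn.aemeasurable ?_ measurableSet_Ioc
        refine ContinuousOn.enorm (hu.comp ((continuous_boxMap A p v w).comp
          (by fun_prop : Continuous fun α : ℝ => (α, η j, η j))).continuousOn fun α hα => ?_)
        have := hη0 j
        exact hbox _ ⟨⟨lt_trans this.1 hα.1, by linarith [hα.2]⟩,
          ⟨this.1, by linarith⟩, ⟨this.1, by linarith⟩⟩
    _ ≤ 4 * Z := by
        refine liminf_le_of_le (by isBoundedDefault) fun b hb => ?_
        obtain ⟨j, hj⟩ := hb.exists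
        refine hj.trans (le_trans ?_ (step1 (η j) (hη0 j).1 (hη0 j).2))
        refine (setLIntegral_le_lintegral _ _).trans (le_of_eq ?_)
        rw [lintegral_indicator measurableSet_Ioc]

/-! ### A Hardy inequality for functions vanishing on an axis. -/

theorem lintegral_Ioc_inv_cube_le {M : ℝ} (hM : 0 < M) :
    ∫⁻ τ in Ioi M, ENNReal.ofReal ((τ ^ 3)⁻¹) ≤ ENNReal.ofReal ((M ^ 2)⁻¹) := by
  have h1 : ∀ τ ∈ Ioi M, ENNReal.ofReal ((τ ^ 3)⁻¹) = ENNReal.ofReal (τ ^ (-3 : ℝ)) := by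
    intro τ hτ
    have : 0 < τ := hM.trans hτ
    rw [Real.rpow_neg this.le]
    norm_cast
  rw [setLIntegral_congr_fun measurableSet_Ioi h1,
    ← ofReal_integral_eq_lintegral_ofReal (integrableOn_Ioi_rpow_of_lt (by norm_num) hM),
    integral_Ioi_rpow_of_lt (by norm_num) hM]
  · refine ENNReal.ofReal_le_ofReal ?_
    norm_num
    positivity
  · filter_upwards [ae_restrict_mem measurableSet_Ioi] with τ hτ
    have : 0 < τ := hM.trans hτ
    positivity

theorem lintegral_prod_comp_smul (F : ℝ × ℝ → ENNReal) {τ : ℝ} (hτ : 0 < τ) :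
    ∫⁻ y : ℝ × ℝ, F (τ • y) = ENNReal.ofReal ((τ ^ 2)⁻¹) * ∫⁻ y, F y := by
  have h1 := lintegral_map_equiv F (μ := volume) (MeasurableEquiv.smul₀ (α := ℝ × ℝ) τ hτ.ne')
  have h2 : Measure.map (MeasurableEquiv.smul₀ (α := ℝ × ℝ) τ hτ.ne') volume
      = Measure.map (τ • ·) volume := rfl
  rw [h2, Measure.map_addHaar_smul volume hτ.ne', lintegral_smul_measure] at h1
  have h3 : |(τ ^ Module.finrank ℝ (ℝ × ℝ))⁻¹| = (τ ^ 2)⁻¹ := by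
    simp
  rw [h3] at h1
  exact h1.symm

/-- A Hardy-type estimate for averages over dilations of the square. -/
theorem lintegral_dilation_le {f : ℝ × ℝ → ENNReal} (hf : Measurable f) {κ : ℝ} (hκ : 0 < κ) :
    ∫⁻ y in Ioo (0 : ℝ) 1 ×ˢ Ioo (0 : ℝ) 1, ∫⁻ τ in Ioc κ 1, ENNReal.ofReal ‖y‖ * f (τ • y)
      ≤ ∫⁻ y in {y : ℝ × ℝ | 0 < ‖y‖}, f y * ENNReal.ofReal (‖y‖⁻¹) := by
  have hm : Measurable fun q : (ℝ × ℝ) × ℝ => ENNReal.ofReal ‖q.1‖ * f (q.2 • q.1) :=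
    (measurable_fst.norm.ennreal_ofReal).mul (hf.comp (by fun_prop))
  rw [lintegral_lintegral_swap hm.aemeasurable]
  set h : ℝ → ℝ × ℝ → ENNReal := fun τ z =>
    {z : ℝ × ℝ | 0 < ‖z‖ ∧ ‖z‖ < τ}.indicator (fun z => ENNReal.ofReal ‖z‖ * f z) z with hh
  -- Substitute z = τy in the plane: the Jacobian gives τ⁻², ‖y‖ = ‖z‖/τ gives another τ⁻¹, and ‖y‖
  -- < 1 becomes ‖z‖ < τ. The norm is the maximum norm, whose unit ball contains the open square.
  have hs : ∀ τ ∈ Ioc κ 1, ∫⁻ y in Ioo (0 : ℝ) 1 ×ˢ Ioo (0 : ℝ) 1, ENNReal.ofReal ‖y‖ * f (τ • y)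
      ≤ ∫⁻ z, ENNReal.ofReal ((τ ^ 3)⁻¹) * h τ z := by
    intro τ hτ
    have hτ0 : 0 < τ := hκ.trans hτ.1
    rw [lintegral_const_mul' _ _ ENNReal.ofReal_ne_top]
    have e1 : ENNReal.ofReal ((τ ^ 3)⁻¹) =
        ENNReal.ofReal (τ⁻¹) * ENNReal.ofReal ((τ ^ 2)⁻¹) := by
      rw [← ENNReal.ofReal_mul (by positivity)]
      congr 1; field_simp
    rw [e1, mul_assoc, ← lintegral_prod_comp_smul (h τ) hτ0,
      ← lintegral_const_mul' _ _ ENNReal.ofReal_ne_top,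
      ← lintegral_indicator (measurableSet_Ioo.prod measurableSet_Ioo)]
    refine lintegral_mono fun y => ?_
    by_cases hy : y ∈ Ioo (0 : ℝ) 1 ×ˢ Ioo (0 : ℝ) 1
    · rw [indicator_of_mem hy]
      obtain ⟨⟨a1, a2⟩, b1, b2⟩ := hy
      have n1 : ‖y‖ < 1 := by
        rw [Prod.norm_def, max_lt_iff, Real.norm_of_nonneg a1.le, Real.norm_of_nonneg b1.le]
        exact ⟨a2, b2⟩
      have n0 : 0 < ‖y‖ := norm_pos_iff.2 fun h0 => by simp [h0] at a1
      have n2 : ‖τ • y‖ = τ * ‖y‖ := by rw [norm_smul, Real.norm_of_nonneg hτ0.le]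
      have hmem : τ • y ∈ {z : ℝ × ℝ | 0 < ‖z‖ ∧ ‖z‖ < τ} := by
        simp only [mem_ofPred_eq, n2]
        exact ⟨by positivity, by nlinarith⟩
      simp only [hh]
      rw [indicator_of_mem hmem, n2, ← mul_assoc, ← ENNReal.ofReal_mul (by positivity),
        inv_mul_cancel_left₀ hτ0.ne']
    · rw [indicator_of_notMem hy]; exact zero_le
  refine (setLIntegral_mono' measurableSet_Ioc hs).trans ?_
  have hhm : Measurable fun q : ℝ × (ℝ × ℝ) => ENNReal.ofReal ((q.1 ^ 3)⁻¹) * h q.1 q.2 := by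
    refine Measurable.mul (by fun_prop) ?_
    have : (fun q : ℝ × (ℝ × ℝ) => h q.1 q.2) =
        {q : ℝ × (ℝ × ℝ) | 0 < ‖q.2‖ ∧ ‖q.2‖ < q.1}.indicator
          (fun q => ENNReal.ofReal ‖q.2‖ * f q.2) := by
      funext q; simp only [hh, indicator]; rfl
    rw [this]
    refine Measurable.indicator ?_ ?_
    · exact (measurable_snd.norm.ennreal_ofReal).mul (hf.comp measurable_snd)
    · exact (measurableSet_lt measurable_const measurable_snd.norm).inter
        (measurableSet_lt measurable_snd.norm measurable_fst)
  rw [lintegral_lintegral_swap hhm.aemeasurable, ← lintegral_indicator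
    (measurableSet_lt measurable_const measurable_norm)]
  refine lintegral_mono fun z => ?_
  by_cases hz : 0 < ‖z‖
  · rw [indicator_of_mem (show z ∈ {y : ℝ × ℝ | 0 < ‖y‖} from hz)]
    -- The integral of τ⁻³ over τ > ‖z‖ is at most ‖z‖⁻²; multiplied by ‖z‖ it leaves the weight
    -- ‖z‖⁻¹.
    have e2 : ∀ τ, ENNReal.ofReal ((τ ^ 3)⁻¹) * h τ z ≤ (Ioi ‖z‖).indicator (fun τ =>
        ENNReal.ofReal ((τ ^ 3)⁻¹) * (ENNReal.ofReal ‖z‖ * f z)) τ := by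
      intro τ
      by_cases hzτ : ‖z‖ < τ
      · rw [indicator_of_mem (show τ ∈ Ioi ‖z‖ from hzτ)]
        refine mul_le_mul_right ?_ _
        exact indicator_le_self' (fun _ _ => zero_le) z
      · have : h τ z = 0 := indicator_of_notMem (fun hc => hzτ hc.2) _
        rw [this, mul_zero]; exact zero_le
    refine (setLIntegral_le_lintegral _ _).trans ((lintegral_mono e2).trans ?_)
    rw [lintegral_indicator measurableSet_Ioi, lintegral_mul_const _ (by fun_prop)]
    refine (mul_le_mul_left (lintegral_Ioc_inv_cube_le hz) _).trans (le_of_eq ?_)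
    rw [← mul_assoc, ← ENNReal.ofReal_mul (by positivity), mul_comm]
    congr 2
    field_simp
  · have : ∀ τ, h τ z = 0 := fun τ => indicator_of_notMem (fun hc => hz hc.1) _
    simp [this]

open Metric Filter Topology in
/-- A function vanishing on the axis of a parallelepiped is controlled by its weighted
transversal derivatives. -/
theorem lintegral_box_axis_le {U : Set E3} (hU : IsOpen U) {u gp gq : E3 → ℝ}
    (hu : ContinuousOn u U) {A p q w : E3} (hp : WeakDir U u p gp) (hq : WeakDir U u q gq)
    (hdet : det3 p q w ≠ 0)
    (hbox : ∀ x ∈ Ioo (0 : ℝ) 1 ×ˢ Ioo (0 : ℝ) 1 ×ˢ Ioo (0 : ℝ) 1, boxMap A p q w x ∈ U)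
    {ρ : E3 → ℝ} (hρ : Continuous ρ) {c : ℝ}
    (hρ0 : ∀ x ∈ Ioo (0 : ℝ) 1 ×ˢ Ioo (0 : ℝ) 1 ×ˢ Ioo (0 : ℝ) 1, 0 < ρ (boxMap A p q w x) ∧
      ρ (boxMap A p q w x) ≤ c * max x.1 x.2.1)
    (hlim : ∀ x ∈ Ioo (0 : ℝ) 1 ×ˢ Ioo (0 : ℝ) 1 ×ˢ Ioo (0 : ℝ) 1,
      Tendsto (fun κ => u (boxMap A p q w (κ * x.1, κ * x.2.1, x.2.2))) (𝓝[>] 0) (𝓝 0)) :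
    ∫⁻ x in Ioo (0 : ℝ) 1 ×ˢ Ioo (0 : ℝ) 1 ×ˢ Ioo (0 : ℝ) 1, ‖u (boxMap A p q w x)‖ₑ ≤
      2 * (ENNReal.ofReal c * (ENNReal.ofReal |det3 p q w|⁻¹ *
        ∫⁻ x in U, (‖gp x‖ₑ + ‖gq x‖ₑ) * ENNReal.ofReal (ρ x)⁻¹)) := by
  set wt : E3 → ENNReal := fun x => ENNReal.ofReal (ρ x)⁻¹ with hwt
  have hwtm : Measurable wt := hρ.measurable.inv.ennreal_ofReal
  set Z := ∫⁻ x in U, (‖gp x‖ₑ + ‖gq x‖ₑ) * wt x with hZ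
  -- The value at a point is compared with the value at the point contracted towards the axis by the
  -- factor η. The derivative along this path is a combination of the two transversal ones, with
  -- coefficients at most the norm of the transversal coordinates. As η → 0 the second value tends
  -- to 0.
  have step1 : ∀ η : ℝ, 0 < η → η ≤ 1 / 4 →
      ∫⁻ x in Icc η (1 - η) ×ˢ Icc η (1 - η) ×ˢ Icc η (1 - η),
        ‖u (boxMap A p q w x) - u (boxMap A p q w (η * x.1, η * x.2.1, x.2.2))‖ₑ ≤
      2 * (ENNReal.ofReal c * (ENNReal.ofReal |det3 p q w|⁻¹ * Z)) := by
    intro η h0 h1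
    set J := Icc η (1 - η) with hJ
    -- Coordinates at least η, contracted by factors at least η, remain at least η².
    set J' := Icc (η * η) (1 - η) with hJ'
    have hsub : J ⊆ J' := Icc_subset_Icc_left (by nlinarith)
    have hJ'01 : J' ⊆ Ioo (0 : ℝ) 1 := fun x hx =>
      ⟨lt_of_lt_of_le (by positivity) hx.1, lt_of_le_of_lt hx.2 (by linarith)⟩
    have hτJ : ∀ τ ∈ Icc η 1, ∀ α ∈ J, τ * α ∈ J' := by
      intro τ hτ α hα
      have : 0 < α := h0.trans_le hα.1
      exact ⟨mul_le_mul hτ.1 hα.1 h0.le (h0.le.trans hτ.1),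
        (mul_le_of_le_one_left this.le hτ.2).trans hα.2⟩
    set K := boxMap A p q w '' (J' ×ˢ J' ×ˢ J) with hKd
    have hK : IsCompact K :=
      (isCompact_Icc.prod (isCompact_Icc.prod isCompact_Icc)).image (continuous_boxMap A p q w)
    have hK01 : J' ×ˢ J' ×ˢ J ⊆ Ioo (0 : ℝ) 1 ×ˢ Ioo (0 : ℝ) 1 ×ˢ Ioo (0 : ℝ) 1 :=
      Set.prod_mono hJ'01 (Set.prod_mono hJ'01 (hsub.trans hJ'01))
    have hKU : K ⊆ U := by
      rintro _ ⟨x, hx, rfl⟩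
      exact hbox x (hK01 hx)
    have hKρ : ∀ x ∈ K, 0 < ρ x := by
      rintro _ ⟨x, hx, rfl⟩
      exact (hρ0 x (hK01 hx)).1
    obtain ⟨K', O, hK', hK'U, hO, hKO, hOK', φ, hφ, hb⟩ := exists_compact_bumps hU hK hKU
    obtain ⟨m, hm0, hm⟩ : ∃ m > 0, ∀ x ∈ K, m ≤ ρ x := by
      rcases K.eq_empty_or_nonempty with h | h
      · exact ⟨1, one_pos, by simp [h]⟩
      · obtain ⟨x0, hx0, hmin⟩ := hK.exists_isMinOn h hρ.continuousOn
        exact ⟨ρ x0, hKρ x0 hx0, fun x hx => hmin hx⟩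
    -- On `K` the function `ρ` is at least `m`. Where it changes by less than `m / 2`, its
    -- reciprocal changes at most by the factor 2, as the weighted Young inequality requires.
    obtain ⟨ε, hε, hε'⟩ : ∃ ε > 0, ∀ x ∈ K, ∀ y, dist y x < ε → wt x ≤ 2 * wt y := by
      have hh := hK.uniformContinuousAt_of_continuousAt ρ (fun a _ => hρ.continuousAt)
        (Metric.dist_mem_uniformity (half_pos hm0))
      obtain ⟨ε, hε, h⟩ := Metric.mem_uniformity_dist.1 hh
      refine ⟨ε, hε, fun x hx y hy => ?_⟩
      have h2 := h (a := x) (b := y) (by rwa [dist_comm]) hx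
      simp only [mem_ofPred_eq, Real.dist_eq] at h2
      have h3 := hm x hx
      rw [abs_lt] at h2
      have h4 : 0 < ρ y := by linarith
      simp only [hwt]
      rw [← ENNReal.ofReal_ofNat, ← ENNReal.ofReal_mul (by norm_num)]
      refine ENNReal.ofReal_le_ofReal ?_
      rw [inv_eq_one_div, ← div_eq_mul_inv, div_le_div_iff₀ (by linarith) h4]
      linarith
    set V : ℕ → E3 → ℝ := fun i => mollify (φ i) (K'.indicator u) with hV
    have hint : ∀ {f : E3 → ℝ}, LocallyIntegrableOn f U → Integrable (K'.indicator f) :=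
      fun hf => (hf.integrableOn_compact_subset hK'U hK').integrable_indicator hK'.measurableSet
    have hVs : ∀ i, ContDiff ℝ ∞ (V i) := fun i => contDiff_mollify _ (hint hp.1)
    have hi : ∀ i, (φ i).rOut < ε → ∫⁻ x in J ×ˢ J ×ˢ J,
        ‖V i (boxMap A p q w x) - V i (boxMap A p q w (η * x.1, η * x.2.1, x.2.2))‖ₑ ≤
        2 * (ENNReal.ofReal c * (ENNReal.ofReal |det3 p q w|⁻¹ * Z)) := by
      intro i hiε
      set P : E3 → ENNReal := fun x => ‖mollify (φ i) (K'.indicator gp) x‖ₑ +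
        ‖mollify (φ i) (K'.indicator gq) x‖ₑ with hP
      have hPc : Continuous P := (contDiff_mollify _ (hint hp.2.1)).continuous.enorm.add
        (contDiff_mollify _ (hint hq.2.1)).continuous.enorm
      set X := boxMap A p q w with hX
      have hXc : Continuous X := continuous_boxMap A p q w
      -- Extending the mollified derivatives by zero outside `J' ×ˢ J'` makes the dilation estimate
      -- applicable slice by slice in γ.
      set F : ℝ → ℝ × ℝ → ENNReal := fun γ =>
        (J' ×ˢ J').indicator fun y => P (X (y.1, y.2, γ)) with hF
      have hFm : ∀ γ, Measurable (F γ) := fun γ =>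
        (hPc.comp (hXc.comp (by fun_prop))).measurable.indicator
          (measurableSet_Icc.prod measurableSet_Icc)
      set Φ : (ℝ × ℝ) × ℝ → ENNReal := fun z =>
        ∫⁻ τ in Ioc η 1, ENNReal.ofReal ‖z.1‖ * F z.2 (τ • z.1) with hΦ
      have hFm2 : Measurable fun r : ℝ × (ℝ × ℝ) => F r.1 r.2 := by
        have : (fun r : ℝ × (ℝ × ℝ) => F r.1 r.2) = (univ ×ˢ (J' ×ˢ J')).indicator
            fun r : ℝ × (ℝ × ℝ) => P (X (r.2.1, r.2.2, r.1)) := by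
          funext r
          by_cases h : r.2 ∈ J' ×ˢ J'
          · rw [indicator_of_mem (show r ∈ univ ×ˢ (J' ×ˢ J') from ⟨mem_univ _, h⟩)]
            exact indicator_of_mem h _
          · rw [indicator_of_notMem (show r ∉ univ ×ˢ (J' ×ˢ J') from fun hc => h hc.2)]
            exact indicator_of_notMem h _
        rw [this]
        exact (hPc.comp (hXc.comp (by fun_prop))).measurable.indicator
          (MeasurableSet.univ.prod (measurableSet_Icc.prod measurableSet_Icc))
      have hΦm : Measurable Φ := by
        refine Measurable.lintegral_prod_right' (f := fun r : ((ℝ × ℝ) × ℝ) × ℝ =>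
          ENNReal.ofReal ‖r.1.1‖ * F r.1.2 (r.2 • r.1.1)) ?_
        exact (by fun_prop : Measurable fun r : ((ℝ × ℝ) × ℝ) × ℝ => ENNReal.ofReal ‖r.1.1‖).mul
          (hFm2.comp (by fun_prop : Measurable fun r : ((ℝ × ℝ) × ℝ) × ℝ => (r.1.2, r.2 • r.1.1)))
      have s1 : ∀ x ∈ J ×ˢ J ×ˢ J, ‖V i (X x) - V i (X (η * x.1, η * x.2.1, x.2.2))‖ₑ
          ≤ Φ ((x.1, x.2.1), x.2.2) := by
        rintro ⟨α, β, γ⟩ ⟨hα, hβ, hγ⟩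
        have e1 : ∀ τ : ℝ, X (τ * α, τ * β, γ) = (A + γ • w) + τ • (α • p + β • q) := fun τ => by
          simp only [hX, boxMap]; module
        have e2 := enorm_sub_le_lintegral_fderiv (hVs i) (A + γ • w) (α • p + β • q)
          (show η ≤ 1 by linarith)
        rw [← e1, ← e1, one_mul, one_mul] at e2
        refine e2.trans (setLIntegral_mono' measurableSet_Ioc fun τ hτ => ?_)
        have hτ' : τ ∈ Icc η 1 := Ioc_subset_Icc_self hτ
        rw [← e1]
        have hmem : (τ * α, τ * β) ∈ J' ×ˢ J' := ⟨hτJ τ hτ' α hα, hτJ τ hτ' β hβ⟩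
        have hO' : X (τ * α, τ * β, γ) ∈ O := hKO ⟨(τ * α, τ * β, γ), ⟨hmem.1, hmem.2, hγ⟩, rfl⟩
        have hFe : F γ (τ • (α, β)) = P (X (τ * α, τ * β, γ)) := indicator_of_mem hmem _
        rw [hFe, map_add, map_smul, map_smul, hV,
          hp.fderiv_mollify hK' hK'U (φ i) (hb i _ hO'),
          hq.fderiv_mollify hK' hK'U (φ i) (hb i _ hO')]
        refine (enorm_add_le _ _).trans ?_
        rw [smul_eq_mul, smul_eq_mul, enorm_mul, enorm_mul, hP, mul_add]
        have n1 : ‖α‖ₑ ≤ ENNReal.ofReal ‖(α, β)‖ := by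
          rw [← ofReal_norm]
          exact ENNReal.ofReal_le_ofReal (norm_fst_le (α, β))
        have n2 : ‖β‖ₑ ≤ ENNReal.ofReal ‖(α, β)‖ := by
          rw [← ofReal_norm]
          exact ENNReal.ofReal_le_ofReal (norm_snd_le (α, β))
        exact add_le_add (mul_le_mul_left n1 _) (mul_le_mul_left n2 _)
      have s2 : ∫⁻ x in J ×ˢ J ×ˢ J, Φ ((x.1, x.2.1), x.2.2) ≤
          ∫⁻ γ in J, ∫⁻ y in Ioo (0 : ℝ) 1 ×ˢ Ioo (0 : ℝ) 1, Φ (y, γ) := by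
        have mp : MeasurePreserving (MeasurableEquiv.prodAssoc (α := ℝ) (β := ℝ) (γ := ℝ)).symm
            volume volume := volume_preserving_prodAssoc.symm _
        have h01 : J ⊆ Ioo (0 : ℝ) 1 := hsub.trans hJ'01
        have e : J ×ˢ J ×ˢ J ⊆ (MeasurableEquiv.prodAssoc (α := ℝ) (β := ℝ) (γ := ℝ)).symm ⁻¹'
            ((Ioo (0 : ℝ) 1 ×ˢ Ioo (0 : ℝ) 1) ×ˢ J) := fun x hx => ⟨⟨h01 hx.1, h01 hx.2.1⟩, hx.2.2⟩
        refine (lintegral_mono_set e).trans ?_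
        have := mp.setLIntegral_comp_preimage_emb (MeasurableEquiv.measurableEmbedding _) Φ
          ((Ioo (0 : ℝ) 1 ×ˢ Ioo (0 : ℝ) 1) ×ˢ J)
        refine (le_of_eq this).trans (le_of_eq ?_)
        rw [Measure.volume_eq_prod, ← Measure.prod_restrict, lintegral_prod_symm' _ hΦm]
      have s3 : ∀ γ ∈ J, ∫⁻ y in Ioo (0 : ℝ) 1 ×ˢ Ioo (0 : ℝ) 1, Φ (y, γ) ≤
          ∫⁻ y : ℝ × ℝ, ENNReal.ofReal c * (K.indicator (fun x => P x * wt x) (X (y.1, y.2, γ))) := by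
        intro γ hγ
        refine (lintegral_dilation_le (hFm γ) h0).trans ?_
        refine (setLIntegral_le_lintegral _ _).trans (lintegral_mono fun y => ?_)
        by_cases hy : y ∈ J' ×ˢ J'
        · have hm3 : (y.1, y.2, γ) ∈ J' ×ˢ J' ×ˢ J := ⟨hy.1, hy.2, hγ⟩
          have hm4 : X (y.1, y.2, γ) ∈ K := ⟨_, hm3, rfl⟩
          have hFe : F γ y = P (X (y.1, y.2, γ)) := indicator_of_mem hy _
          rw [indicator_of_mem hm4, hFe, mul_left_comm]
          refine mul_le_mul_right ?_ _
          obtain ⟨r1, r2⟩ := hρ0 _ (hK01 hm3)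
          have y1 := (hJ'01 hy.1).1
          have y2 := (hJ'01 hy.2).1
          have hn : ‖y‖ = max y.1 y.2 := by
            rw [Prod.norm_def, Real.norm_of_nonneg y1.le, Real.norm_of_nonneg y2.le]
          have hmax : 0 < max y.1 y.2 := lt_max_of_lt_left y1
          have hc0 : 0 < c := by
            by_contra hc
            exact absurd r2 (not_le.2 (lt_of_le_of_lt
              (mul_nonpos_of_nonpos_of_nonneg (not_lt.1 hc) hmax.le) r1))
          simp only [hwt]
          rw [← ENNReal.ofReal_mul hc0.le, hn]
          refine ENNReal.ofReal_le_ofReal ?_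
          rw [← div_eq_mul_inv, inv_eq_one_div, div_le_div_iff₀ hmax r1, one_mul]
          exact r2
        · have hFe : F γ y = 0 := indicator_of_notMem hy _
          rw [hFe, zero_mul]; exact zero_le
      have hKm : Measurable (K.indicator fun x => P x * wt x) :=
        (hPc.measurable.mul hwtm).indicator hK.measurableSet
      have s4 : ∫⁻ γ, ∫⁻ y : ℝ × ℝ, K.indicator (fun x => P x * wt x) (X (y.1, y.2, γ)) =
          ENNReal.ofReal |det3 p q w|⁻¹ * ∫⁻ x in K, P x * wt x := by
        rw [← lintegral_indicator hK.measurableSet, ← lintegral_comp_boxMap A hdet hKm]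
        have hm5 : Measurable fun z : (ℝ × ℝ) × ℝ =>
            K.indicator (fun x => P x * wt x) (X (z.1.1, z.1.2, z.2)) :=
          hKm.comp (hXc.comp (by fun_prop)).measurable
        rw [← lintegral_prod_symm' (fun z : (ℝ × ℝ) × ℝ =>
            K.indicator (fun x => P x * wt x) (X (z.1.1, z.1.2, z.2))) hm5]
        have mp : MeasurePreserving (MeasurableEquiv.prodAssoc (α := ℝ) (β := ℝ) (γ := ℝ))
            volume volume := volume_preserving_prodAssoc
        exact mp.lintegral_comp_emb (MeasurableEquiv.measurableEmbedding _)
          (fun q' => K.indicator (fun x => P x * wt x) (X q'))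
      have s5 : ∫⁻ x in K, P x * wt x ≤ 2 * Z := by
        have hr : ∀ x ∈ K, ∀ y, dist y x ≤ (φ i).rOut → wt x ≤ 2 * wt y :=
          fun x hx y hy => hε' x hx y (hy.trans_lt hiε)
        have b1 := lintegral_enorm_mollify_mul_le hU hp.2.1 hK' hK'U (φ i) hwtm
          hK.measurableSet hr
        have b2 := lintegral_enorm_mollify_mul_le hU hq.2.1 hK' hK'U (φ i) hwtm
          hK.measurableSet hr
        simp only [hP, hZ, add_mul]
        rw [lintegral_add_left
          (f := fun x => ‖mollify (φ i) (K'.indicator gp) x‖ₑ * wt x)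
          ((contDiff_mollify _ (hint hp.2.1)).continuous.measurable.enorm.mul hwtm),
          lintegral_add_left' (f := fun x => ‖gp x‖ₑ * wt x)
            (hp.2.1.aestronglyMeasurable.enorm.mul hwtm.aemeasurable), mul_add]
        exact add_le_add b1 b2
      calc _ ≤ ∫⁻ x in J ×ˢ J ×ˢ J, Φ ((x.1, x.2.1), x.2.2) :=
            setLIntegral_mono' (measurableSet_Icc.prod
              (measurableSet_Icc.prod measurableSet_Icc)) s1
        _ ≤ ∫⁻ γ in J, ∫⁻ y : ℝ × ℝ, ENNReal.ofReal c *
              (K.indicator (fun x => P x * wt x) (X (y.1, y.2, γ))) :=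
            s2.trans (setLIntegral_mono' measurableSet_Icc s3)
        _ ≤ ∫⁻ γ, ENNReal.ofReal c * ∫⁻ y : ℝ × ℝ,
              (K.indicator (fun x => P x * wt x) (X (y.1, y.2, γ))) := by
            refine (setLIntegral_le_lintegral _ _).trans (le_of_eq (lintegral_congr fun γ => ?_))
            rw [lintegral_const_mul' _ _ ENNReal.ofReal_ne_top]
        _ ≤ ENNReal.ofReal c * (ENNReal.ofReal |det3 p q w|⁻¹ * (2 * Z)) := by
            rw [lintegral_const_mul' _ _ ENNReal.ofReal_ne_top, s4]
            gcongr
        _ = _ := by ring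
    have hmemK : ∀ x ∈ J ×ˢ J ×ˢ J, boxMap A p q w x ∈ K ∧
        boxMap A p q w (η * x.1, η * x.2.1, x.2.2) ∈ K := by
      intro x hx
      exact ⟨⟨x, ⟨hsub hx.1, hsub hx.2.1, hx.2.2⟩, rfl⟩,
        ⟨(η * x.1, η * x.2.1, x.2.2), ⟨hτJ η ⟨le_rfl, by linarith⟩ _ hx.1,
          hτJ η ⟨le_rfl, by linarith⟩ _ hx.2.1, hx.2.2⟩, rfl⟩⟩
    calc _ = ∫⁻ x in J ×ˢ J ×ˢ J, liminf (fun i => ‖V i (boxMap A p q w x) -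
          V i (boxMap A p q w (η * x.1, η * x.2.1, x.2.2))‖ₑ) atTop := by
          refine setLIntegral_congr_fun (measurableSet_Icc.prod
            (measurableSet_Icc.prod measurableSet_Icc)) fun x hx => ?_
          have t : ∀ y ∈ K, Tendsto (fun i => V i y) atTop (𝓝 (u y)) := fun y hy =>
            tendsto_mollify hφ hK' (hu.mono hK'U) (mem_of_superset (hO.mem_nhds (hKO hy)) hOK')
          exact ((t _ (hmemK x hx).1).sub (t _ (hmemK x hx).2)).enorm.liminf_eq.symm
      _ ≤ liminf (fun i => ∫⁻ x in J ×ˢ J ×ˢ J, ‖V i (boxMap A p q w x) -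
          V i (boxMap A p q w (η * x.1, η * x.2.1, x.2.2))‖ₑ) atTop := by
          refine lintegral_liminf_le fun i => ?_
          have c1 := (hVs i).continuous
          have c2 := continuous_boxMap A p q w
          exact ((c1.comp c2).sub (c1.comp (c2.comp (by fun_prop)))).measurable.enorm
      _ ≤ _ := by
          refine liminf_le_of_le (by isBoundedDefault) fun b hb => ?_
          obtain ⟨i, hi', hi''⟩ := (hb.and (hφ.eventually (gt_mem_nhds hε))).exists
          exact hi'.trans (hi i hi'')
  set η : ℕ → ℝ := fun j => 1 / ((j : ℝ) + 4) with hη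
  have hη0 : ∀ j, 0 < η j ∧ η j ≤ 1 / 4 := fun j => by
    refine ⟨by positivity, ?_⟩
    simp only [hη]
    gcongr
    linarith [(Nat.cast_nonneg j : (0 : ℝ) ≤ j)]
  have hηl : Tendsto η atTop (𝓝 0) :=
    Tendsto.div_atTop tendsto_const_nhds
      (tendsto_atTop_add_const_right _ _ tendsto_natCast_atTop_atTop)
  have hηl' : Tendsto η atTop (𝓝[>] 0) :=
    tendsto_nhdsWithin_iff.2 ⟨hηl, Eventually.of_forall fun j => (hη0 j).1⟩
  set J3 : ℕ → Set (ℝ × ℝ × ℝ) := fun j =>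
    Icc (η j) (1 - η j) ×ˢ Icc (η j) (1 - η j) ×ˢ Icc (η j) (1 - η j) with hJ3
  have hJ3m : ∀ j, MeasurableSet (J3 j) := fun j =>
    measurableSet_Icc.prod (measurableSet_Icc.prod measurableSet_Icc)
  set G : ℕ → ℝ × ℝ × ℝ → ENNReal := fun j x =>
    ‖u (boxMap A p q w x) - u (boxMap A p q w (η j * x.1, η j * x.2.1, x.2.2))‖ₑ with hG
  calc _ = ∫⁻ x in Ioo (0 : ℝ) 1 ×ˢ Ioo (0 : ℝ) 1 ×ˢ Ioo (0 : ℝ) 1,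
        liminf (fun j => (J3 j).indicator (G j) x) atTop := by
        refine setLIntegral_congr_fun (measurableSet_Ioo.prod
          (measurableSet_Ioo.prod measurableSet_Ioo)) fun x hx => ?_
        refine (Tendsto.liminf_eq ?_).symm
        -- This is where the vanishing of `u` on the axis enters.
        have t0 := ((((hlim x hx).comp hηl').const_sub (u (boxMap A p q w x)))).enorm
        rw [sub_zero] at t0
        refine Tendsto.congr' ?_ t0
        have ev : ∀ a ∈ Ioo (0 : ℝ) 1, ∀ᶠ j in atTop, a ∈ Icc (η j) (1 - η j) := by
          intro a ha
          filter_upwards [hηl.eventually (gt_mem_nhds ha.1),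
            hηl.eventually (gt_mem_nhds (sub_pos.2 ha.2))] with j h1 h2
          exact ⟨h1.le, by linarith⟩
        filter_upwards [ev _ hx.1, ev _ hx.2.1, ev _ hx.2.2] with j h1 h2 h3
        exact (indicator_of_mem (s := J3 j) (a := x) ⟨h1, h2, h3⟩ (G j)).symm
    _ ≤ liminf (fun j => ∫⁻ x in Ioo (0 : ℝ) 1 ×ˢ Ioo (0 : ℝ) 1 ×ˢ Ioo (0 : ℝ) 1,
          (J3 j).indicator (G j) x) atTop := by
        refine lintegral_liminf_le' fun j => ?_
        refine AEMeasurable.mono_measure ?_ Measure.restrict_le_self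
        rw [aemeasurable_indicator_iff (hJ3m j)]
        refine ContinuousOn.aemeasurable ?_ (hJ3m j)
        have hJ01 : Icc (η j) (1 - η j) ⊆ Ioo (0 : ℝ) 1 := fun x hx =>
          ⟨lt_of_lt_of_le (hη0 j).1 hx.1, lt_of_le_of_lt hx.2 (by linarith [hη0 j])⟩
        have hη1 : ∀ x ∈ Ioo (0 : ℝ) 1, η j * x ∈ Ioo (0 : ℝ) 1 := fun x hx =>
          ⟨mul_pos (hη0 j).1 hx.1, by nlinarith [hη0 j, hx.1, hx.2]⟩
        refine ContinuousOn.enorm (ContinuousOn.sub (hu.comp (continuous_boxMap A p q w).continuousOn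
          fun x hx => hbox x ⟨hJ01 hx.1, hJ01 hx.2.1, hJ01 hx.2.2⟩)
          (hu.comp ((continuous_boxMap A p q w).comp (by fun_prop)).continuousOn
          fun x hx => hbox _ ⟨hη1 _ (hJ01 hx.1), hη1 _ (hJ01 hx.2.1), hJ01 hx.2.2⟩))
    _ ≤ _ := by
        refine liminf_le_of_le (by isBoundedDefault) fun b hb => ?_
        obtain ⟨j, hj⟩ := hb.exists
        refine hj.trans (le_trans ?_ (step1 (η j) (hη0 j).1 (hη0 j).2))
        refine (setLIntegral_le_lintegral _ _).trans (le_of_eq ?_)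
        rw [lintegral_indicator (hJ3m j)]

/-! ### Combinatorics of the graded lattice. -/

/-- A lattice triangle of the first kind. -/
def upTri (i j : ℕ) : Finset (ℕ × ℕ) := {(i, j), (i + 1, j), (i, j + 1)}

/-- A lattice triangle of the second kind. -/
def downTri (i j : ℕ) : Finset (ℕ × ℕ) := {(i + 1, j), (i, j + 1), (i + 1, j + 1)}

theorem isLatticeTriangle_iff {n : ℕ} {τ : Finset (ℕ × ℕ)} : IsLatticeTriangle n τ ↔
    ∃ i j, (i + j + 1 ≤ n ∧ τ = upTri i j) ∨ (i + j + 2 ≤ n ∧ τ = downTri i j) := Iff.rfl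

theorem mem_upTri {i j : ℕ} {p : ℕ × ℕ} : p ∈ upTri i j ↔
    (p.1 = i ∧ p.2 = j) ∨ (p.1 = i + 1 ∧ p.2 = j) ∨ (p.1 = i ∧ p.2 = j + 1) := by
  simp [upTri, Prod.ext_iff]

theorem mem_downTri {i j : ℕ} {p : ℕ × ℕ} : p ∈ downTri i j ↔
    (p.1 = i + 1 ∧ p.2 = j) ∨ (p.1 = i ∧ p.2 = j + 1) ∨ (p.1 = i + 1 ∧ p.2 = j + 1) := by
  simp [downTri, Prod.ext_iff]

theorem IsLatticeTriangle.level_le {n : ℕ} {τ : Finset (ℕ × ℕ)} (h : IsLatticeTriangle n τ)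
    {p : ℕ × ℕ} (hp : p ∈ τ) : p.1 + p.2 ≤ n := by
  obtain ⟨i, j, ⟨h1, rfl⟩ | ⟨h1, rfl⟩⟩ := isLatticeTriangle_iff.1 h
  · rw [mem_upTri] at hp; omega
  · rw [mem_downTri] at hp; omega

theorem IsLatticeTriangle.exists_level_lt {n : ℕ} {τ : Finset (ℕ × ℕ)}
    (h : IsLatticeTriangle n τ) : ∃ p ∈ τ, p.1 + p.2 < n := by
  obtain ⟨i, j, ⟨h1, rfl⟩ | ⟨h1, rfl⟩⟩ := isLatticeTriangle_iff.1 h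
  · exact ⟨(i, j), by simp [upTri], by simp; omega⟩
  · exact ⟨(i + 1, j), by simp [downTri], by simp; omega⟩

theorem IsLatticeTriangle.level_le_of_mem {n l : ℕ} {τ : Finset (ℕ × ℕ)}
    (h : IsLatticeTriangle n τ) {p q : ℕ × ℕ} (hp : p ∈ τ) (hq : q ∈ τ) (hl : p.1 + p.2 ≤ l) :
    q.1 + q.2 ≤ l + 1 := by
  obtain ⟨i, j, ⟨h1, rfl⟩ | ⟨h1, rfl⟩⟩ := isLatticeTriangle_iff.1 h
  · rw [mem_upTri] at hp hq; omega
  · rw [mem_downTri] at hp hq; omega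

/-- The scaled position of a lattice point. -/
def latPt (G : ℕ → ℝ) (p : ℕ × ℕ) : ℝ × ℝ := (G (p.1 + p.2) * p.1, G (p.1 + p.2) * p.2)

/-- A radial grading function of the lattice. -/
structure IsGrading (G : ℕ → ℝ) : Prop where
  pos : ∀ m, 1 ≤ m → 0 < G m
  mono : StrictMono fun m : ℕ => G m * m

theorem IsGrading.nonneg {G : ℕ → ℝ} (hG : IsGrading G) (m : ℕ) : 0 ≤ G m * m := by
  have := hG.mono.monotone (Nat.zero_le m)
  simpa using this

theorem latPt_add (G : ℕ → ℝ) (p : ℕ × ℕ) :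
    (latPt G p).1 + (latPt G p).2 = G (p.1 + p.2) * ((p.1 + p.2 : ℕ) : ℝ) := by
  simp only [latPt]; push_cast; ring

theorem IsGrading.latPt_nonneg {G : ℕ → ℝ} (hG : IsGrading G) (p : ℕ × ℕ) :
    0 ≤ (latPt G p).1 ∧ 0 ≤ (latPt G p).2 := by
  rcases Nat.eq_zero_or_pos (p.1 + p.2) with h | h
  · have h1 : p.1 = 0 := by omega
    have h2 : p.2 = 0 := by omega
    simp [latPt, h1, h2]
  · have := hG.pos _ h
    exact ⟨by simp only [latPt]; positivity, by simp only [latPt]; positivity⟩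

theorem IsGrading.latPt_injective {G : ℕ → ℝ} (hG : IsGrading G) :
    Function.Injective (latPt G) := by
  intro p q h
  have h1 : G (p.1 + p.2) * ((p.1 + p.2 : ℕ) : ℝ) = G (q.1 + q.2) * ((q.1 + q.2 : ℕ) : ℝ) := by
    rw [← latPt_add, ← latPt_add, h]
  have h2 : p.1 + p.2 = q.1 + q.2 := hG.mono.injective h1
  rcases Nat.eq_zero_or_pos (p.1 + p.2) with h0 | h0
  · ext <;> omega
  · have h3 := congrArg Prod.fst h
    simp only [latPt, h2] at h3
    have h4 := mul_left_cancel₀ (hG.pos _ (by omega)).ne' h3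
    have h5 : p.1 = q.1 := by exact_mod_cast h4
    ext <;> omega

theorem mem_convexHull_image_triple {E : Type*} [AddCommGroup E] [Module ℝ E]
    {f : ℕ × ℕ → E} {p q r : ℕ × ℕ} {x : E}
    (h : x ∈ convexHull ℝ (f '' (({p, q, r} : Finset (ℕ × ℕ)) : Set (ℕ × ℕ)))) :
    ∃ a b c : ℝ, 0 ≤ a ∧ 0 ≤ b ∧ 0 ≤ c ∧ a + b + c = 1 ∧ x = a • f p + b • f q + c • f r := by
  have e : f '' (({p, q, r} : Finset (ℕ × ℕ)) : Set (ℕ × ℕ)) = {f p, f q, f r} := by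
    simp [Set.image_insert_eq]
  rw [e, convexHull_insert (by simp), convexHull_pair] at h
  simp only [mem_convexJoin, mem_singleton_iff, exists_eq_left] at h
  obtain ⟨y, ⟨a, b, ha, hb, hab, rfl⟩, ⟨c, d, hc, hd, hcd, rfl⟩⟩ := h
  refine ⟨c, d * a, d * b, hc, by positivity, by positivity, ?_, ?_⟩
  · rw [add_assoc, ← mul_add, hab, mul_one, hcd]
  · module

theorem IsLatticeTriangle.pair_cases {n : ℕ} {τ : Finset (ℕ × ℕ)} (h : IsLatticeTriangle n τ)
    {p q : ℕ × ℕ} (hp : p ∈ τ) (hq : q ∈ τ) (hpq : p.1 + p.2 ≤ q.1 + q.2) :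
    (p.1 + p.2 = q.1 + q.2 ∧ p.1 ≤ q.1 + 1 ∧ q.1 ≤ p.1 + 1) ∨
      (q.1 + q.2 = p.1 + p.2 + 1 ∧ p.1 ≤ q.1 ∧ q.1 ≤ p.1 + 1) := by
  obtain ⟨i, j, ⟨h1, rfl⟩ | ⟨h1, rfl⟩⟩ := isLatticeTriangle_iff.1 h
  · rw [mem_upTri] at hp hq; omega
  · rw [mem_downTri] at hp hq; omega

/-- The sum of the two coordinates of a lattice point depends strictly monotonically on its level.
Hence the position of a midpoint between two consecutive level lines determines the levels of both
endpoints. -/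
theorem IsGrading.level_eq {G : ℕ → ℝ} (hG : IsGrading G) {p q : ℕ × ℕ} {m : ℕ} {s : ℝ}
    (hs0 : 0 ≤ s) (hs1 : s ≤ 1)
    (h : ((latPt G p).1 + (latPt G p).2 + ((latPt G q).1 + (latPt G q).2)) / 2
      = (1 - s) * (G m * m) + s * (G (m + 1) * ((m + 1 : ℕ) : ℝ))) :
    (p.1 + p.2 = q.1 + q.2 → (p.1 + p.2 = m ∧ s = 0) ∨ (p.1 + p.2 = m + 1 ∧ s = 1)) ∧
    (q.1 + q.2 = p.1 + p.2 + 1 → p.1 + p.2 = m ∧ s = 1 / 2) := by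
  rw [latPt_add, latPt_add] at h
  set M := p.1 + p.2 with hM
  have hmm : G m * m < G (m + 1) * ((m + 1 : ℕ) : ℝ) := hG.mono (Nat.lt_succ_self m)
  refine ⟨fun he => ?_, fun he => ?_⟩
  · rw [← he] at h
    have h1 : m ≤ M := by
      rw [← hG.mono.le_iff_le]; nlinarith
    have h2 : M ≤ m + 1 := by
      rw [← hG.mono.le_iff_le]; nlinarith
    rcases (by omega : M = m ∨ M = m + 1) with h3 | h3
    · left
      rw [h3] at h
      exact ⟨h3, by nlinarith⟩
    · right
      rw [h3] at h
      exact ⟨h3, by nlinarith⟩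
  · rw [he] at h
    have hMM : G M * M < G (M + 1) * ((M + 1 : ℕ) : ℝ) := hG.mono (Nat.lt_succ_self M)
    have h1 : m < M + 1 := by
      rw [← hG.mono.lt_iff_lt]; nlinarith
    have h2 : M < m + 1 := by
      rw [← hG.mono.lt_iff_lt]; nlinarith
    have h3 : M = m := by omega
    rw [h3] at h
    exact ⟨h3, by nlinarith⟩

/-- The levels of `p` and `q` follow from the coordinate sums; then the first coordinates are
compared. Since they are integers times known scales, only the vertices of the triangle itself
remain. When the levels differ, a wrong first index would give two terms of the same sign whose sum
is zero. -/
theorem IsGrading.mem_upTri_of_midpoint {G : ℕ → ℝ} (hG : IsGrading G) {i j : ℕ} {p q : ℕ × ℕ}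
    (hpq : (p.1 + p.2 = q.1 + q.2 ∧ p.1 ≤ q.1 + 1 ∧ q.1 ≤ p.1 + 1) ∨
      (q.1 + q.2 = p.1 + p.2 + 1 ∧ p.1 ≤ q.1 ∧ q.1 ≤ p.1 + 1))
    (hm : (1 / 2 : ℝ) • latPt G p + (1 / 2 : ℝ) • latPt G q
      ∈ convexHull ℝ (latPt G '' (upTri i j))) : p ∈ upTri i j ∧ q ∈ upTri i j := by
  obtain ⟨a, b, c, ha, hb, hc, habc, hx⟩ := mem_convexHull_image_triple hm
  have hx1 := congrArg Prod.fst hx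
  have hx2 := congrArg Prod.snd hx
  simp only [Prod.fst_add, Prod.snd_add, Prod.smul_fst, Prod.smul_snd, smul_eq_mul] at hx1 hx2
  have e1 := latPt_add G (i, j)
  have e2 := latPt_add G (i + 1, j)
  have e3 := latPt_add G (i, j + 1)
  have o2 : i + 1 + j = i + j + 1 := by ring
  have o3 : i + (j + 1) = i + j + 1 := by ring
  simp only [o2, o3] at e1 e2 e3
  have hl := hG.level_eq (p := p) (q := q) (m := i + j) (s := b + c) (by linarith) (by linarith)
    (by
      have ha' : 1 - (b + c) = a := by linarith
      rw [ha', ← e1, add_mul]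
      nth_rewrite 1 [← e2]
      rw [← e3]
      linarith)
  have f2 : (latPt G (i + 1, j)).1 = G (i + j + 1) * (i + 1) := by simp [latPt, o2]
  have f3 : (latPt G (i, j + 1)).1 = G (i + j + 1) * i := by simp [latPt, o3]
  have f1 : (latPt G (i, j)).1 = G (i + j) * i := rfl
  rw [f1, f2, f3] at hx1
  have g1 : 0 < G (i + j + 1) := hG.pos _ (by omega)
  rw [mem_upTri, mem_upTri]
  rcases hpq with ⟨h1, h2, h3⟩ | ⟨h1, h2, h3⟩
  · have fq : (latPt G q).1 = G (p.1 + p.2) * q.1 := by rw [h1]; rfl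
    have fp : (latPt G p).1 = G (p.1 + p.2) * p.1 := rfl
    rw [fp, fq] at hx1
    rcases hl.1 h1 with ⟨h4, h5⟩ | ⟨h4, h5⟩
    · have hb0 : b = 0 := by linarith
      have hc0 : c = 0 := by linarith
      have ha1 : a = 1 := by linarith
      rw [h4, hb0, hc0, ha1] at hx1
      rcases Nat.eq_zero_or_pos (i + j) with h0 | h0
      · omega
      · have g0 := hG.pos _ h0
        have : (p.1 : ℝ) + q.1 = 2 * i := by
          apply mul_left_cancel₀ g0.ne'; linarith
        have : p.1 + q.1 = 2 * i := by exact_mod_cast this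
        omega
    · have ha0 : a = 0 := by linarith
      rw [h4, ha0] at hx1
      have : (p.1 : ℝ) + q.1 = 2 * i + 2 * b := by
        apply mul_left_cancel₀ g1.ne'
        have : c = 1 - b := by linarith
        rw [this] at hx1; linarith
      have h6 : (2 * i : ℝ) ≤ p.1 + q.1 := by linarith
      have h7 : (p.1 + q.1 : ℝ) ≤ 2 * i + 2 := by linarith
      have h6' : 2 * i ≤ p.1 + q.1 := by exact_mod_cast h6
      have h7' : p.1 + q.1 ≤ 2 * i + 2 := by exact_mod_cast h7
      omega
  · obtain ⟨h4, h5⟩ := hl.2 h1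
    have fq : (latPt G q).1 = G (i + j + 1) * q.1 := by simp [latPt, h1, h4]
    have fp : (latPt G p).1 = G (i + j) * p.1 := by simp [latPt, h4]
    have ha0 : a = 1 / 2 := by linarith
    have hc0 : c = 1 / 2 - b := by linarith
    rw [fp, fq, ha0, hc0] at hx1
    -- As 0 ≤ 2b ≤ 1, both summands are negative or zero if `p.1 < i` and positive or zero if `p.1 >
    -- i`, the first one strictly.
    have key : G (i + j) * (p.1 - i) + G (i + j + 1) * (q.1 - i - 2 * b) = 0 := by linarith
    have hb2 : 2 * b ≤ 1 := by linarith
    have hp1 : p.1 = i := by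
      by_contra hne
      rcases Nat.lt_or_gt_of_ne hne with hlt | hgt
      · have g0 := hG.pos (i + j) (by omega)
        have c1 : (p.1 : ℝ) + 1 ≤ i := by exact_mod_cast hlt
        have c2 : (q.1 : ℝ) ≤ i := by
          have : q.1 ≤ i := by omega
          exact_mod_cast this
        have d1 : G (i + j) * (p.1 - i) < 0 := mul_neg_of_pos_of_neg g0 (by linarith)
        have d2 : G (i + j + 1) * (q.1 - i - 2 * b) ≤ 0 :=
          mul_nonpos_of_nonneg_of_nonpos g1.le (by linarith)
        linarith
      · have g0 := hG.pos (i + j) (by omega)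
        have c1 : (i : ℝ) + 1 ≤ p.1 := by exact_mod_cast hgt
        have c2 : (i : ℝ) + 1 ≤ q.1 := by
          have : i + 1 ≤ q.1 := by omega
          exact_mod_cast this
        have d1 : 0 < G (i + j) * (p.1 - i) := mul_pos g0 (by linarith)
        have d2 : 0 ≤ G (i + j + 1) * (q.1 - i - 2 * b) := mul_nonneg g1.le (by linarith)
        linarith
    omega

theorem IsGrading.mem_downTri_of_midpoint {G : ℕ → ℝ} (hG : IsGrading G) {i j : ℕ} {p q : ℕ × ℕ}
    (hpq : (p.1 + p.2 = q.1 + q.2 ∧ p.1 ≤ q.1 + 1 ∧ q.1 ≤ p.1 + 1) ∨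
      (q.1 + q.2 = p.1 + p.2 + 1 ∧ p.1 ≤ q.1 ∧ q.1 ≤ p.1 + 1))
    (hm : (1 / 2 : ℝ) • latPt G p + (1 / 2 : ℝ) • latPt G q
      ∈ convexHull ℝ (latPt G '' (downTri i j))) : p ∈ downTri i j ∧ q ∈ downTri i j := by
  obtain ⟨a, b, c, ha, hb, hc, habc, hx⟩ := mem_convexHull_image_triple hm
  have hx1 := congrArg Prod.fst hx
  have hx2 := congrArg Prod.snd hx
  simp only [Prod.fst_add, Prod.snd_add, Prod.smul_fst, Prod.smul_snd, smul_eq_mul] at hx1 hx2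
  have e1 := latPt_add G (i + 1, j)
  have e2 := latPt_add G (i, j + 1)
  have e3 := latPt_add G (i + 1, j + 1)
  have o2 : i + 1 + j = i + j + 1 := by ring
  have o3 : i + (j + 1) = i + j + 1 := by ring
  have o4 : i + 1 + (j + 1) = i + j + 1 + 1 := by ring
  simp only [o2, o3, o4] at e1 e2 e3
  have hl := hG.level_eq (p := p) (q := q) (m := i + j + 1) (s := c) (by linarith) (by linarith)
    (by
      have ha' : 1 - c = a + b := by linarith
      rw [ha', ← e3, add_mul]
      nth_rewrite 1 [← e1]
      rw [← e2]
      linarith)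
  have f1 : (latPt G (i + 1, j)).1 = G (i + j + 1) * (i + 1) := by simp [latPt, o2]
  have f2 : (latPt G (i, j + 1)).1 = G (i + j + 1) * i := by simp [latPt, o3]
  have f3 : (latPt G (i + 1, j + 1)).1 = G (i + j + 1 + 1) * (i + 1) := by simp [latPt, o4]
  rw [f1, f2, f3] at hx1
  have g1 : 0 < G (i + j + 1) := hG.pos _ (by omega)
  have g2 : 0 < G (i + j + 1 + 1) := hG.pos _ (by omega)
  rw [mem_downTri, mem_downTri]
  rcases hpq with ⟨h1, h2, h3⟩ | ⟨h1, h2, h3⟩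
  · have fq : (latPt G q).1 = G (p.1 + p.2) * q.1 := by rw [h1]; rfl
    have fp : (latPt G p).1 = G (p.1 + p.2) * p.1 := rfl
    rw [fp, fq] at hx1
    rcases hl.1 h1 with ⟨h4, h5⟩ | ⟨h4, h5⟩
    · rw [h4, h5] at hx1
      have : (p.1 : ℝ) + q.1 = 2 * i + 2 * a := by
        apply mul_left_cancel₀ g1.ne'
        have : b = 1 - a := by linarith
        rw [this] at hx1; linarith
      have h6 : (2 * i : ℝ) ≤ p.1 + q.1 := by linarith
      have h7 : (p.1 + q.1 : ℝ) ≤ 2 * i + 2 := by linarith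
      have h6' : 2 * i ≤ p.1 + q.1 := by exact_mod_cast h6
      have h7' : p.1 + q.1 ≤ 2 * i + 2 := by exact_mod_cast h7
      omega
    · have ha0 : a = 0 := by linarith
      have hb0 : b = 0 := by linarith
      rw [h4, h5, ha0, hb0] at hx1
      have : (p.1 : ℝ) + q.1 = 2 * (i + 1) := by
        apply mul_left_cancel₀ g2.ne'; linarith
      have : p.1 + q.1 = 2 * (i + 1) := by exact_mod_cast this
      omega
  · obtain ⟨h4, h5⟩ := hl.2 h1
    have fq : (latPt G q).1 = G (i + j + 1 + 1) * q.1 := by simp [latPt, h1, h4]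
    have fp : (latPt G p).1 = G (i + j + 1) * p.1 := by simp [latPt, h4]
    have hb0 : b = 1 / 2 - a := by linarith
    rw [fp, fq, h5, hb0] at hx1
    have key : G (i + j + 1) * (p.1 - i - 2 * a) + G (i + j + 1 + 1) * (q.1 - (i + 1)) = 0 := by
      linarith
    have ha2 : 2 * a ≤ 1 := by linarith
    have hq1 : q.1 = i + 1 := by
      by_contra hne
      rcases Nat.lt_or_gt_of_ne hne with hlt | hgt
      · have c1 : (q.1 : ℝ) ≤ i := by
          have : q.1 ≤ i := by omega
          exact_mod_cast this
        have c2 : (p.1 : ℝ) ≤ i := by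
          have : p.1 ≤ i := by omega
          exact_mod_cast this
        have d1 : G (i + j + 1) * (p.1 - i - 2 * a) ≤ 0 :=
          mul_nonpos_of_nonneg_of_nonpos g1.le (by linarith)
        have d2 : G (i + j + 1 + 1) * (q.1 - (i + 1)) < 0 :=
          mul_neg_of_pos_of_neg g2 (by linarith)
        linarith
      · have c1 : (i : ℝ) + 2 ≤ q.1 := by exact_mod_cast hgt
        have c2 : (i : ℝ) + 1 ≤ p.1 := by
          have : i + 1 ≤ p.1 := by omega
          exact_mod_cast this
        have d1 : 0 ≤ G (i + j + 1) * (p.1 - i - 2 * a) := mul_nonneg g1.le (by linarith)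
        have d2 : 0 < G (i + j + 1 + 1) * (q.1 - (i + 1)) := mul_pos g2 (by linarith)
        linarith
    omega

/-- An edge or a vertex of the lattice that meets a lattice triangle in its midpoint is an edge or
a vertex of this triangle. -/
theorem IsGrading.mem_of_midpoint {G : ℕ → ℝ} (hG : IsGrading G) {n n' : ℕ}
    {τ τ' : Finset (ℕ × ℕ)} (hτ : IsLatticeTriangle n τ) (hτ' : IsLatticeTriangle n' τ')
    {p q : ℕ × ℕ} (hp : p ∈ τ') (hq : q ∈ τ')
    (hm : (1 / 2 : ℝ) • latPt G p + (1 / 2 : ℝ) • latPt G q ∈ convexHull ℝ (latPt G '' τ)) :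
    p ∈ τ ∧ q ∈ τ := by
  wlog hpq : p.1 + p.2 ≤ q.1 + q.2 generalizing p q
  · rw [add_comm] at hm
    exact (this hq hp hm (by omega)).symm
  obtain ⟨i, j, ⟨h1, rfl⟩ | ⟨h1, rfl⟩⟩ := isLatticeTriangle_iff.1 hτ
  · exact hG.mem_upTri_of_midpoint (hτ'.pair_cases hp hq hpq) hm
  · exact hG.mem_downTri_of_midpoint (hτ'.pair_cases hp hq hpq) hm

/-- Twice the signed area of a triangle. -/
def area2 (P Q R : ℝ × ℝ) : ℝ := (Q.1 - P.1) * (R.2 - P.2) - (Q.2 - P.2) * (R.1 - P.1)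

/-- The area is `G (i + j + 1)` times the distance of the two level lines, so it is strict
monotonicity that keeps the triangles nondegenerate and positively oriented. -/
theorem IsGrading.area2_up_pos {G : ℕ → ℝ} (hG : IsGrading G) (i j : ℕ) :
    0 < area2 (latPt G (i, j)) (latPt G (i + 1, j)) (latPt G (i, j + 1)) := by
  have o2 : i + 1 + j = i + j + 1 := by ring
  have o3 : i + (j + 1) = i + j + 1 := by ring
  have g1 : 0 < G (i + j + 1) := hG.pos _ (by omega)
  have hmm : G (i + j) * ((i + j : ℕ) : ℝ) < G (i + j + 1) * ((i + j + 1 : ℕ) : ℝ) :=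
    hG.mono (Nat.lt_succ_self _)
  simp only [area2, latPt, o2, o3]
  push_cast at hmm ⊢
  have := mul_pos g1 (sub_pos.2 hmm)
  linarith

theorem IsGrading.area2_down_pos {G : ℕ → ℝ} (hG : IsGrading G) (i j : ℕ) :
    0 < area2 (latPt G (i + 1, j + 1)) (latPt G (i, j + 1)) (latPt G (i + 1, j)) := by
  have o2 : i + 1 + j = i + j + 1 := by ring
  have o3 : i + (j + 1) = i + j + 1 := by ring
  have o4 : i + 1 + (j + 1) = i + j + 1 + 1 := by ring
  have g1 : 0 < G (i + j + 1) := hG.pos _ (by omega)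
  have hmm : G (i + j + 1) * ((i + j + 1 : ℕ) : ℝ) <
    G (i + j + 1 + 1) * ((i + j + 1 + 1 : ℕ) : ℝ) := hG.mono (Nat.lt_succ_self _)
  simp only [area2, latPt, o2, o3, o4]
  push_cast at hmm ⊢
  have := mul_pos g1 (sub_pos.2 hmm)
  linarith

theorem inter_eq_pair_cases {i j i' j' : ℕ} {x y : ℕ × ℕ} (hxy : x ≠ y) (hx : x ∈ upTri i j)
    (hy : y ∈ upTri i j) (hx' : x ∈ downTri i' j') (hy' : y ∈ downTri i' j') :
    (i = i' ∧ j = j') ∨ (i = i' + 1 ∧ j = j') ∨ (i = i' ∧ j = j' + 1) := by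
  rw [mem_upTri] at hx hy
  rw [mem_downTri] at hx' hy'
  have : x.1 ≠ y.1 ∨ x.2 ≠ y.2 := by
    by_contra hc
    push Not at hc
    exact hxy (Prod.ext hc.1 hc.2)
  omega

/-- The endpoint listed first has a level below `n`, so that the vertical mesh edge over it has
positive length; the common face is then thick enough for a box to straddle it. The sign of the
product says that the triangles lie on different sides. -/
theorem IsGrading.exists_common_edge_up_down {G : ℕ → ℝ} (hG : IsGrading G) {n i j i' j' : ℕ}
    (hn : i' + j' + 2 ≤ n) {x y : ℕ × ℕ} (hxy : x ≠ y) (hx : x ∈ upTri i j)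
    (hy : y ∈ upTri i j) (hx' : x ∈ downTri i' j') (hy' : y ∈ downTri i' j') :
    ∃ p q r r', upTri i j = {p, q, r} ∧ downTri i' j' = {p, q, r'} ∧ p.1 + p.2 < n ∧
      area2 (latPt G p) (latPt G q) (latPt G r) * area2 (latPt G p) (latPt G q) (latPt G r') < 0 := by
  have hup := hG.area2_up_pos i j
  have hdown := hG.area2_down_pos i' j'
  rcases inter_eq_pair_cases hxy hx hy hx' hy' with ⟨rfl, rfl⟩ | ⟨rfl, rfl⟩ | ⟨rfl, rfl⟩
  · refine ⟨(i + 1, j), (i, j + 1), (i, j), (i + 1, j + 1), ?_, ?_, by simp; omega,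
      mul_neg_of_pos_of_neg (hup.trans_eq ?_) (neg_pos.1 (hdown.trans_eq ?_))⟩
    · ext p; simp only [upTri, Finset.mem_insert, Finset.mem_singleton]; tauto
    · ext p; simp only [downTri, Finset.mem_insert, Finset.mem_singleton]
    · simp only [area2]; ring
    · simp only [area2]; ring
  · refine ⟨(i' + 1, j), (i' + 1, j + 1), (i' + 1 + 1, j), (i', j + 1), ?_, ?_, by simp; omega,
      mul_neg_of_neg_of_pos (neg_pos.1 (hup.trans_eq ?_)) (hdown.trans_eq ?_)⟩
    · ext p; simp only [upTri, Finset.mem_insert, Finset.mem_singleton]; tauto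
    · ext p; simp only [downTri, Finset.mem_insert, Finset.mem_singleton]; tauto
    · simp only [area2]; ring
    · simp only [area2]; ring
  · refine ⟨(i, j' + 1), (i + 1, j' + 1), (i, j' + 1 + 1), (i + 1, j'), ?_, ?_, by simp; omega,
      mul_neg_of_pos_of_neg hup (neg_pos.1 (hdown.trans_eq ?_))⟩
    · ext p; simp only [upTri, Finset.mem_insert, Finset.mem_singleton]
    · ext p; simp only [downTri, Finset.mem_insert, Finset.mem_singleton]; tauto
    · simp only [area2]; ring

/-- Neighbouring triangles lie on different sides of their common edge. -/
theorem IsGrading.exists_common_edge {G : ℕ → ℝ} (hG : IsGrading G) {n : ℕ}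
    {τ τ' : Finset (ℕ × ℕ)} (hτ : IsLatticeTriangle n τ) (hτ' : IsLatticeTriangle n τ')
    (h : (τ ∩ τ').card = 2) : ∃ p q r r', τ = {p, q, r} ∧ τ' = {p, q, r'} ∧ p.1 + p.2 < n ∧
      area2 (latPt G p) (latPt G q) (latPt G r) * area2 (latPt G p) (latPt G q) (latPt G r') < 0 := by
  obtain ⟨x, y, hxy, he⟩ := Finset.card_eq_two.1 h
  have hx : x ∈ τ ∩ τ' := by rw [he]; simp
  have hy : y ∈ τ ∩ τ' := by rw [he]; simp
  rw [Finset.mem_inter] at hx hy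
  have hne : x.1 ≠ y.1 ∨ x.2 ≠ y.2 := by
    by_contra hc
    push Not at hc
    exact hxy (Prod.ext hc.1 hc.2)
  obtain ⟨i, j, ⟨h1, rfl⟩ | ⟨h1, rfl⟩⟩ := isLatticeTriangle_iff.1 hτ <;>
    obtain ⟨i', j', ⟨h1', rfl⟩ | ⟨h1', rfl⟩⟩ := isLatticeTriangle_iff.1 hτ'
  · exfalso
    have e : i = i' ∧ j = j' := by
      have a1 := hx.1; have a2 := hx.2; have a3 := hy.1; have a4 := hy.2
      rw [mem_upTri] at a1 a2 a3 a4; omega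
    obtain ⟨rfl, rfl⟩ := e
    rw [Finset.inter_self, upTri, Finset.card_eq_three.2
      ⟨(i, j), (i + 1, j), (i, j + 1), by simp, by simp, by simp, rfl⟩] at h
    omega
  · exact hG.exists_common_edge_up_down h1' hxy hx.1 hy.1 hx.2 hy.2
  · obtain ⟨p, q, r, r', e1, e2, e3, e4⟩ :=
      hG.exists_common_edge_up_down h1 hxy hx.2 hy.2 hx.1 hy.1
    exact ⟨p, q, r', r, e2, e1, e3, by rwa [mul_comm]⟩
  · exfalso
    have e : i = i' ∧ j = j' := by
      have a1 := hx.1; have a2 := hx.2; have a3 := hy.1; have a4 := hy.2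
      rw [mem_downTri] at a1 a2 a3 a4; omega
    obtain ⟨rfl, rfl⟩ := e
    rw [Finset.inter_self, downTri, Finset.card_eq_three.2
      ⟨(i + 1, j), (i, j + 1), (i + 1, j + 1), by simp, by simp, by simp, rfl⟩] at h
    omega

theorem exists_exit {α : Type*} {R : α → α → Prop} {P : α → Prop} {x y : α}
    (h : Relation.ReflTransGen R x y) (hx : P x) (hy : ¬P y) : ∃ s t, R s t ∧ P s ∧ ¬P t := by
  by_contra hc
  push Not at hc
  exact hy (h.rec hx fun _ hst hs => hc _ _ hst hs)

/-- In a connected finite set everything can be reached in fewer steps than there are elements. -/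
theorem subset_of_connected {α : Type*} [DecidableEq α] {B : Finset α} {r : α → α → Prop}
    (hconn : ∀ s ∈ B, ∀ t ∈ B, Relation.ReflTransGen (fun s t => s ∈ B ∧ t ∈ B ∧ r s t) s t)
    {A : ℕ → Set α} {s₀ : α} (h0B : s₀ ∈ B) (h0 : s₀ ∈ A 0) (hmono : ∀ j, A j ⊆ A (j + 1))
    (hstep : ∀ j, ∀ s ∈ A j, ∀ t, s ∈ B → t ∈ B → r s t → t ∈ A (j + 1)) :
    ∀ t ∈ B, t ∈ A B.card := by
  classical
  have h0' : ∀ j, s₀ ∈ A j := fun j => by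
    induction j with
    | zero => exact h0
    | succ j ih => exact hmono j ih
  -- As long as something is missing, a chain from `s₀` to it leaves `A j`, and the point of exit is
  -- new in `A (j + 1)`. So every step gains at least one element.
  have key : ∀ j, (∀ t ∈ B, t ∈ A j) ∨ j + 1 ≤ (B.filter (· ∈ A j)).card := by
    intro j
    induction j with
    | zero =>
      right
      exact Finset.card_pos.2 ⟨s₀, Finset.mem_filter.2 ⟨h0B, h0⟩⟩
    | succ j ih =>
      by_cases hall : ∀ t ∈ B, t ∈ A j
      · exact Or.inl fun t ht => hmono j (hall t ht)
      · right
        have ih' := ih.resolve_left hall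
        push Not at hall
        obtain ⟨t, htB, ht⟩ := hall
        obtain ⟨x, y, ⟨hxB, hyB, hxy⟩, hx, hy⟩ :=
          exists_exit (P := (· ∈ A j)) (hconn s₀ h0B t htB) (h0' j) ht
        have : B.filter (· ∈ A j) ⊂ B.filter (· ∈ A (j + 1)) := by
          refine Finset.ssubset_iff_of_subset (Finset.monotone_filter_right _
            fun z _ hz => hmono j hz) |>.2 ⟨y, Finset.mem_filter.2 ⟨hyB, hstep j x hx y hxB hyB hxy⟩,
            fun hc => hy (Finset.mem_filter.1 hc).2⟩
        have := Finset.card_lt_card this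
        omega
  rcases key B.card with h | h
  · exact h
  · have := Finset.card_filter_le B (· ∈ A B.card)
    omega

/-- The lattice triangles in the triangle with the corner `(i₁, j₁)` and the levels at most `s`. -/
def cornerPatch (i₁ j₁ L s : ℕ) : Finset (Finset (ℕ × ℕ)) :=
  (((Finset.Icc i₁ (i₁ + L)) ×ˢ (Finset.Icc j₁ (j₁ + L))).filter
      (fun p => p.1 + p.2 + 1 ≤ s)).image (fun p => upTri p.1 p.2) ∪
    (((Finset.Icc i₁ (i₁ + L)) ×ˢ (Finset.Icc j₁ (j₁ + L))).filter
      (fun p => p.1 + p.2 + 2 ≤ s)).image (fun p => downTri p.1 p.2)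

theorem card_cornerPatch_le (i₁ j₁ L s : ℕ) :
    (cornerPatch i₁ j₁ L s).card ≤ 2 * ((L + 1) * (L + 1)) := by
  have h : ∀ q : ℕ × ℕ → Prop, ∀ [DecidablePred q],
      (((Finset.Icc i₁ (i₁ + L)) ×ˢ (Finset.Icc j₁ (j₁ + L))).filter q).card
      ≤ (L + 1) * (L + 1) := by
    intro q _
    refine (Finset.card_filter_le _ _).trans (le_of_eq ?_)
    rw [Finset.card_product, Nat.card_Icc, Nat.card_Icc]
    congr 1 <;> omega
  refine (Finset.card_union_le _ _).trans ?_
  rw [two_mul]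
  exact add_le_add (Finset.card_image_le.trans (h _)) (Finset.card_image_le.trans (h _))

theorem upTri_mem_cornerPatch {i₁ j₁ L s i j : ℕ} (hs : s ≤ i₁ + j₁ + L) (h1 : i₁ ≤ i)
    (h2 : j₁ ≤ j) (h3 : i + j + 1 ≤ s) : upTri i j ∈ cornerPatch i₁ j₁ L s := by
  refine Finset.mem_union_left _ (Finset.mem_image.2 ⟨(i, j), ?_, rfl⟩)
  simp only [Finset.mem_filter, Finset.mem_product, Finset.mem_Icc]
  omega

theorem downTri_mem_cornerPatch {i₁ j₁ L s i j : ℕ} (hs : s ≤ i₁ + j₁ + L) (h1 : i₁ ≤ i)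
    (h2 : j₁ ≤ j) (h3 : i + j + 2 ≤ s) : downTri i j ∈ cornerPatch i₁ j₁ L s := by
  refine Finset.mem_union_right _ (Finset.mem_image.2 ⟨(i, j), ?_, rfl⟩)
  simp only [Finset.mem_filter, Finset.mem_product, Finset.mem_Icc]
  omega

theorem mem_cornerPatch {i₁ j₁ L s : ℕ} {τ : Finset (ℕ × ℕ)} (h : τ ∈ cornerPatch i₁ j₁ L s) :
    ∃ i j, i₁ ≤ i ∧ j₁ ≤ j ∧
      ((i + j + 1 ≤ s ∧ τ = upTri i j) ∨ (i + j + 2 ≤ s ∧ τ = downTri i j)) := by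
  rcases Finset.mem_union.1 h with h | h <;> obtain ⟨p, hp, rfl⟩ := Finset.mem_image.1 h <;>
    simp only [Finset.mem_filter, Finset.mem_product, Finset.mem_Icc] at hp
  · exact ⟨p.1, p.2, hp.1.1.1, hp.1.2.1, Or.inl ⟨hp.2, rfl⟩⟩
  · exact ⟨p.1, p.2, hp.1.1.1, hp.1.2.1, Or.inr ⟨hp.2, rfl⟩⟩

theorem card_up_inter_down (i j : ℕ) : (upTri i j ∩ downTri i j).card = 2 ∧
    (upTri (i + 1) j ∩ downTri i j).card = 2 ∧ (upTri i (j + 1) ∩ downTri i j).card = 2 := by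
  refine ⟨?_, ?_, ?_⟩
  · rw [Finset.card_eq_two]
    refine ⟨(i + 1, j), (i, j + 1), by simp, ?_⟩
    ext p
    simp only [Finset.mem_inter, mem_upTri, mem_downTri, Finset.mem_insert, Finset.mem_singleton,
      Prod.ext_iff]
    omega
  · rw [Finset.card_eq_two]
    refine ⟨(i + 1, j), (i + 1, j + 1), by simp, ?_⟩
    ext p
    simp only [Finset.mem_inter, mem_upTri, mem_downTri, Finset.mem_insert, Finset.mem_singleton,
      Prod.ext_iff]
    omega
  · rw [Finset.card_eq_two]
    refine ⟨(i, j + 1), (i + 1, j + 1), by simp, ?_⟩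
    ext p
    simp only [Finset.mem_inter, mem_upTri, mem_downTri, Finset.mem_insert, Finset.mem_singleton,
      Prod.ext_iff]
    omega

/-- Every triangle can be moved to the corner triangle by lowering one of its indices at a time,
through the triangle of the second kind in between. The condition on `s` makes the bound `L` on the
indices irrelevant. -/
theorem cornerPatch_connected {i₁ j₁ L s : ℕ} (hs : s ≤ i₁ + j₁ + L) :
    ∀ τ ∈ cornerPatch i₁ j₁ L s, ∀ τ' ∈ cornerPatch i₁ j₁ L s,
      Relation.ReflTransGen (fun a b => a ∈ cornerPatch i₁ j₁ L s ∧ b ∈ cornerPatch i₁ j₁ L s ∧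
        (a ∩ b).card = 2) τ τ' := by
  set R : Finset (ℕ × ℕ) → Finset (ℕ × ℕ) → Prop := fun a b => a ∈ cornerPatch i₁ j₁ L s ∧
    b ∈ cornerPatch i₁ j₁ L s ∧ (a ∩ b).card = 2 with hR
  have hsymm : ∀ {a b}, Relation.ReflTransGen R a b → Relation.ReflTransGen R b a := by
    intro a b h
    induction h with
    | refl => exact .refl
    | tail _ hxy ih =>
      exact .head ⟨hxy.2.1, hxy.1, by rw [Finset.inter_comm]; exact hxy.2.2⟩ ih
  have hup : ∀ m i j, i₁ ≤ i → j₁ ≤ j → i + j = i₁ + j₁ + m → i + j + 1 ≤ s →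
      Relation.ReflTransGen R (upTri i j) (upTri i₁ j₁) := by
    intro m
    induction m with
    | zero =>
      intro i j h1 h2 h3 h4
      have e1 : i = i₁ := by omega
      have e2 : j = j₁ := by omega
      rw [e1, e2]
    | succ m ih =>
      intro i j h1 h2 h3 h4
      rcases (by omega : i₁ + 1 ≤ i ∨ j₁ + 1 ≤ j) with h | h
      · obtain ⟨i, rfl⟩ : ∃ i', i = i' + 1 := ⟨i - 1, by omega⟩
        have d := downTri_mem_cornerPatch (i := i) (j := j) hs (by omega) h2 (by omega)
        refine Relation.ReflTransGen.head (b := downTri i j) ⟨upTri_mem_cornerPatch hs h1 h2 h4, d,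
          (card_up_inter_down i j).2.1⟩ (Relation.ReflTransGen.head (b := upTri i j)
          ⟨d, upTri_mem_cornerPatch hs (by omega) h2 (by omega), ?_⟩
          (ih i j (by omega) h2 (by omega) (by omega)))
        rw [Finset.inter_comm]; exact (card_up_inter_down i j).1
      · obtain ⟨j, rfl⟩ : ∃ j', j = j' + 1 := ⟨j - 1, by omega⟩
        have d := downTri_mem_cornerPatch (i := i) (j := j) hs h1 (by omega) (by omega)
        refine Relation.ReflTransGen.head (b := downTri i j) ⟨upTri_mem_cornerPatch hs h1 h2 h4, d,
          (card_up_inter_down i j).2.2⟩ (Relation.ReflTransGen.head (b := upTri i j)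
          ⟨d, upTri_mem_cornerPatch hs h1 (by omega) (by omega), ?_⟩
          (ih i j h1 (by omega) (by omega) (by omega)))
        rw [Finset.inter_comm]; exact (card_up_inter_down i j).1
  have hroot : ∀ τ ∈ cornerPatch i₁ j₁ L s, Relation.ReflTransGen R τ (upTri i₁ j₁) := by
    intro τ hτ
    obtain ⟨i, j, h1, h2, ⟨h3, rfl⟩ | ⟨h3, rfl⟩⟩ := mem_cornerPatch hτ
    · exact hup (i + j - (i₁ + j₁)) i j h1 h2 (by omega) h3
    · refine Relation.ReflTransGen.head (b := upTri i j)
        ⟨hτ, upTri_mem_cornerPatch hs h1 h2 (by omega), ?_⟩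
        (hup (i + j - (i₁ + j₁)) i j h1 h2 (by omega) (by omega))
      rw [Finset.inter_comm]; exact (card_up_inter_down i j).1
  exact fun τ hτ τ' hτ' => (hroot τ hτ).trans (hsymm (hroot τ' hτ'))

/-- A small connected set of lattice triangles that contains all the triangles which have a common
vertex with a given one. -/
theorem exists_small_patch {n : ℕ} {τ : Finset (ℕ × ℕ)} (hτ : IsLatticeTriangle n τ) :
    ∃ B : Finset (Finset (ℕ × ℕ)), B.card ≤ 72 ∧ (∀ σ ∈ B, IsLatticeTriangle n σ) ∧
      (∀ σ ∈ B, ∀ σ' ∈ B,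
        Relation.ReflTransGen (fun s t => s ∈ B ∧ t ∈ B ∧ (s ∩ t).card = 2) σ σ') ∧
      ∀ σ, IsLatticeTriangle n σ → (∃ p ∈ σ, p ∈ τ) → σ ∈ B := by
  obtain ⟨i, j, hn, hij⟩ : ∃ i j, i + j + 1 ≤ n ∧ ∀ p ∈ τ, i ≤ p.1 ∧ j ≤ p.2 ∧
      p.1 + p.2 ≤ i + j + 2 := by
    obtain ⟨i, j, ⟨h1, rfl⟩ | ⟨h1, rfl⟩⟩ := isLatticeTriangle_iff.1 hτ
    · refine ⟨i, j, h1, fun p hp => ?_⟩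
      rw [mem_upTri] at hp; omega
    · refine ⟨i, j, by omega, fun p hp => ?_⟩
      rw [mem_downTri] at hp; omega
  -- A triangle with a vertex in `τ` reaches at most one index below `(i, j)` (truncated subtraction
  -- stops at 0) and one level above `i + j + 2`. With `L = 5` the number of triangles is at most 2
  -- · 6 · 6 = 72.
  have hs : min n (i + j + 3) ≤ (i - 1) + (j - 1) + 5 := by omega
  refine ⟨cornerPatch (i - 1) (j - 1) 5 (min n (i + j + 3)), card_cornerPatch_le _ _ _ _,
    fun σ hσ => ?_, cornerPatch_connected hs, fun σ hσ hp => ?_⟩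
  · obtain ⟨i', j', -, -, ⟨h3, rfl⟩ | ⟨h3, rfl⟩⟩ := mem_cornerPatch hσ
    · exact isLatticeTriangle_iff.2 ⟨i', j', Or.inl ⟨by omega, rfl⟩⟩
    · exact isLatticeTriangle_iff.2 ⟨i', j', Or.inr ⟨by omega, rfl⟩⟩
  · obtain ⟨p, hpσ, hpτ⟩ := hp
    have := hij p hpτ
    obtain ⟨i', j', ⟨h3, rfl⟩ | ⟨h3, rfl⟩⟩ := isLatticeTriangle_iff.1 hσ
    · rw [mem_upTri] at hpσ
      exact upTri_mem_cornerPatch hs (by omega) (by omega) (by omega)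
    · rw [mem_downTri] at hpσ
      exact downTri_mem_cornerPatch hs (by omega) (by omega) (by omega)

/-! ### Affine coordinates and volumes of boxes. -/

/-- The linear combination of three vectors. -/
def boxLin (p v w : E3) : ℝ × ℝ × ℝ →ₗ[ℝ] E3 :=
  (LinearMap.fst ℝ ℝ (ℝ × ℝ)).smulRight p +
    ((LinearMap.fst ℝ ℝ ℝ).comp (LinearMap.snd ℝ ℝ (ℝ × ℝ))).smulRight v +
    ((LinearMap.snd ℝ ℝ ℝ).comp (LinearMap.snd ℝ ℝ (ℝ × ℝ))).smulRight w

theorem boxLin_apply (p v w : E3) (x : ℝ × ℝ × ℝ) :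
    boxLin p v w x = x.1 • p + x.2.1 • v + x.2.2 • w := rfl

theorem boxMap_eq (A p v w : E3) (x : ℝ × ℝ × ℝ) : boxMap A p v w x = A + boxLin p v w x := by
  simp only [boxMap, boxLin_apply]; abel

theorem boxMap_sub (A p v w : E3) (x y : ℝ × ℝ × ℝ) :
    boxMap A p v w x - boxMap A p v w y = boxLin p v w (x - y) := by
  rw [boxMap_eq, boxMap_eq, map_sub]; abel

theorem boxMap_combo (A p v w : E3) {a b : ℝ} (h : a + b = 1) (x y : ℝ × ℝ × ℝ) :
    boxMap A p v w (a • x + b • y) = a • boxMap A p v w x + b • boxMap A p v w y := by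
  obtain rfl : a = 1 - b := by linarith
  simp only [boxMap_eq, map_add, map_smul]; module

/-- Small boxes inside a prism are given by reference coordinates. This identity and `det3_boxLin`
reduce all inclusions and volumes to computations there. -/
theorem boxMap_boxLin (A p v w : E3) (x a b c q : ℝ × ℝ × ℝ) :
    boxMap (boxMap A p v w x) (boxLin p v w a) (boxLin p v w b) (boxLin p v w c) q =
      boxMap A p v w (x + q.1 • a + q.2.1 • b + q.2.2 • c) := by
  simp only [boxMap_eq, map_add, map_smul]
  rw [boxLin_apply (boxLin p v w a)]
  abel

/-- The determinant of three triples. -/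
def coordDet (a b c : ℝ × ℝ × ℝ) : ℝ :=
  a.1 * (b.2.1 * c.2.2 - b.2.2 * c.2.1) - a.2.1 * (b.1 * c.2.2 - b.2.2 * c.1)
    + a.2.2 * (b.1 * c.2.1 - b.2.1 * c.1)

theorem det3_eq (p v w : E3) : det3 p v w = p 0 * (v 1 * w 2 - w 1 * v 2)
    - v 0 * (p 1 * w 2 - w 1 * p 2) + w 0 * (p 1 * v 2 - v 1 * p 2) := by
  rw [det3, Matrix.det_fin_three]
  simp
  ring

theorem det3_boxLin (p v w : E3) (a b c : ℝ × ℝ × ℝ) :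
    det3 (boxLin p v w a) (boxLin p v w b) (boxLin p v w c) = coordDet a b c * det3 p v w := by
  simp only [det3_eq, boxLin_apply, coordDet, PiLp.add_apply, PiLp.smul_apply, smul_eq_mul]
  ring

theorem boxLin_injective {p v w : E3} (h : det3 p v w ≠ 0) :
    Function.Injective (boxLin p v w) := by
  rw [← LinearMap.ker_eq_bot, LinearMap.ker_eq_bot']
  intro x hx
  have h1 : Matrix.mulVec (Matrix.of fun i j => (![p, v, w] j) i) ![x.1, x.2.1, x.2.2] = 0 := by
    funext i
    have := congrArg (fun y : E3 => y i) hx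
    simp only [boxLin_apply, PiLp.add_apply, PiLp.smul_apply, smul_eq_mul, PiLp.zero_apply] at this
    simp [Matrix.mulVec, dotProduct, Fin.sum_univ_three]
    linarith
  have h2 := Matrix.eq_zero_of_mulVec_eq_zero h h1
  have e1 := congrFun h2 0
  have e2 := congrFun h2 1
  have e3 := congrFun h2 2
  simp at e1 e2 e3
  ext <;> simp [e1, e2, e3]

theorem boxMap_injective (A : E3) {p v w : E3} (h : det3 p v w ≠ 0) :
    Function.Injective (boxMap A p v w) := by
  intro x y hxy
  rw [boxMap_eq, boxMap_eq] at hxy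
  exact boxLin_injective h (add_left_cancel hxy)

/-- The coordinate system with the given origin and edge vectors. -/
def boxHomeo (A : E3) {p v w : E3} (h : det3 p v w ≠ 0) : ℝ × ℝ × ℝ ≃ₜ E3 :=
  ((boxLin p v w).linearEquivOfInjective (boxLin_injective h)
    (by simp)).toContinuousLinearEquiv.toHomeomorph.trans (Homeomorph.addLeft A)

theorem boxHomeo_apply (A : E3) {p v w : E3} (h : det3 p v w ≠ 0) (x : ℝ × ℝ × ℝ) :
    boxHomeo A h x = boxMap A p v w x := by
  rw [boxMap_eq]; rfl

theorem coe_boxHomeo (A : E3) {p v w : E3} (h : det3 p v w ≠ 0) :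
    ⇑(boxHomeo A h) = boxMap A p v w := funext (boxHomeo_apply A h)

theorem exists_boxMap (A : E3) {p v w : E3} (h : det3 p v w ≠ 0) (x : E3) :
    ∃ y, boxMap A p v w y = x := by
  obtain ⟨y, hy⟩ := (boxHomeo A h).surjective x
  exact ⟨y, by rw [← boxHomeo_apply A h, hy]⟩

/-- The open unit cube. -/
def cube : Set (ℝ × ℝ × ℝ) := Ioo (0 : ℝ) 1 ×ˢ Ioo (0 : ℝ) 1 ×ˢ Ioo (0 : ℝ) 1

theorem isOpen_cube : IsOpen cube := isOpen_Ioo.prod (isOpen_Ioo.prod isOpen_Ioo)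

theorem convex_cube : Convex ℝ cube := (convex_Ioo 0 1).prod ((convex_Ioo 0 1).prod (convex_Ioo 0 1))

theorem volume_cube : volume cube = 1 := by
  rw [cube, Measure.volume_eq_prod, Measure.prod_prod, Measure.volume_eq_prod, Measure.prod_prod]
  simp

theorem isOpen_boxMap_image (A : E3) {p v w : E3} (h : det3 p v w ≠ 0) {s : Set (ℝ × ℝ × ℝ)}
    (hs : IsOpen s) : IsOpen (boxMap A p v w '' s) := by
  rw [← coe_boxHomeo A h]
  exact (boxHomeo A h).isOpenMap s hs

theorem boxMap_image_subset_interior (A : E3) {p v w : E3} (h : det3 p v w ≠ 0) {X : Set E3}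
    (hX : ∀ q ∈ cube, boxMap A p v w q ∈ X) : boxMap A p v w '' cube ⊆ interior X :=
  (isOpen_boxMap_image A h isOpen_cube).subset_interior_iff.2 (image_subset_iff.2 hX)

theorem convex_boxMap_image (A p v w : E3) {s : Set (ℝ × ℝ × ℝ)} (hs : Convex ℝ s) :
    Convex ℝ (boxMap A p v w '' s) := by
  rintro _ ⟨x, hx, rfl⟩ _ ⟨y, hy, rfl⟩ a b ha hb hab
  exact ⟨a • x + b • y, hs hx hy ha hb hab, boxMap_combo A p v w hab x y⟩

theorem volume_boxMap_image (A : E3) {p v w : E3} (h : det3 p v w ≠ 0) {s : Set (ℝ × ℝ × ℝ)}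
    (hs : MeasurableSet s) :
    volume (boxMap A p v w '' s) = ENNReal.ofReal |det3 p v w| * volume s := by
  have hm : MeasurableSet (boxMap A p v w '' s) := by
    rw [← coe_boxHomeo A h]
    exact (boxHomeo A h).measurableEmbedding.measurableSet_image.2 hs
  have h1 := congrArg (fun m => m (boxMap A p v w '' s)) (map_boxMap A h)
  simp only [Measure.smul_apply, smul_eq_mul] at h1
  rw [Measure.map_apply (continuous_boxMap A p v w).measurable hm,
    preimage_image_eq _ (boxMap_injective A h)] at h1
  have hd : 0 < |det3 p v w| := abs_pos.2 h
  rw [h1, ← mul_assoc, ← ENNReal.ofReal_mul hd.le, mul_inv_cancel₀ hd.ne', ENNReal.ofReal_one,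
    one_mul]

theorem setLIntegral_boxMap_image (A : E3) {p v w : E3} (h : det3 p v w ≠ 0)
    (s : Set (ℝ × ℝ × ℝ)) (F : E3 → ENNReal) :
    ∫⁻ x in boxMap A p v w '' s, F x =
      ENNReal.ofReal |det3 p v w| * ∫⁻ q in s, F (boxMap A p v w q) := by
  have hd : 0 < |det3 p v w| := abs_pos.2 h
  have hemb : MeasurableEmbedding (boxMap A p v w) := by
    rw [← coe_boxHomeo A h]; exact (boxHomeo A h).measurableEmbedding
  have h1 : (volume : Measure E3) =
      ENNReal.ofReal |det3 p v w| • Measure.map (boxMap A p v w) volume := by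
    rw [map_boxMap A h, smul_smul, ← ENNReal.ofReal_mul hd.le, mul_inv_cancel₀ hd.ne',
      ENNReal.ofReal_one, one_smul]
  conv_lhs => rw [h1, Measure.restrict_smul, lintegral_smul_measure, smul_eq_mul]
  rw [hemb.restrict_map, preimage_image_eq _ hemb.injective, hemb.lintegral_map]

/-! ### Prisms of a layer in reference coordinates. -/

/-- The prism over the lattice triangle `τ` in reference coordinates. -/
def refPrism (G : ℕ → ℝ) (lam : ℝ) (τ : Finset (ℕ × ℕ)) : Set (ℝ × ℝ × ℝ) :=
  {x | (x.1, x.2.1) ∈ convexHull ℝ (latPt G '' τ) ∧ 0 ≤ x.2.2 ∧ x.2.2 ≤ 1 - lam * (x.1 + x.2.1)}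

theorem convex_refPrism (G : ℕ → ℝ) (lam : ℝ) (τ : Finset (ℕ × ℕ)) :
    Convex ℝ (refPrism G lam τ) := by
  rintro x ⟨h1, h2, h3⟩ y ⟨h1', h2', h3'⟩ a b ha hb hab
  refine ⟨convex_convexHull ℝ _ h1 h1' ha hb hab, ?_, ?_⟩
  · simp only [Prod.snd_add, Prod.smul_snd, smul_eq_mul]; positivity
  · simp only [Prod.snd_add, Prod.smul_snd, Prod.fst_add, Prod.smul_fst, smul_eq_mul]
    obtain rfl : a = 1 - b := by linarith
    nlinarith

/-- The vectors that span a layer of prisms. -/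
structure PrismFrame (G : ℕ → ℝ) where
  n : ℕ
  lam : ℝ
  s : E3
  P : E3
  Q : E3
  V : E3
  lam_pos : 0 < lam
  lam_mul : lam * (G n * n) = 1
  det_ne : det3 P Q V ≠ 0

namespace PrismFrame

variable {G : ℕ → ℝ} (F : PrismFrame G)

/-- The coordinate map of the frame. -/
def map (x : ℝ × ℝ × ℝ) : E3 := boxMap F.s F.P F.Q F.V x

/-- The prism over a triangle. -/
def prism (τ : Finset (ℕ × ℕ)) : Set E3 := F.map '' refPrism G F.lam τ

/-- The length of the vertical edge over a lattice point. -/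
def height (p : ℕ × ℕ) : ℝ := 1 - F.lam * (G (p.1 + p.2) * ((p.1 + p.2 : ℕ) : ℝ))

/-- The lower node over a lattice point. -/
def bot (p : ℕ × ℕ) : E3 := F.map ((latPt G p).1, (latPt G p).2, 0)

/-- The upper node over a lattice point. -/
def top (p : ℕ × ℕ) : E3 := F.map ((latPt G p).1, (latPt G p).2, F.height p)

theorem map_injective : Function.Injective F.map := boxMap_injective _ F.det_ne

theorem n_pos : 0 < F.n := by
  rcases Nat.eq_zero_or_pos F.n with h | h
  · have := F.lam_mul
    simp [h] at this
  · exact h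

theorem height_eq (p : ℕ × ℕ) : F.height p = 1 - F.lam * ((latPt G p).1 + (latPt G p).2) := by
  rw [latPt_add]; rfl

theorem height_nonneg (hG : IsGrading G) {p : ℕ × ℕ} (hp : p.1 + p.2 ≤ F.n) : 0 ≤ F.height p := by
  have := mul_le_mul_of_nonneg_left (hG.mono.monotone hp) F.lam_pos.le
  have h2 := F.lam_mul
  simp only [height] at this ⊢
  linarith

theorem height_le (hG : IsGrading G) (p : ℕ × ℕ) : F.height p ≤ 1 := by
  have := mul_nonneg F.lam_pos.le (hG.nonneg (p.1 + p.2))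
  simp only [height]
  linarith

/-- With m the level of `p`, monotonicity of `G` gives λ G(m) m ≤ m/n ≤ m/(m + 1). The bound does
not depend on `n`: over low levels the prisms do not degenerate, however few layers there are. -/
theorem le_height (hGm : Monotone G) {p : ℕ × ℕ} (hp : p.1 + p.2 < F.n) :
    1 / (((p.1 + p.2 : ℕ) : ℝ) + 1) ≤ F.height p := by
  have h2 := F.lam_mul
  have hn : (0 : ℝ) < F.n := by exact_mod_cast F.n_pos
  set m := p.1 + p.2 with hm
  have h3 : F.lam * (G m * m) ≤ m / F.n := by
    rw [le_div_iff₀ hn]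
    calc F.lam * (G m * m) * F.n = (F.lam * F.n * m) * G m := by ring
      _ ≤ (F.lam * F.n * m) * G F.n :=
          mul_le_mul_of_nonneg_left (hGm hp.le) (by have := F.lam_pos; positivity)
      _ = m * (F.lam * (G F.n * F.n)) := by ring
      _ = m := by rw [h2, mul_one]
  have h4 : (m : ℝ) / F.n ≤ m / (m + 1) := by
    apply div_le_div_of_nonneg_left (by positivity) (by positivity)
    exact_mod_cast hp
  have h5 : (1 : ℝ) / (m + 1) = 1 - m / (m + 1) := by field_simp; ring
  rw [h5]
  simp only [height, ← hm]
  linarith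

theorem height_pos (hGm : Monotone G) {p : ℕ × ℕ} (hp : p.1 + p.2 < F.n) :
    0 < F.height p := lt_of_lt_of_le (by positivity) (F.le_height hGm hp)

theorem convex_prism (τ : Finset (ℕ × ℕ)) : Convex ℝ (F.prism τ) :=
  convex_boxMap_image _ _ _ _ (convex_refPrism G F.lam τ)

theorem mem_refPrism_bot (hG : IsGrading G) {τ : Finset (ℕ × ℕ)}
    (hτ : IsLatticeTriangle F.n τ) {p : ℕ × ℕ} (hp : p ∈ τ) :
    ((latPt G p).1, (latPt G p).2, (0 : ℝ)) ∈ refPrism G F.lam τ :=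
  ⟨subset_convexHull ℝ _ (mem_image_of_mem _ hp), le_rfl, by
    simpa [F.height_eq] using F.height_nonneg hG (hτ.level_le hp)⟩

theorem mem_refPrism_top (hG : IsGrading G) {τ : Finset (ℕ × ℕ)}
    (hτ : IsLatticeTriangle F.n τ) {p : ℕ × ℕ} (hp : p ∈ τ) :
    ((latPt G p).1, (latPt G p).2, F.height p) ∈ refPrism G F.lam τ :=
  ⟨subset_convexHull ℝ _ (mem_image_of_mem _ hp), F.height_nonneg hG (hτ.level_le hp),
    (F.height_eq p).le⟩

theorem bot_mem (hG : IsGrading G) {τ : Finset (ℕ × ℕ)}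
    (hτ : IsLatticeTriangle F.n τ) {p : ℕ × ℕ} (hp : p ∈ τ) : F.bot p ∈ F.prism τ :=
  mem_image_of_mem _ (F.mem_refPrism_bot hG hτ hp)

theorem top_mem (hG : IsGrading G) {τ : Finset (ℕ × ℕ)}
    (hτ : IsLatticeTriangle F.n τ) {p : ℕ × ℕ} (hp : p ∈ τ) : F.top p ∈ F.prism τ :=
  mem_image_of_mem _ (F.mem_refPrism_top hG hτ hp)

theorem exists_triple {n : ℕ} {τ : Finset (ℕ × ℕ)} (hτ : IsLatticeTriangle n τ) :
    ∃ p q r, τ = {p, q, r} := by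
  obtain ⟨i, j, ⟨-, rfl⟩ | ⟨-, rfl⟩⟩ := hτ <;> exact ⟨_, _, _, rfl⟩

/-- A prism is the convex hull of its lower and upper nodes. -/
theorem prism_eq_convexHull (hG : IsGrading G) {τ : Finset (ℕ × ℕ)}
    (hτ : IsLatticeTriangle F.n τ) : F.prism τ = convexHull ℝ (F.bot '' τ ∪ F.top '' τ) := by
  refine Subset.antisymm ?_ (convexHull_min ?_ (F.convex_prism τ))
  · rintro _ ⟨x, ⟨h1, h2, h3⟩, rfl⟩
    -- The top is the graph of an affine function, so points of the bottom and of the top are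
    -- handled alike by convexity in the base point; the points in between are convex combinations
    -- along a vertical segment.
    have hcomb : ∀ y ∈ convexHull ℝ (latPt G '' τ),
        F.map (y.1, y.2, 0) ∈ convexHull ℝ (F.bot '' τ ∪ F.top '' τ) ∧
        F.map (y.1, y.2, 1 - F.lam * (y.1 + y.2)) ∈ convexHull ℝ (F.bot '' τ ∪ F.top '' τ) := by
      intro y hy
      refine convexHull_min (s := latPt G '' τ) (t := {y : ℝ × ℝ |
        F.map (y.1, y.2, 0) ∈ convexHull ℝ (F.bot '' τ ∪ F.top '' τ) ∧
        F.map (y.1, y.2, 1 - F.lam * (y.1 + y.2)) ∈ convexHull ℝ (F.bot '' τ ∪ F.top '' τ)})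
        ?_ ?_ hy
      · rintro _ ⟨p, hp, rfl⟩
        refine ⟨subset_convexHull ℝ _ (Or.inl ⟨p, hp, rfl⟩), subset_convexHull ℝ _ (Or.inr
          ⟨p, hp, ?_⟩)⟩
        rw [top, height_eq]
      · rintro y ⟨hy1, hy2⟩ z ⟨hz1, hz2⟩ a b ha hb hab
        have c1 := convex_convexHull ℝ _ hy1 hz1 ha hb hab
        have c2 := convex_convexHull ℝ _ hy2 hz2 ha hb hab
        rw [map, map, ← boxMap_combo _ _ _ _ hab] at c1 c2
        constructor
        · convert! c1 using 2
          ext <;> simp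
        · convert! c2 using 2
          obtain rfl : a = 1 - b := by linarith
          ext <;> simp
          ring
    obtain ⟨c1, c2⟩ := hcomb _ h1
    rcases eq_or_lt_of_le (h2.trans h3) with h0 | h0
    · have : x = (x.1, x.2.1, 0) := by ext <;> simp; linarith
      rw [this]; exact c1
    · have hs : (1 - x.2.2 / (1 - F.lam * (x.1 + x.2.1))) + x.2.2 / (1 - F.lam * (x.1 + x.2.1))
          = 1 := by ring
      have := convex_convexHull ℝ _ c1 c2 (sub_nonneg.2 ((div_le_one h0).2 h3)) (by positivity) hs
      rw [map, map, ← boxMap_combo _ _ _ _ hs] at this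
      convert! this using 1
      rw [map]
      congr 1
      ext
      · simp; ring
      · simp; ring
      · simp; field_simp
  · rintro _ (⟨p, hp, rfl⟩ | ⟨p, hp, rfl⟩)
    · exact F.bot_mem hG hτ hp
    · exact F.top_mem hG hτ hp

theorem isCompact_prism (hG : IsGrading G) {τ : Finset (ℕ × ℕ)}
    (hτ : IsLatticeTriangle F.n τ) : IsCompact (F.prism τ) := by
  rw [F.prism_eq_convexHull hG hτ]
  exact Set.Finite.isCompact_convexHull ℝ ((τ.finite_toSet.image _).union (τ.finite_toSet.image _))

/-- The same layer, seen from above. -/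
def flip : PrismFrame G where
  n := F.n
  lam := F.lam
  s := F.s + F.V
  P := F.P - F.lam • F.V
  Q := F.Q - F.lam • F.V
  V := -F.V
  lam_pos := F.lam_pos
  lam_mul := F.lam_mul
  det_ne := by
    have : det3 (F.P - F.lam • F.V) (F.Q - F.lam • F.V) (-F.V) = -det3 F.P F.Q F.V := by
      simp only [det3_eq, PiLp.sub_apply, PiLp.smul_apply, PiLp.neg_apply, smul_eq_mul]; ring
    rw [this]
    exact neg_ne_zero.2 F.det_ne

theorem flip_map (x : ℝ × ℝ × ℝ) :
    F.flip.map x = F.map (x.1, x.2.1, 1 - F.lam * (x.1 + x.2.1) - x.2.2) := by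
  simp only [map, boxMap, flip]; module

theorem flip_bot (p : ℕ × ℕ) : F.flip.bot p = F.top p := by
  rw [bot, flip_map, top, height_eq]; simp

theorem flip_prism (τ : Finset (ℕ × ℕ)) : F.flip.prism τ = F.prism τ := by
  ext y
  constructor
  · rintro ⟨x, ⟨h1, h2, h3⟩, rfl⟩
    refine ⟨(x.1, x.2.1, 1 - F.lam * (x.1 + x.2.1) - x.2.2), ⟨h1, ?_, ?_⟩, (F.flip_map x).symm⟩
    · change 0 ≤ 1 - F.lam * (x.1 + x.2.1) - x.2.2
      change x.2.2 ≤ 1 - F.lam * (x.1 + x.2.1) at h3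
      linarith
    · simp only
      linarith
  · rintro ⟨x, ⟨h1, h2, h3⟩, rfl⟩
    refine ⟨(x.1, x.2.1, 1 - F.lam * (x.1 + x.2.1) - x.2.2), ⟨h1, ?_, ?_⟩, ?_⟩
    · simp only
      linarith
    · change 1 - F.lam * (x.1 + x.2.1) - x.2.2 ≤ 1 - F.lam * (x.1 + x.2.1)
      linarith
    · rw [flip_map]; congr 1; ext <;> simp

end PrismFrame

/-- The third vertex does it, since all orderings of the vertices give the same area up to sign. -/
theorem IsGrading.exists_area2_ne_zero {G : ℕ → ℝ} (hG : IsGrading G) {n : ℕ}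
    {τ : Finset (ℕ × ℕ)} (hτ : IsLatticeTriangle n τ) {p q : ℕ × ℕ} (hp : p ∈ τ) (hq : q ∈ τ)
    (hpq : p ≠ q) : ∃ r ∈ τ, area2 (latPt G p) (latPt G q) (latPt G r) ≠ 0 := by
  have key : ∀ x y z : ℕ × ℕ, area2 (latPt G x) (latPt G y) (latPt G z) ≠ 0 →
      p ∈ ({x, y, z} : Finset (ℕ × ℕ)) → q ∈ ({x, y, z} : Finset (ℕ × ℕ)) →
      ∃ r ∈ ({x, y, z} : Finset (ℕ × ℕ)), area2 (latPt G p) (latPt G q) (latPt G r) ≠ 0 := by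
    intro x y z h h1 h2
    have e : area2 (latPt G y) (latPt G x) (latPt G z) =
        -area2 (latPt G x) (latPt G y) (latPt G z) := by simp only [area2]; ring
    have e' : area2 (latPt G x) (latPt G z) (latPt G y) =
        -area2 (latPt G x) (latPt G y) (latPt G z) := by simp only [area2]; ring
    have e'' : area2 (latPt G z) (latPt G y) (latPt G x) =
        -area2 (latPt G x) (latPt G y) (latPt G z) := by simp only [area2]; ring
    have f : area2 (latPt G y) (latPt G z) (latPt G x) =
        area2 (latPt G x) (latPt G y) (latPt G z) := by simp only [area2]; ring
    have f' : area2 (latPt G z) (latPt G x) (latPt G y) =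
        area2 (latPt G x) (latPt G y) (latPt G z) := by simp only [area2]; ring
    simp only [Finset.mem_insert, Finset.mem_singleton] at h1 h2
    have n0 := neg_ne_zero.2 h
    rcases h1 with rfl | rfl | rfl <;> rcases h2 with rfl | rfl | rfl
    · exact absurd rfl hpq
    · exact ⟨z, by simp, h⟩
    · exact ⟨y, by simp, e' ▸ n0⟩
    · exact ⟨z, by simp, e ▸ n0⟩
    · exact absurd rfl hpq
    · exact ⟨x, by simp, f ▸ h⟩
    · exact ⟨y, by simp, f' ▸ h⟩
    · exact ⟨x, by simp, e'' ▸ n0⟩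
    · exact absurd rfl hpq
  obtain ⟨i, j, ⟨-, rfl⟩ | ⟨-, rfl⟩⟩ := isLatticeTriangle_iff.1 hτ
  · exact key _ _ _ (hG.area2_up_pos i j).ne' hp hq
  · refine key _ _ _ ?_ hp hq
    have : area2 (latPt G (i + 1, j)) (latPt G (i, j + 1)) (latPt G (i + 1, j + 1)) =
      -area2 (latPt G (i + 1, j + 1)) (latPt G (i, j + 1)) (latPt G (i + 1, j)) := by
      simp only [area2]; ring
    rw [this]
    exact neg_ne_zero.2 (hG.area2_down_pos i j).ne'

namespace PrismFrame

variable {G : ℕ → ℝ} (F : PrismFrame G)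

/-- A parallelepiped with three of its edges on the edges of a tetrahedron is contained in this
tetrahedron if the edges are short enough. -/
theorem box_mem_prism {τ : Finset (ℕ × ℕ)} {a b c d : ℝ × ℝ × ℝ} (ha : a ∈ refPrism G F.lam τ)
    (hb : b ∈ refPrism G F.lam τ) (hc : c ∈ refPrism G F.lam τ) (hd : d ∈ refPrism G F.lam τ)
    {q : ℝ × ℝ × ℝ} (h1 : 0 ≤ q.1) (h2 : 0 ≤ q.2.1) (h3 : 0 ≤ q.2.2) (h1' : q.1 ≤ 1)
    (h2' : q.2.1 ≤ 1) (h3' : q.2.2 ≤ 1) :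
    a + q.1 • ((1 / 2 : ℝ) • (b - a)) + q.2.1 • ((1 / 4 : ℝ) • (c - a)) +
      q.2.2 • ((1 / 4 : ℝ) • (d - a)) ∈ refPrism G F.lam τ := by
  -- The factors 1/2, 1/4, 1/4 add up to 1, so each corner of the box is a convex combination of the
  -- four points.
  have hconv := convex_refPrism G F.lam τ
  have h4 := hconv.sum_mem (t := Finset.univ) (w := ![1 - q.1 / 2 - q.2.1 / 4 - q.2.2 / 4,
    q.1 / 2, q.2.1 / 4, q.2.2 / 4]) (z := ![a, b, c, d]) (by
      intro i _
      fin_cases i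
      · simp; linarith
      · simp; linarith
      · simp; linarith
      · simp; linarith) (by simp [Fin.sum_univ_four]; ring) (by
      intro i _
      fin_cases i <;> simpa)
  convert! h4 using 1
  simp [Fin.sum_univ_four]
  module

end PrismFrame

/-! ### Functions on a patch, and transfer between subsets. -/

section

open Filter Topology

/-- A function on a patch in a layer of prisms, with a majorant `Φ` of the weighted derivatives that
control its values. -/
structure LocalFunction {G : ℕ → ℝ} (F : PrismFrame G) where
  B : Finset (Finset (ℕ × ℕ))
  S : Set E3
  u : E3 → ℝ
  g : E3 →ₗ[ℝ] E3 → ℝ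
  h : E3 →ₗ[ℝ] E3 →ₗ[ℝ] E3 → ℝ
  ρ : E3 → ℝ
  Φ : E3 → ENNReal
  Z : Set E3
  lattice : ∀ τ ∈ B, IsLatticeTriangle F.n τ
  S_eq : S = interior (⋃ τ ∈ B, F.prism τ)
  cont : ContinuousOn u (closure S \ Z)
  zero : ∀ x ∈ (closure S ∩ segment ℝ F.s (F.s + F.V)) \ Z, u x = 0
  -- `Z` will be empty, or the singular vertex, where `u` need not be continuous.
  Z_sub : Z ⊆ {F.s, F.s + F.V}
  weak1 : ∀ e, WeakDir S u e (g e)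
  weak2 : ∀ e e', WeakDir S (g e) e' (h e e')
  meas : AEMeasurable Φ (volume.restrict S)
  ρ_cont : Continuous ρ
  ρ_pos : ∀ x : ℝ × ℝ × ℝ, 0 < x.1 → 0 < x.2.1 → 0 < ρ (F.map x) ∧ ρ (F.map x) ≤ x.1 + x.2.1
  axis : ∀ x ∈ S, (‖g F.P x‖ₑ + ‖g F.Q x‖ₑ) * ENNReal.ofReal (ρ x)⁻¹ ≤ Φ x
  first : ∀ x ∈ S, ‖g F.P x‖ₑ + ‖g F.Q x‖ₑ + ‖g F.V x‖ₑ ≤ Φ x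
  -- The direction of the second differentiation is always `P` or `Q`. In particular the second
  -- derivative twice along `V`, the long direction, is not required to be controlled.
  second : ∀ x ∈ S, ‖h F.P F.P x‖ₑ + ‖h F.P F.Q x‖ₑ + (‖h F.Q F.P x‖ₑ + ‖h F.Q F.Q x‖ₑ) +
    (‖h F.V F.P x‖ₑ + ‖h F.V F.Q x‖ₑ) ≤ Φ x

theorem enorm_mul_le_ofReal_mul {a M : ℝ} (h : |a| ≤ M) (b : ℝ) :
    ‖a * b‖ₑ ≤ ENNReal.ofReal M * ‖b‖ₑ := by
  rw [enorm_mul]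
  refine mul_le_mul_left ?_ _
  rw [Real.enorm_eq_ofReal_abs]
  exact ENNReal.ofReal_le_ofReal h

theorem latPt_mem_triple {E : Type*} [AddCommGroup E] [Module ℝ E] {C : Set E} (hC : Convex ℝ C)
    {x y z : E} (hx : x ∈ C) (hy : y ∈ C) (hz : z ∈ C) {a b c : ℝ} (ha : 0 ≤ a) (hb : 0 ≤ b)
    (hc : 0 ≤ c) (h : a + b + c = 1) : a • x + b • y + c • z ∈ C := by
  have h4 := hC.sum_mem (t := Finset.univ) (w := ![a, b, c]) (z := ![x, y, z]) (by
      intro i _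
      fin_cases i <;> simpa) (by simpa [Fin.sum_univ_three]) (by
      intro i _
      fin_cases i <;> simpa)
  simpa [Fin.sum_univ_three] using h4

namespace PrismFrame

variable {G : ℕ → ℝ} (F : PrismFrame G)

/-- The height at a convex combination is the same combination of heights. Only the part contributed
by `p` is used, since the heights over `q` and `r` may be zero. -/
theorem mem_refPrism_combo (hG : IsGrading G) {τ : Finset (ℕ × ℕ)} (hτ : IsLatticeTriangle F.n τ)
    {p q r : ℕ × ℕ} (hp : p ∈ τ) (hq : q ∈ τ) (hr : r ∈ τ) {a b c z : ℝ} (ha : 0 ≤ a) (hb : 0 ≤ b)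
    (hc : 0 ≤ c) (h : a + b + c = 1) (hz0 : 0 ≤ z) (hz : z ≤ a * F.height p) :
    (a * (latPt G p).1 + b * (latPt G q).1 + c * (latPt G r).1,
      a * (latPt G p).2 + b * (latPt G q).2 + c * (latPt G r).2, z) ∈ refPrism G F.lam τ := by
  refine ⟨?_, hz0, ?_⟩
  · have := latPt_mem_triple (convex_convexHull ℝ (latPt G '' τ))
      (subset_convexHull ℝ _ (mem_image_of_mem _ hp)) (subset_convexHull ℝ _ (mem_image_of_mem _ hq))
      (subset_convexHull ℝ _ (mem_image_of_mem _ hr)) ha hb hc h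
    convert! this using 1
  · have hq0 := mul_nonneg hb (F.height_nonneg hG (hτ.level_le hq))
    have hr0 := mul_nonneg hc (F.height_nonneg hG (hτ.level_le hr))
    rw [height_eq] at hq0 hr0 hz
    obtain rfl : a = 1 - b - c := by linarith
    simp only
    linarith

theorem refPrism_subset {G : ℕ → ℝ} {lam : ℝ} (hlam : 0 ≤ lam) {τ : Finset (ℕ × ℕ)} {M : ℝ}
    (hG : IsGrading G) (hM : 1 ≤ M) (h : ∀ p ∈ τ, (latPt G p).1 ≤ M ∧ (latPt G p).2 ≤ M) :
    refPrism G lam τ ⊆ Icc 0 M ×ˢ Icc 0 M ×ˢ Icc 0 M := by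
  rintro x ⟨h1, h2, h3⟩
  have h4 : (x.1, x.2.1) ∈ Icc 0 M ×ˢ Icc 0 M := by
    refine convexHull_min ?_ ((convex_Icc 0 M).prod (convex_Icc 0 M)) h1
    rintro _ ⟨p, hp, rfl⟩
    exact ⟨⟨(hG.latPt_nonneg p).1, (h p hp).1⟩, ⟨(hG.latPt_nonneg p).2, (h p hp).2⟩⟩
  refine ⟨h4.1, h4.2, h2, h3.trans ?_⟩
  have := mul_nonneg hlam (add_nonneg h4.1.1 h4.2.1)
  simp only at this
  linarith

theorem prism_subset {τ : Finset (ℕ × ℕ)} {M : ℝ}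
    (hG : IsGrading G) (hM : 1 ≤ M) (h : ∀ p ∈ τ, (latPt G p).1 ≤ M ∧ (latPt G p).2 ≤ M) :
    F.prism τ ⊆ F.map '' (Icc 0 M ×ˢ Icc 0 M ×ˢ Icc 0 M) :=
  image_mono (refPrism_subset F.lam_pos.le hG hM h)

theorem latPt_le_sum (hG : IsGrading G) {T : Finset (ℕ × ℕ)} {p : ℕ × ℕ} (hp : p ∈ T) :
    (latPt G p).1 ≤ 1 + ∑ q ∈ T, ((latPt G q).1 + (latPt G q).2) ∧
      (latPt G p).2 ≤ 1 + ∑ q ∈ T, ((latPt G q).1 + (latPt G q).2) := by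
  have := Finset.single_le_sum (f := fun q => (latPt G q).1 + (latPt G q).2)
    (fun q _ => add_nonneg (hG.latPt_nonneg q).1 (hG.latPt_nonneg q).2) hp
  have h1 := hG.latPt_nonneg p
  constructor <;> linarith

end PrismFrame

namespace LocalFunction

variable {G : ℕ → ℝ} {F : PrismFrame G} (X : LocalFunction F)

/-- The integral of the majorant. -/
def J : ENNReal := ∫⁻ x in X.S, X.Φ x

/-- The integral of the function over a prism. -/
def I (τ : Finset (ℕ × ℕ)) : ENNReal := ∫⁻ x in interior (F.prism τ), ‖X.u x‖ₑ

theorem isOpen_S : IsOpen X.S := by rw [X.S_eq]; exact isOpen_interior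

/-- An open subset of the closed octant lies in the open octant. So the patch avoids the axis, where
the weights are singular and where `Z` is located. -/
theorem pos_of_mem (hG : IsGrading G) {x : E3} (hx : x ∈ X.S) :
    ∃ y, F.map y = x ∧ 0 < y.1 ∧ 0 < y.2.1 ∧ 0 < y.2.2 := by
  have h1 : (⋃ τ ∈ X.B, F.prism τ) ⊆ F.map '' (Ici 0 ×ˢ Ici 0 ×ˢ Ici 0) := by
    refine iUnion₂_subset fun τ _ => image_mono ?_
    rintro y ⟨h1, h2, -⟩
    have h4 : (y.1, y.2.1) ∈ Ici (0 : ℝ) ×ˢ Ici (0 : ℝ) := by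
      refine convexHull_min ?_ ((convex_Ici (0 : ℝ)).prod (convex_Ici (0 : ℝ))) h1
      rintro _ ⟨p, -, rfl⟩
      exact ⟨(hG.latPt_nonneg p).1, (hG.latPt_nonneg p).2⟩
    exact ⟨h4.1, h4.2, h2⟩
  rw [X.S_eq] at hx
  have h2 := interior_mono h1 hx
  have e : F.map = boxHomeo F.s F.det_ne := (coe_boxHomeo _ _).symm
  rw [e, ← Homeomorph.image_interior, interior_prod_eq, interior_prod_eq, interior_Ici, ← e] at h2
  obtain ⟨y, ⟨h3, h4, h5⟩, rfl⟩ := h2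
  exact ⟨y, rfl, h3, h4, h5⟩

theorem S_subset (hG : IsGrading G) : X.S ⊆ closure X.S \ X.Z := by
  intro x hx
  refine ⟨subset_closure hx, fun hZ => ?_⟩
  obtain ⟨y, hy, h1, h2, h3⟩ := X.pos_of_mem hG hx
  rcases X.Z_sub hZ with h | h
  · have : F.map y = F.map 0 := by rw [hy, h]; simp [PrismFrame.map, boxMap]
    rw [F.map_injective this] at h1
    simp at h1
  · have : F.map y = F.map (0, 0, 1) := by
      rw [hy, mem_singleton_iff.1 h]; simp [PrismFrame.map, boxMap]
    rw [F.map_injective this] at h1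
    simp at h1

theorem interior_prism_subset {τ : Finset (ℕ × ℕ)} (hτ : τ ∈ X.B) :
    interior (F.prism τ) ⊆ X.S := by
  rw [X.S_eq]
  exact interior_mono (subset_biUnion_of_mem (u := fun τ => F.prism τ) hτ)

theorem continuousOn (hG : IsGrading G) : ContinuousOn X.u X.S := X.cont.mono (X.S_subset hG)

/-- Continuity of `u` up to the boundary of the patch provides the limits that the trace and the
Hardy estimates need. -/
theorem tendsto (hG : IsGrading G) {x : E3} (hx : x ∈ closure X.S \ X.Z) {l : Filter ℝ}
    {f : ℝ → E3} (hf : Tendsto f l (𝓝 x)) (hfS : ∀ᶠ s in l, f s ∈ X.S) :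
    Tendsto (fun s => X.u (f s)) l (𝓝 (X.u x)) := by
  have h1 : Tendsto X.u (𝓝[X.S] x) (𝓝 (X.u x)) := (X.cont x hx).mono (X.S_subset hG)
  exact h1.comp (tendsto_nhdsWithin_iff.2 ⟨hf, hfS⟩)

theorem enorm_g_le {M : ℝ} {a : ℝ × ℝ × ℝ} (h1 : |a.1| ≤ M) (h2 : |a.2.1| ≤ M)
    (h3 : |a.2.2| ≤ M) {x : E3} (hx : x ∈ X.S) :
    ‖X.g (boxLin F.P F.Q F.V a) x‖ₑ ≤ ENNReal.ofReal M * X.Φ x := by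
  have e : X.g (boxLin F.P F.Q F.V a) x =
      a.1 * X.g F.P x + a.2.1 * X.g F.Q x + a.2.2 * X.g F.V x := by
    simp [boxLin_apply]
  rw [e]
  calc _ ≤ ‖a.1 * X.g F.P x‖ₑ + ‖a.2.1 * X.g F.Q x‖ₑ + ‖a.2.2 * X.g F.V x‖ₑ :=
        (enorm_add_le _ _).trans (add_le_add (enorm_add_le _ _) le_rfl)
    _ ≤ ENNReal.ofReal M * ‖X.g F.P x‖ₑ + ENNReal.ofReal M * ‖X.g F.Q x‖ₑ +
        ENNReal.ofReal M * ‖X.g F.V x‖ₑ := add_le_add (add_le_add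
          (enorm_mul_le_ofReal_mul h1 _) (enorm_mul_le_ofReal_mul h2 _))
          (enorm_mul_le_ofReal_mul h3 _)
    _ = ENNReal.ofReal M * (‖X.g F.P x‖ₑ + ‖X.g F.Q x‖ₑ + ‖X.g F.V x‖ₑ) := by ring
    _ ≤ _ := mul_le_mul_right (X.first x hx) _

/-- With `b` horizontal the expansion contains exactly the six terms of the field `second`. -/
theorem enorm_h_le {M : ℝ} {a b : ℝ × ℝ × ℝ} (h1 : |a.1| ≤ M) (h2 : |a.2.1| ≤ M)
    (h3 : |a.2.2| ≤ M) (h4 : |b.1| ≤ M) (h5 : |b.2.1| ≤ M) (h6 : b.2.2 = 0) {x : E3}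
    (hx : x ∈ X.S) :
    ‖X.h (boxLin F.P F.Q F.V a) (boxLin F.P F.Q F.V b) x‖ₑ ≤ ENNReal.ofReal (M * M) * X.Φ x := by
  have e : X.h (boxLin F.P F.Q F.V a) (boxLin F.P F.Q F.V b) x =
      ((a.1 * b.1) * X.h F.P F.P x + (a.1 * b.2.1) * X.h F.P F.Q x) +
      ((a.2.1 * b.1) * X.h F.Q F.P x + (a.2.1 * b.2.1) * X.h F.Q F.Q x) +
      ((a.2.2 * b.1) * X.h F.V F.P x + (a.2.2 * b.2.1) * X.h F.V F.Q x) := by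
    simp [boxLin_apply, h6]
    ring
  have hM : 0 ≤ M := (abs_nonneg _).trans h1
  have hab : ∀ s t : ℝ, |s| ≤ M → |t| ≤ M → |s * t| ≤ M * M := fun s t hs ht => by
    rw [abs_mul]; exact mul_le_mul hs ht (abs_nonneg _) hM
  rw [e]
  have hadd : ∀ s t : ℝ, ∀ S T : ENNReal, ‖s‖ₑ ≤ S → ‖t‖ₑ ≤ T → ‖s + t‖ₑ ≤ S + T :=
    fun s t S T hs ht => (enorm_add_le _ _).trans (add_le_add hs ht)
  refine (hadd _ _ _ _ (hadd _ _ _ _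
    (hadd _ _ _ _ (enorm_mul_le_ofReal_mul (hab _ _ h1 h4) _)
      (enorm_mul_le_ofReal_mul (hab _ _ h1 h5) _))
    (hadd _ _ _ _ (enorm_mul_le_ofReal_mul (hab _ _ h2 h4) _)
      (enorm_mul_le_ofReal_mul (hab _ _ h2 h5) _)))
    (hadd _ _ _ _ (enorm_mul_le_ofReal_mul (hab _ _ h3 h4) _)
      (enorm_mul_le_ofReal_mul (hab _ _ h3 h5) _))).trans ?_
  rw [← mul_add, ← mul_add, ← mul_add, ← mul_add, ← mul_add]
  exact mul_le_mul_right (X.second x hx) _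

/-- The integral over a convex subset is controlled by the integral over a part of it. -/
theorem transfer (hG : IsGrading G) {U A : Set E3} (hU : IsOpen U) (hUc : Convex ℝ U)
    (hUS : U ⊆ X.S) {M : ℝ} (hUM : U ⊆ F.map '' (Icc 0 M ×ˢ Icc 0 M ×ˢ Icc 0 M)) (hAU : A ⊆ U)
    {c : ℝ} (hc : 0 < c)
    (hA : ENNReal.ofReal c * ENNReal.ofReal |det3 F.P F.Q F.V| ≤ volume A) :
    ∫⁻ x in U, ‖X.u x‖ₑ ≤ ENNReal.ofReal (M ^ 3 / c) *
      ((∫⁻ x in A, ‖X.u x‖ₑ) + 8 * (ENNReal.ofReal M * X.J)) := by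
  rcases U.eq_empty_or_nonempty with rfl | ⟨x₀, hx₀⟩
  · simp
  have hM : 0 ≤ M := by
    obtain ⟨y, ⟨h1, -, -⟩, -⟩ := hUM hx₀
    exact h1.1.trans h1.2
  set Δ := ENNReal.ofReal |det3 F.P F.Q F.V| with hΔ
  have hΔ0 : Δ ≠ 0 := (ENNReal.ofReal_pos.2 (abs_pos.2 F.det_ne)).ne'
  have hbox : IsCompact (F.map '' (Icc 0 M ×ˢ Icc 0 M ×ˢ Icc 0 M)) :=
    (isCompact_Icc.prod (isCompact_Icc.prod isCompact_Icc)).image (continuous_boxMap _ _ _ _)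
  have hvol : volume U ≤ ENNReal.ofReal (M ^ 3) * Δ := by
    refine (measure_mono hUM).trans (le_of_eq ?_)
    unfold PrismFrame.map
    rw [volume_boxMap_image _ F.det_ne
      (measurableSet_Icc.prod (measurableSet_Icc.prod measurableSet_Icc)),
      Measure.volume_eq_prod, Measure.prod_prod, Measure.volume_eq_prod, Measure.prod_prod,
      Real.volume_Icc, sub_zero, ← ENNReal.ofReal_mul hM, ← ENNReal.ofReal_mul hM, mul_comm]
    congr 2; ring
  -- Chords of `U` have reference coordinates at most `M`, so the majorant of the frame derivatives
  -- is also one for the Poincaré inequality, with no loss from the anisotropy.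
  have hH : ∀ x ∈ U, ∀ y ∈ U, ∀ z ∈ U, ‖X.g (x - y) z‖ₑ ≤ ENNReal.ofReal M * X.Φ z := by
    intro x hx y hy z hz
    obtain ⟨x', ⟨h1, h2, h3⟩, rfl⟩ := hUM hx
    obtain ⟨y', ⟨h4, h5, h6⟩, rfl⟩ := hUM hy
    rw [PrismFrame.map, PrismFrame.map, boxMap_sub]
    have hd : ∀ {s t : ℝ}, s ∈ Icc 0 M → t ∈ Icc 0 M → |s - t| ≤ M := fun hs ht =>
      abs_le.2 ⟨by linarith [hs.1, ht.2], by linarith [hs.2, ht.1]⟩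
    exact X.enorm_g_le (hd h1 h4) (hd h2 h5) (hd h3 h6) (hUS hz)
  have key := volume_mul_lintegral_enorm_le hU hUc (hbox.isBounded.subset hUM)
    ((X.continuousOn hG).mono hUS) (fun e => (X.weak1 e).mono hUS)
    ((X.meas.mono_measure (Measure.restrict_mono hUS le_rfl)).const_mul _) hH hAU
  have hJ : ∫⁻ x in U, ENNReal.ofReal M * X.Φ x ≤ ENNReal.ofReal M * X.J := by
    rw [lintegral_const_mul' _ _ ENNReal.ofReal_ne_top]
    exact mul_le_mul_right (lintegral_mono_set hUS) _
  set a := ∫⁻ x in A, ‖X.u x‖ₑ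
  set I := ∫⁻ x in U, ‖X.u x‖ₑ
  -- Both volumes are proportional to the determinant of the frame, which cancels; the constant is
  -- thus independent of the frame.
  have h1 : Δ * (ENNReal.ofReal c * I) ≤
      Δ * (ENNReal.ofReal (M ^ 3) * (a + 8 * (ENNReal.ofReal M * X.J))) :=
    calc Δ * (ENNReal.ofReal c * I) = ENNReal.ofReal c * Δ * I := by ring
      _ ≤ volume A * I := mul_le_mul_left hA _
      _ ≤ volume U * a + 8 * volume U * (ENNReal.ofReal M * X.J) :=
          key.trans (add_le_add le_rfl (mul_le_mul_right hJ _))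
      _ = volume U * (a + 8 * (ENNReal.ofReal M * X.J)) := by ring
      _ ≤ ENNReal.ofReal (M ^ 3) * Δ * (a + 8 * (ENNReal.ofReal M * X.J)) :=
          mul_le_mul_left hvol _
      _ = _ := by ring
  have h2 := (ENNReal.mul_le_mul_iff_right hΔ0 ENNReal.ofReal_ne_top).1 h1
  have e : ENNReal.ofReal (M ^ 3 / c) = (ENNReal.ofReal c)⁻¹ * ENNReal.ofReal (M ^ 3) := by
    rw [← ENNReal.ofReal_inv_of_pos hc, ← ENNReal.ofReal_mul (by positivity)]
    congr 1; field_simp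
  have hc0 : ENNReal.ofReal c ≠ 0 := (ENNReal.ofReal_pos.2 hc).ne'
  calc I = (ENNReal.ofReal c)⁻¹ * (ENNReal.ofReal c * I) := by
        rw [← mul_assoc, ENNReal.inv_mul_cancel hc0 ENNReal.ofReal_ne_top, one_mul]
    _ ≤ _ := by rw [e, mul_assoc]; exact mul_le_mul_right h2 _

end LocalFunction

end

/-! ### The trace estimate on the horizontal edges of a prism. -/

section

open Filter Topology

namespace PrismFrame

variable {G : ℕ → ℝ} (F : PrismFrame G)

/-- The coordinates of a lower node. -/
def botC (G : ℕ → ℝ) (p : ℕ × ℕ) : ℝ × ℝ × ℝ := ((latPt G p).1, (latPt G p).2, 0)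

/-- The coordinates of an upper node. -/
def topC (p : ℕ × ℕ) : ℝ × ℝ × ℝ := ((latPt G p).1, (latPt G p).2, F.height p)

theorem coordDet_tetra (p q r t : ℕ × ℕ) :
    coordDet ((1 / 2 : ℝ) • (botC G q - botC G p)) ((1 / 4 : ℝ) • (botC G r - botC G p))
      ((1 / 4 : ℝ) • (F.topC t - botC G p)) =
      area2 (latPt G p) (latPt G q) (latPt G r) * F.height t / 32 := by
  simp [coordDet, botC, topC, area2]
  ring

theorem det_tetra_ne (hGm : Monotone G) {p q r t : ℕ × ℕ}
    (ha : area2 (latPt G p) (latPt G q) (latPt G r) ≠ 0) (ht : t.1 + t.2 < F.n) :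
    det3 (boxLin F.P F.Q F.V ((1 / 2 : ℝ) • (botC G q - botC G p)))
      (boxLin F.P F.Q F.V ((1 / 4 : ℝ) • (botC G r - botC G p)))
      (boxLin F.P F.Q F.V ((1 / 4 : ℝ) • (F.topC t - botC G p))) ≠ 0 := by
  rw [det3_boxLin, coordDet_tetra]
  have := F.height_pos hGm ht
  exact mul_ne_zero (div_ne_zero (mul_ne_zero ha this.ne') (by norm_num)) F.det_ne

/-- The box spans half of the edge from `p` to `q`, since the coefficients 1/2, 1/4, 1/4 must add up
to at most 1; the other half of the edge is reached from `q`. -/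
theorem tetra_mem (hG : IsGrading G) {τ : Finset (ℕ × ℕ)} (hτ : IsLatticeTriangle F.n τ)
    {p q r t : ℕ × ℕ} (hp : p ∈ τ) (hq : q ∈ τ) (hr : r ∈ τ) (ht : t ∈ τ) {x : ℝ × ℝ × ℝ}
    (hx : x ∈ Icc (0 : ℝ) 1 ×ˢ Icc (0 : ℝ) 1 ×ˢ Icc (0 : ℝ) 1) :
    boxMap (F.bot p) (boxLin F.P F.Q F.V ((1 / 2 : ℝ) • (botC G q - botC G p)))
      (boxLin F.P F.Q F.V ((1 / 4 : ℝ) • (botC G r - botC G p)))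
      (boxLin F.P F.Q F.V ((1 / 4 : ℝ) • (F.topC t - botC G p))) x ∈ F.prism τ := by
  rw [bot, map, boxMap_boxLin]
  exact mem_image_of_mem _ (F.box_mem_prism (F.mem_refPrism_bot hG hτ hp)
    (F.mem_refPrism_bot hG hτ hq) (F.mem_refPrism_bot hG hτ hr) (F.mem_refPrism_top hG hτ ht)
    hx.1.1 hx.2.1.1 hx.2.2.1 hx.1.2 hx.2.1.2 hx.2.2.2)

theorem cube_subset : cube ⊆ Icc (0 : ℝ) 1 ×ˢ Icc (0 : ℝ) 1 ×ˢ Icc (0 : ℝ) 1 :=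
  prod_mono Ioo_subset_Icc_self (prod_mono Ioo_subset_Icc_self Ioo_subset_Icc_self)

theorem interior_prism_nonempty (hG : IsGrading G) (hGm : Monotone G) {τ : Finset (ℕ × ℕ)}
    (hτ : IsLatticeTriangle F.n τ) : (interior (F.prism τ)).Nonempty := by
  obtain ⟨t, ht, htn⟩ := hτ.exists_level_lt
  obtain ⟨p, q, hp, hq, hpq⟩ : ∃ p q, p ∈ τ ∧ q ∈ τ ∧ p ≠ q := by
    obtain ⟨i, j, ⟨-, rfl⟩ | ⟨-, rfl⟩⟩ := hτ
    · exact ⟨(i, j), (i + 1, j), by simp, by simp, by simp⟩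
    · exact ⟨(i + 1, j), (i, j + 1), by simp, by simp, by simp⟩
  obtain ⟨r, hr, ha⟩ := hG.exists_area2_ne_zero hτ hp hq hpq
  have := boxMap_image_subset_interior (F.bot p) (F.det_tetra_ne hGm ha htn)
    (X := F.prism τ) (fun x hx => F.tetra_mem hG hτ hp hq hr ht (cube_subset hx))
  refine Set.Nonempty.mono this (Set.Nonempty.image _ ⟨(1 / 2, 1 / 2, 1 / 2), ?_⟩)
  refine ⟨?_, ?_, ?_⟩ <;> constructor <;> norm_num

theorem closure_interior_prism (hG : IsGrading G) (hGm : Monotone G) {τ : Finset (ℕ × ℕ)}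
    (hτ : IsLatticeTriangle F.n τ) : closure (interior (F.prism τ)) = F.prism τ := by
  rw [(F.convex_prism τ).closure_interior_eq_closure_of_nonempty_interior
    (F.interior_prism_nonempty hG hGm hτ)]
  exact (F.isCompact_prism hG hτ).isClosed.closure_eq

end PrismFrame

namespace LocalFunction

open PrismFrame

variable {G : ℕ → ℝ}

theorem prism_subset_closure {F : PrismFrame G} (X : LocalFunction F) (hG : IsGrading G)
    (hGm : Monotone G) {τ : Finset (ℕ × ℕ)} (hτ : τ ∈ X.B) : F.prism τ ⊆ closure X.S := by
  rw [← F.closure_interior_prism hG hGm (X.lattice τ hτ)]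
  exact closure_mono (X.interior_prism_subset hτ)

/-- The trace estimate on a half of an edge. -/
theorem lintegral_half_edge_le (hG : IsGrading G) (hGm : Monotone G) (p q r t : ℕ × ℕ)
    (ha : area2 (latPt G p) (latPt G q) (latPt G r) ≠ 0) : ∃ K : ENNReal, K ≠ ⊤ ∧
    ∀ (F : PrismFrame G) (X : LocalFunction F), ∀ τ ∈ X.B, p ∈ τ → q ∈ τ → r ∈ τ → t ∈ τ →
      t.1 + t.2 < F.n → ∫⁻ α in Ioo (0 : ℝ) 1, ‖X.u (F.bot p + (α / 2) • (F.bot q - F.bot p))‖ₑ ≤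
        K * (ENNReal.ofReal |det3 F.P F.Q F.V|⁻¹ * (X.I τ + X.J)) := by
  have hpq : p ≠ q := by
    rintro rfl
    simp [area2] at ha
  set M := 1 + ∑ x ∈ {p, q, r, t}, ((latPt G x).1 + (latPt G x).2) with hM
  have hM1 : 1 ≤ M := by
    have := Finset.sum_nonneg (s := {p, q, r, t}) (f := fun x => (latPt G x).1 + (latPt G x).2)
      (fun x _ => add_nonneg (hG.latPt_nonneg x).1 (hG.latPt_nonneg x).2)
    linarith
  -- A lower bound for the determinant of the box relative to that of the frame, from
  -- `coordDet_tetra` and `le_height`; it depends on lattice points only.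
  set κ : ℝ := |area2 (latPt G p) (latPt G q) (latPt G r)| * (1 / (((t.1 + t.2 : ℕ) : ℝ) + 1)) / 32
    with hκ
  have hκ0 : 0 < κ := by have := abs_pos.2 ha; positivity
  refine ⟨4 * (ENNReal.ofReal κ⁻¹ * (1 + (ENNReal.ofReal M + (ENNReal.ofReal M +
    ENNReal.ofReal (M * M))))), by finiteness, fun F X τ hτB hp hq hr ht htn => ?_⟩
  have hτ := X.lattice τ hτB
  have hb : ∀ x ∈ ({p, q, r, t} : Finset (ℕ × ℕ)), 0 ≤ (latPt G x).1 ∧ 0 ≤ (latPt G x).2 ∧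
      (latPt G x).1 ≤ M ∧ (latPt G x).2 ≤ M := fun x hx =>
    ⟨(hG.latPt_nonneg x).1, (hG.latPt_nonneg x).2, latPt_le_sum hG hx⟩
  obtain ⟨p1, p2, p3, p4⟩ := hb p (by simp)
  obtain ⟨q1, q2, q3, q4⟩ := hb q (by simp)
  obtain ⟨r1, r2, r3, r4⟩ := hb r (by simp)
  obtain ⟨t1, t2, t3, t4⟩ := hb t (by simp)
  have hh := F.le_height hGm htn
  have hh0 := F.height_pos hGm htn
  have hh1 := F.height_le hG t
  have hdet := F.det_tetra_ne hGm ha htn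
  set a := (1 / 2 : ℝ) • (botC G q - botC G p) with hadef
  set b := (1 / 4 : ℝ) • (botC G r - botC G p) with hbdef
  set c := (1 / 4 : ℝ) • (F.topC t - botC G p) with hcdef
  set U := interior (F.prism τ) with hU
  have hUS : U ⊆ X.S := X.interior_prism_subset hτB
  have hbox : ∀ x ∈ cube, boxMap (F.bot p) (boxLin F.P F.Q F.V a) (boxLin F.P F.Q F.V b)
      (boxLin F.P F.Q F.V c) x ∈ U := fun x hx =>
    boxMap_image_subset_interior (F.bot p) hdet
      (fun x hx => F.tetra_mem hG hτ hp hq hr ht (cube_subset hx)) (mem_image_of_mem _ hx)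
  have he := lintegral_edge_le (U := U) isOpen_interior ((X.continuousOn hG).mono hUS)
    (A := F.bot p) (p := boxLin F.P F.Q F.V a)
    ((X.weak1 (boxLin F.P F.Q F.V b)).mono hUS) ((X.weak1 (boxLin F.P F.Q F.V c)).mono hUS)
    ((X.weak2 (boxLin F.P F.Q F.V c) (boxLin F.P F.Q F.V b)).mono hUS) hdet hbox (by
      intro α hα
      refine X.tendsto hG ⟨?_, ?_⟩ ?_ ?_
      · refine X.prism_subset_closure hG hGm hτB ?_
        have := F.tetra_mem hG hτ hp hq hr ht (x := (α, 0, 0))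
          ⟨Ioo_subset_Icc_self hα, by simp, by simp⟩
        simpa only [boxMap, zero_smul, add_zero] using this
      -- The edge has third coordinate 0, so it could only meet `Z` in `F.s`. In the half considered
      -- both endpoints have positive coefficients, and all coordinates are nonnegative; hence both
      -- endpoints would be `F.s`, contrary to `p ≠ q`.
      · intro hZ
        have e1 : F.bot p + α • boxLin F.P F.Q F.V a = F.map (botC G p + α • a) := by
          rw [bot, PrismFrame.map, PrismFrame.map, boxMap_eq, boxMap_eq, map_add,
            map_smul _ α, add_assoc]
          rfl
        rw [e1] at hZ
        have hfirst : (botC G p + α • a).2.2 = 0 := by simp [hadef, botC]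
        rcases X.Z_sub hZ with h | h
        · have : F.map (botC G p + α • a) = F.map 0 := by
            rw [h]; simp [PrismFrame.map, boxMap]
          have h0 := F.map_injective this
          have c1 := congrArg (fun x : ℝ × ℝ × ℝ => x.1) h0
          have c2 := congrArg (fun x : ℝ × ℝ × ℝ => x.2.1) h0
          simp [hadef, botC] at c1 c2
          have α0 := hα.1
          have α1 := hα.2
          have f : ∀ x y : ℝ, 0 ≤ x → 0 ≤ y → x + α * (2⁻¹ * (y - x)) = 0 → x = 0 ∧ y = 0 := by
            intro x y hx hy hxy
            have m1 : 0 ≤ (1 - α / 2) * x := mul_nonneg (by linarith) hx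
            have m2 : 0 ≤ α / 2 * y := mul_nonneg (by linarith) hy
            have m3 : (1 - α / 2) * x = 0 := by linarith
            have m4 : α / 2 * y = 0 := by linarith
            constructor
            · rcases mul_eq_zero.1 m3 with h | h
              · linarith
              · exact h
            · rcases mul_eq_zero.1 m4 with h | h
              · linarith
              · exact h
          obtain ⟨d1, d2⟩ := f _ _ p1 q1 c1
          obtain ⟨d3, d4⟩ := f _ _ p2 q2 c2
          exact hpq (hG.latPt_injective (Prod.ext (d1.trans d2.symm) (d3.trans d4.symm)))
        · have : F.map (botC G p + α • a) = F.map (0, 0, 1) := by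
            rw [mem_singleton_iff.1 h]; simp [PrismFrame.map, boxMap]
          rw [F.map_injective this] at hfirst
          simp at hfirst
      · have hcont : Continuous fun s : ℝ => boxMap (F.bot p) (boxLin F.P F.Q F.V a)
            (boxLin F.P F.Q F.V b) (boxLin F.P F.Q F.V c) (α, s, s) :=
          (continuous_boxMap _ _ _ _).comp (by fun_prop)
        have := (hcont.tendsto 0).mono_left (nhdsWithin_le_nhds (s := Ioi 0))
        simpa [boxMap] using this
      · filter_upwards [Ioo_mem_nhdsGT (show (0 : ℝ) < 1 by norm_num)] with s hs
        exact hUS (hbox (α, s, s) ⟨hα, hs, hs⟩))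
  have e1 : ∀ α : ℝ, F.bot p + (α / 2) • (F.bot q - F.bot p) =
      F.bot p + α • boxLin F.P F.Q F.V a := by
    intro α
    have : F.bot q - F.bot p = boxLin F.P F.Q F.V (botC G q - botC G p) := by
      rw [bot, bot, PrismFrame.map, PrismFrame.map, boxMap_sub]; rfl
    rw [this, hadef, map_smul, smul_smul]
    congr 2; ring
  simp_rw [e1]
  refine he.trans ?_
  have hdetle : ENNReal.ofReal |det3 (boxLin F.P F.Q F.V a) (boxLin F.P F.Q F.V b)
      (boxLin F.P F.Q F.V c)|⁻¹ ≤ ENNReal.ofReal κ⁻¹ * ENNReal.ofReal |det3 F.P F.Q F.V|⁻¹ := by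
    rw [← ENNReal.ofReal_mul (by positivity)]
    apply ENNReal.ofReal_le_ofReal
    rw [← mul_inv]
    have hd : 0 < |det3 F.P F.Q F.V| := abs_pos.2 F.det_ne
    apply inv_anti₀ (by positivity)
    rw [det3_boxLin, hadef, hbdef, hcdef, coordDet_tetra, abs_mul]
    apply mul_le_mul_of_nonneg_right _ hd.le
    rw [abs_div, abs_mul, abs_of_pos hh0, hκ, abs_of_pos (by norm_num : (0 : ℝ) < 32)]
    gcongr
  have hint : ∫⁻ x in U, ((‖X.u x‖ₑ + ‖X.g (boxLin F.P F.Q F.V b) x‖ₑ) +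
      (‖X.g (boxLin F.P F.Q F.V c) x‖ₑ + ‖X.h (boxLin F.P F.Q F.V c) (boxLin F.P F.Q F.V b) x‖ₑ)) ≤
      X.I τ + (ENNReal.ofReal M + (ENNReal.ofReal M + ENNReal.ofReal (M * M))) * X.J := by
    have hb1 : |b.1| ≤ M := by
      rw [hbdef]; simp only [botC, Prod.smul_fst, Prod.fst_sub, smul_eq_mul]
      rw [abs_le]; constructor <;> linarith
    have hb2 : |b.2.1| ≤ M := by
      rw [hbdef]
      simp only [botC, Prod.smul_fst, Prod.fst_sub, smul_eq_mul, Prod.smul_snd, Prod.snd_sub]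
      rw [abs_le]; constructor <;> linarith
    -- The direction `b` lies in the bottom plane; this keeps the second derivative along `V` twice
    -- out of the estimate.
    have hb3 : b.2.2 = 0 := by rw [hbdef]; simp [botC]
    have hc1 : |c.1| ≤ M := by
      rw [hcdef]; simp only [botC, topC, Prod.smul_fst, Prod.fst_sub, smul_eq_mul]
      rw [abs_le]; constructor <;> linarith
    have hc2 : |c.2.1| ≤ M := by
      rw [hcdef]
      simp only [botC, topC, Prod.smul_fst, Prod.fst_sub, smul_eq_mul, Prod.smul_snd, Prod.snd_sub]
      rw [abs_le]; constructor <;> linarith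
    have hc3 : |c.2.2| ≤ M := by
      rw [hcdef]
      simp only [botC, topC, Prod.smul_snd, Prod.snd_sub, smul_eq_mul]
      rw [abs_le]; constructor <;> linarith
    have hΦ : AEMeasurable X.Φ (volume.restrict U) :=
      X.meas.mono_measure (Measure.restrict_mono hUS le_rfl)
    calc _ ≤ ∫⁻ x in U, (‖X.u x‖ₑ + (ENNReal.ofReal M + (ENNReal.ofReal M +
          ENNReal.ofReal (M * M))) * X.Φ x) := by
          refine setLIntegral_mono_ae' isOpen_interior.measurableSet (ae_of_all _ fun x hx => ?_)
          rw [add_assoc, add_mul, add_mul]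
          exact add_le_add le_rfl (add_le_add (X.enorm_g_le hb1 hb2 (by
              rw [hb3, abs_zero]; linarith) (hUS hx))
            (add_le_add (X.enorm_g_le hc1 hc2 hc3 (hUS hx))
              (X.enorm_h_le hc1 hc2 hc3 hb1 hb2 hb3 (hUS hx))))
      _ = X.I τ + (ENNReal.ofReal M + (ENNReal.ofReal M + ENNReal.ofReal (M * M))) *
          ∫⁻ x in U, X.Φ x := by
          rw [lintegral_add_right' _ (hΦ.const_mul _), lintegral_const_mul' _ _ (by finiteness)]
          rfl
      _ ≤ _ := add_le_add le_rfl (mul_le_mul_right (lintegral_mono_set hUS) _)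
  set L := ENNReal.ofReal M + (ENNReal.ofReal M + ENNReal.ofReal (M * M))
  calc _ ≤ 4 * ((ENNReal.ofReal κ⁻¹ * ENNReal.ofReal |det3 F.P F.Q F.V|⁻¹) *
        (X.I τ + L * X.J)) := mul_le_mul_right (mul_le_mul' hdetle hint) _
    _ ≤ 4 * ((ENNReal.ofReal κ⁻¹ * ENNReal.ofReal |det3 F.P F.Q F.V|⁻¹) *
        ((1 + L) * (X.I τ + X.J))) := by
        refine mul_le_mul_right (mul_le_mul_right ?_ _) _
        rw [mul_add]
        exact add_le_add (le_mul_of_one_le_left' le_self_add)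
          (mul_le_mul_left le_add_self _)
    _ = _ := by ring

end LocalFunction

end

/-! ### The prism at the axis, and the step to a neighbouring prism. -/

section

open Filter Topology

namespace LocalFunction

open PrismFrame

variable {G : ℕ → ℝ}

theorem axis_notMem_Z {F : PrismFrame G} (X : LocalFunction F) {z : ℝ} (hz : z ∈ Ioo (0 : ℝ) 1) :
    F.s + z • F.V ∉ X.Z := by
  intro hZ
  have e : F.s + z • F.V = F.map (0, 0, z) := by simp [PrismFrame.map, boxMap]
  rw [e] at hZ
  rcases X.Z_sub hZ with h | h
  · have : F.map (0, 0, z) = F.map 0 := by rw [h]; simp [PrismFrame.map, boxMap]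
    have := congrArg (fun x : ℝ × ℝ × ℝ => x.2.2) (F.map_injective this)
    exact hz.1.ne' this
  · have : F.map (0, 0, z) = F.map (0, 0, 1) := by
      rw [mem_singleton_iff.1 h]; simp [PrismFrame.map, boxMap]
    have := congrArg (fun x : ℝ × ℝ × ℝ => x.2.2) (F.map_injective this)
    exact hz.2.ne this

/-- The coordinates of two points on different sides of a line, in terms of each other. -/
theorem exists_opposite_coords {Yp Yq Yr Yr' : ℝ × ℝ}
    (harea : area2 Yp Yq Yr * area2 Yp Yq Yr' < 0) : ∃ σ t : ℝ, 0 < σ ∧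
      Yr.1 - (Yp.1 + Yq.1) / 2 = -σ * (Yr'.1 - (Yp.1 + Yq.1) / 2) + t * (Yp.1 - Yq.1) ∧
      Yr.2 - (Yp.2 + Yq.2) / 2 = -σ * (Yr'.2 - (Yp.2 + Yq.2) / 2) + t * (Yp.2 - Yq.2) := by
  set ar := area2 Yp Yq Yr with har
  set ar' := area2 Yp Yq Yr' with har'
  have har0 : ar ≠ 0 := fun h => by rw [h] at harea; simp at harea
  have har0' : ar' ≠ 0 := fun h => by rw [h] at harea; simp at harea
  -- With this ratio of areas the vector Yr - mid + σ (Yr' - mid) is parallel to the line through Yp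
  -- and Yq, where mid is their midpoint; `t` is then obtained by projection onto this line.
  set σ := -ar / ar' with hσdef
  have hσ0 : 0 < σ := by
    rw [hσdef, neg_div, neg_pos]
    rcases mul_neg_iff.1 harea with h | h
    · exact div_neg_of_pos_of_neg h.1 h.2
    · exact div_neg_of_neg_of_pos h.1 h.2
  set w1 := Yr.1 - (Yp.1 + Yq.1) / 2 + σ * (Yr'.1 - (Yp.1 + Yq.1) / 2) with hw1
  set w2 := Yr.2 - (Yp.2 + Yq.2) / 2 + σ * (Yr'.2 - (Yp.2 + Yq.2) / 2) with hw2
  have hpar : (Yp.1 - Yq.1) * w2 = (Yp.2 - Yq.2) * w1 := by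
    have h1 : σ * ar' = -ar := by rw [hσdef]; field_simp
    simp only [har, har', area2] at h1
    rw [hw1, hw2]
    linear_combination (-1 : ℝ) * h1
  have hD : (Yp.1 - Yq.1) ^ 2 + (Yp.2 - Yq.2) ^ 2 ≠ 0 := by
    intro h
    have e1 : Yp.1 - Yq.1 = 0 := by nlinarith [sq_nonneg (Yp.1 - Yq.1), sq_nonneg (Yp.2 - Yq.2)]
    have e2 : Yp.2 - Yq.2 = 0 := by nlinarith [sq_nonneg (Yp.1 - Yq.1), sq_nonneg (Yp.2 - Yq.2)]
    apply har0
    rw [har, area2]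
    linear_combination (-(Yr.2 - Yp.2)) * e1 + (Yr.1 - Yp.1) * e2
  refine ⟨σ, (w1 * (Yp.1 - Yq.1) + w2 * (Yp.2 - Yq.2)) /
    ((Yp.1 - Yq.1) ^ 2 + (Yp.2 - Yq.2) ^ 2), hσ0, ?_, ?_⟩
  · have : (w1 * (Yp.1 - Yq.1) + w2 * (Yp.2 - Yq.2)) /
      ((Yp.1 - Yq.1) ^ 2 + (Yp.2 - Yq.2) ^ 2) * (Yp.1 - Yq.1) = w1 := by
      rw [div_mul_eq_mul_div, div_eq_iff hD]
      linear_combination (Yp.2 - Yq.2) * hpar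
    rw [this, hw1]; ring
  · have : (w1 * (Yp.1 - Yq.1) + w2 * (Yp.2 - Yq.2)) /
      ((Yp.1 - Yq.1) ^ 2 + (Yp.2 - Yq.2) ^ 2) * (Yp.2 - Yq.2) = w2 := by
      rw [div_mul_eq_mul_div, div_eq_iff hD]
      linear_combination (-(Yp.1 - Yq.1)) * hpar
    rw [this, hw2]; ring

/-- The Hardy inequality bounds `u` on a small box along the axis, because `u` vanishes there; the
Poincaré inequality extends the bound to the whole prism. -/
theorem lintegral_axis_prism_le (hG : IsGrading G) (hGm : Monotone G) : ∃ K : ENNReal, K ≠ ⊤ ∧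
    ∀ (F : PrismFrame G) (X : LocalFunction F), upTri 0 0 ∈ X.B → X.I (upTri 0 0) ≤ K * X.J := by
  set M := 1 + ∑ x ∈ upTri 0 0, ((latPt G x).1 + (latPt G x).2) with hM
  have hM1 : 1 ≤ M := by
    have := Finset.sum_nonneg (s := upTri 0 0) (f := fun x => (latPt G x).1 + (latPt G x).2)
      (fun x _ => add_nonneg (hG.latPt_nonneg x).1 (hG.latPt_nonneg x).2)
    linarith
  have hG1 : 0 < G 1 := hG.pos 1 le_rfl
  -- The relative volume of a box with the edges (G 1)/4, (G 1)/4 and 1/2.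
  set c : ℝ := G 1 * G 1 / 32 with hc
  have hc0 : 0 < c := by positivity
  refine ⟨ENNReal.ofReal (M ^ 3 / c) * (2 * (ENNReal.ofReal (G 1 / 2) * ENNReal.ofReal (G 1 / 4)) +
    8 * ENNReal.ofReal M), by finiteness, fun F X hB => ?_⟩
  have hτ := X.lattice _ hB
  have hlev : 1 ≤ F.n := F.n_pos
  have hlamG : F.lam * G 1 ≤ 1 := by
    have := F.height_nonneg hG (p := (1, 0)) (by simpa using hlev)
    simp [height] at this
    linarith
  have hh0 : F.height (0, 0) = 1 := by simp [height]
  set a : ℝ × ℝ × ℝ := (G 1 / 4, 0, 0) with hadef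
  set b : ℝ × ℝ × ℝ := (0, G 1 / 4, 0) with hbdef
  set d : ℝ × ℝ × ℝ := (0, 0, 1 / 2) with hddef
  have hdet : det3 (boxLin F.P F.Q F.V a) (boxLin F.P F.Q F.V b) (boxLin F.P F.Q F.V d) =
      c * det3 F.P F.Q F.V := by
    rw [det3_boxLin]; congr 1
    simp [coordDet, hadef, hbdef, hddef, hc]; ring
  have hdet0 : det3 (boxLin F.P F.Q F.V a) (boxLin F.P F.Q F.V b) (boxLin F.P F.Q F.V d) ≠ 0 := by
    rw [hdet]; exact mul_ne_zero hc0.ne' F.det_ne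
  have hmap : ∀ x : ℝ × ℝ × ℝ, boxMap F.s (boxLin F.P F.Q F.V a) (boxLin F.P F.Q F.V b)
      (boxLin F.P F.Q F.V d) x = F.map (G 1 / 4 * x.1, G 1 / 4 * x.2.1, x.2.2 / 2) := by
    intro x
    have : F.s = boxMap F.s F.P F.Q F.V 0 := by simp [boxMap]
    nth_rw 1 [this]
    rw [boxMap_boxLin, PrismFrame.map]
    congr 1
    ext <;> simp [hadef, hbdef, hddef] <;> ring
  have hlp : latPt G (0, 0) = (0, 0) ∧ latPt G (1, 0) = (G 1, 0) ∧ latPt G (0, 1) = (0, G 1) := by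
    simp [latPt]
  have hmem : ∀ x ∈ Icc (0 : ℝ) 1 ×ˢ Icc (0 : ℝ) 1 ×ˢ Icc (0 : ℝ) 1,
      boxMap F.s (boxLin F.P F.Q F.V a) (boxLin F.P F.Q F.V b) (boxLin F.P F.Q F.V d) x
        ∈ F.prism (upTri 0 0) := by
    intro x hx
    rw [hmap]
    refine mem_image_of_mem _ ?_
    obtain ⟨⟨x1, x2⟩, ⟨x3, x4⟩, x5, x6⟩ := hx
    have := F.mem_refPrism_combo hG hτ (p := (0, 0)) (q := (1, 0)) (r := (0, 1))
      (by simp [upTri]) (by simp [upTri]) (by simp [upTri]) (a := 1 - x.1 / 4 - x.2.1 / 4)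
      (b := x.1 / 4) (c := x.2.1 / 4) (z := x.2.2 / 2) (by linarith) (by linarith) (by linarith)
      (by ring) (by linarith) (by rw [hh0]; linarith)
    rw [hlp.1, hlp.2.1, hlp.2.2] at this
    convert! this using 2
    · simp; ring
    · simp; ring
  set A := boxMap F.s (boxLin F.P F.Q F.V a) (boxLin F.P F.Q F.V b) (boxLin F.P F.Q F.V d) '' cube
    with hA
  have hAU : A ⊆ interior (F.prism (upTri 0 0)) :=
    boxMap_image_subset_interior _ hdet0 fun x hx => hmem x (cube_subset hx)
  have hAS : A ⊆ X.S := hAU.trans (X.interior_prism_subset hB)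
  have h1 := X.transfer hG (U := interior (F.prism (upTri 0 0))) isOpen_interior
    (F.convex_prism _).interior (X.interior_prism_subset hB) (M := M)
    (interior_subset.trans (F.prism_subset hG hM1 fun p hp => latPt_le_sum hG hp)) hAU hc0 (by
      rw [hA, volume_boxMap_image _ hdet0 isOpen_cube.measurableSet, volume_cube, mul_one, hdet,
        abs_mul, abs_of_pos hc0, ENNReal.ofReal_mul hc0.le])
  have h2 := lintegral_box_axis_le X.isOpen_S (X.continuousOn hG) (A := F.s)
    (X.weak1 (boxLin F.P F.Q F.V a)) (X.weak1 (boxLin F.P F.Q F.V b)) hdet0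
    -- `ρ` is at most the sum of the reference coordinates, (G 1)/4 times a sum which is at most
    -- twice the maximum.
    (fun x hx => hAS (mem_image_of_mem _ hx)) X.ρ_cont (c := G 1 / 2) (by
      intro x hx
      rw [hmap]
      have m1 := le_max_left x.1 x.2.1
      have m2 := le_max_right x.1 x.2.1
      obtain ⟨r1, r2⟩ := X.ρ_pos (G 1 / 4 * x.1, G 1 / 4 * x.2.1, x.2.2 / 2)
        (mul_pos (by positivity) hx.1.1) (mul_pos (by positivity) hx.2.1.1)
      refine ⟨r1, r2.trans ?_⟩
      simp only
      nlinarith) (by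
      intro x hx
      have hz2 : x.2.2 / 2 ∈ Ioo (0 : ℝ) 1 :=
        ⟨by have := hx.2.2.1; linarith, by have := hx.2.2.2; linarith⟩
      have hcl : F.s + (x.2.2 / 2) • F.V ∈ closure X.S := by
        refine X.prism_subset_closure hG hGm hB ?_
        have := hmem (0, 0, x.2.2) ⟨by simp, by simp, Ioo_subset_Icc_self hx.2.2⟩
        rw [hmap] at this
        simpa [PrismFrame.map, boxMap] using this
      -- The heights in the box are strictly between 0 and 1/2, so these points of the axis are not
      -- in `Z`.
      have hz : X.u (F.s + (x.2.2 / 2) • F.V) = 0 := by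
        refine X.zero _ ⟨⟨hcl, ?_⟩, X.axis_notMem_Z hz2⟩
        rw [segment_eq_image']
        exact ⟨x.2.2 / 2, Ioo_subset_Icc_self hz2, by simp⟩
      have key := X.tendsto hG ⟨hcl, X.axis_notMem_Z hz2⟩ (l := 𝓝[>] (0 : ℝ))
        (f := fun κ => boxMap F.s (boxLin F.P F.Q F.V a)
          (boxLin F.P F.Q F.V b) (boxLin F.P F.Q F.V d) (κ * x.1, κ * x.2.1, x.2.2)) (by
          have hcont : Continuous fun κ : ℝ => boxMap F.s (boxLin F.P F.Q F.V a)
              (boxLin F.P F.Q F.V b) (boxLin F.P F.Q F.V d) (κ * x.1, κ * x.2.1, x.2.2) :=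
            (continuous_boxMap _ _ _ _).comp (by fun_prop)
          have := (hcont.tendsto 0).mono_left (nhdsWithin_le_nhds (s := Ioi 0))
          rw [hmap] at this
          simpa [PrismFrame.map, boxMap] using this) (by
          filter_upwards [Ioo_mem_nhdsGT (show (0 : ℝ) < 1 by norm_num)] with s hs
          refine hAS (mem_image_of_mem _ ⟨?_, ?_, hx.2.2⟩)
          · exact ⟨mul_pos hs.1 hx.1.1, mul_lt_one_of_nonneg_of_lt_one_left hs.1.le hs.2 hx.1.2.le⟩
          · exact ⟨mul_pos hs.1 hx.2.1.1,
              mul_lt_one_of_nonneg_of_lt_one_left hs.1.le hs.2 hx.2.1.2.le⟩)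
      rwa [hz] at key)
  have h3 : ∫⁻ x in X.S, (‖X.g (boxLin F.P F.Q F.V a) x‖ₑ + ‖X.g (boxLin F.P F.Q F.V b) x‖ₑ) *
      ENNReal.ofReal (X.ρ x)⁻¹ ≤ ENNReal.ofReal (G 1 / 4) * X.J := by
    rw [J, ← lintegral_const_mul' _ _ ENNReal.ofReal_ne_top]
    refine setLIntegral_mono_ae' X.isOpen_S.measurableSet (ae_of_all _ fun x hx => ?_)
    have ea : X.g (boxLin F.P F.Q F.V a) x = G 1 / 4 * X.g F.P x := by simp [boxLin_apply, hadef]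
    have eb : X.g (boxLin F.P F.Q F.V b) x = G 1 / 4 * X.g F.Q x := by simp [boxLin_apply, hbdef]
    rw [ea, eb]
    have hM4 : |G 1 / 4| ≤ G 1 / 4 := (abs_of_pos (by positivity)).le
    calc _ ≤ (ENNReal.ofReal (G 1 / 4) * ‖X.g F.P x‖ₑ + ENNReal.ofReal (G 1 / 4) *
          ‖X.g F.Q x‖ₑ) * ENNReal.ofReal (X.ρ x)⁻¹ := mul_le_mul_left (add_le_add
          (enorm_mul_le_ofReal_mul hM4 _) (enorm_mul_le_ofReal_mul hM4 _)) _
      _ = ENNReal.ofReal (G 1 / 4) * ((‖X.g F.P x‖ₑ + ‖X.g F.Q x‖ₑ) *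
          ENNReal.ofReal (X.ρ x)⁻¹) := by ring
      _ ≤ _ := mul_le_mul_right (X.axis x hx) _
  have h4 : ∫⁻ x in A, ‖X.u x‖ₑ ≤
      2 * (ENNReal.ofReal (G 1 / 2) * ENNReal.ofReal (G 1 / 4)) * X.J := by
    rw [hA, setLIntegral_boxMap_image _ hdet0]
    have hpos := abs_pos.2 hdet0
    calc _ ≤ _ := mul_le_mul_right h2 _
      _ = 2 * (ENNReal.ofReal (G 1 / 2) * ((ENNReal.ofReal |det3 (boxLin F.P F.Q F.V a)
          (boxLin F.P F.Q F.V b) (boxLin F.P F.Q F.V d)| * ENNReal.ofReal |det3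
          (boxLin F.P F.Q F.V a) (boxLin F.P F.Q F.V b) (boxLin F.P F.Q F.V d)|⁻¹) *
          ∫⁻ x in X.S, (‖X.g (boxLin F.P F.Q F.V a) x‖ₑ + ‖X.g (boxLin F.P F.Q F.V b) x‖ₑ) *
          ENNReal.ofReal (X.ρ x)⁻¹)) := by ring
      _ ≤ 2 * (ENNReal.ofReal (G 1 / 2) * (1 * (ENNReal.ofReal (G 1 / 4) * X.J))) := by
          rw [← ENNReal.ofReal_mul hpos.le, mul_inv_cancel₀ hpos.ne', ENNReal.ofReal_one]
          exact mul_le_mul_right (mul_le_mul_right (mul_le_mul_right h3 _) _) _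
      _ = _ := by ring
  refine h1.trans ?_
  calc _ ≤ ENNReal.ofReal (M ^ 3 / c) * (2 * (ENNReal.ofReal (G 1 / 2) * ENNReal.ofReal (G 1 / 4)) *
        X.J + 8 * (ENNReal.ofReal M * X.J)) := mul_le_mul_right (add_le_add h4 le_rfl) _
    _ = _ := by ring

set_option maxHeartbeats 1000000 in
/-- The passage from a prism to a neighbouring one. -/
theorem lintegral_neighbour_le (hG : IsGrading G) (hGm : Monotone G) (p q r r' : ℕ × ℕ)
    (harea : area2 (latPt G p) (latPt G q) (latPt G r) *
      area2 (latPt G p) (latPt G q) (latPt G r') < 0) : ∃ K : ENNReal, K ≠ ⊤ ∧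
    ∀ (F : PrismFrame G) (X : LocalFunction F), {p, q, r} ∈ X.B → {p, q, r'} ∈ X.B →
      p.1 + p.2 < F.n → X.I {p, q, r'} ≤ K * (X.I {p, q, r} + X.J) := by
  set T : Finset (ℕ × ℕ) := {p, q, r, r'} with hT
  set M := 1 + ∑ x ∈ T, ((latPt G x).1 + (latPt G x).2) with hM
  have hM1 : 1 ≤ M := by
    have := Finset.sum_nonneg (s := T) (f := fun x => (latPt G x).1 + (latPt G x).2)
      (fun x _ => add_nonneg (hG.latPt_nonneg x).1 (hG.latPt_nonneg x).2)
    linarith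
  set Yp := latPt G p with hYp
  set Yq := latPt G q with hYq
  set Yr := latPt G r with hYr
  set Yr' := latPt G r' with hYr'
  set ar := area2 Yp Yq Yr with har
  have har0 : ar ≠ 0 := fun h => by rw [h] at harea; simp at harea
  obtain ⟨σ, t, hσ, ht1, ht2⟩ := exists_opposite_coords harea
  -- Half the width of the box across the common face. It is so small that the coordinates with
  -- respect to the other triangle, which are changed by the factors σ and t, stay admissible.
  set η : ℝ := 1 / (4 + 16 * |t| + 8 * σ) with hη
  have hη0 : 0 < η := by positivity
  have hη4 : η ≤ 1 / 4 := by
    rw [hη]; apply one_div_le_one_div_of_le (by norm_num)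
    have := abs_nonneg t; linarith
  have hηt : η * |t| ≤ 1 / 16 := by
    rw [hη, one_div_mul_eq_div, div_le_div_iff₀ (by positivity) (by norm_num)]
    linarith
  have hησ : η * σ ≤ 1 / 8 := by
    rw [hη, one_div_mul_eq_div, div_le_div_iff₀ (by positivity) (by norm_num)]
    have := abs_nonneg t; linarith
  -- The height of the box: everywhere in the box the barycentric coefficient of `p` is at least
  -- 1/4, so there is room for a quarter of the height over `p`.
  set κ : ℝ := 1 / (((p.1 + p.2 : ℕ) : ℝ) + 1) / 4 with hκ
  have hκ0 : 0 < κ := by positivity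
  set c : ℝ := κ * η * |ar| / 4 with hc
  have hc0 : 0 < c := by have := abs_pos.2 har0; positivity
  set e : ENNReal := ENNReal.ofReal (M ^ 3 / c) with he
  refine ⟨e * (e * (1 + 8 * ENNReal.ofReal M) + 8 * ENNReal.ofReal M), by finiteness,
    fun F X hB hB' hpn => ?_⟩
  have hτ := X.lattice _ hB
  have hτ' := X.lattice _ hB'
  have hh := F.le_height hGm hpn
  -- The base of the box is centred at the midpoint of the common edge: `a` runs along the edge, `b`
  -- towards `r`, `d` upwards. Its half with second coordinate above 1/2 is in the prism over `{p,
  -- q, r}`, the other half in the neighbour.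
  set a : ℝ × ℝ × ℝ := (1 / 4 * (Yp.1 - Yq.1), 1 / 4 * (Yp.2 - Yq.2), 0) with hadef
  set b : ℝ × ℝ × ℝ := (2 * η * (Yr.1 - (Yp.1 + Yq.1) / 2),
    2 * η * (Yr.2 - (Yp.2 + Yq.2) / 2), 0) with hbdef
  set d : ℝ × ℝ × ℝ := (0, 0, κ) with hddef
  set x0 : ℝ × ℝ × ℝ :=
    ((Yp.1 + Yq.1) / 2 - 1 / 8 * (Yp.1 - Yq.1) - η * (Yr.1 - (Yp.1 + Yq.1) / 2),
      (Yp.2 + Yq.2) / 2 - 1 / 8 * (Yp.2 - Yq.2) - η * (Yr.2 - (Yp.2 + Yq.2) / 2), 0) with hx0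
  have hdet : det3 (boxLin F.P F.Q F.V a) (boxLin F.P F.Q F.V b) (boxLin F.P F.Q F.V d) =
      -(κ * η * ar / 2) * det3 F.P F.Q F.V := by
    rw [det3_boxLin]; congr 1
    simp only [coordDet, hadef, hbdef, hddef, har, area2]; ring
  have hdet0 : det3 (boxLin F.P F.Q F.V a) (boxLin F.P F.Q F.V b) (boxLin F.P F.Q F.V d) ≠ 0 := by
    rw [hdet]
    refine mul_ne_zero (neg_ne_zero.2 (div_ne_zero (mul_ne_zero ?_ har0) (by norm_num))) F.det_ne
    positivity
  have hdet_abs : |det3 (boxLin F.P F.Q F.V a) (boxLin F.P F.Q F.V b) (boxLin F.P F.Q F.V d)| =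
      2 * c * |det3 F.P F.Q F.V| := by
    rw [hdet, abs_mul, abs_neg, abs_div, abs_mul, abs_mul, abs_of_pos hκ0, abs_of_pos hη0,
      abs_of_pos (by norm_num : (0 : ℝ) < 2), hc]
    ring
  set bm := boxMap (F.map x0) (boxLin F.P F.Q F.V a) (boxLin F.P F.Q F.V b)
    (boxLin F.P F.Q F.V d) with hbm
  have hmap : ∀ x : ℝ × ℝ × ℝ, bm x = F.map (x0 + x.1 • a + x.2.1 • b + x.2.2 • d) := fun x => by
    rw [hbm, PrismFrame.map, boxMap_boxLin]; rfl
  have hup : ∀ x ∈ Icc (0 : ℝ) 1 ×ˢ Icc (1 / 2 : ℝ) 1 ×ˢ Icc (0 : ℝ) 1,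
      bm x ∈ F.prism {p, q, r} := by
    rintro x ⟨⟨x1, x2⟩, ⟨x3, x4⟩, x5, x6⟩
    rw [hmap]
    refine mem_image_of_mem _ ?_
    set α := x.1 / 4 - 1 / 8 with hα
    set β := 2 * η * (x.2.1 - 1 / 2) with hβ
    have hβ0 : 0 ≤ β := by
      have : 0 ≤ x.2.1 - 1 / 2 := by linarith
      positivity
    have hβ1 : β ≤ 1 / 4 := by
      have : 2 * (x.2.1 - 1 / 2) ≤ 1 := by linarith
      nlinarith
    have := F.mem_refPrism_combo hG hτ (p := p) (q := q) (r := r) (by simp) (by simp) (by simp)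
      (a := 1 / 2 + α - β / 2) (b := 1 / 2 - α - β / 2) (c := β) (z := x.2.2 * κ)
      (by linarith) (by linarith) hβ0 (by ring) (by positivity) (by
        have : x.2.2 * κ ≤ κ := mul_le_of_le_one_left hκ0.le x6
        have h2 : 1 / 4 * F.height p ≤ (1 / 2 + α - β / 2) * F.height p :=
          mul_le_mul_of_nonneg_right (by linarith) (F.height_pos hGm hpn).le
        rw [hκ] at *
        linarith)
    convert! this using 2
    · simp only [hx0, hadef, hbdef, hddef, Prod.smul_mk, Prod.mk_add_mk, smul_eq_mul, hα, hβ]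
      ring
    · simp only [hx0, hadef, hbdef, hddef, Prod.smul_mk, Prod.mk_add_mk, smul_eq_mul, hα, hβ]
      congr 1 <;> ring
  have hdown : ∀ x ∈ Icc (0 : ℝ) 1 ×ˢ Icc (0 : ℝ) (1 / 2) ×ˢ Icc (0 : ℝ) 1,
      bm x ∈ F.prism {p, q, r'} := by
    rintro x ⟨⟨x1, x2⟩, ⟨x3, x4⟩, x5, x6⟩
    rw [hmap]
    refine mem_image_of_mem _ ?_
    set β := 2 * η * (1 / 2 - x.2.1) with hβ
    have hβ0 : 0 ≤ β := by
      have : 0 ≤ 1 / 2 - x.2.1 := by linarith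
      positivity
    have hβη : β ≤ η := by
      have : 2 * (1 / 2 - x.2.1) ≤ 1 := by linarith
      nlinarith
    have hβσ : β * σ ≤ 1 / 8 := (mul_le_mul_of_nonneg_right hβη hσ.le).trans hησ
    have hβσ0 : 0 ≤ β * σ := by positivity
    have hβt : |β * t| ≤ 1 / 16 := by
      rw [abs_mul, abs_of_nonneg hβ0]
      exact (mul_le_mul_of_nonneg_right hβη (abs_nonneg t)).trans hηt
    obtain ⟨hβt1, hβt2⟩ := abs_le.1 hβt
    set α := x.1 / 4 - 1 / 8 - β * t with hα
    have := F.mem_refPrism_combo hG hτ' (p := p) (q := q) (r := r') (by simp) (by simp) (by simp)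
      (a := 1 / 2 + α - β * σ / 2) (b := 1 / 2 - α - β * σ / 2) (c := β * σ) (z := x.2.2 * κ)
      (by linarith) (by linarith) hβσ0 (by ring) (by positivity) (by
        have : x.2.2 * κ ≤ κ := mul_le_of_le_one_left hκ0.le x6
        have h2 : 1 / 4 * F.height p ≤ (1 / 2 + α - β * σ / 2) * F.height p :=
          mul_le_mul_of_nonneg_right (by linarith) (F.height_pos hGm hpn).le
        rw [hκ] at *
        linarith)
    convert! this using 2
    · simp only [hx0, hadef, hbdef, hddef, Prod.smul_mk, Prod.mk_add_mk, smul_eq_mul, hα, ← hYp,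
        ← hYq, ← hYr', hβ]
      linear_combination (η * (2 * x.2.1 - 1)) * ht1
    · simp only [hx0, hadef, hbdef, hddef, Prod.smul_mk, Prod.mk_add_mk, smul_eq_mul, hα, ← hYp,
        ← hYq, ← hYr', hβ]
      congr 1
      · linear_combination (η * (2 * x.2.1 - 1)) * ht2
      · ring
  set U := bm '' cube with hU
  set up : Set (ℝ × ℝ × ℝ) := Ioo (0 : ℝ) 1 ×ˢ Ioo (1 / 2 : ℝ) 1 ×ˢ Ioo (0 : ℝ) 1 with hupdef
  set down : Set (ℝ × ℝ × ℝ) := Ioo (0 : ℝ) 1 ×ˢ Ioo (0 : ℝ) (1 / 2) ×ˢ Ioo (0 : ℝ) 1 with hdndef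
  have oup : IsOpen up := isOpen_Ioo.prod (isOpen_Ioo.prod isOpen_Ioo)
  have odn : IsOpen down := isOpen_Ioo.prod (isOpen_Ioo.prod isOpen_Ioo)
  have vhalf : volume (bm '' up) = ENNReal.ofReal c * ENNReal.ofReal |det3 F.P F.Q F.V| ∧
      volume (bm '' down) = ENNReal.ofReal c * ENNReal.ofReal |det3 F.P F.Q F.V| := by
    rw [hbm, volume_boxMap_image _ hdet0 oup.measurableSet,
      volume_boxMap_image _ hdet0 odn.measurableSet, hupdef, hdndef, Measure.volume_eq_prod,
      Measure.prod_prod, Measure.prod_prod, Measure.volume_eq_prod, Measure.prod_prod,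
      Measure.prod_prod, hdet_abs]
    have e1 : (1 : ℝ) - 1 / 2 = 1 / 2 := by norm_num
    simp only [Real.volume_Ioo, sub_zero, ENNReal.ofReal_one, one_mul, mul_one, e1, and_self]
    rw [← ENNReal.ofReal_mul (by positivity), ← ENNReal.ofReal_mul hc0.le]
    congr 1; ring
  have upU : bm '' up ⊆ U := image_mono (Set.prod_mono Subset.rfl
    (Set.prod_mono (Ioo_subset_Ioo_left (by norm_num)) Subset.rfl))
  have dnU : bm '' down ⊆ U := image_mono (Set.prod_mono Subset.rfl
    (Set.prod_mono (Ioo_subset_Ioo_right (by norm_num)) Subset.rfl))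
  have up_int : bm '' up ⊆ interior (F.prism {p, q, r}) := by
    refine (isOpen_boxMap_image _ hdet0 oup).subset_interior_iff.2 (image_subset_iff.2 fun x hx => ?_)
    exact hup x (Set.prod_mono Ioo_subset_Icc_self (Set.prod_mono Ioo_subset_Icc_self
      Ioo_subset_Icc_self) hx)
  have dn_int : bm '' down ⊆ interior (F.prism {p, q, r'}) := by
    refine (isOpen_boxMap_image _ hdet0 odn).subset_interior_iff.2 (image_subset_iff.2 fun x hx => ?_)
    exact hdown x (Set.prod_mono Ioo_subset_Icc_self (Set.prod_mono Ioo_subset_Icc_self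
      Ioo_subset_Icc_self) hx)
  have hUp : U ⊆ F.prism {p, q, r} ∪ F.prism {p, q, r'} := by
    rintro _ ⟨x, hx, rfl⟩
    have hx' := cube_subset hx
    rcases le_total x.2.1 (1 / 2) with h | h
    · exact Or.inr (hdown x ⟨hx'.1, ⟨hx'.2.1.1, h⟩, hx'.2.2⟩)
    · exact Or.inl (hup x ⟨hx'.1, ⟨h, hx'.2.1.2⟩, hx'.2.2⟩)
  have hUo : IsOpen U := isOpen_boxMap_image _ hdet0 isOpen_cube
  have hUS : U ⊆ X.S := by
    rw [X.S_eq]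
    refine hUo.subset_interior_iff.2 (hUp.trans (union_subset ?_ ?_))
    · exact subset_biUnion_of_mem (u := fun τ => F.prism τ) hB
    · exact subset_biUnion_of_mem (u := fun τ => F.prism τ) hB'
  have hM' : F.prism {p, q, r} ⊆ F.map '' (Icc 0 M ×ˢ Icc 0 M ×ˢ Icc 0 M) ∧
      F.prism {p, q, r'} ⊆ F.map '' (Icc 0 M ×ˢ Icc 0 M ×ˢ Icc 0 M) := by
    constructor <;> refine F.prism_subset hG hM1 fun x hx => latPt_le_sum hG ?_
    · rw [hT]; simp only [Finset.mem_insert, Finset.mem_singleton] at hx ⊢; tauto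
    · rw [hT]; simp only [Finset.mem_insert, Finset.mem_singleton] at hx ⊢; tauto
  -- Two transfers: from one half of the box to the whole box, then from its other half to the
  -- neighbouring prism.
  have s1 := X.transfer hG hUo (convex_boxMap_image _ _ _ _ convex_cube) hUS
    (hUp.trans (union_subset hM'.1 hM'.2)) upU hc0 vhalf.1.ge
  have s2 := X.transfer hG (U := interior (F.prism {p, q, r'})) isOpen_interior
    (F.convex_prism _).interior (X.interior_prism_subset hB') (interior_subset.trans hM'.2)
    dn_int hc0 vhalf.2.ge
  have s3 : ∫⁻ x in bm '' up, ‖X.u x‖ₑ ≤ X.I {p, q, r} := lintegral_mono_set up_int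
  have s4 : ∫⁻ x in bm '' down, ‖X.u x‖ₑ ≤ ∫⁻ x in U, ‖X.u x‖ₑ := lintegral_mono_set dnU
  set m := ENNReal.ofReal M
  calc X.I {p, q, r'} ≤ e * ((∫⁻ x in bm '' down, ‖X.u x‖ₑ) + 8 * (m * X.J)) := s2
    _ ≤ e * (e * (X.I {p, q, r} + 8 * (m * X.J)) + 8 * (m * X.J)) :=
        mul_le_mul_right (add_le_add (s4.trans (s1.trans
          (mul_le_mul_right (add_le_add s3 le_rfl) _))) le_rfl) _
    _ ≤ e * (e * ((1 + 8 * m) * (X.I {p, q, r} + X.J)) + 8 * m * (X.I {p, q, r} + X.J)) := by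
        refine mul_le_mul_right (add_le_add (mul_le_mul_right ?_ _) ?_) _
        · rw [add_mul, one_mul, mul_assoc]
          exact add_le_add le_self_add (mul_le_mul_right (mul_le_mul_right le_add_self _) _)
        · rw [mul_assoc]
          exact mul_le_mul_right (mul_le_mul_right le_add_self _) _
    _ = _ := by ring

end LocalFunction

end

/-! ### Constants that are uniform over bounded levels. -/

section

open Filter Topology

/-- Uniform constants for finitely many statements. -/
theorem exists_uniform_constant {ι : Type*} (s : Finset ι) {p : ι → ENNReal → Prop}
    (hmono : ∀ i K K', K ≤ K' → p i K → p i K') (h : ∀ i ∈ s, ∃ K : ENNReal, K ≠ ⊤ ∧ p i K) :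
    ∃ K : ENNReal, K ≠ ⊤ ∧ ∀ i ∈ s, p i K := by
  classical
  choose! K hK hp using h
  exact ⟨∑ i ∈ s, K i, ENNReal.sum_ne_top.2 hK, fun i hi => hmono i _ _
    (Finset.single_le_sum (f := K) (fun _ _ => zero_le) hi) (hp i hi)⟩

/-- The lattice points up to a level. -/
def levelBox (L : ℕ) : Finset (ℕ × ℕ) := Finset.range (L + 1) ×ˢ Finset.range (L + 1)

theorem mem_levelBox {L : ℕ} {p : ℕ × ℕ} (h : p.1 + p.2 ≤ L) : p ∈ levelBox L := by
  simp only [levelBox, Finset.mem_product, Finset.mem_range]; omega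

/-- The trace estimate covers half an edge; starting at either endpoint, two such estimates cover
the edge up to its midpoint. -/
theorem lintegral_Ioo_le_halves (f : ℝ → ENNReal) : ∫⁻ x in Ioo (0 : ℝ) 1, f x ≤
    (∫⁻ x in Ioo (0 : ℝ) 1, f (x / 2)) + ∫⁻ x in Ioo (0 : ℝ) 1, f (1 - x / 2) := by
  have h1 : ∫⁻ x in (fun x : ℝ => x / 2) '' Ioo 0 1, f x ≤ ∫⁻ x in Ioo (0 : ℝ) 1, f (x / 2) := by
    rw [lintegral_image_eq_lintegral_abs_deriv_mul measurableSet_Ioo (f := fun x : ℝ => x / 2)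
      (f' := fun _ => 1 / 2) (fun x _ => ((hasDerivAt_id x).div_const 2).hasDerivWithinAt)
      (fun x _ y _ hxy => by linarith)]
    refine lintegral_mono fun x => mul_le_of_le_one_left' ?_
    rw [abs_of_pos (by norm_num)]
    exact ENNReal.ofReal_le_one.2 (by norm_num)
  have h2 : ∫⁻ x in (fun x : ℝ => 1 - x / 2) '' Ioo 0 1, f x ≤
      ∫⁻ x in Ioo (0 : ℝ) 1, f (1 - x / 2) := by
    rw [lintegral_image_eq_lintegral_abs_deriv_mul measurableSet_Ioo (f := fun x : ℝ => 1 - x / 2)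
      (f' := fun _ => -(1 / 2)) (fun x _ =>
        (((hasDerivAt_id x).div_const 2).const_sub 1).hasDerivWithinAt)
      (fun x _ y _ hxy => by linarith)]
    refine lintegral_mono fun x => mul_le_of_le_one_left' ?_
    rw [abs_neg, abs_of_pos (by norm_num)]
    exact ENNReal.ofReal_le_one.2 (by norm_num)
  have hsub : Ioo (0 : ℝ) 1 ⊆ ((fun x : ℝ => x / 2) '' Ioo 0 1 ∪ {1 / 2}) ∪
      (fun x : ℝ => 1 - x / 2) '' Ioo 0 1 := by
    intro x hx
    rcases lt_trichotomy x (1 / 2) with h | h | h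
    · exact Or.inl (Or.inl ⟨2 * x, ⟨by linarith [hx.1], by linarith⟩, by simp⟩)
    · exact Or.inl (Or.inr h)
    · exact Or.inr ⟨2 * (1 - x), ⟨by linarith [hx.2], by linarith⟩, by simp⟩
  calc _ ≤ _ := lintegral_mono_set hsub
    _ ≤ ((∫⁻ x in (fun x : ℝ => x / 2) '' Ioo 0 1, f x) + ∫⁻ x in {1 / 2}, f x) +
        ∫⁻ x in (fun x : ℝ => 1 - x / 2) '' Ioo 0 1, f x :=
      (lintegral_union_le _ _ _).trans (add_le_add (lintegral_union_le _ _ _) le_rfl)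
    _ = (∫⁻ x in (fun x : ℝ => x / 2) '' Ioo 0 1, f x) +
        ∫⁻ x in (fun x : ℝ => 1 - x / 2) '' Ioo 0 1, f x := by
      rw [Measure.restrict_singleton]; simp
    _ ≤ _ := add_le_add h1 h2

namespace LocalFunction

open PrismFrame

variable {G : ℕ → ℝ}

/-- Up to a given level there are only finitely many quadruples of lattice points, hence finitely
many constants, each independent of the frame and of the function. -/
theorem exists_neighbour_constant (hG : IsGrading G) (hGm : Monotone G) (L : ℕ) :
    ∃ K : ENNReal, K ≠ ⊤ ∧ ∀ (F : PrismFrame G) (X : LocalFunction F), ∀ τ ∈ X.B, ∀ τ' ∈ X.B,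
      (τ ∩ τ').card = 2 → (∀ p ∈ τ, p.1 + p.2 ≤ L) → (∀ p ∈ τ', p.1 + p.2 ≤ L) →
      X.I τ' ≤ K * (X.I τ + X.J) := by
  obtain ⟨K, hK, h⟩ := exists_uniform_constant
    (levelBox L ×ˢ levelBox L ×ˢ levelBox L ×ˢ levelBox L)
    (p := fun i K => area2 (latPt G i.1) (latPt G i.2.1) (latPt G i.2.2.1) *
        area2 (latPt G i.1) (latPt G i.2.1) (latPt G i.2.2.2) < 0 →
      ∀ (F : PrismFrame G) (X : LocalFunction F), {i.1, i.2.1, i.2.2.1} ∈ X.B →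
        {i.1, i.2.1, i.2.2.2} ∈ X.B → i.1.1 + i.1.2 < F.n →
        X.I {i.1, i.2.1, i.2.2.2} ≤ K * (X.I {i.1, i.2.1, i.2.2.1} + X.J))
    (fun i K K' hKK h ha F X h1 h2 h3 => (h ha F X h1 h2 h3).trans (mul_le_mul_left hKK _))
    (fun i _ => by
      by_cases ha : area2 (latPt G i.1) (latPt G i.2.1) (latPt G i.2.2.1) *
        area2 (latPt G i.1) (latPt G i.2.1) (latPt G i.2.2.2) < 0
      · obtain ⟨K, hK, h⟩ := lintegral_neighbour_le hG hGm _ _ _ _ ha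
        exact ⟨K, hK, fun _ => h⟩
      · exact ⟨0, by simp, fun h => absurd h ha⟩)
  refine ⟨K, hK, fun F X τ hτ τ' hτ' hcard hl hl' => ?_⟩
  obtain ⟨p, q, r, r', rfl, rfl, hp, harea⟩ :=
    hG.exists_common_edge (X.lattice _ hτ) (X.lattice _ hτ') hcard
  exact h (p, q, r, r') (by
    simp only [Finset.mem_product]
    exact ⟨mem_levelBox (hl _ (by simp)), mem_levelBox (hl _ (by simp)),
      mem_levelBox (hl _ (by simp)), mem_levelBox (hl' _ (by simp))⟩) harea F X hτ hτ' hp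

/-- All prisms of a small connected patch at the axis. -/
theorem exists_patch_constant (hG : IsGrading G) (hGm : Monotone G) (m : ℕ) :
    ∃ K : ENNReal, K ≠ ⊤ ∧ ∀ (F : PrismFrame G) (X : LocalFunction F), upTri 0 0 ∈ X.B →
      X.B.card ≤ m →
      (∀ s ∈ X.B, ∀ t ∈ X.B, Relation.ReflTransGen
        (fun s t => s ∈ X.B ∧ t ∈ X.B ∧ (s ∩ t).card = 2) s t) →
      ∀ τ ∈ X.B, (∀ p ∈ τ, p.1 + p.2 ≤ m + 1) ∧ X.I τ ≤ K * X.J := by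
  obtain ⟨K₀, hK₀, h₀⟩ := lintegral_axis_prism_le hG hGm
  choose N hN hstep using exists_neighbour_constant hG hGm
  -- The constant after `j` steps from the axis. A step gives I' ≤ N (I + J) ≤ N (K + 1) J, and the
  -- summand `k` makes the sequence monotone. After `j` steps the levels are at most `j + 1`, so the
  -- next step needs the constant for the level `j + 2`.
  set K : ℕ → ENNReal := fun j => Nat.rec K₀ (fun j k => k + N (j + 2) * (k + 1)) j with hKdef
  have hKs : ∀ j, K (j + 1) = K j + N (j + 2) * (K j + 1) := fun j => rfl
  have hKtop : ∀ j, K j ≠ ⊤ := by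
    intro j
    induction j with
    | zero => exact hK₀
    | succ j ih =>
      rw [hKs]
      have := hN (j + 2)
      finiteness
  have hKmono : Monotone K := monotone_nat_of_le_succ fun j => by rw [hKs]; exact le_self_add
  refine ⟨K m, hKtop m, fun F X h0 hcard hconn τ hτ => ?_⟩
  have := subset_of_connected (B := X.B) (r := fun s t => (s ∩ t).card = 2) hconn
    (A := fun j => {τ | (∀ p ∈ τ, p.1 + p.2 ≤ j + 1) ∧ X.I τ ≤ K j * X.J}) h0
    ⟨fun p hp => by rw [mem_upTri] at hp; omega, h₀ F X h0⟩
    (fun j τ h => ⟨fun p hp => (h.1 p hp).trans (by omega),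
      h.2.trans (mul_le_mul_left (hKmono (Nat.le_succ j)) _)⟩)
    (fun j s hs t hsB htB hst => by
      have hlev : ∀ p ∈ t, p.1 + p.2 ≤ j + 1 + 1 := by
        obtain ⟨x, hx⟩ := Finset.card_pos.1 (by omega : 0 < (s ∩ t).card)
        rw [Finset.mem_inter] at hx
        exact fun p hp => (X.lattice t htB).level_le_of_mem hx.2 hp (hs.1 x hx.1)
      refine ⟨hlev, ?_⟩
      calc X.I t ≤ N (j + 2) * (X.I s + X.J) := hstep (j + 2) F X s hsB t htB hst
            (fun p hp => (hs.1 p hp).trans (by omega)) (fun p hp => (hlev p hp).trans (by omega))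
        _ ≤ N (j + 2) * (K j * X.J + X.J) := mul_le_mul_right (add_le_add hs.2 le_rfl) _
        _ = N (j + 2) * (K j + 1) * X.J := by ring
        _ ≤ K (j + 1) * X.J := mul_le_mul_left (by rw [hKs]; exact le_add_self) _) τ hτ
  exact ⟨fun p hp => (this.1 p hp).trans (by omega),
    this.2.trans (mul_le_mul_left (hKmono hcard) _)⟩

/-- The trace estimate on the edges in a plane. -/
theorem exists_edge_constant (hG : IsGrading G) (hGm : Monotone G) (L : ℕ) :
    ∃ K : ENNReal, K ≠ ⊤ ∧ ∀ (F : PrismFrame G) (X : LocalFunction F), ∀ τ ∈ X.B,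
      (∀ p ∈ τ, p.1 + p.2 ≤ L) → ∀ p ∈ τ, ∀ q ∈ τ, p ≠ q →
      ∫⁻ α in Ioo (0 : ℝ) 1, ‖X.u (F.bot p + α • (F.bot q - F.bot p))‖ₑ ≤
        K * (ENNReal.ofReal |det3 F.P F.Q F.V|⁻¹ * (X.I τ + X.J)) := by
  obtain ⟨K, hK, h⟩ := exists_uniform_constant
    (levelBox L ×ˢ levelBox L ×ˢ levelBox L ×ˢ levelBox L)
    (p := fun i K => area2 (latPt G i.1) (latPt G i.2.1) (latPt G i.2.2.1) ≠ 0 →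
      ∀ (F : PrismFrame G) (X : LocalFunction F), ∀ τ ∈ X.B, i.1 ∈ τ → i.2.1 ∈ τ → i.2.2.1 ∈ τ →
      i.2.2.2 ∈ τ → i.2.2.2.1 + i.2.2.2.2 < F.n →
      ∫⁻ α in Ioo (0 : ℝ) 1, ‖X.u (F.bot i.1 + (α / 2) • (F.bot i.2.1 - F.bot i.1))‖ₑ ≤
        K * (ENNReal.ofReal |det3 F.P F.Q F.V|⁻¹ * (X.I τ + X.J)))
    (fun i K K' hKK h ha F X τ hτ h1 h2 h3 h4 h5 =>
      (h ha F X τ hτ h1 h2 h3 h4 h5).trans (mul_le_mul_left hKK _))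
    (fun i _ => by
      by_cases ha : area2 (latPt G i.1) (latPt G i.2.1) (latPt G i.2.2.1) ≠ 0
      · obtain ⟨K, hK, h⟩ := lintegral_half_edge_le hG hGm _ _ _ i.2.2.2 ha
        exact ⟨K, hK, fun _ => h⟩
      · exact ⟨0, by simp, fun h => absurd h ha⟩)
  have half : ∀ (F : PrismFrame G) (X : LocalFunction F), ∀ τ ∈ X.B,
      (∀ p ∈ τ, p.1 + p.2 ≤ L) → ∀ p ∈ τ, ∀ q ∈ τ, p ≠ q →
      ∫⁻ α in Ioo (0 : ℝ) 1, ‖X.u (F.bot p + (α / 2) • (F.bot q - F.bot p))‖ₑ ≤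
        K * (ENNReal.ofReal |det3 F.P F.Q F.V|⁻¹ * (X.I τ + X.J)) := by
    intro F X τ hτ hl p hp q hq hpq
    obtain ⟨r, hr, ha⟩ := hG.exists_area2_ne_zero (X.lattice τ hτ) hp hq hpq
    obtain ⟨t, ht, htn⟩ := (X.lattice τ hτ).exists_level_lt
    exact h (p, q, r, t) (by
      simp only [Finset.mem_product]
      exact ⟨mem_levelBox (hl _ hp), mem_levelBox (hl _ hq), mem_levelBox (hl _ hr),
        mem_levelBox (hl _ ht)⟩) ha F X τ hτ hp hq hr ht htn
  refine ⟨2 * K, by finiteness, fun F X τ hτ hl p hp q hq hpq => ?_⟩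
  refine (lintegral_Ioo_le_halves _).trans ?_
  have e : ∀ α : ℝ, F.bot p + (1 - α / 2) • (F.bot q - F.bot p) =
      F.bot q + (α / 2) • (F.bot p - F.bot q) := fun α => by module
  simp_rw [e]
  rw [two_mul, add_mul]
  exact add_le_add (half F X τ hτ hl p hp q hq hpq) (half F X τ hτ hl q hq p hp hpq.symm)

end LocalFunction

end

/-! ### Weak gradients and the seminorm of the error. -/

theorem integrable_smul_gradient {U : Set E3} {v φ : E3 → ℝ} (hv : LocallyIntegrableOn v U)
    (c1 : ContDiff ℝ ∞ φ) (c2 : HasCompactSupport φ) (c3 : tsupport φ ⊆ U) :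
    Integrable (fun x => v x • gradient φ x) := by
  have hgc : Continuous (gradient φ) :=
    (InnerProductSpace.toDual ℝ E3).symm.continuous.comp (c1.continuous_fderiv (by simp))
  rw [← integrableOn_iff_integrable_of_support_subset (s := tsupport φ)]
  · exact (hv.integrableOn_compact_subset c3 c2).smul_continuousOn hgc.continuousOn c2
  · intro x hx
    by_contra hxs
    apply hx
    have : fderiv ℝ φ x = 0 := by
      by_contra h0
      exact hxs (support_fderiv_subset ℝ h0)
    simp [gradient, this]

theorem integrable_smul_locallyIntegrable {U : Set E3} {W : E3 → E3} {φ : E3 → ℝ}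
    (hW : LocallyIntegrableOn W U) (c1 : Continuous φ) (c2 : HasCompactSupport φ)
    (c3 : tsupport φ ⊆ U) : Integrable (fun x => φ x • W x) := by
  rw [← integrableOn_iff_integrable_of_support_subset (s := tsupport φ)]
  · exact (hW.integrableOn_compact_subset c3 c2).continuousOn_smul c1.continuousOn c2
  · intro x hx
    by_contra hxs
    apply hx
    simp [image_eq_zero_of_notMem_tsupport hxs]

theorem hasWeakGradient_affine (U : Set E3) (l : E3) (κ : ℝ) :
    HasWeakGradient U (fun x => inner ℝ l x + κ) (fun _ => l) := by
  have hc : Continuous fun x : E3 => inner ℝ l x + κ := by fun_prop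
  have h1 : LocallyIntegrableOn (fun x : E3 => inner ℝ l x + κ) U :=
    (hc.locallyIntegrable (μ := volume)).locallyIntegrableOn U
  have h2 : LocallyIntegrableOn (fun _ : E3 => l) U :=
    ((continuous_const (y := l)).locallyIntegrable (μ := volume)).locallyIntegrableOn U
  refine ⟨h1, h2, fun φ c1 c2 c3 => ?_⟩
  have i1 := integrable_smul_gradient h1 c1 c2 c3
  have i2 := integrable_smul_locallyIntegrable h2 c1.continuous c2 c3
  rw [setIntegral_eq_integral_of_forall_compl_eq_zero,
    setIntegral_eq_integral_of_forall_compl_eq_zero]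
  -- Tested with a fixed vector `w`, the identity is integration by parts in the direction `w`.
  · refine ext_inner_left ℝ fun w => ?_
    rw [inner_neg_right, ← integral_inner i1, ← integral_inner i2]
    have hφd : Differentiable ℝ φ := c1.differentiable (by simp)
    have key := integral_mul_fderiv_eq_neg_fderiv_mul_of_integrable (μ := (volume : Measure E3))
      (f := fun x : E3 => inner ℝ l x + κ) (g := φ) (v := w) (𝕜 := ℝ)
      (by
        have : ∀ x : E3, fderiv ℝ (fun x : E3 => inner ℝ l x + κ) x w = inner ℝ l w := fun x => by
          have : HasFDerivAt (fun x : E3 => inner ℝ l x + κ) (innerSL ℝ l) x :=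
            ((innerSL ℝ l).hasFDerivAt).add_const κ
          rw [this.fderiv]; rfl
        simp_rw [this]
        exact (c1.continuous.integrable_of_hasCompactSupport c2).const_mul _)
      (by
        have := integrable_mul_fderiv w h1 c1 c2 c3
        exact this)
      ((hc.mul c1.continuous).integrable_of_hasCompactSupport c2.mul_left)
      (fun x _ => ((innerSL ℝ l).differentiable.add_const κ) x) (fun x _ => hφd x)
    have e1 : ∀ x, inner ℝ w ((inner ℝ l x + κ) • gradient φ x) =
        (inner ℝ l x + κ) * fderiv ℝ φ x w := fun x => by
      rw [real_inner_smul_right, real_inner_comm (gradient φ x) w, inner_gradient_left]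
    have e2 : ∀ x, inner ℝ w (φ x • l) =
        fderiv ℝ (fun x : E3 => inner ℝ l x + κ) x w * φ x := fun x => by
      have : HasFDerivAt (fun x : E3 => inner ℝ l x + κ) (innerSL ℝ l) x :=
        ((innerSL ℝ l).hasFDerivAt).add_const κ
      rw [this.fderiv, real_inner_smul_right, real_inner_comm]
      simp [mul_comm]
    simp_rw [e1, e2]
    exact key
  · intro x hx
    rw [image_eq_zero_of_notMem_tsupport fun h => hx (c3 h), zero_smul]
  · intro x hx
    have : fderiv ℝ φ x = 0 := by
      by_contra h0
      exact hx (c3 (support_fderiv_subset ℝ h0))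
    simp [gradient, this]

theorem HasWeakGradient.mono {U S : Set E3} {u : E3 → ℝ} {W : E3 → E3}
    (h : HasWeakGradient S u W) (hUS : U ⊆ S) : HasWeakGradient U u W := by
  refine ⟨h.1.mono_set hUS, h.2.1.mono_set hUS, fun φ c1 c2 c3 => ?_⟩
  have := h.2.2 φ c1 c2 (c3.trans hUS)
  have z1 : ∀ x, x ∉ U → u x • gradient φ x = 0 := fun x hx => by
    have : fderiv ℝ φ x = 0 := by
      by_contra h0
      exact hx (c3 (support_fderiv_subset ℝ h0))
    simp [gradient, this]
  have z2 : ∀ x, x ∉ U → φ x • W x = 0 := fun x hx => by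
    rw [image_eq_zero_of_notMem_tsupport fun h => hx (c3 h), zero_smul]
  rw [setIntegral_eq_integral_of_forall_compl_eq_zero z1,
    setIntegral_eq_integral_of_forall_compl_eq_zero z2]
  rwa [setIntegral_eq_integral_of_forall_compl_eq_zero fun x hx => z1 x fun h => hx (hUS h),
    setIntegral_eq_integral_of_forall_compl_eq_zero fun x hx => z2 x fun h => hx (hUS h)] at this

theorem HasWeakGradient.sub {U : Set E3} {u v : E3 → ℝ} {W W' : E3 → E3}
    (h : HasWeakGradient U u W) (h' : HasWeakGradient U v W') :
    HasWeakGradient U (fun x => u x - v x) (fun x => W x - W' x) := by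
  refine ⟨h.1.sub h'.1, h.2.1.sub h'.2.1, fun φ c1 c2 c3 => ?_⟩
  simp_rw [sub_smul, smul_sub]
  rw [integral_sub (integrable_smul_gradient h.1 c1 c2 c3).integrableOn
      (integrable_smul_gradient h'.1 c1 c2 c3).integrableOn,
    integral_sub (integrable_smul_locallyIntegrable h.2.1 c1.continuous c2 c3).integrableOn
      (integrable_smul_locallyIntegrable h'.2.1 c1.continuous c2 c3).integrableOn,
    h.2.2 φ c1 c2 c3, h'.2.2 φ c1 c2 c3]
  abel

theorem HasWeakGradient.congr {U : Set E3} (hU : IsOpen U) {u v : E3 → ℝ} {W : E3 → E3}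
    (h : HasWeakGradient U u W) (huv : ∀ x ∈ U, v x = u x) : HasWeakGradient U v W := by
  have hae : ∀ᵐ x ∂(volume.restrict U), u x = v x :=
    ae_restrict_of_forall_mem hU.measurableSet fun x hx => (huv x hx).symm
  refine ⟨fun x hx => ?_, h.2.1, fun φ c1 c2 c3 => ?_⟩
  · obtain ⟨s, hs, hi⟩ := h.1 x hx
    refine ⟨s ∩ U, Filter.inter_mem hs self_mem_nhdsWithin, ?_⟩
    exact (hi.mono_set inter_subset_left).congr
      (ae_restrict_of_ae_restrict_of_subset inter_subset_right hae)
  · rw [← h.2.2 φ c1 c2 c3]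
    exact setIntegral_congr_fun hU.measurableSet fun x hx => by simp only [huv x hx]

/-- The seminorm of the difference of a function and an affine function. -/
theorem h1Seminorm_sub_affine_le {U S : Set E3} (hU : IsOpen U) (hUS : U ⊆ S) {u f : E3 → ℝ}
    {W : E3 → E3} (hW : HasWeakGradient S u W) (l : E3) (κ : ℝ)
    (hf : ∀ x ∈ U, f x = u x - (inner ℝ l x + κ)) :
    h1Seminorm U f ≤ (∫⁻ x in U, ‖W x‖ₑ ^ 2) ^ (1 / 2 : ℝ) +
      volume U ^ (1 / 2 : ℝ) * ‖l‖ₑ := by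
  have h := ((hW.mono hUS).sub (hasWeakGradient_affine U l κ)).congr hU hf
  refine (iInf₂_le _ h).trans ?_
  have hm : AEMeasurable (fun x => ‖W x‖ₑ) (volume.restrict U) :=
    (hW.2.1.mono_set hUS).aestronglyMeasurable.enorm
  have key := ENNReal.lintegral_Lp_add_le (μ := volume.restrict U) (p := 2) hm
    (aemeasurable_const (b := ‖l‖ₑ)) (by norm_num)
  simp only [Pi.add_apply, ENNReal.rpow_two] at key
  refine (ENNReal.rpow_le_rpow (lintegral_mono fun x => ?_) (by norm_num)).trans (key.trans ?_)
  · exact pow_le_pow_left' enorm_sub_le 2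
  · refine add_le_add le_rfl (le_of_eq ?_)
    rw [setLIntegral_const, ENNReal.mul_rpow_of_nonneg _ _ (by norm_num), mul_comm,
      ← ENNReal.rpow_two, ← ENNReal.rpow_mul]
    norm_num

/-! ### Gradients of affine functions from their values at vertices. -/

namespace PrismFrame

variable {G : ℕ → ℝ}

/-- The gradient of an affine function on a prism, from its values at a vertical edge and at two
further nodes. -/
theorem exists_gradient_constant_tuple (p q r : ℕ × ℕ) (hG : IsGrading G)
    (hGm : Monotone G)
    (ha : area2 (latPt G p) (latPt G q) (latPt G r) ≠ 0) : ∃ K : ℝ, 0 ≤ K ∧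
    ∀ (F : PrismFrame G), p.1 + p.2 < F.n → q.1 + q.2 ≤ F.n → r.1 + r.2 ≤ F.n →
    ∀ (l : E3) (κ m : ℝ), |inner ℝ l (F.bot p) + κ| ≤ m → |inner ℝ l (F.top p) + κ| ≤ m →
    ∀ x y : E3, (x = F.bot q ∨ x = F.top q) → (y = F.bot r ∨ y = F.top r) →
      |inner ℝ l x + κ| ≤ m → |inner ℝ l y + κ| ≤ m →
      |inner ℝ l F.P| ≤ K * m ∧ |inner ℝ l F.Q| ≤ K * m ∧ |inner ℝ l F.V| ≤ K * m := by
  -- The values at the ends of the vertical edge bound the derivative along `V` by 2 (level + 1) m,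
  -- because of the lower bound for its length. A further difference of two values contributes 2m to
  -- the horizontal derivatives.
  set N : ℝ := 2 + 2 * (((p.1 + p.2 : ℕ) : ℝ) + 1) with hN
  set M := 1 + ∑ x ∈ {p, q, r}, ((latPt G x).1 + (latPt G x).2) with hM
  set ar := area2 (latPt G p) (latPt G q) (latPt G r) with har
  have hN0 : 0 ≤ N := by positivity
  have hM0 : 0 ≤ M := by
    have := Finset.sum_nonneg (s := {p, q, r}) (f := fun x => (latPt G x).1 + (latPt G x).2)
      (fun x _ => add_nonneg (hG.latPt_nonneg x).1 (hG.latPt_nonneg x).2)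
    linarith
  have har0 : 0 < |ar| := abs_pos.2 ha
  refine ⟨N + 2 * N * M / |ar|, by positivity, fun F hp hq hr l κ m b1 b2 x y hx hy b3 b4 => ?_⟩
  have hm : 0 ≤ m := (abs_nonneg _).trans b1
  have hmapv : ∀ z : ℝ × ℝ × ℝ, inner ℝ l (F.map z) + κ =
      (inner ℝ l F.s + κ) + z.1 * inner ℝ l F.P + z.2.1 * inner ℝ l F.Q +
        z.2.2 * inner ℝ l F.V := fun z => by
    simp only [map, boxMap, inner_add_right, real_inner_smul_right]; ring
  set α := inner ℝ l F.P
  set β := inner ℝ l F.Q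
  set γ := inner ℝ l F.V
  set A0 := inner ℝ l F.s + κ
  have hbq : ∀ w ∈ ({p, q, r} : Finset (ℕ × ℕ)), 0 ≤ (latPt G w).1 ∧ 0 ≤ (latPt G w).2 ∧
      (latPt G w).1 ≤ M ∧ (latPt G w).2 ≤ M := fun w hw =>
    ⟨(hG.latPt_nonneg w).1, (hG.latPt_nonneg w).2, latPt_le_sum hG hw⟩
  obtain ⟨p1, p2, p3, p4⟩ := hbq p (by simp)
  obtain ⟨q1, q2, q3, q4⟩ := hbq q (by simp)
  obtain ⟨r1, r2, r3, r4⟩ := hbq r (by simp)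
  have hh := F.le_height hGm hp
  have hh0 := F.height_pos hGm hp
  rw [bot, hmapv] at b1
  rw [top, hmapv] at b2
  simp only at b1 b2
  have hγ : |γ| ≤ 2 * (((p.1 + p.2 : ℕ) : ℝ) + 1) * m := by
    have h1 : |F.height p * γ| ≤ 2 * m := by
      rw [abs_le] at b1 b2 ⊢
      constructor <;> linarith [b1.1, b1.2, b2.1, b2.2]
    rw [abs_mul, abs_of_pos hh0] at h1
    have h2 := mul_le_mul_of_nonneg_right hh (abs_nonneg γ)
    have h3 : 1 / (((p.1 + p.2 : ℕ) : ℝ) + 1) * |γ| ≤ 2 * m := h2.trans h1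
    rw [one_div_mul_eq_div, div_le_iff₀ (by positivity)] at h3
    linarith
  have hnode : ∀ w : ℕ × ℕ, w.1 + w.2 ≤ F.n → ∀ z : E3, (z = F.bot w ∨ z = F.top w) →
      |inner ℝ l z + κ| ≤ m →
      |((latPt G w).1 - (latPt G p).1) * α + ((latPt G w).2 - (latPt G p).2) * β| ≤ N * m := by
    intro w hw z hz hzm
    have h1 := F.height_nonneg hG hw
    have h2 := F.height_le hG w
    obtain ⟨ε, hε0, hε1, hε⟩ : ∃ ε : ℝ, 0 ≤ ε ∧ ε ≤ 1 ∧
        inner ℝ l z + κ = A0 + (latPt G w).1 * α + (latPt G w).2 * β + ε * γ := by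
      rcases hz with rfl | rfl
      · exact ⟨0, le_rfl, zero_le_one, by rw [bot, hmapv]⟩
      · exact ⟨F.height w, h1, h2, by rw [top, hmapv]⟩
    rw [hε] at hzm
    have h3 : |ε * γ| ≤ 2 * (((p.1 + p.2 : ℕ) : ℝ) + 1) * m := by
      rw [abs_mul, abs_of_nonneg hε0]
      exact (mul_le_of_le_one_left (abs_nonneg γ) hε1).trans hγ
    rw [hN]
    rw [abs_le] at h3 hzm b1 ⊢
    constructor <;> linarith [h3.1, h3.2, hzm.1, hzm.2, b1.1, b1.2]
  have hq' := hnode q hq x hx b3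
  have hr' := hnode r hr y hy b4
  set X := ((latPt G q).1 - (latPt G p).1) * α + ((latPt G q).2 - (latPt G p).2) * β with hX
  set Y := ((latPt G r).1 - (latPt G p).1) * α + ((latPt G r).2 - (latPt G p).2) * β with hY
  have hNm : 0 ≤ N * m := by positivity
  have hcomb : ∀ s t v w : ℝ, |s| ≤ M → |t| ≤ M → |v| ≤ N * m → |w| ≤ N * m →
      |v * s - w * t| ≤ 2 * N * M * m := by
    intro s t v w hs ht hv hw
    calc |v * s - w * t| ≤ |v * s| + |w * t| := abs_sub _ _
      _ = |v| * |s| + |w| * |t| := by rw [abs_mul, abs_mul]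
      _ ≤ (N * m) * M + (N * m) * M := add_le_add (mul_le_mul hv hs (abs_nonneg _) hNm)
          (mul_le_mul hw ht (abs_nonneg _) hNm)
      _ = _ := by ring
  have hd : ∀ s t : ℝ, 0 ≤ s → 0 ≤ t → s ≤ M → t ≤ M → |s - t| ≤ M := fun s t h1 h2 h3 h4 =>
    abs_le.2 ⟨by linarith, by linarith⟩
  -- Cramer's rule for the two horizontal differences.
  have hα : α * ar = X * ((latPt G r).2 - (latPt G p).2) - Y * ((latPt G q).2 - (latPt G p).2) := by
    rw [har, area2, hX, hY]; ring
  have hβ : β * ar = Y * ((latPt G q).1 - (latPt G p).1) - X * ((latPt G r).1 - (latPt G p).1) := by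
    rw [har, area2, hX, hY]; ring
  have fin : ∀ v : ℝ, |v * ar| ≤ 2 * N * M * m → |v| ≤ (N + 2 * N * M / |ar|) * m := by
    intro v hv
    rw [abs_mul, ← le_div_iff₀ har0] at hv
    have : (N + 2 * N * M / |ar|) * m = N * m + 2 * N * M * m / |ar| := by ring
    rw [this]; linarith
  refine ⟨fin α ?_, fin β ?_, ?_⟩
  · rw [hα]
    exact hcomb _ _ _ _ (hd _ _ r2 p2 r4 p4) (hd _ _ q2 p2 q4 p4) hq' hr'
  · rw [hβ]
    exact hcomb _ _ _ _ (hd _ _ q1 p1 q3 p3) (hd _ _ r1 p1 r3 p3) hr' hq'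
  · refine hγ.trans (mul_le_mul_of_nonneg_right ?_ hm)
    have : 0 ≤ 2 * N * M / |ar| := by positivity
    linarith

/-- The nodes of a tetrahedron in a prism. -/
theorem exists_vertical_edge (F : PrismFrame G) (hG : IsGrading G) {τ : Finset (ℕ × ℕ)}
    (hτ : IsLatticeTriangle F.n τ) {T : Tet} (hT : T.verts ⊆ F.bot '' τ ∪ F.top '' τ) :
    ∃ p q r, p ∈ τ ∧ q ∈ τ ∧ r ∈ τ ∧ area2 (latPt G p) (latPt G q) (latPt G r) ≠ 0 ∧
      p.1 + p.2 < F.n ∧ F.bot p ∈ T.verts ∧ F.top p ∈ T.verts ∧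
      (F.bot q ∈ T.verts ∨ F.top q ∈ T.verts) ∧ (F.bot r ∈ T.verts ∨ F.top r ∈ T.verts) := by
  have hv : ∀ i : Fin 4, ∃ p ∈ τ, T.points i = F.bot p ∨ T.points i = F.top p := by
    intro i
    rcases hT (mem_range_self i) with ⟨p, hp, h⟩ | ⟨p, hp, h⟩
    · exact ⟨p, hp, Or.inl h.symm⟩
    · exact ⟨p, hp, Or.inr h.symm⟩
  choose π hπ hπ' using hv
  have hcard : τ.card ≤ 3 := by
    obtain ⟨p, q, r, rfl⟩ := exists_triple hτ
    exact Finset.card_le_three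
  -- Four vertices over three lattice points: two of them lie over the same point and are the ends
  -- of a vertical edge.
  obtain ⟨i, -, j, -, hij, hπij⟩ := Finset.exists_ne_map_eq_of_card_lt_of_maps_to
    (s := Finset.univ) (t := τ) (f := π) (by simp; omega) (fun i _ => hπ i)
  have hne : T.points i ≠ T.points j := fun h => hij (T.independent.injective h)
  have hboth : F.bot (π i) ∈ T.verts ∧ F.top (π i) ∈ T.verts ∧ F.bot (π i) ≠ F.top (π i) := by
    have hi := hπ' i
    have hj := hπ' j
    rw [← hπij] at hj
    rcases hi with hi | hi <;> rcases hj with hj | hj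
    · exact absurd (hi.trans hj.symm) hne
    · exact ⟨hi ▸ mem_range_self i, hj ▸ mem_range_self j, hi ▸ hj ▸ hne⟩
    · exact ⟨hj ▸ mem_range_self j, hi ▸ mem_range_self i, hi ▸ hj ▸ hne.symm⟩
    · exact absurd (hi.trans hj.symm) hne
  set p := π i with hpdef
  have hlev : p.1 + p.2 < F.n := by
    refine lt_of_le_of_ne (hτ.level_le (hπ i)) fun h => hboth.2.2 ?_
    have : F.height p = 0 := by rw [height, h, F.lam_mul, sub_self]
    rw [bot, top, this]
  obtain ⟨q, hq, hpq⟩ : ∃ q ∈ τ, p ≠ q := by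
    obtain ⟨i, j, ⟨-, rfl⟩ | ⟨-, rfl⟩⟩ := hτ
    · by_cases h : p = (i, j)
      · exact ⟨(i + 1, j), by simp, by simp [h]⟩
      · exact ⟨(i, j), by simp, h⟩
    · by_cases h : p = (i + 1, j)
      · exact ⟨(i, j + 1), by simp, by simp [h]⟩
      · exact ⟨(i + 1, j), by simp, h⟩
  obtain ⟨r, hr, harea⟩ := hG.exists_area2_ne_zero hτ (hπ i) hq hpq
  -- If no vertex lay over `z`, all four would be in the vertical plane over `p` and `y`, the zero
  -- set of the affine function `Λ`. As the vertices span the space, `Λ` would also vanish over `z`,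
  -- and the area would be zero.
  have hcov : ∀ y z : ℕ × ℕ, y ∈ τ → z ∈ τ →
      area2 (latPt G p) (latPt G y) (latPt G z) ≠ 0 → (∀ x ∈ τ, x = p ∨ x = y ∨ x = z) →
      F.bot z ∈ T.verts ∨ F.top z ∈ T.verts := by
    intro y z hy hz ha hall
    by_contra hc
    push Not at hc
    have hπz : ∀ i, π i ≠ z := by
      intro i hi
      rcases hπ' i with h | h
      · exact hc.1 (by rw [← hi, ← h]; exact mem_range_self i)
      · exact hc.2 (by rw [← hi, ← h]; exact mem_range_self i)
    set Λ : ℝ × ℝ × ℝ → ℝ := fun x => ((latPt G y).1 - (latPt G p).1) * (x.2.1 - (latPt G p).2) -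
      ((latPt G y).2 - (latPt G p).2) * (x.1 - (latPt G p).1) with hΛ
    have hco : ∀ i, ∃ x : ℝ × ℝ × ℝ, T.points i = F.map x ∧ Λ x = 0 := by
      intro i
      have hpy : π i = p ∨ π i = y := by
        rcases hall _ (hπ i) with h | h | h
        · exact Or.inl h
        · exact Or.inr h
        · exact absurd h (hπz i)
      rcases hπ' i with h | h
      · refine ⟨_, h, ?_⟩
        rcases hpy with h' | h' <;> simp only [hΛ, h'] <;> ring
      · refine ⟨_, h, ?_⟩
        rcases hpy with h' | h' <;> simp only [hΛ, h'] <;> ring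
    choose ξ hξ hΛξ using hco
    have hsum := T.basis.linear_combination_coord_eq_self (F.bot z)
    have hone := T.basis.sum_coord_apply_eq_one (F.bot z)
    set w := fun i => T.basis.coord i (F.bot z) with hw
    have hpts : ∀ i, (T.basis : Fin 4 → E3) i = T.points i := fun i => rfl
    have e : F.map (∑ i, w i • ξ i) = F.bot z := by
      rw [← hsum]
      simp only [hpts, hξ, PrismFrame.map, boxMap_eq, map_sum, map_smul, smul_add,
        Finset.sum_add_distrib, ← Finset.sum_smul]
      have hone' : ∑ i, w i = 1 := hone
      rw [show ∑ i, T.basis.coord i (F.bot z) = 1 from hone, one_smul]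
    have e2 := F.map_injective e
    have h0 : Λ (∑ i, w i • ξ i) = ∑ i, w i * Λ (ξ i) := by
      have hone' : ∑ i, w i = 1 := hone
      rw [Fin.sum_univ_four] at hone'
      simp only [hΛ, Fin.sum_univ_four, Prod.fst_add, Prod.snd_add, Prod.smul_fst, Prod.smul_snd,
        smul_eq_mul]
      linear_combination (((latPt G y).1 - (latPt G p).1) * (latPt G p).2 -
        ((latPt G y).2 - (latPt G p).2) * (latPt G p).1) * hone'
    rw [e2] at h0
    simp only [hΛξ, mul_zero, Finset.sum_const_zero] at h0
    apply ha
    rw [area2]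
    simpa [hΛ] using h0
  have hall : ∀ x ∈ τ, x = p ∨ x = q ∨ x = r := by
    intro x hx
    by_contra hc
    push Not at hc
    have hpr : p ≠ r := by
      rintro h; rw [← h] at harea; apply harea; rw [area2]; ring
    have hqr : q ≠ r := by
      rintro h; rw [← h] at harea; apply harea; rw [area2]; ring
    have h4 : ({x, p, q, r} : Finset (ℕ × ℕ)).card ≤ τ.card := Finset.card_le_card (by
      intro z hz
      simp only [Finset.mem_insert, Finset.mem_singleton] at hz
      rcases hz with rfl | rfl | rfl | rfl <;> first | assumption | exact hπ i)
    rw [Finset.card_insert_of_notMem (by simp [hc.1, hc.2.1, hc.2.2]),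
      Finset.card_insert_of_notMem (by simp [hpq, hpr]),
      Finset.card_insert_of_notMem (by simp [hqr]), Finset.card_singleton] at h4
    omega
  refine ⟨p, q, r, hπ i, hq, hr, harea, hlev, hboth.1, hboth.2.1, ?_, hcov q r hq hr harea hall⟩
  refine hcov r q hr hq ?_ fun x hx => ?_
  · intro h
    apply harea
    rw [area2] at h ⊢
    linarith
  · rcases hall x hx with h | h | h
    · exact Or.inl h
    · exact Or.inr (Or.inr h)
    · exact Or.inr (Or.inl h)

/-- The gradient of an affine function on a tetrahedron in a prism, from its values at the
vertices. -/
theorem exists_gradient_constant (hG : IsGrading G) (hGm : Monotone G) (L : ℕ) : ∃ K : ℝ, 0 ≤ K ∧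
    ∀ (F : PrismFrame G) (τ : Finset (ℕ × ℕ)), IsLatticeTriangle F.n τ →
    (∀ p ∈ τ, p.1 + p.2 ≤ L) → ∀ T : Tet, T.verts ⊆ F.bot '' τ ∪ F.top '' τ →
    ∀ (l : E3) (κ m : ℝ), (∀ i, |inner ℝ l (T.points i) + κ| ≤ m) →
      |inner ℝ l F.P| ≤ K * m ∧ |inner ℝ l F.Q| ≤ K * m ∧ |inner ℝ l F.V| ≤ K * m := by
  classical
  have h : ∀ i : (ℕ × ℕ) × (ℕ × ℕ) × (ℕ × ℕ), ∃ K : ℝ, 0 ≤ K ∧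
      (area2 (latPt G i.1) (latPt G i.2.1) (latPt G i.2.2) ≠ 0 →
    ∀ (F : PrismFrame G), i.1.1 + i.1.2 < F.n → i.2.1.1 + i.2.1.2 ≤ F.n →
    i.2.2.1 + i.2.2.2 ≤ F.n →
    ∀ (l : E3) (κ m : ℝ), |inner ℝ l (F.bot i.1) + κ| ≤ m → |inner ℝ l (F.top i.1) + κ| ≤ m →
    ∀ x y : E3, (x = F.bot i.2.1 ∨ x = F.top i.2.1) → (y = F.bot i.2.2 ∨ y = F.top i.2.2) →
      |inner ℝ l x + κ| ≤ m → |inner ℝ l y + κ| ≤ m →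
      |inner ℝ l F.P| ≤ K * m ∧ |inner ℝ l F.Q| ≤ K * m ∧ |inner ℝ l F.V| ≤ K * m) := by
    intro i
    by_cases ha : area2 (latPt G i.1) (latPt G i.2.1) (latPt G i.2.2) ≠ 0
    · obtain ⟨K, hK, h⟩ := exists_gradient_constant_tuple i.1 i.2.1 i.2.2 hG hGm ha
      exact ⟨K, hK, fun _ => h⟩
    · exact ⟨0, le_rfl, fun h => absurd h ha⟩
  choose K hK h using h
  refine ⟨∑ i ∈ levelBox L ×ˢ levelBox L ×ˢ levelBox L, K i, Finset.sum_nonneg fun i _ => hK i,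
    fun F τ hτ hl T hT l κ m hm => ?_⟩
  obtain ⟨p, q, r, hp, hq, hr, ha, hpn, v1, v2, v3, v4⟩ := F.exists_vertical_edge hG hτ hT
  have hvert : ∀ x ∈ T.verts, |inner ℝ l x + κ| ≤ m := by
    rintro _ ⟨i, rfl⟩; exact hm i
  have hm0 : 0 ≤ m := (abs_nonneg _).trans (hm 0)
  have hle := Finset.single_le_sum (f := K) (fun i _ => hK i)
    (show (p, q, r) ∈ levelBox L ×ˢ levelBox L ×ˢ levelBox L by
      simp only [Finset.mem_product]
      exact ⟨mem_levelBox (hl p hp), mem_levelBox (hl q hq), mem_levelBox (hl r hr)⟩)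
  obtain ⟨x, hx, hxv⟩ : ∃ x, (x = F.bot q ∨ x = F.top q) ∧ x ∈ T.verts := by
    rcases v3 with h | h
    exacts [⟨_, Or.inl rfl, h⟩, ⟨_, Or.inr rfl, h⟩]
  obtain ⟨y, hy, hyv⟩ : ∃ x, (x = F.bot r ∨ x = F.top r) ∧ x ∈ T.verts := by
    rcases v4 with h | h
    exacts [⟨_, Or.inl rfl, h⟩, ⟨_, Or.inr rfl, h⟩]
  obtain ⟨k1, k2, k3⟩ := h (p, q, r) ha F hpn (hτ.level_le hq) (hτ.level_le hr) l κ m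
    (hvert _ v1) (hvert _ v2) x y hx hy (hvert _ hxv) (hvert _ hyv)
  have hle' := mul_le_mul_of_nonneg_right hle hm0
  exact ⟨k1.trans hle', k2.trans hle', k3.trans hle'⟩

end PrismFrame

/-! ### The distance from the singular edge. -/

/-- The projection along the edge `ab`. -/
def axisProj (a b : E3) : E3 →ₗ[ℝ] E3 :=
  LinearMap.id - ((innerₗ E3 (b - a)).smulRight ((1 / ‖b - a‖ ^ 2) • (b - a)))

theorem axisProj_apply (a b v : E3) :
    axisProj a b v = v - (inner ℝ (b - a) v / ‖b - a‖ ^ 2) • (b - a) := by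
  simp [axisProj, smul_smul, div_eq_mul_inv, inner_sub_left]

theorem axisProj_self {a b : E3} (h : a ≠ b) : axisProj a b (b - a) = 0 := by
  rw [axisProj_apply, real_inner_self_eq_norm_sq, div_self, one_smul, sub_self]
  exact pow_ne_zero _ (norm_ne_zero_iff.2 (sub_ne_zero.2 h.symm))

/-- The distance from the edge `ab`, extended to a line. -/
def edgeDist (a b x : E3) : ℝ := ‖axisProj a b (x - a)‖

theorem continuous_edgeDist (a b : E3) : Continuous (edgeDist a b) := by
  unfold edgeDist
  exact ((axisProj a b).continuous_of_finiteDimensional.comp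
    (continuous_id.sub continuous_const)).norm

/-- Pythagoras. The distance from the axis does not depend on the chosen frame, nor on the position
of the origin on the line. -/
theorem axisDist_eq {a b o : E3} {e : OrthonormalBasis (Fin 3) ℝ E3} (hab : a ≠ b)
    (haxis : ∃ s : ℝ, b - a = s • e 2) (ho : o ∈ affineSpan ℝ {a, b}) (x : E3) :
    axisDist o e x = edgeDist a b x := by
  obtain ⟨s, hs⟩ := haxis
  obtain ⟨t, ht⟩ := mem_vectorSpan_pair_rev.1
    (vsub_mem_vectorSpan_of_mem_affineSpan_of_mem_affineSpan ho (left_mem_affineSpan_pair ℝ a b))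
  obtain rfl : o = a + t • (b - a) := by
    rw [vsub_eq_sub, vsub_eq_sub] at ht
    rw [ht]; abel
  have hs0 : s ≠ 0 := by
    rintro rfl
    rw [zero_smul, sub_eq_zero] at hs
    exact hab hs.symm
  have e02 : inner ℝ (e 0) (e 2) = 0 := e.orthonormal.2 (by decide)
  have e12 : inner ℝ (e 1) (e 2) = 0 := e.orthonormal.2 (by decide)
  have e22 : inner ℝ (e 2) (e 2) = 1 := by
    rw [real_inner_self_eq_norm_sq, e.orthonormal.1 2]; norm_num
  have ho' : x - (a + t • (b - a)) = (x - a) - (t * s) • e 2 := by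
    rw [hs, smul_smul]; abel
  have hp : axisProj a b (x - a) = (x - a) - inner ℝ (e 2) (x - a) • e 2 := by
    rw [axisProj_apply, hs, norm_smul, e.orthonormal.1 2, real_inner_smul_left, smul_smul, mul_one,
      Real.norm_eq_abs, sq_abs]
    congr 2
    field_simp
  rw [axisDist, ho', edgeDist, hp]
  rw [← Real.sqrt_sq (norm_nonneg ((x - a) - inner ℝ (e 2) (x - a) • e 2))]
  congr 1
  rw [← e.sum_sq_norm_inner_right, Fin.sum_univ_three]
  simp only [inner_sub_right, real_inner_smul_right, e02, e12, e22, Real.norm_eq_abs, sq_abs]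
  ring

theorem edgeDist_le_dist {a b o : E3} {e : OrthonormalBasis (Fin 3) ℝ E3} (hab : a ≠ b)
    (haxis : ∃ s : ℝ, b - a = s • e 2) (ho : o ∈ affineSpan ℝ {a, b}) (x : E3) :
    edgeDist a b x ≤ dist x o := by
  rw [← axisDist_eq hab haxis ho, axisDist, dist_eq_norm]
  refine Real.sqrt_le_iff.2 ⟨norm_nonneg _, ?_⟩
  rw [← e.sum_sq_norm_inner_right (x - o), Fin.sum_univ_three]
  simp only [Real.norm_eq_abs, sq_abs]
  have := sq_nonneg (inner ℝ (e 2) (x - o))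
  linarith

/-- The edges of the tetrahedron `abcd` at `a` are linearly independent. -/
theorem exists_edgeDist_lower {a b c d : E3} (hdet : det3 (c - a) (d - a) (b - a) ≠ 0) :
    ∃ κ : ℝ, 0 < κ ∧ ∀ y z : ℝ, κ * (|y| + |z|) ≤
      ‖y • axisProj a b (c - a) + z • axisProj a b (d - a)‖ := by
  set f : ℝ × ℝ →ₗ[ℝ] E3 := (LinearMap.fst ℝ ℝ ℝ).smulRight (axisProj a b (c - a)) +
    (LinearMap.snd ℝ ℝ ℝ).smulRight (axisProj a b (d - a)) with hf
  -- A combination of `c - a` and `d - a` with zero projection would be a multiple of `b - a`.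
  -- Injectivity in finite dimensions then gives the lower bound.
  have hinj : LinearMap.ker f = ⊥ := by
    rw [LinearMap.ker_eq_bot']
    rintro ⟨y, z⟩ h
    have h1 : axisProj a b (y • (c - a) + z • (d - a)) = 0 := by
      rw [map_add, map_smul, map_smul]; exact h
    rw [axisProj_apply, sub_eq_zero] at h1
    have h2 : boxLin (c - a) (d - a) (b - a) (y, z, -(inner ℝ (b - a) (y • (c - a) + z • (d - a)) /
        ‖b - a‖ ^ 2)) = boxLin (c - a) (d - a) (b - a) 0 := by
      rw [boxLin_apply, map_zero, neg_smul, ← h1]; simp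
    have h3 := boxLin_injective hdet h2
    exact Prod.ext (congrArg (fun x : ℝ × ℝ × ℝ => x.1) h3)
      (congrArg (fun x : ℝ × ℝ × ℝ => x.2.1) h3)
  obtain ⟨K, hK, hanti⟩ := f.exists_antilipschitzWith hinj
  refine ⟨1 / (2 * K), by positivity, fun y z => ?_⟩
  have h1 := hanti.le_mul_dist (y, z) 0
  rw [map_zero, dist_zero_right, dist_zero_right] at h1
  have h2 : |y| + |z| ≤ 2 * ‖(y, z)‖ := by
    have h3 := norm_fst_le (y, z)
    have h4 := norm_snd_le (y, z)
    simp only [Real.norm_eq_abs] at h3 h4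
    linarith
  have e : f (y, z) = y • axisProj a b (c - a) + z • axisProj a b (d - a) := rfl
  rw [e] at h1
  have hK' : (0 : ℝ) < K := hK
  rw [one_div_mul_eq_div, div_le_iff₀ (by positivity)]
  linarith

/-- A vector is controlled by its products with the edges of the tetrahedron at `a`. -/
theorem exists_norm_le_inner {a b c d : E3} (hdet : det3 (c - a) (d - a) (b - a) ≠ 0) :
    ∃ κ : ℝ, 0 ≤ κ ∧ ∀ l : E3, ‖l‖ ≤
      κ * (|inner ℝ l (c - a)| + |inner ℝ l (d - a)| + |inner ℝ l (b - a)|) := by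
  set f : E3 →ₗ[ℝ] ℝ × ℝ × ℝ := (innerₗ E3 (c - a)).prod
    ((innerₗ E3 (d - a)).prod (innerₗ E3 (b - a))) with hf
  have hinj : LinearMap.ker f = ⊥ := by
    rw [LinearMap.ker_eq_bot']
    intro l hl
    have h1 : inner ℝ (c - a) l = 0 := congrArg (fun x : ℝ × ℝ × ℝ => x.1) hl
    have h2 : inner ℝ (d - a) l = 0 := congrArg (fun x : ℝ × ℝ × ℝ => x.2.1) hl
    have h3 : inner ℝ (b - a) l = 0 := congrArg (fun x : ℝ × ℝ × ℝ => x.2.2) hl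
    obtain ⟨y, hy⟩ := exists_boxMap (0 : E3) hdet l
    have h4 : inner ℝ (boxMap 0 (c - a) (d - a) (b - a) y) l = 0 := by
      simp [boxMap, inner_add_left, real_inner_smul_left, h1, h2, h3]
    rw [hy] at h4
    exact inner_self_eq_zero.1 h4
  obtain ⟨K, hK, hanti⟩ := f.exists_antilipschitzWith hinj
  refine ⟨K, K.2, fun l => ?_⟩
  have h1 := hanti.le_mul_dist l 0
  rw [map_zero, dist_zero_right, dist_zero_right] at h1
  refine h1.trans (mul_le_mul_of_nonneg_left ?_ K.2)
  have e : f l = (inner ℝ (c - a) l, inner ℝ (d - a) l, inner ℝ (b - a) l) := rfl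
  rw [e, Prod.norm_def, Prod.norm_def, real_inner_comm l, real_inner_comm l, real_inner_comm l]
  simp only [Real.norm_eq_abs]
  have := abs_nonneg (inner ℝ l (c - a))
  have := abs_nonneg (inner ℝ l (d - a))
  have := abs_nonneg (inner ℝ l (b - a))
  refine max_le (by linarith) (max_le (by linarith) (by linarith))

/-- Passing to a neighbour raises the maximal level at most by one, and in a connected set
everything is reached in at most `m` steps. -/
theorem level_le_of_connected {n m : ℕ} {B : Finset (Finset (ℕ × ℕ))}
    (hB : ∀ τ ∈ B, IsLatticeTriangle n τ) (hcard : B.card ≤ m) (h0 : upTri 0 0 ∈ B)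
    (hconn : ∀ s ∈ B, ∀ t ∈ B, Relation.ReflTransGen
      (fun s t => s ∈ B ∧ t ∈ B ∧ (s ∩ t).card = 2) s t) :
    ∀ τ ∈ B, ∀ p ∈ τ, p.1 + p.2 ≤ m + 1 := by
  intro τ hτ p hp
  have := subset_of_connected (B := B) (r := fun s t => (s ∩ t).card = 2) hconn
    (A := fun j => {τ | ∀ p ∈ τ, p.1 + p.2 ≤ j + 1}) h0
    (fun p hp => by rw [mem_upTri] at hp; omega)
    (fun j τ h p hp => (h p hp).trans (by omega))
    (fun j s hs t hsB htB hst p hp => by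
      obtain ⟨x, hx⟩ := Finset.card_pos.1 (by omega : 0 < (s ∩ t).card)
      rw [Finset.mem_inter] at hx
      exact (hB t htB).level_le_of_mem hx.2 hp (hs x hx.1)) τ hτ p hp
  omega

/-! ### Patches at the edge in physical coordinates. -/

/-- A patch at the edge `ab` in a layer of a macro-element. -/
structure NeedlePatch (G : ℕ → ℝ) (a b c d : E3) (C₀ : ℝ) (m : ℕ) where
  F : PrismFrame G
  t : ℝ
  D : ℝ
  t_mem : t ∈ Icc (0 : ℝ) 1
  tD_mem : t + D ∈ Icc (0 : ℝ) 1
  -- The sign of `D` is left open, since a layer seen from above has negative thickness.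
  D_ne : D ≠ 0
  s_eq : F.s = a + t • (b - a)
  P_eq : F.P = F.lam • (c - F.s)
  Q_eq : F.Q = F.lam • (d - F.s)
  V_eq : F.V = D • (b - a)
  lam_le : F.lam ≤ C₀ * |D|
  B : Finset (Finset (ℕ × ℕ))
  S : Set E3
  lattice : ∀ τ ∈ B, IsLatticeTriangle F.n τ
  S_eq : S = interior (⋃ τ ∈ B, F.prism τ)
  card_le : B.card ≤ m
  corner : upTri 0 0 ∈ B
  connected : ∀ s ∈ B, ∀ t ∈ B, Relation.ReflTransGen
    (fun s t => s ∈ B ∧ t ∈ B ∧ (s ∩ t).card = 2) s t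

/-- A function on a patch at the edge `ab` in a layer of a macro-element. -/
structure NeedleData (G : ℕ → ℝ) (a b c d : E3) (C₀ : ℝ) (m : ℕ) extends
    NeedlePatch G a b c d C₀ m where
  o : E3
  e : OrthonormalBasis (Fin 3) ℝ E3
  axis : ∃ s : ℝ, b - a = s • e 2
  origin : o ∈ affineSpan ℝ {a, b}
  u : E3 → ℝ
  W : E3 → E3
  H : Fin 3 → E3 → E3
  weak : HasWeakGradient S u W
  weak' : ∀ i, HasWeakGradient S (partialOf e W i) (H i)
  Z : Set E3
  Z_sub : Z ⊆ {F.s, F.s + F.V}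
  cont : ContinuousOn u (closure S \ Z)
  zero : ∀ x ∈ (closure S ∩ segment ℝ F.s (F.s + F.V)) \ Z, u x = 0

namespace NeedleData

variable {G : ℕ → ℝ} {a b c d : E3} {C₀ : ℝ} {m : ℕ} (N : NeedleData G a b c d C₀ m)

/-- The same situation, seen from above. -/
def flip : NeedleData G a b c d C₀ m where
  F := N.F.flip
  t := N.t + N.D
  D := -N.D
  t_mem := N.tD_mem
  tD_mem := by simpa using N.t_mem
  D_ne := neg_ne_zero.2 N.D_ne
  s_eq := by
    change N.F.s + N.F.V = _
    rw [N.s_eq, N.V_eq]; module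
  P_eq := by
    change N.F.P - N.F.lam • N.F.V = N.F.lam • (c - (N.F.s + N.F.V))
    rw [N.P_eq]; module
  Q_eq := by
    change N.F.Q - N.F.lam • N.F.V = N.F.lam • (d - (N.F.s + N.F.V))
    rw [N.Q_eq]; module
  V_eq := by
    change -N.F.V = _
    rw [N.V_eq]; module
  lam_le := by rw [abs_neg]; exact N.lam_le
  B := N.B
  S := N.S
  lattice := N.lattice
  S_eq := by simp_rw [N.F.flip_prism]; exact N.S_eq
  card_le := N.card_le
  corner := N.corner
  connected := N.connected
  o := N.o
  e := N.e
  axis := N.axis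
  origin := N.origin
  u := N.u
  W := N.W
  H := N.H
  weak := N.weak
  weak' := N.weak'
  Z := N.Z
  Z_sub := by
    change N.Z ⊆ {N.F.s + N.F.V, N.F.s + N.F.V + -N.F.V}
    rw [add_neg_cancel_right, pair_comm]
    exact N.Z_sub
  cont := N.cont
  zero := by
    change ∀ x ∈ (closure N.S ∩ segment ℝ (N.F.s + N.F.V) (N.F.s + N.F.V + -N.F.V)) \ N.Z, N.u x = 0
    rw [add_neg_cancel_right, segment_symm]
    exact N.zero

theorem level_le : ∀ τ ∈ N.B, ∀ p ∈ τ, p.1 + p.2 ≤ m + 1 :=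
  level_le_of_connected N.lattice N.card_le N.corner N.connected

/-- A bound for the reference coordinates in the patch. -/
def coordBound (G : ℕ → ℝ) (m : ℕ) : ℝ :=
  1 + ∑ q ∈ levelBox (m + 1), ((latPt G q).1 + (latPt G q).2)

theorem one_le_coordBound (hG : IsGrading G) (m : ℕ) : 1 ≤ coordBound G m := by
  have := Finset.sum_nonneg (s := levelBox (m + 1)) (f := fun q => (latPt G q).1 + (latPt G q).2)
    (fun q _ => add_nonneg (hG.latPt_nonneg q).1 (hG.latPt_nonneg q).2)
  unfold coordBound
  linarith

theorem prism_subset (hG : IsGrading G) {τ : Finset (ℕ × ℕ)} (hτ : τ ∈ N.B) :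
    N.F.prism τ ⊆ N.F.map '' (Icc 0 (coordBound G m) ×ˢ Icc 0 (coordBound G m) ×ˢ
      Icc 0 (coordBound G m)) :=
  N.F.prism_subset hG (one_le_coordBound hG m) fun p hp =>
    PrismFrame.latPt_le_sum hG (mem_levelBox (N.level_le τ hτ p hp))

/-- A bound for the edges of the macro-element. -/
def edgeBound (a b c d : E3) : ℝ := 1 + ‖c - a‖ + ‖d - a‖ + ‖b - a‖ + ‖axisProj a b (c - a)‖ +
  ‖axisProj a b (d - a)‖

theorem one_le_edgeBound (a b c d : E3) : 1 ≤ edgeBound a b c d := by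
  unfold edgeBound
  have : 0 ≤ ‖c - a‖ + ‖d - a‖ + ‖b - a‖ + ‖axisProj a b (c - a)‖ + ‖axisProj a b (d - a)‖ := by
    positivity
  linarith

end NeedleData

theorem ofReal_abs_eq_enorm (x : ℝ) : ENNReal.ofReal |x| = ‖x‖ₑ := (Real.enorm_eq_ofReal_abs x).symm

theorem WeakDir.congr_fun {U : Set E3} {f g f' g' : E3 → ℝ} {e : E3} (h : WeakDir U f e g)
    (hf : ∀ x, f' x = f x) (hg : ∀ x, g' x = g x) : WeakDir U f' e g' := by
  rwa [funext hf, funext hg]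

namespace NeedleData

variable {G : ℕ → ℝ} {a b c d : E3} {C₀ : ℝ} {m : ℕ} (N : NeedleData G a b c d C₀ m)

theorem ne_of_det (hdet : det3 (c - a) (d - a) (b - a) ≠ 0) : a ≠ b := by
  rintro rfl
  apply hdet
  simp [det3_eq]

/-- Moving along `ab` does not change the projection, so neither the height nor the position of the
layer matters; only the scale λ survives. -/
theorem axisProj_map (hab : a ≠ b) (y : ℝ × ℝ × ℝ) : axisProj a b (N.F.map y - a) =
    N.F.lam • (y.1 • axisProj a b (c - a) + y.2.1 • axisProj a b (d - a)) := by
  have h0 := axisProj_self hab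
  have e : N.F.map y - a = (N.F.lam * y.1) • (c - a) + (N.F.lam * y.2.1) • (d - a) +
      (N.t - N.F.lam * y.1 * N.t - N.F.lam * y.2.1 * N.t + y.2.2 * N.D) • (b - a) := by
    rw [PrismFrame.map, boxMap, N.V_eq, N.P_eq, N.Q_eq, N.s_eq]
    module
  rw [e, map_add, map_add, map_smul, map_smul, map_smul, h0]
  module

theorem edgeDist_map (hab : a ≠ b) (y : ℝ × ℝ × ℝ) : edgeDist a b (N.F.map y) =
    N.F.lam * ‖y.1 • axisProj a b (c - a) + y.2.1 • axisProj a b (d - a)‖ := by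
  rw [edgeDist, N.axisProj_map hab, norm_smul, Real.norm_of_nonneg N.F.lam_pos.le]

theorem edgeDist_map_le (hab : a ≠ b) (y : ℝ × ℝ × ℝ) : edgeDist a b (N.F.map y) ≤
    N.F.lam * edgeBound a b c d * (|y.1| + |y.2.1|) := by
  rw [N.edgeDist_map hab, mul_assoc]
  refine mul_le_mul_of_nonneg_left ?_ N.F.lam_pos.le
  refine (norm_add_le _ _).trans ?_
  rw [norm_smul, norm_smul, mul_add, Real.norm_eq_abs, Real.norm_eq_abs, mul_comm (edgeBound a b c d),
    mul_comm (edgeBound a b c d)]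
  have h1 := norm_nonneg (c - a)
  have h2 := norm_nonneg (d - a)
  have h3 := norm_nonneg (b - a)
  have h4 := norm_nonneg (axisProj a b (c - a))
  have h5 := norm_nonneg (axisProj a b (d - a))
  refine add_le_add (mul_le_mul_of_nonneg_left ?_ (abs_nonneg _))
    (mul_le_mul_of_nonneg_left ?_ (abs_nonneg _)) <;> unfold edgeBound <;> linarith

theorem S_subset_union : N.S ⊆ ⋃ τ ∈ N.B, N.F.prism τ := by
  rw [N.S_eq]; exact interior_subset

theorem isOpen_S : IsOpen N.S := by rw [N.S_eq]; exact isOpen_interior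

theorem S_subset_box (hG : IsGrading G) : N.S ⊆ N.F.map '' (Icc 0 (coordBound G m) ×ˢ
    Icc 0 (coordBound G m) ×ˢ Icc 0 (coordBound G m)) :=
  N.S_subset_union.trans (iUnion₂_subset fun _ hτ => N.prism_subset hG hτ)

theorem edgeDist_le (hG : IsGrading G) (hab : a ≠ b) {x : E3} (hx : x ∈ N.S) :
    edgeDist a b x ≤ 2 * edgeBound a b c d * coordBound G m * N.F.lam := by
  obtain ⟨y, ⟨h1, h2, h3⟩, rfl⟩ := N.S_subset_box hG hx
  refine (N.edgeDist_map_le hab y).trans ?_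
  rw [abs_of_nonneg h1.1, abs_of_nonneg h2.1]
  have hE := one_le_edgeBound a b c d
  have := mul_le_mul_of_nonneg_left (add_le_add h1.2 h2.2)
    (mul_nonneg N.F.lam_pos.le (zero_le_one.trans hE))
  linarith

theorem edgeDist_pos_of_coords (hdet : det3 (c - a) (d - a) (b - a) ≠ 0) {y : ℝ × ℝ × ℝ}
    (h1 : 0 < y.1) : 0 < edgeDist a b (N.F.map y) := by
  obtain ⟨κ, hκ, h⟩ := exists_edgeDist_lower hdet
  rw [N.edgeDist_map (ne_of_det hdet)]
  refine mul_pos N.F.lam_pos (lt_of_lt_of_le ?_ (h y.1 y.2.1))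
  have := abs_pos.2 h1.ne'
  have := abs_nonneg y.2.1
  positivity

theorem exists_coords (hG : IsGrading G) {x : E3} (hx : x ∈ N.S) : ∃ y : ℝ × ℝ × ℝ,
    N.F.map y = x ∧ 0 < y.1 ∧ 0 < y.2.1 := by
  have h1 : (⋃ τ ∈ N.B, N.F.prism τ) ⊆ N.F.map '' (Ici 0 ×ˢ Ici 0 ×ˢ Ici 0) := by
    refine iUnion₂_subset fun τ hτ => (N.prism_subset hG hτ).trans (image_mono ?_)
    exact prod_mono Icc_subset_Ici_self (prod_mono Icc_subset_Ici_self Icc_subset_Ici_self)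
  rw [N.S_eq] at hx
  have h2 := interior_mono h1 hx
  have e : N.F.map = boxHomeo N.F.s N.F.det_ne := (coe_boxHomeo _ _).symm
  rw [e, ← Homeomorph.image_interior, interior_prod_eq, interior_prod_eq, interior_Ici, ← e] at h2
  obtain ⟨y, ⟨h3, h4, h5⟩, rfl⟩ := h2
  exact ⟨y, rfl, h3, h4⟩

theorem edgeDist_pos (hG : IsGrading G) (hdet : det3 (c - a) (d - a) (b - a) ≠ 0) {x : E3}
    (hx : x ∈ N.S) : 0 < edgeDist a b x := by
  obtain ⟨y, rfl, h1, -⟩ := N.exists_coords hG hx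
  exact N.edgeDist_pos_of_coords hdet h1

/-- The size of a partial derivative. -/
def pd (i : Fin 3) (x : E3) : ℝ := |partialOf N.e N.W i x|

theorem pd_nonneg (i : Fin 3) (x : E3) : 0 ≤ N.pd i x := abs_nonneg _

/-- The majorant of the weighted derivatives. -/
def maj (x : E3) : ℝ :=
  -- Two transversal differentiations in reference coordinates cost λ², one transversal and one
  -- longitudinal λ|D|. Since r ≤ C λ on the patch, first derivatives may be divided by r at the
  -- price of one power of λ.
  N.F.lam ^ 2 * ((N.pd 0 x + N.pd 1 x) / edgeDist a b x + (‖N.H 0 x‖ + ‖N.H 1 x‖)) +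
    N.F.lam * |N.D| * (N.pd 2 x / edgeDist a b x + ‖N.H 2 x‖)

theorem inner_W_eq (w x : E3) : inner ℝ w (N.W x) =
    inner ℝ w (N.e 0) * partialOf N.e N.W 0 x + inner ℝ w (N.e 1) * partialOf N.e N.W 1 x +
      inner ℝ w (N.e 2) * partialOf N.e N.W 2 x := by
  rw [← N.e.sum_inner_mul_inner, Fin.sum_univ_three]; rfl

theorem abs_inner_e_le (w : E3) (i : Fin 3) : |inner ℝ w (N.e i)| ≤ ‖w‖ := by
  have := abs_real_inner_le_norm w (N.e i)
  rwa [N.e.orthonormal.1 i, mul_one] at this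

theorem abs_inner_W_le (w x : E3) :
    |inner ℝ w (N.W x)| ≤ ‖w‖ * (N.pd 0 x + N.pd 1 x + N.pd 2 x) := by
  rw [N.inner_W_eq]
  refine (abs_add_three _ _ _).trans ?_
  rw [abs_mul, abs_mul, abs_mul, mul_add, mul_add]
  exact add_le_add (add_le_add
    (mul_le_mul_of_nonneg_right (N.abs_inner_e_le w 0) (abs_nonneg _))
    (mul_le_mul_of_nonneg_right (N.abs_inner_e_le w 1) (abs_nonneg _)))
    (mul_le_mul_of_nonneg_right (N.abs_inner_e_le w 2) (abs_nonneg _))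

/-- `V` is parallel to the third axis, so differentiation along `V` involves ∂₃u only. Hence the
factor |D| appears in the majorant only together with ∂₃u and its gradient. -/
theorem inner_V_e : inner ℝ N.F.V (N.e 0) = 0 ∧ inner ℝ N.F.V (N.e 1) = 0 := by
  obtain ⟨s, hs⟩ := N.axis
  rw [N.V_eq, hs, smul_smul, real_inner_smul_left, real_inner_smul_left]
  have e02 : inner ℝ (N.e 2) (N.e 0) = 0 := N.e.orthonormal.2 (by decide)
  have e12 : inner ℝ (N.e 2) (N.e 1) = 0 := N.e.orthonormal.2 (by decide)
  simp [e02, e12]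

theorem abs_inner_V_W_le (x : E3) : |inner ℝ N.F.V (N.W x)| ≤ ‖N.F.V‖ * N.pd 2 x := by
  rw [N.inner_W_eq, N.inner_V_e.1, N.inner_V_e.2, zero_mul, zero_mul, zero_add, zero_add, abs_mul]
  exact mul_le_mul_of_nonneg_right (N.abs_inner_e_le _ 2) (abs_nonneg _)

/-- The directional derivatives. -/
def dir : E3 →ₗ[ℝ] E3 → ℝ where
  toFun w x := inner ℝ w (N.W x)
  map_add' w w' := by funext x; exact inner_add_left _ _ _
  map_smul' s w := by funext x; exact real_inner_smul_left _ _ _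

/-- The directional derivatives of second order. -/
def dir2 : E3 →ₗ[ℝ] E3 →ₗ[ℝ] E3 → ℝ :=
  LinearMap.mk₂ ℝ (fun w v x => inner ℝ w (N.e 0) * inner ℝ v (N.H 0 x) +
      inner ℝ w (N.e 1) * inner ℝ v (N.H 1 x) + inner ℝ w (N.e 2) * inner ℝ v (N.H 2 x))
    (fun w w' v => by funext x; simp only [inner_add_left, Pi.add_apply]; ring)
    (fun s w v => by funext x; simp only [real_inner_smul_left, Pi.smul_apply, smul_eq_mul]; ring)
    (fun w v v' => by funext x; simp only [inner_add_left, Pi.add_apply]; ring)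
    (fun s w v => by funext x; simp only [real_inner_smul_left, Pi.smul_apply, smul_eq_mul]; ring)

theorem dir2_apply (w v x : E3) : N.dir2 w v x = inner ℝ w (N.e 0) * inner ℝ v (N.H 0 x) +
      inner ℝ w (N.e 1) * inner ℝ v (N.H 1 x) + inner ℝ w (N.e 2) * inner ℝ v (N.H 2 x) := rfl

theorem weakDir_dir (w v : E3) : WeakDir N.S (N.dir w) v (N.dir2 w v) := by
  have h := fun i => ((N.weak' i).weakDir v).const_mul (inner ℝ w (N.e i))
  exact (((h 0).add (h 1)).add (h 2)).congr_fun (fun x => N.inner_W_eq w x) fun x => rfl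

theorem abs_dir2_le (w v x : E3) :
    |N.dir2 w v x| ≤ ‖w‖ * ‖v‖ * (‖N.H 0 x‖ + ‖N.H 1 x‖ + ‖N.H 2 x‖) := by
  rw [dir2_apply]
  refine (abs_add_three _ _ _).trans ?_
  rw [abs_mul, abs_mul, abs_mul, mul_add, mul_add, mul_assoc, mul_assoc, mul_assoc]
  have h := fun i => mul_le_mul (N.abs_inner_e_le w i) (abs_real_inner_le_norm v (N.H i x))
    (abs_nonneg _) (norm_nonneg _)
  exact add_le_add (add_le_add (h 0) (h 1)) (h 2)

theorem abs_dir2_V_le (v x : E3) : |N.dir2 N.F.V v x| ≤ ‖N.F.V‖ * ‖v‖ * ‖N.H 2 x‖ := by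
  rw [dir2_apply, N.inner_V_e.1, N.inner_V_e.2, zero_mul, zero_mul, zero_add, zero_add, abs_mul,
    mul_assoc]
  exact mul_le_mul (N.abs_inner_e_le _ 2) (abs_real_inner_le_norm v (N.H 2 x))
    (abs_nonneg _) (norm_nonneg _)

theorem norm_le : ‖N.F.P‖ ≤ N.F.lam * edgeBound a b c d ∧ ‖N.F.Q‖ ≤ N.F.lam * edgeBound a b c d ∧
    ‖N.F.V‖ ≤ |N.D| * edgeBound a b c d := by
  have h1 := norm_nonneg (c - a)
  have h2 := norm_nonneg (d - a)
  have h3 := norm_nonneg (b - a)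
  have h4 := norm_nonneg (axisProj a b (c - a))
  have h5 := norm_nonneg (axisProj a b (d - a))
  have ht : ‖N.t • (b - a)‖ ≤ ‖b - a‖ := by
    rw [norm_smul, Real.norm_of_nonneg N.t_mem.1]
    exact mul_le_of_le_one_left h3 N.t_mem.2
  refine ⟨?_, ?_, ?_⟩
  · rw [N.P_eq, N.s_eq, norm_smul, Real.norm_of_nonneg N.F.lam_pos.le]
    refine mul_le_mul_of_nonneg_left ?_ N.F.lam_pos.le
    have e : c - (a + N.t • (b - a)) = (c - a) - N.t • (b - a) := by abel
    rw [e]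
    refine (norm_sub_le _ _).trans ?_
    unfold edgeBound; linarith
  · rw [N.Q_eq, N.s_eq, norm_smul, Real.norm_of_nonneg N.F.lam_pos.le]
    refine mul_le_mul_of_nonneg_left ?_ N.F.lam_pos.le
    have e : d - (a + N.t • (b - a)) = (d - a) - N.t • (b - a) := by abel
    rw [e]
    refine (norm_sub_le _ _).trans ?_
    unfold edgeBound; linarith
  · rw [N.V_eq, norm_smul, Real.norm_eq_abs]
    refine mul_le_mul_of_nonneg_left ?_ (abs_nonneg _)
    unfold edgeBound; linarith

/-- The constant of the majorant. -/
def majConst (G : ℕ → ℝ) (a b c d : E3) (C₀ : ℝ) (m : ℕ) : ℝ :=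
  6 * edgeBound a b c d ^ 2 * coordBound G m * (1 + |C₀|)

theorem majConst_pos (hG : IsGrading G) : 0 < majConst G a b c d C₀ m := by
  have := one_le_edgeBound a b c d
  have := one_le_coordBound hG m
  unfold majConst
  positivity

theorem lam_le' : N.F.lam ≤ (1 + |C₀|) * |N.D| := by
  have h1 := N.lam_le
  have h2 := mul_le_mul_of_nonneg_right (le_abs_self C₀) (abs_nonneg N.D)
  have h3 := abs_nonneg N.D
  linarith

theorem aemeasurable_maj : AEMeasurable (fun x => N.maj x) (volume.restrict N.S) := by
  have h1 : ∀ i, AEMeasurable (N.pd i) (volume.restrict N.S) := fun i =>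
    (N.weak' i).1.aestronglyMeasurable.aemeasurable.abs
  have h2 : ∀ i, AEMeasurable (fun x => ‖N.H i x‖) (volume.restrict N.S) := fun i =>
    (N.weak' i).2.1.aestronglyMeasurable.norm.aemeasurable
  have h3 : AEMeasurable (edgeDist a b) (volume.restrict N.S) :=
    (continuous_edgeDist a b).measurable.aemeasurable
  unfold maj
  exact (((((h1 0).add (h1 1)).div h3).add ((h2 0).add (h2 1))).const_mul _).add
    ((((h1 2).div h3).add (h2 2)).const_mul _)

/-- `P` and `Q` need not be orthogonal to the axis, so the derivatives along them also contain ∂₃u,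
with the factor λ². The needle condition absorbs this by λ² ≤ C λ|D|. -/
theorem real_bounds (hG : IsGrading G) (hdet : det3 (c - a) (d - a) (b - a) ≠ 0) {x : E3}
    (hx : x ∈ N.S) :
    (|inner ℝ N.F.P (N.W x)| + |inner ℝ N.F.Q (N.W x)|) *
        (edgeDist a b x / (N.F.lam * edgeBound a b c d))⁻¹ ≤ majConst G a b c d C₀ m * N.maj x ∧
    |inner ℝ N.F.P (N.W x)| + |inner ℝ N.F.Q (N.W x)| + |inner ℝ N.F.V (N.W x)| ≤
      majConst G a b c d C₀ m * N.maj x ∧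
    |N.dir2 N.F.P N.F.P x| + |N.dir2 N.F.P N.F.Q x| + (|N.dir2 N.F.Q N.F.P x| +
      |N.dir2 N.F.Q N.F.Q x|) + (|N.dir2 N.F.V N.F.P x| + |N.dir2 N.F.V N.F.Q x|) ≤
      majConst G a b c d C₀ m * N.maj x := by
  have hr := N.edgeDist_pos hG hdet hx
  have hr2 := N.edgeDist_le hG (ne_of_det hdet) hx
  have hE := one_le_edgeBound a b c d
  have hM := one_le_coordBound hG m
  obtain ⟨nP, nQ, nV⟩ := N.norm_le
  have hlam := N.F.lam_pos
  have hγ := N.lam_le'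
  have hD := abs_nonneg N.D
  have w1 := N.abs_inner_W_le N.F.P x
  have w2 := N.abs_inner_W_le N.F.Q x
  have w3 := N.abs_inner_V_W_le x
  have p0 := N.pd_nonneg 0 x
  have p1 := N.pd_nonneg 1 x
  have p2 := N.pd_nonneg 2 x
  rw [majConst]
  set E := edgeBound a b c d
  set M := coordBound G m
  set r := edgeDist a b x
  set lam := N.F.lam
  set γ := 1 + |C₀| with hγdef
  set δ := |N.D|
  have hγ1 : 1 ≤ γ := by have := abs_nonneg C₀; linarith
  set p := (N.pd 0 x + N.pd 1 x) / r with hp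
  set q := N.pd 2 x / r with hq
  have hp0 : 0 ≤ p := by positivity
  have hq0 : 0 ≤ q := by positivity
  have ep : N.pd 0 x + N.pd 1 x = p * r := by rw [hp]; field_simp
  have eq : N.pd 2 x = q * r := by rw [hq]; field_simp
  set gp := ‖N.H 0 x‖ + ‖N.H 1 x‖ with hgp
  set gq := ‖N.H 2 x‖ with hgq
  have hgp0 : 0 ≤ gp := by positivity
  have hgq0 : 0 ≤ gq := norm_nonneg _
  have hmaj : N.maj x = lam ^ 2 * (p + gp) + lam * δ * (q + gq) := rfl
  have hll : lam ^ 2 ≤ γ * (lam * δ) := by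
    have := mul_le_mul_of_nonneg_left hγ hlam.le
    linarith
  have hsum : N.pd 0 x + N.pd 1 x + N.pd 2 x = (p + q) * r := by rw [ep, eq]; ring
  rw [hsum] at w1 w2
  rw [eq] at w3
  have hlE : 0 ≤ lam * E := by positivity
  have w1' : |inner ℝ N.F.P (N.W x)| ≤ lam * E * ((p + q) * r) :=
    w1.trans (mul_le_mul_of_nonneg_right nP (by positivity))
  have w2' : |inner ℝ N.F.Q (N.W x)| ≤ lam * E * ((p + q) * r) :=
    w2.trans (mul_le_mul_of_nonneg_right nQ (by positivity))
  have w3' : |inner ℝ N.F.V (N.W x)| ≤ δ * E * (q * r) :=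
    w3.trans (mul_le_mul_of_nonneg_right nV (by positivity))
  have hE2 : 1 ≤ E ^ 2 := one_le_pow₀ hE
  -- The common form of the three estimates: `s` stands for the contributions of ∂₁u and ∂₂u, `t`
  -- for those of ∂₃u; λ² t is moved into λ|D| t.
  have key : ∀ k₁ k₂ s t : ℝ, 0 ≤ k₁ → 0 ≤ k₂ → k₁ ≤ 4 → k₂ ≤ 2 → 0 ≤ s → 0 ≤ t →
      k₁ * E ^ 2 * M * (lam ^ 2 * (s + t)) + k₂ * E ^ 2 * M * (lam * δ * t) ≤
      6 * E ^ 2 * M * γ * (lam ^ 2 * s + lam * δ * t) := by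
    intro k₁ k₂ s t hk1 hk2 hk1' hk2' hs ht
    have a1 : lam ^ 2 * t ≤ γ * (lam * δ) * t := mul_le_mul_of_nonneg_right hll ht
    have a2 : k₁ * (lam ^ 2 * (s + t)) + k₂ * (lam * δ * t) ≤
        6 * γ * (lam ^ 2 * s + lam * δ * t) := by
      have b1 : 0 ≤ lam ^ 2 * s := by positivity
      have b2 : 0 ≤ lam * δ * t := by positivity
      have b3 : k₁ * (lam ^ 2 * s) ≤ 6 * γ * (lam ^ 2 * s) :=
        mul_le_mul_of_nonneg_right (by linarith) b1
      have b4 : k₁ * (lam ^ 2 * t) ≤ 4 * (γ * (lam * δ) * t) :=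
        mul_le_mul hk1' a1 (by positivity) (by norm_num)
      have b5 : k₂ * (lam * δ * t) ≤ 2 * γ * (lam * δ * t) :=
        mul_le_mul_of_nonneg_right (by linarith) b2
      linarith
    have a3 : 0 ≤ E ^ 2 * M := by positivity
    have := mul_le_mul_of_nonneg_left a2 a3
    linarith
  have hmaj1 : 6 * E ^ 2 * M * γ * (lam ^ 2 * p + lam * δ * q) ≤ 6 * E ^ 2 * M * γ * N.maj x := by
    refine mul_le_mul_of_nonneg_left ?_ (by positivity)
    rw [hmaj]
    have : 0 ≤ lam ^ 2 * gp := by positivity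
    have : 0 ≤ lam * δ * gq := by positivity
    linarith
  have hmaj2 : 6 * E ^ 2 * M * γ * (lam ^ 2 * gp + lam * δ * gq) ≤ 6 * E ^ 2 * M * γ * N.maj x := by
    refine mul_le_mul_of_nonneg_left ?_ (by positivity)
    rw [hmaj]
    have : 0 ≤ lam ^ 2 * p := by positivity
    have : 0 ≤ lam * δ * q := by positivity
    linarith
  refine ⟨?_, ?_, ?_⟩
  · refine le_trans ?_ hmaj1
    refine le_trans ?_ (key 2 0 p q (by norm_num) le_rfl (by norm_num) (by norm_num) hp0 hq0)
    have hinv : 0 ≤ (r / (lam * E))⁻¹ := by positivity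
    refine (mul_le_mul_of_nonneg_right (add_le_add w1' w2') hinv).trans ?_
    have e1 : (lam * E * ((p + q) * r) + lam * E * ((p + q) * r)) * (r / (lam * E))⁻¹ =
        2 * E ^ 2 * (lam ^ 2 * (p + q)) := by
      field_simp
      ring
    rw [e1]
    have : 2 * E ^ 2 * (lam ^ 2 * (p + q)) * 1 ≤ 2 * E ^ 2 * (lam ^ 2 * (p + q)) * M :=
      mul_le_mul_of_nonneg_left hM (by positivity)
    linarith
  · refine le_trans ?_ hmaj1
    refine le_trans ?_ (key 4 2 p q (by norm_num) (by norm_num) le_rfl le_rfl hp0 hq0)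
    have b1 : lam * E * ((p + q) * r) ≤ lam * E * ((p + q) * (2 * E * M * lam)) := by gcongr
    have b2 : δ * E * (q * r) ≤ δ * E * (q * (2 * E * M * lam)) := by gcongr
    linarith
  · refine le_trans ?_ hmaj2
    refine le_trans ?_ (key 4 2 gp gq (by norm_num) (by norm_num) le_rfl le_rfl hgp0 hgq0)
    have hb : ∀ w v : E3, ‖w‖ ≤ lam * E → ‖v‖ ≤ lam * E →
        |N.dir2 w v x| ≤ E ^ 2 * (lam ^ 2 * (gp + gq)) := by
      intro w v hw hv
      refine (N.abs_dir2_le w v x).trans ?_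
      have := mul_le_mul hw hv (norm_nonneg _) hlE
      refine (mul_le_mul_of_nonneg_right this (by positivity)).trans (le_of_eq ?_)
      rw [← hgp, ← hgq]; ring
    have hbV : ∀ v : E3, ‖v‖ ≤ lam * E →
        |N.dir2 N.F.V v x| ≤ E ^ 2 * (lam * δ * gq) := by
      intro v hv
      refine (N.abs_dir2_V_le v x).trans ?_
      have := mul_le_mul nV hv (norm_nonneg _) (by positivity)
      refine (mul_le_mul_of_nonneg_right this (by positivity)).trans (le_of_eq ?_)
      rw [← hgq]; ring
    have c1 := hb _ _ nP nP
    have c2 := hb _ _ nP nQ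
    have c3 := hb _ _ nQ nP
    have c4 := hb _ _ nQ nQ
    have c5 := hbV _ nP
    have c6 := hbV _ nQ
    have d1 : E ^ 2 * (lam ^ 2 * (gp + gq)) * 1 ≤ E ^ 2 * (lam ^ 2 * (gp + gq)) * M :=
      mul_le_mul_of_nonneg_left hM (by positivity)
    have d2 : E ^ 2 * (lam * δ * gq) * 1 ≤ E ^ 2 * (lam * δ * gq) * M :=
      mul_le_mul_of_nonneg_left hM (by positivity)
    linarith

/-- The function on the patch, in reference coordinates. -/
def loc (hG : IsGrading G) (hdet : det3 (c - a) (d - a) (b - a) ≠ 0) : LocalFunction N.F where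
  B := N.B
  S := N.S
  u := N.u
  g := N.dir
  h := N.dir2
  ρ := fun x => edgeDist a b x / (N.F.lam * edgeBound a b c d)
  Φ := fun x => ENNReal.ofReal (majConst G a b c d C₀ m * N.maj x)
  Z := N.Z
  lattice := N.lattice
  S_eq := N.S_eq
  cont := N.cont
  zero := N.zero
  Z_sub := N.Z_sub
  weak1 := fun w => N.weak.weakDir w
  weak2 := N.weakDir_dir
  meas := (N.aemeasurable_maj.const_mul _).ennreal_ofReal
  ρ_cont := (continuous_edgeDist a b).div_const _
  ρ_pos := fun y h1 h2 => by
    have hE := one_le_edgeBound a b c d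
    have hlam := N.F.lam_pos
    refine ⟨div_pos (N.edgeDist_pos_of_coords hdet h1) (by positivity), ?_⟩
    rw [div_le_iff₀ (by positivity)]
    have := N.edgeDist_map_le (ne_of_det hdet) y
    rw [abs_of_pos h1, abs_of_pos h2] at this
    linarith
  axis := fun x hx => by
    have := (N.real_bounds hG hdet hx).1
    rw [← ofReal_abs_eq_enorm, ← ofReal_abs_eq_enorm, ← ENNReal.ofReal_add (abs_nonneg _)
      (abs_nonneg _), ← ENNReal.ofReal_mul (by positivity)]
    exact ENNReal.ofReal_le_ofReal this
  first := fun x hx => by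
    have := (N.real_bounds hG hdet hx).2.1
    rw [← ofReal_abs_eq_enorm, ← ofReal_abs_eq_enorm, ← ofReal_abs_eq_enorm,
      ← ENNReal.ofReal_add (by positivity) (by positivity),
      ← ENNReal.ofReal_add (by positivity) (by positivity)]
    exact ENNReal.ofReal_le_ofReal this
  second := fun x hx => by
    have := (N.real_bounds hG hdet hx).2.2
    simp only [← ofReal_abs_eq_enorm]
    rw [← ENNReal.ofReal_add (by positivity) (by positivity),
      ← ENNReal.ofReal_add (by positivity) (by positivity),
      ← ENNReal.ofReal_add (by positivity) (by positivity),
      ← ENNReal.ofReal_add (by positivity) (by positivity),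
      ← ENNReal.ofReal_add (by positivity) (by positivity)]
    exact ENNReal.ofReal_le_ofReal this

end NeedleData

/-! ### From weighted square integrability to L¹-bounds. -/

theorem lintegral_rpow_neg_ne_top {s : ℝ} (hs : s < 1) (M : ℝ) :
    ∫⁻ y in Ioc (0 : ℝ) M, ENNReal.ofReal (y ^ (-s)) ≠ ⊤ := by
  have h := (intervalIntegral.intervalIntegrable_rpow' (a := 0) (b := M) (by linarith : -1 < -s)).1
  have h2 := h.2
  rw [hasFiniteIntegral_iff_enorm] at h2
  refine ((lintegral_mono fun y => ?_).trans_lt h2).ne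
  rw [Real.enorm_eq_ofReal_abs]
  exact ENNReal.ofReal_le_ofReal (le_abs_self _)

namespace NeedleData

variable {G : ℕ → ℝ} {a b c d : E3} {C₀ : ℝ} {m : ℕ} (N : NeedleData G a b c d C₀ m)

theorem abs_det_eq : |det3 N.F.P N.F.Q N.F.V| =
    N.F.lam ^ 2 * |N.D| * |det3 (c - a) (d - a) (b - a)| := by
  have : det3 N.F.P N.F.Q N.F.V = N.F.lam ^ 2 * N.D * det3 (c - a) (d - a) (b - a) := by
    rw [N.P_eq, N.Q_eq, N.V_eq, N.s_eq]
    simp only [det3_eq, PiLp.sub_apply, PiLp.add_apply, PiLp.smul_apply, smul_eq_mul]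
    ring
  rw [this, abs_mul, abs_mul, abs_of_pos (pow_pos N.F.lam_pos 2)]

/-- Integrability of negative powers of the distance from the edge. -/
theorem exists_weight_constant (hG : IsGrading G) (hdet : det3 (c - a) (d - a) (b - a) ≠ 0)
    {s : ℝ} (hs0 : 0 ≤ s) (hs : s < 1) : ∃ K : ℝ, 0 < K ∧ ∀ N : NeedleData G a b c d C₀ m,
      (∫⁻ x in N.S, ENNReal.ofReal (edgeDist a b x ^ (-s)) ^ 2) ^ (1 / 2 : ℝ) ≤
        ENNReal.ofReal (K * (N.F.lam ^ (1 - s) * |N.D| ^ (1 / 2 : ℝ))) := by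
  obtain ⟨κ, hκ, hlow⟩ := exists_edgeDist_lower hdet
  set M := coordBound G m with hM
  set I := ∫⁻ y in Ioc (0 : ℝ) M, ENNReal.ofReal (y ^ (-s)) with hI
  have hItop : I ≠ ⊤ := lintegral_rpow_neg_ne_top hs M
  have hM1 := one_le_coordBound hG m
  set Δ := |det3 (c - a) (d - a) (b - a)| with hΔ
  have hΔ0 : 0 < Δ := abs_pos.2 hdet
  have hM0 : 0 ≤ M := zero_le_one.trans hM1
  set K := Δ * (κ ^ (-(2 * s))) * (I.toReal * I.toReal * M) with hK
  have hK0 : 0 ≤ K := by positivity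
  refine ⟨(K + 1) ^ (1 / 2 : ℝ), by positivity, fun N => ?_⟩
  have hlam := N.F.lam_pos
  have hD := abs_pos.2 N.D_ne
  have hsub : N.S ⊆ N.F.map '' (Ioc 0 M ×ˢ Ioc 0 M ×ˢ Icc 0 M) := by
    intro x hx
    obtain ⟨y, rfl, h1, h2⟩ := N.exists_coords hG hx
    obtain ⟨z, ⟨h3, h4, h5⟩, hz⟩ := N.S_subset_box hG hx
    obtain rfl := boxMap_injective _ N.F.det_ne hz
    exact mem_image_of_mem _ ⟨⟨h1, h3.2⟩, ⟨h2, h4.2⟩, h5⟩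
  have hpt : ∀ y ∈ Ioc (0 : ℝ) M ×ˢ Ioc (0 : ℝ) M ×ˢ Icc (0 : ℝ) M,
      ENNReal.ofReal (edgeDist a b (N.F.map y) ^ (-s)) ^ 2 ≤
      ENNReal.ofReal ((κ * N.F.lam) ^ (-(2 * s))) *
        (ENNReal.ofReal (y.1 ^ (-s)) * (ENNReal.ofReal (y.2.1 ^ (-s)) * 1)) := by
    rintro ⟨y, z, w⟩ ⟨h1, h2, -⟩
    have hy : 0 < y := h1.1
    have hz : 0 < z := h2.1
    have hE : 0 ≤ edgeDist a b (N.F.map (y, z, w)) := norm_nonneg _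
    simp only [mul_one]
    rw [← ENNReal.ofReal_pow (by positivity), ← ENNReal.ofReal_mul (by positivity),
      ← ENNReal.ofReal_mul (by positivity)]
    refine ENNReal.ofReal_le_ofReal ?_
    -- r is at least κλ(y + z), and y + z dominates the geometric mean. Hence r^(-2s) is bounded by
    -- a multiple of y^(-s) z^(-s), whose integral factorises and is finite for s < 1.
    have hr : κ * N.F.lam * (y ^ (1 / 2 : ℝ) * z ^ (1 / 2 : ℝ)) ≤
        edgeDist a b (N.F.map (y, z, w)) := by
      rw [N.edgeDist_map (ne_of_det hdet)]
      have h := hlow y z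
      rw [abs_of_pos hy, abs_of_pos hz] at h
      have h2 : y ^ (1 / 2 : ℝ) * z ^ (1 / 2 : ℝ) ≤ y + z := by
        have e1 : (y ^ (1 / 2 : ℝ)) ^ 2 = y := by
          rw [← Real.rpow_natCast, ← Real.rpow_mul hy.le]; norm_num
        have e2 : (z ^ (1 / 2 : ℝ)) ^ 2 = z := by
          rw [← Real.rpow_natCast, ← Real.rpow_mul hz.le]; norm_num
        have := sq_nonneg (y ^ (1 / 2 : ℝ) - z ^ (1 / 2 : ℝ))
        have := mul_nonneg (Real.rpow_nonneg hy.le (1 / 2)) (Real.rpow_nonneg hz.le (1 / 2))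
        linarith
      have h3 := mul_le_mul_of_nonneg_left h2 hκ.le
      have h4 := mul_le_mul_of_nonneg_left (h3.trans h) hlam.le
      linarith
    have hX0 : 0 < κ * N.F.lam := by positivity
    generalize κ * N.F.lam = X at hr hX0 ⊢
    have h0 : 0 < X * (y ^ (1 / 2 : ℝ) * z ^ (1 / 2 : ℝ)) := by positivity
    have h3 := Real.rpow_le_rpow_of_nonpos h0 hr (by linarith : -s ≤ 0)
    have h4 := pow_le_pow_left₀ (by positivity) h3 2
    refine h4.trans (le_of_eq ?_)
    rw [← Real.rpow_natCast, ← Real.rpow_mul h0.le, Real.mul_rpow (by positivity) (by positivity),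
      Real.mul_rpow (by positivity) (by positivity), ← Real.rpow_mul hy.le, ← Real.rpow_mul hz.le]
    have e1 : (1 / 2 : ℝ) * (-s * ((2 : ℕ) : ℝ)) = -s := by push_cast; ring
    have e2 : -s * ((2 : ℕ) : ℝ) = -(2 * s) := by push_cast; ring
    rw [e1, e2]
  have hint : ∫⁻ x in N.S, ENNReal.ofReal (edgeDist a b x ^ (-s)) ^ 2 ≤
      ENNReal.ofReal (K * (N.F.lam ^ (2 * (1 - s)) * |N.D|)) := by
    refine (lintegral_mono_set hsub).trans ?_
    unfold PrismFrame.map at hpt ⊢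
    rw [setLIntegral_boxMap_image _ N.F.det_ne, N.abs_det_eq]
    have hmeas : MeasurableSet (Ioc (0 : ℝ) M ×ˢ Ioc (0 : ℝ) M ×ˢ Icc (0 : ℝ) M) :=
      measurableSet_Ioc.prod (measurableSet_Ioc.prod measurableSet_Icc)
    have hm : ∀ t, AEMeasurable (fun y : ℝ => ENNReal.ofReal (y ^ (-s)))
        (volume.restrict (Ioc (0 : ℝ) t)) := fun t =>
      (measurable_id.pow_const (-s)).ennreal_ofReal.aemeasurable
    have hprod : ∫⁻ y in Ioc (0 : ℝ) M ×ˢ Ioc (0 : ℝ) M ×ˢ Icc (0 : ℝ) M,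
        ENNReal.ofReal (y.1 ^ (-s)) * (ENNReal.ofReal (y.2.1 ^ (-s)) * 1) =
        I * (I * ENNReal.ofReal M) := by
      rw [Measure.volume_eq_prod, ← Measure.prod_restrict,
        lintegral_prod_mul (f := fun y : ℝ => ENNReal.ofReal (y ^ (-s)))
          (g := fun q : ℝ × ℝ => ENNReal.ofReal (q.1 ^ (-s)) * 1) (hm M)
          ((measurable_fst.pow_const (-s)).ennreal_ofReal.mul_const 1).aemeasurable]
      congr 1
      rw [Measure.volume_eq_prod, ← Measure.prod_restrict,
        lintegral_prod_mul (f := fun y : ℝ => ENNReal.ofReal (y ^ (-s)))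
          (g := fun _ : ℝ => 1) (hm M) aemeasurable_const]
      simp
      rfl
    refine (mul_le_mul_right (setLIntegral_mono' hmeas hpt) _).trans ?_
    rw [lintegral_const_mul' _ _ ENNReal.ofReal_ne_top, hprod, ← ENNReal.ofReal_toReal hItop,
      ← ENNReal.ofReal_mul (by positivity), ← ENNReal.ofReal_mul (by positivity),
      ← ENNReal.ofReal_mul (by positivity), ← ENNReal.ofReal_mul (by positivity)]
    refine ENNReal.ofReal_le_ofReal (le_of_eq ?_)
    -- The factor λ² is from the Jacobian λ²|D|, the other one from the scaling of r^(-2s).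
    have e1 : N.F.lam ^ (2 * (1 - s)) = N.F.lam ^ 2 * N.F.lam ^ (-(2 * s)) := by
      rw [← Real.rpow_natCast, ← Real.rpow_add hlam]; congr 1; push_cast; ring
    rw [hK, e1, Real.mul_rpow hκ.le hlam.le]
    ring
  refine (ENNReal.rpow_le_rpow hint (by norm_num)).trans ?_
  clear_value K
  rw [ENNReal.ofReal_rpow_of_nonneg (by positivity) (by norm_num)]
  refine ENNReal.ofReal_le_ofReal ?_
  rw [Real.mul_rpow hK0 (by positivity), Real.mul_rpow (by positivity) (by positivity),
    ← Real.rpow_mul hlam.le]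
  have e : 2 * (1 - s) * (1 / 2) = 1 - s := by ring
  rw [e]
  exact mul_le_mul_of_nonneg_right (Real.rpow_le_rpow hK0 (by linarith) (by norm_num))
    (by positivity)

/-- The Cauchy-Schwarz inequality with weights. -/
theorem lintegral_le_weighted {S : Set E3} (hS : MeasurableSet S) {r f w : E3 → ℝ} {s A : ℝ}
    (hA : 0 ≤ A) (hr : Measurable r) (hr0 : ∀ x ∈ S, 0 < r x) (hw : ∀ x ∈ S, r x ^ s ≤ A * w x)
    {g : E3 → ENNReal} (hg : ∀ x ∈ S, ‖w x * f x‖ₑ ≤ g x)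
    (hf : AEMeasurable f (volume.restrict S)) :
    ∫⁻ x in S, ‖f x‖ₑ ≤ ENNReal.ofReal A *
      ((∫⁻ x in S, ENNReal.ofReal (r x ^ (-s)) ^ 2) ^ (1 / 2 : ℝ) *
        (∫⁻ x in S, g x ^ 2) ^ (1 / 2 : ℝ)) := by
  have hpt : ∀ x ∈ S, ‖f x‖ₑ ≤ ENNReal.ofReal (r x ^ (-s)) * ‖r x ^ s * f x‖ₑ := by
    intro x hx
    rw [enorm_mul, ← mul_assoc, Real.enorm_of_nonneg (Real.rpow_nonneg (hr0 x hx).le _),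
      ← ENNReal.ofReal_mul (Real.rpow_nonneg (hr0 x hx).le _), ← Real.rpow_add (hr0 x hx)]
    simp
  have hpt2 : ∀ x ∈ S, ‖r x ^ s * f x‖ₑ ≤ ENNReal.ofReal A * g x := by
    intro x hx
    have h0 := Real.rpow_nonneg (hr0 x hx).le s
    rw [enorm_mul, Real.enorm_of_nonneg h0]
    refine le_trans ?_ (mul_le_mul_right (hg x hx) _)
    rw [enorm_mul, ← mul_assoc]
    refine mul_le_mul_left ?_ _
    rw [Real.enorm_eq_ofReal_abs, ← ENNReal.ofReal_mul hA]
    exact ENNReal.ofReal_le_ofReal ((hw x hx).trans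
      (mul_le_mul_of_nonneg_left (le_abs_self _) hA))
  refine (setLIntegral_mono' hS hpt).trans ?_
  have hcs := ENNReal.lintegral_mul_le_Lp_mul_Lq (volume.restrict S)
    (p := 2) (q := 2) ⟨by norm_num, by norm_num, by norm_num⟩
    (f := fun x => ENNReal.ofReal (r x ^ (-s))) (g := fun x => ‖r x ^ s * f x‖ₑ)
    ((hr.pow_const (-s)).ennreal_ofReal.aemeasurable)
    ((hr.pow_const s).aemeasurable.mul hf).enorm
  refine hcs.trans ?_
  simp only [ENNReal.rpow_two]
  rw [mul_left_comm]
  refine mul_le_mul_right ?_ _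
  have : ∫⁻ x in S, ‖r x ^ s * f x‖ₑ ^ 2 ≤ ENNReal.ofReal A ^ 2 * ∫⁻ x in S, g x ^ 2 := by
    rw [← lintegral_const_mul' _ _ (by finiteness)]
    refine setLIntegral_mono' hS fun x hx => ?_
    rw [← mul_pow]
    exact pow_le_pow_left' (hpt2 x hx) 2
  refine (ENNReal.rpow_le_rpow this (by norm_num)).trans (le_of_eq ?_)
  rw [ENNReal.mul_rpow_of_nonneg _ _ (by norm_num), ← ENNReal.rpow_natCast, ← ENNReal.rpow_mul]
  norm_num

/-- The weighted norm of a partial derivative, with the weight `w`. -/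
def wNorm (w : E3 → ℝ) (i : Fin 3) : ENNReal :=
  ((∫⁻ x in N.S, ‖w x / edgeDist a b x * partialOf N.e N.W i x‖ₑ ^ 2) +
    ∫⁻ x in N.S, ‖w x • N.H i x‖ₑ ^ 2) ^ (1 / 2 : ℝ)

theorem aemeasurable_partialOf (i : Fin 3) :
    AEMeasurable (partialOf N.e N.W i) (volume.restrict N.S) :=
  (N.weak' i).1.aestronglyMeasurable.aemeasurable

/-- Cauchy-Schwarz, separately for ∂ᵢu / r and for the gradient of ∂ᵢu; both are parts of the same
weighted norm. -/
theorem exists_lintegral_constant (hG : IsGrading G) (hdet : det3 (c - a) (d - a) (b - a) ≠ 0)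
    {s : ℝ} (hs0 : 0 ≤ s) (hs : s < 1) : ∃ K : ℝ, 0 < K ∧ ∀ (N : NeedleData G a b c d C₀ m)
      (w : E3 → ℝ) (A : ℝ), 0 ≤ A → (∀ x ∈ N.S, edgeDist a b x ^ s ≤ A * w x) → ∀ i,
      ∫⁻ x in N.S, ENNReal.ofReal (N.pd i x / edgeDist a b x + ‖N.H i x‖) ≤
        ENNReal.ofReal (K * (A * (N.F.lam ^ (1 - s) * |N.D| ^ (1 / 2 : ℝ)))) * N.wNorm w i := by
  obtain ⟨K, hK, h⟩ := exists_weight_constant (C₀ := C₀) (m := m) hG hdet hs0 hs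
  refine ⟨2 * K, by positivity, fun N w A hA hw i => ?_⟩
  have hr : Measurable (edgeDist a b) := (continuous_edgeDist a b).measurable
  have hr0 : ∀ x ∈ N.S, 0 < edgeDist a b x := fun x hx => N.edgeDist_pos hG hdet hx
  have hS := N.isOpen_S.measurableSet
  have m1 : AEMeasurable (fun x => partialOf N.e N.W i x / edgeDist a b x)
      (volume.restrict N.S) := (N.aemeasurable_partialOf i).div hr.aemeasurable
  have m2 : AEMeasurable (fun x => ‖N.H i x‖) (volume.restrict N.S) :=
    (N.weak' i).2.1.aestronglyMeasurable.norm.aemeasurable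
  have i1 := lintegral_le_weighted hS (s := s) hA hr hr0 hw
    (g := fun x => ‖w x / edgeDist a b x * partialOf N.e N.W i x‖ₑ)
    (fun x hx => le_of_eq (by rw [mul_div_assoc', div_mul_eq_mul_div])) m1
  have i2 := lintegral_le_weighted hS (s := s) hA hr hr0 hw (g := fun x => ‖w x • N.H i x‖ₑ)
    (fun x hx => le_of_eq (by rw [enorm_mul, enorm_smul, enorm_norm])) m2
  have hb : ∀ J : ENNReal, J ^ (1 / 2 : ℝ) ≤ N.wNorm w i →
      ENNReal.ofReal A * ((∫⁻ x in N.S, ENNReal.ofReal (edgeDist a b x ^ (-s)) ^ 2) ^ (1 / 2 : ℝ) *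
        J ^ (1 / 2 : ℝ)) ≤
      ENNReal.ofReal (K * (A * (N.F.lam ^ (1 - s) * |N.D| ^ (1 / 2 : ℝ)))) * N.wNorm w i := by
    intro J hJ
    rw [← mul_assoc]
    refine mul_le_mul' ?_ hJ
    refine (mul_le_mul_right (h N) _).trans (le_of_eq ?_)
    rw [← ENNReal.ofReal_mul hA]
    congr 1; ring
  have j1 := i1.trans (hb _ (ENNReal.rpow_le_rpow le_self_add (by norm_num)))
  have j2 := i2.trans (hb _ (ENNReal.rpow_le_rpow le_add_self (by norm_num)))
  have hlam := N.F.lam_pos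
  have e : ENNReal.ofReal (2 * K * (A * (N.F.lam ^ (1 - s) * |N.D| ^ (1 / 2 : ℝ)))) =
      ENNReal.ofReal (K * (A * (N.F.lam ^ (1 - s) * |N.D| ^ (1 / 2 : ℝ)))) +
      ENNReal.ofReal (K * (A * (N.F.lam ^ (1 - s) * |N.D| ^ (1 / 2 : ℝ)))) := by
    rw [← ENNReal.ofReal_add (by positivity) (by positivity)]; congr 1; ring
  rw [e, add_mul]
  refine le_trans ?_ (add_le_add j1 j2)
  rw [← lintegral_add_right' _ m2.enorm]
  refine setLIntegral_mono' hS fun x hx => ?_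
  rw [← ofReal_abs_eq_enorm, ← ofReal_abs_eq_enorm, ← ENNReal.ofReal_add (abs_nonneg _)
    (abs_nonneg _), abs_div, abs_of_pos (hr0 x hx), abs_norm]
  rfl

end NeedleData

/-! ### The error estimate in a layer. -/

theorem enorm_edgeProj_le (u : E3 → ℝ) (n k : E3) :
    ‖edgeProj u n k‖ₑ ≤ 4 * ∫⁻ t in Ioo (0 : ℝ) 1, ‖u (n + t • (k - n))‖ₑ := by
  rw [edgeProj, intervalIntegral.integral_of_le zero_le_one, integral_Ioc_eq_integral_Ioo]
  refine (enorm_integral_le_lintegral_enorm _).trans ?_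
  rw [← lintegral_const_mul' _ _ (by norm_num)]
  refine setLIntegral_mono' measurableSet_Ioo fun t ht => ?_
  rw [enorm_mul]
  refine mul_le_mul_left ?_ _
  rw [Real.enorm_eq_ofReal_abs]
  refine (ENNReal.ofReal_le_ofReal (abs_le.2 ⟨?_, ?_⟩ : |4 - 6 * t| ≤ 4)).trans (by simp)
  · linarith [ht.2]
  · linarith [ht.1]

theorem ofReal_mul_ofReal_mul {x : ℝ} (hx : 0 ≤ x) (y : ℝ) (z : ENNReal) :
    ENNReal.ofReal x * (ENNReal.ofReal y * z) = ENNReal.ofReal (x * y) * z := by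
  rw [← mul_assoc, ← ENNReal.ofReal_mul hx]

namespace NeedleData

variable {G : ℕ → ℝ} {a b c d : E3} {C₀ : ℝ} {m : ℕ} (N : NeedleData G a b c d C₀ m)

/-- The right-hand side of the error estimate, for weights that dominate powers of the distance
from the edge. -/
def bound (s s₃ : ℝ) (w w₃ : E3 → ℝ) (A A₃ : ℝ) : ENNReal :=
  ENNReal.ofReal (A * N.F.lam ^ (1 - s)) * (N.wNorm w 0 + N.wNorm w 1) +
    ENNReal.ofReal (A₃ * (N.F.lam ^ (-s₃) * |N.D|)) * N.wNorm w₃ 2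

theorem flip_bound (s s₃ : ℝ) (w w₃ : E3 → ℝ) (A A₃ : ℝ) :
    N.flip.bound s s₃ w w₃ A A₃ = N.bound s s₃ w w₃ A A₃ := by
  have : |N.flip.D| = |N.D| := abs_neg _
  unfold bound
  rw [this]
  rfl

/-- The weights dominate powers of the distance from the edge. -/
structure Dominates (s s₃ : ℝ) (w w₃ : E3 → ℝ) (A A₃ : ℝ) : Prop where
  pos : 0 ≤ A
  pos₃ : 0 ≤ A₃
  le : ∀ x ∈ N.S, edgeDist a b x ^ s ≤ A * w x
  le₃ : ∀ x ∈ N.S, edgeDist a b x ^ s₃ ≤ A₃ * w₃ x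

/-- The factors λ² and λ|D| of the majorant meet the factors λ^(1-s)|D|^(1/2) and λ^(1-s₃)|D|^(1/2)
of Cauchy-Schwarz. Both products contain λ²|D|^(1/2), and what remains are the coefficients of
`bound`. -/
theorem exists_J_constant (hG : IsGrading G) (hdet : det3 (c - a) (d - a) (b - a) ≠ 0)
    {s s₃ : ℝ} (hs0 : 0 ≤ s) (hs : s < 1) (hs₃0 : 0 ≤ s₃) (hs₃ : s₃ < 1) :
    ∃ K : ℝ, 0 < K ∧ ∀ (N : NeedleData G a b c d C₀ m) (w w₃ : E3 → ℝ) (A A₃ : ℝ),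
      N.Dominates s s₃ w w₃ A A₃ → (N.loc hG hdet).J ≤
        ENNReal.ofReal (K * (N.F.lam ^ 2 * |N.D| ^ (1 / 2 : ℝ))) * N.bound s s₃ w w₃ A A₃ := by
  obtain ⟨K₁, hK₁, h₁⟩ := exists_lintegral_constant (C₀ := C₀) (m := m) hG hdet hs0 hs
  obtain ⟨K₂, hK₂, h₂⟩ := exists_lintegral_constant (C₀ := C₀) (m := m) hG hdet hs₃0 hs₃
  have hc := majConst_pos (a := a) (b := b) (c := c) (d := d) (C₀ := C₀) (m := m) hG
  set k := majConst G a b c d C₀ m with hk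
  refine ⟨k * (K₁ + K₂), by positivity, fun N w w₃ A A₃ hw => ?_⟩
  have hlam := N.F.lam_pos
  have hD := abs_pos.2 N.D_ne
  have hA := hw.pos
  have hA₃ := hw.pos₃
  have hr : Measurable (edgeDist a b) := (continuous_edgeDist a b).measurable
  set ψ : Fin 3 → E3 → ENNReal := fun i x =>
    ENNReal.ofReal (N.pd i x / edgeDist a b x + ‖N.H i x‖) with hψ
  have hm : ∀ i, AEMeasurable (ψ i) (volume.restrict N.S) := fun i =>
    (((N.aemeasurable_partialOf i).abs.div hr.aemeasurable).add
      (N.weak' i).2.1.aestronglyMeasurable.norm.aemeasurable).ennreal_ofReal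
  have e : (N.loc hG hdet).J = ENNReal.ofReal (k * N.F.lam ^ 2) *
      ((∫⁻ x in N.S, ψ 0 x) + ∫⁻ x in N.S, ψ 1 x) +
      ENNReal.ofReal (k * (N.F.lam * |N.D|)) * ∫⁻ x in N.S, ψ 2 x := by
    rw [← lintegral_add_left' (hm 0), ← lintegral_const_mul' _ _ ENNReal.ofReal_ne_top,
      ← lintegral_const_mul' _ _ ENNReal.ofReal_ne_top,
      ← lintegral_add_right' _ ((hm 2).const_mul _)]
    refine lintegral_congr fun x => ?_
    have h0 : 0 ≤ edgeDist a b x := norm_nonneg _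
    have p0 := N.pd_nonneg 0 x
    have p1 := N.pd_nonneg 1 x
    have p2 := N.pd_nonneg 2 x
    simp only [hψ]
    rw [← ENNReal.ofReal_add (by positivity) (by positivity), ← ENNReal.ofReal_mul (by positivity),
      ← ENNReal.ofReal_mul (by positivity), ← ENNReal.ofReal_add (by positivity) (by positivity)]
    change ENNReal.ofReal (k * N.maj x) = _
    congr 1
    unfold maj
    ring
  rw [e, bound, mul_add (ENNReal.ofReal (k * (K₁ + K₂) * _)), ofReal_mul_ofReal_mul (by positivity),
    ofReal_mul_ofReal_mul (by positivity)]
  have i0 := h₁ N w A hA hw.le 0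
  have i1 := h₁ N w A hA hw.le 1
  have i2 := h₂ N w₃ A₃ hA₃ hw.le₃ 2
  refine add_le_add ?_ ?_
  · refine (mul_le_mul_right (add_le_add i0 i1) _).trans ?_
    rw [← mul_add, ofReal_mul_ofReal_mul (by positivity)]
    refine mul_le_mul_left (ENNReal.ofReal_le_ofReal ?_) _
    have : 0 ≤ k * K₂ * (N.F.lam ^ 2 * |N.D| ^ (1 / 2 : ℝ)) * (A * N.F.lam ^ (1 - s)) := by
      positivity
    linarith
  · refine (mul_le_mul_right i2 _).trans ?_
    rw [ofReal_mul_ofReal_mul (by positivity)]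
    refine mul_le_mul_left (ENNReal.ofReal_le_ofReal ?_) _
    have : 0 ≤ k * K₁ * (N.F.lam ^ 2 * |N.D| ^ (1 / 2 : ℝ)) * (A₃ * (N.F.lam ^ (-s₃) * |N.D|)) := by
      positivity
    have e1 : N.F.lam ^ (1 - s₃) = N.F.lam * N.F.lam ^ (-s₃) := by
      rw [sub_eq_add_neg, Real.rpow_add hlam, Real.rpow_one]
    rw [e1]
    linarith

/-- The functionals of the interpolant, at the bottom. -/
theorem exists_edgeProj_bot_constant (hG : IsGrading G) (hGm : Monotone G)
    (hdet : det3 (c - a) (d - a) (b - a) ≠ 0)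
    {s s₃ : ℝ} (hs0 : 0 ≤ s) (hs : s < 1) (hs₃0 : 0 ≤ s₃) (hs₃ : s₃ < 1) :
    ∃ K : ℝ, 0 < K ∧ ∀ (N : NeedleData G a b c d C₀ m) (w w₃ : E3 → ℝ) (A A₃ : ℝ),
      N.Dominates s s₃ w w₃ A A₃ → ∀ τ ∈ N.B, ∀ p ∈ τ, ∀ q ∈ τ, p ≠ q →
      ‖edgeProj N.u (N.F.bot p) (N.F.bot q)‖ₑ ≤
        ENNReal.ofReal (K * (|N.D| ^ (1 / 2 : ℝ))⁻¹) * N.bound s s₃ w w₃ A A₃ := by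
  obtain ⟨K, hK, h⟩ := exists_J_constant (C₀ := C₀) (m := m) hG hdet hs0 hs hs₃0 hs₃
  obtain ⟨K₁, hK₁, h₁⟩ := LocalFunction.exists_patch_constant hG hGm m
  obtain ⟨K₂, hK₂, h₂⟩ := LocalFunction.exists_edge_constant hG hGm (m + 1)
  set k : ENNReal := 4 * K₂ * (K₁ + 1) with hk
  have hktop : k ≠ ⊤ := by finiteness
  have hΔ : 0 < |det3 (c - a) (d - a) (b - a)| := abs_pos.2 hdet
  refine ⟨(k.toReal + 1) * (|det3 (c - a) (d - a) (b - a)|⁻¹ * K), by positivity,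
    fun N w w₃ A A₃ hw τ hτ p hp q hq hpq => ?_⟩
  have hlam := N.F.lam_pos
  have hD := abs_pos.2 N.D_ne
  set X := N.loc hG hdet with hX
  obtain ⟨hl, hI⟩ := h₁ N.F X N.corner N.card_le N.connected τ hτ
  calc ‖edgeProj N.u (N.F.bot p) (N.F.bot q)‖ₑ ≤ 4 * (K₂ *
        (ENNReal.ofReal |det3 N.F.P N.F.Q N.F.V|⁻¹ * (X.I τ + X.J))) :=
        (enorm_edgeProj_le _ _ _).trans (mul_le_mul_right (h₂ N.F X τ hτ hl p hp q hq hpq) _)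
    _ ≤ 4 * (K₂ * (ENNReal.ofReal |det3 N.F.P N.F.Q N.F.V|⁻¹ * (K₁ * X.J + X.J))) := by gcongr
    _ = k * (ENNReal.ofReal |det3 N.F.P N.F.Q N.F.V|⁻¹ * X.J) := by rw [hk]; ring
    _ ≤ ENNReal.ofReal (k.toReal + 1) * (ENNReal.ofReal |det3 N.F.P N.F.Q N.F.V|⁻¹ *
        (ENNReal.ofReal (K * (N.F.lam ^ 2 * |N.D| ^ (1 / 2 : ℝ))) * N.bound s s₃ w w₃ A A₃)) := by
        refine mul_le_mul' ?_ (mul_le_mul_right (h N w w₃ A A₃ hw) _)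
        rw [← ENNReal.ofReal_toReal hktop, ENNReal.toReal_ofReal ENNReal.toReal_nonneg]
        exact ENNReal.ofReal_le_ofReal (by linarith)
    _ = _ := by
        rw [ofReal_mul_ofReal_mul (by positivity), ofReal_mul_ofReal_mul (by positivity), N.abs_det_eq]
        -- The determinant of the frame is λ²|D| times a constant. So λ² cancels, and |D|^(1/2) /
        -- |D| = |D|^(-1/2) is left.
        congr 2
        have e : |N.D| ^ (1 / 2 : ℝ) * |N.D| ^ (1 / 2 : ℝ) = |N.D| := by
          rw [← Real.rpow_add hD]; norm_num
        have hne : |N.D| ^ (1 / 2 : ℝ) ≠ 0 := by positivity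
        generalize |N.D| ^ (1 / 2 : ℝ) = z at e hne ⊢
        rw [← e]
        field_simp

/-- The upper edges are the lower edges of the flipped layer, which has the same patch, norms and
bound. -/
theorem exists_edgeProj_constant (hG : IsGrading G) (hGm : Monotone G)
    (hdet : det3 (c - a) (d - a) (b - a) ≠ 0)
    {s s₃ : ℝ} (hs0 : 0 ≤ s) (hs : s < 1) (hs₃0 : 0 ≤ s₃) (hs₃ : s₃ < 1) :
    ∃ K : ℝ, 0 < K ∧ ∀ (N : NeedleData G a b c d C₀ m) (w w₃ : E3 → ℝ) (A A₃ : ℝ),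
      N.Dominates s s₃ w w₃ A A₃ → ∀ τ ∈ N.B, ∀ p ∈ τ, ∀ q ∈ τ, p ≠ q →
      ‖edgeProj N.u (N.F.bot p) (N.F.bot q)‖ₑ ≤
        ENNReal.ofReal (K * (|N.D| ^ (1 / 2 : ℝ))⁻¹) * N.bound s s₃ w w₃ A A₃ ∧
      ‖edgeProj N.u (N.F.top p) (N.F.top q)‖ₑ ≤
        ENNReal.ofReal (K * (|N.D| ^ (1 / 2 : ℝ))⁻¹) * N.bound s s₃ w w₃ A A₃ := by
  obtain ⟨K, hK, h⟩ := exists_edgeProj_bot_constant (C₀ := C₀) (m := m) hG hGm hdet hs0 hs hs₃0 hs₃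
  refine ⟨K, hK, fun N w w₃ A A₃ hw τ hτ p hp q hq hpq =>
    ⟨h N w w₃ A A₃ hw τ hτ p hp q hq hpq, ?_⟩⟩
  have := h N.flip w w₃ A A₃ ⟨hw.pos, hw.pos₃, hw.le, hw.le₃⟩ τ hτ p hp q hq hpq
  have e : |N.flip.D| = |N.D| := abs_neg _
  rw [flip_bound, e] at this
  have e2 : ∀ p, N.flip.F.bot p = N.F.top p := fun p => N.F.flip_bot p
  rwa [e2, e2] at this

/-- The first order term. -/
theorem exists_direct_constant (hG : IsGrading G) (hdet : det3 (c - a) (d - a) (b - a) ≠ 0)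
    {s s₃ : ℝ} (hs : s < 1) (hs₃ : s₃ < 1) :
    ∃ K : ℝ, 0 < K ∧ ∀ (N : NeedleData G a b c d C₀ m) (w w₃ : E3 → ℝ) (A A₃ : ℝ),
      N.Dominates s s₃ w w₃ A A₃ →
      (∫⁻ x in N.S, ‖N.W x‖ₑ ^ 2) ^ (1 / 2 : ℝ) ≤ ENNReal.ofReal K * N.bound s s₃ w w₃ A A₃ := by
  have hE := one_le_edgeBound a b c d
  have hM := one_le_coordBound hG m
  set L := 2 * edgeBound a b c d * coordBound G m with hL
  have hL0 : 0 < L := by positivity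
  have hone : ∀ {s : ℝ}, s < 1 → ∀ (N : NeedleData G a b c d C₀ m) (w : E3 → ℝ) (A : ℝ), 0 ≤ A →
      (∀ x ∈ N.S, edgeDist a b x ^ s ≤ A * w x) → ∀ i,
      (∫⁻ x in N.S, ‖partialOf N.e N.W i x‖ₑ ^ 2) ^ (1 / 2 : ℝ) ≤
        ENNReal.ofReal (L ^ (1 - s) * (A * N.F.lam ^ (1 - s))) * N.wNorm w i := by
    intro s hs N w A hA hw i
    have hlam := N.F.lam_pos
    have hpt : ∀ x ∈ N.S, ‖partialOf N.e N.W i x‖ₑ ^ 2 ≤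
        ENNReal.ofReal (L ^ (1 - s) * (A * N.F.lam ^ (1 - s))) ^ 2 *
          ‖w x / edgeDist a b x * partialOf N.e N.W i x‖ₑ ^ 2 := by
      intro x hx
      have hr := N.edgeDist_pos hG hdet hx
      rw [← mul_pow]
      refine pow_le_pow_left' ?_ 2
      rw [← ofReal_abs_eq_enorm, ← ofReal_abs_eq_enorm, ← ENNReal.ofReal_mul (by positivity)]
      refine ENNReal.ofReal_le_ofReal ?_
      rw [abs_mul, ← mul_assoc]
      refine le_mul_of_one_le_left (abs_nonneg _) ?_
      rw [abs_div, abs_of_pos hr]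
      have h1 := hw x hx
      have h2 := N.edgeDist_le hG (ne_of_det hdet) hx
      rw [← hL] at h2
      have h3 := Real.rpow_le_rpow hr.le h2 (by linarith : 0 ≤ 1 - s)
      rw [Real.mul_rpow hL0.le hlam.le] at h3
      -- The first factor is at most (Lλ)^(1-s), as the patch is within distance Lλ of the edge; the
      -- second is at most A w.
      have h4 : edgeDist a b x = edgeDist a b x ^ (1 - s) * edgeDist a b x ^ s := by
        rw [← Real.rpow_add hr]; simp
      rw [mul_div_assoc', le_div_iff₀ hr, one_mul, h4]
      have h5 : A * w x ≤ A * |w x| := mul_le_mul_of_nonneg_left (le_abs_self _) hA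
      have h6 := mul_le_mul h3 (h1.trans h5) (by positivity) (by positivity)
      linarith
    have := ENNReal.rpow_le_rpow (setLIntegral_mono' (μ := volume) N.isOpen_S.measurableSet hpt)
      (by norm_num : (0 : ℝ) ≤ 1 / 2)
    rw [lintegral_const_mul' _ _ (by finiteness), ENNReal.mul_rpow_of_nonneg _ _ (by norm_num),
      ← ENNReal.rpow_natCast, ← ENNReal.rpow_mul] at this
    refine this.trans ?_
    have e : ((2 : ℕ) : ℝ) * (1 / 2) = 1 := by norm_num
    rw [e, ENNReal.rpow_one]
    exact mul_le_mul_right (ENNReal.rpow_le_rpow le_self_add (by norm_num)) _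
  refine ⟨L ^ (1 - s) + L ^ (1 - s₃) * (1 + |C₀|), by positivity, fun N w w₃ A A₃ hw => ?_⟩
  have hlam := N.F.lam_pos
  have hA := hw.pos
  have hA₃ := hw.pos₃
  have i0 := hone hs N w A hA hw.le 0
  have i1 := hone hs N w A hA hw.le 1
  have i2 := hone hs₃ N w₃ A₃ hA₃ hw.le₃ 2
  have hm : ∀ i, AEMeasurable (fun x => ‖partialOf N.e N.W i x‖ₑ ^ 2) (volume.restrict N.S) :=
    fun i => (N.aemeasurable_partialOf i).enorm.pow_const 2
  have hW : ∀ x, ‖N.W x‖ₑ ^ 2 = ‖partialOf N.e N.W 0 x‖ₑ ^ 2 + ‖partialOf N.e N.W 1 x‖ₑ ^ 2 +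
      ‖partialOf N.e N.W 2 x‖ₑ ^ 2 := by
    intro x
    simp only [← ofReal_norm]
    rw [← ENNReal.ofReal_pow (norm_nonneg _), ← ENNReal.ofReal_pow (norm_nonneg _),
      ← ENNReal.ofReal_pow (norm_nonneg _), ← ENNReal.ofReal_pow (norm_nonneg _),
      ← ENNReal.ofReal_add (by positivity) (by positivity),
      ← ENNReal.ofReal_add (by positivity) (by positivity), ← N.e.sum_sq_norm_inner_right (N.W x),
      Fin.sum_univ_three]
    rfl
  simp_rw [hW]
  rw [lintegral_add_right' _ (hm 2), lintegral_add_right' _ (hm 1)]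
  refine (ENNReal.rpow_add_le_add_rpow _ _ (by norm_num) (by norm_num)).trans ?_
  -- Subadditivity of the square root separates the three partial derivatives. For the third,
  -- λ^(1-s₃) is at most a constant times λ^(-s₃)|D| by the needle condition.
  refine (add_le_add_left (ENNReal.rpow_add_le_add_rpow _ _ (by norm_num) (by norm_num)) _).trans ?_
  refine (add_le_add (add_le_add i0 i1) i2).trans ?_
  rw [bound, ← mul_add, mul_add (ENNReal.ofReal (L ^ (1 - s) + _)),
    ofReal_mul_ofReal_mul (by positivity), ofReal_mul_ofReal_mul (by positivity)]
  refine add_le_add (mul_le_mul_left (ENNReal.ofReal_le_ofReal ?_) _)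
    (mul_le_mul_left (ENNReal.ofReal_le_ofReal ?_) _)
  · exact mul_le_mul_of_nonneg_right (le_add_of_nonneg_right (by positivity)) (by positivity)
  · have e1 : N.F.lam ^ (1 - s₃) = N.F.lam * N.F.lam ^ (-s₃) := by
      rw [sub_eq_add_neg, Real.rpow_add hlam, Real.rpow_one]
    rw [e1]
    have h1 := mul_le_mul_of_nonneg_left N.lam_le'
      (by positivity : 0 ≤ L ^ (1 - s₃) * A₃ * N.F.lam ^ (-s₃))
    have h2 : 0 ≤ L ^ (1 - s) * (A₃ * (N.F.lam ^ (-s₃) * |N.D|)) := by positivity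
    linarith

/-- The error of an affine approximation with values given by the functionals of the
interpolant. -/
theorem exists_error_constant (hG : IsGrading G) (hGm : Monotone G)
    (hdet : det3 (c - a) (d - a) (b - a) ≠ 0)
    {s s₃ : ℝ} (hs0 : 0 ≤ s) (hs : s < 1) (hs₃0 : 0 ≤ s₃) (hs₃ : s₃ < 1) :
    ∃ K : ℝ, 0 < K ∧ ∀ (N : NeedleData G a b c d C₀ m) (w w₃ : E3 → ℝ) (A A₃ : ℝ),
      N.Dominates s s₃ w w₃ A A₃ → ∀ τ ∈ N.B, ∀ T : Tet,
      T.verts ⊆ N.F.bot '' τ ∪ N.F.top '' τ → ∀ (f : E3 → ℝ) (l : E3) (κ : ℝ),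
      (∀ x ∈ T.opened, f x = N.u x - (inner ℝ l x + κ)) →
      (∀ i, inner ℝ l (T.points i) + κ = 0 ∨ ∃ τ' ∈ N.B, ∃ p ∈ τ', ∃ q ∈ τ', p ≠ q ∧
        (inner ℝ l (T.points i) + κ = edgeProj N.u (N.F.bot p) (N.F.bot q) ∨
          inner ℝ l (T.points i) + κ = edgeProj N.u (N.F.top p) (N.F.top q))) →
      h1Seminorm T.opened f ≤ ENNReal.ofReal K * N.bound s s₃ w w₃ A A₃ := by
  obtain ⟨K₁, hK₁, h₁⟩ := exists_edgeProj_constant (C₀ := C₀) (m := m) hG hGm hdet hs0 hs hs₃0 hs₃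
  obtain ⟨K₂, hK₂, h₂⟩ := exists_direct_constant (C₀ := C₀) (m := m) hG hdet hs hs₃
  obtain ⟨K₃, hK₃, h₃⟩ := PrismFrame.exists_gradient_constant hG hGm (m + 1)
  obtain ⟨K₄, hK₄, h₄⟩ := exists_norm_le_inner hdet
  have hM := one_le_coordBound hG m
  have hM0 : 0 < coordBound G m := by linarith
  have hΔ : 0 < |det3 (c - a) (d - a) (b - a)| := abs_pos.2 hdet
  set Δ := |det3 (c - a) (d - a) (b - a)| with hΔ'
  set M := coordBound G m with hM'
  set γ := 1 + |C₀| with hγ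
  have hγ1 : 1 ≤ γ := by have := abs_nonneg C₀; linarith
  set k := (M ^ 3 * Δ) ^ (1 / 2 : ℝ) * (K₄ * (5 * γ * K₃) * K₁) with hk
  refine ⟨K₂ + k, by positivity, fun N w w₃ A A₃ hw τ hτ T hT f l κ hf hval => ?_⟩
  have hlam := N.F.lam_pos
  have hD := abs_pos.2 N.D_ne
  set R := N.bound s s₃ w w₃ A A₃ with hR
  -- With an infinite bound there is nothing to prove; otherwise real numbers can be used for the
  -- values at the vertices.
  by_cases hRtop : R = ⊤
  · rw [hRtop, ENNReal.mul_top]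
    · exact le_top
    · exact (ENNReal.ofReal_pos.2 (by positivity)).ne'
  have hTS' : T.closed ⊆ N.F.prism τ := by
    rw [N.F.prism_eq_convexHull hG (N.lattice τ hτ)]
    exact convexHull_mono hT
  have hTS : T.opened ⊆ N.S := by
    rw [N.S_eq]
    exact interior_mono (hTS'.trans (subset_biUnion_of_mem (u := fun τ => N.F.prism τ) hτ))
  refine (h1Seminorm_sub_affine_le isOpen_interior hTS N.weak l κ hf).trans ?_
  rw [ENNReal.ofReal_add hK₂.le (by positivity), add_mul]
  refine add_le_add ?_ ?_
  · exact (ENNReal.rpow_le_rpow (lintegral_mono_set hTS) (by norm_num)).trans (h₂ N w w₃ A A₃ hw)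
  have hvol : volume T.opened ≤ ENNReal.ofReal (M ^ 3 * Δ * (N.F.lam ^ 2 * |N.D|)) := by
    have h5 : T.opened ⊆ N.F.map '' (Icc 0 M ×ˢ Icc 0 M ×ˢ Icc 0 M) :=
      interior_subset.trans (hTS'.trans (N.prism_subset hG hτ))
    refine (measure_mono h5).trans (le_of_eq ?_)
    unfold PrismFrame.map
    rw [volume_boxMap_image _ N.F.det_ne
      (measurableSet_Icc.prod (measurableSet_Icc.prod measurableSet_Icc)), N.abs_det_eq,
      Measure.volume_eq_prod, Measure.prod_prod, Measure.volume_eq_prod, Measure.prod_prod,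
      Real.volume_Icc, sub_zero, ← ENNReal.ofReal_mul (by positivity),
      ← ENNReal.ofReal_mul (by positivity), ← ENNReal.ofReal_mul (by positivity)]
    congr 1; ring
  set z := |N.D| ^ (1 / 2 : ℝ) with hz
  have hz0 : 0 < z := by positivity
  set y := K₁ * z⁻¹ * R.toReal with hy
  have hy0 : 0 ≤ y := by positivity
  have hy' : ENNReal.ofReal (K₁ * z⁻¹) * R = ENNReal.ofReal y := by
    rw [hy, ENNReal.ofReal_mul (p := K₁ * z⁻¹) (by positivity), ENNReal.ofReal_toReal hRtop]
  have hvals : ∀ i, |inner ℝ l (T.points i) + κ| ≤ y := by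
    intro i
    rcases hval i with h | ⟨τ', hτ', p, hp, q, hq, hpq, h⟩
    · rw [h, abs_zero]; exact hy0
    · obtain ⟨h5, h6⟩ := h₁ N w w₃ A A₃ hw τ' hτ' p hp q hq hpq
      rw [← hR, ← hz, hy', ← ofReal_abs_eq_enorm, ENNReal.ofReal_le_ofReal_iff hy0] at h5 h6
      rcases h with h | h <;> rw [h] <;> assumption
  obtain ⟨g1, g2, g3⟩ := h₃ N.F τ (N.lattice τ hτ) (fun p hp => N.level_le τ hτ p hp) T hT l κ y
    hvals
  -- The inverse estimate. The derivatives along `P`, `Q` and `V` are of the size of the vertex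
  -- values. Dividing by λ, respectively by |D| ≥ λ/γ, bounds the derivatives along the fixed edges
  -- `c - a`, `d - a`, `b - a`, with factors 2γ, 2γ and γ.
  have hl : ‖l‖ ≤ K₄ * (5 * γ * K₃) * y / N.F.lam := by
    have e3 : |inner ℝ l (b - a)| ≤ K₃ * y / |N.D| := by
      rw [N.V_eq, real_inner_smul_right, abs_mul] at g3
      rw [le_div_iff₀ hD]; linarith
    have e3' : |inner ℝ l (b - a)| ≤ γ * (K₃ * y) / N.F.lam := by
      refine e3.trans ?_
      rw [div_le_div_iff₀ hD hlam]
      have := mul_le_mul_of_nonneg_left N.lam_le' (by positivity : 0 ≤ K₃ * y)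
      linarith
    have hcd : ∀ v : E3, |inner ℝ l (N.F.lam • (v - N.F.s))| ≤ K₃ * y →
        |inner ℝ l (v - a)| ≤ 2 * γ * (K₃ * y) / N.F.lam := by
      intro v hv
      have e : v - a = (v - N.F.s) + N.t • (b - a) := by rw [N.s_eq]; module
      rw [real_inner_smul_right, abs_mul, abs_of_pos hlam] at hv
      rw [e, inner_add_right, real_inner_smul_right]
      refine (abs_add_le _ _).trans ?_
      rw [abs_mul, abs_of_nonneg N.t_mem.1]
      have h5 : |inner ℝ l (v - N.F.s)| ≤ γ * (K₃ * y) / N.F.lam := by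
        rw [le_div_iff₀ hlam]
        have := mul_le_mul_of_nonneg_right hγ1 (by positivity : 0 ≤ K₃ * y)
        linarith
      have h6 : N.t * |inner ℝ l (b - a)| ≤ 1 * (γ * (K₃ * y) / N.F.lam) :=
        mul_le_mul N.t_mem.2 e3' (abs_nonneg _) zero_le_one
      calc _ ≤ _ := add_le_add h5 h6
        _ = _ := by ring
    rw [N.P_eq] at g1
    rw [N.Q_eq] at g2
    refine (h₄ l).trans ?_
    refine (mul_le_mul_of_nonneg_left (add_le_add (add_le_add (hcd c g1) (hcd d g2)) e3')
      hK₄).trans (le_of_eq ?_)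
    ring
  have hln : ‖l‖ₑ ≤ ENNReal.ofReal (K₄ * (5 * γ * K₃) * y / N.F.lam) := by
    rw [← ofReal_norm]; exact ENNReal.ofReal_le_ofReal hl
  refine (mul_le_mul' (ENNReal.rpow_le_rpow hvol (by norm_num)) hln).trans (le_of_eq ?_)
  rw [ENNReal.ofReal_rpow_of_nonneg (by positivity) (by norm_num),
    ← ENNReal.ofReal_mul (by positivity)]
  rw [← ENNReal.ofReal_toReal hRtop, ← ENNReal.ofReal_mul (by positivity)]
  congr 1
  have e4 : (N.F.lam ^ 2) ^ (1 / 2 : ℝ) = N.F.lam := by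
    rw [← Real.rpow_natCast, ← Real.rpow_mul hlam.le]; norm_num
  rw [Real.mul_rpow (by positivity) (by positivity), Real.mul_rpow (by positivity) hD.le, e4, ← hz,
    hk, hy]
  field_simp

end NeedleData

/-! ### The layers of a graded macro-element as prism frames. -/

/-- The radial grading function of the coordinate transformation. -/
def gradeFun (μ : ℝ) (m : ℕ) : ℝ := (m : ℝ) ^ (1 / μ - 1)

theorem gradeFun_mul {μ : ℝ} (hμ : 0 < μ) (m : ℕ) : gradeFun μ m * m = (m : ℝ) ^ (1 / μ) := by
  rcases Nat.eq_zero_or_pos m with rfl | h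
  · have : 1 / μ ≠ 0 := by positivity
    simp [Real.zero_rpow (by simpa using this : μ⁻¹ ≠ 0)]
  · have h' : (0 : ℝ) < m := by exact_mod_cast h
    rw [gradeFun, Real.rpow_sub_one h'.ne']
    field_simp

theorem isGrading_gradeFun {μ : ℝ} (hμ : 0 < μ) : IsGrading (gradeFun μ) where
  pos m hm := Real.rpow_pos_of_pos (by exact_mod_cast hm) _
  mono m k h := by
    simp only [gradeFun_mul hμ]
    exact Real.rpow_lt_rpow (by positivity) (by exact_mod_cast h) (by positivity)

theorem monotone_gradeFun {μ : ℝ} (hμ : 0 < μ) (hμ1 : μ ≤ 1) : Monotone (gradeFun μ) := by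
  intro m k h
  refine Real.rpow_le_rpow (by positivity) (by exact_mod_cast h) ?_
  rw [sub_nonneg, le_div_iff₀ hμ]
  linarith

/-- The scaling factor of the lattice. -/
def gradeScale (μ : ℝ) (n : ℕ) : ℝ := (n : ℝ) ^ (-(1 / μ))

theorem gradeScale_pos {μ : ℝ} {n : ℕ} (hn : 0 < n) : 0 < gradeScale μ n :=
  Real.rpow_pos_of_pos (by exact_mod_cast hn) _

theorem gradeScale_mul {μ : ℝ} (hμ : 0 < μ) {n : ℕ} (hn : 0 < n) :
    gradeScale μ n * (gradeFun μ n * n) = 1 := by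
  have h' : (0 : ℝ) < n := by exact_mod_cast hn
  rw [gradeFun_mul hμ, gradeScale, ← Real.rpow_add h']
  simp

/-- A power law is self-similar: the number of layers enters through one scalar factor only, and the
lattice in reference coordinates depends on μ alone. -/
theorem gradeScale_mul_gradeFun {μ : ℝ} {n : ℕ} (hn : 0 < n) (i j : ℕ) (x : ℕ) :
    (((i : ℝ) + j) / n) ^ (1 / μ - 1) * ((x : ℝ) / n) =
      gradeScale μ n * (gradeFun μ (i + j) * x) := by
  have h' : (0 : ℝ) < n := by exact_mod_cast hn
  rw [Real.div_rpow (by positivity) h'.le, gradeScale, gradeFun, Real.rpow_sub_one h'.ne',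
    Real.rpow_neg h'.le]
  push_cast
  field_simp

theorem gradePos_strictMono (P : MacroPartition) {ν : ℝ} (hν : 0 < ν) {N : ℕ} (hN : 0 < N)
    (a : E3) : StrictMono (gradePos P ν N a) := by
  intro k l h
  have h' : (0 : ℝ) < N := by exact_mod_cast hN
  have h1 : (k : ℝ) / N < l / N := div_lt_div_of_pos_right (by exact_mod_cast h) h'
  unfold gradePos
  split_ifs
  · exact Real.rpow_lt_rpow (by positivity) h1 (by positivity)
  · exact h1

theorem gradePos_mem (P : MacroPartition) {ν : ℝ} (hν : 0 < ν) {N k : ℕ} (hN : 0 < N) (hk : k ≤ N)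
    (a : E3) : gradePos P ν N a k ∈ Icc (0 : ℝ) 1 := by
  have h' : (0 : ℝ) < N := by exact_mod_cast hN
  have h1 : (k : ℝ) / N ≤ 1 := by rw [div_le_one h']; exact_mod_cast hk
  refine ⟨?_, ?_⟩ <;> unfold gradePos <;> split_ifs
  · positivity
  · positivity
  · exact Real.rpow_le_one (by positivity) h1 (by positivity)
  · exact h1

namespace EdgeLabel

variable {P : MacroPartition} {K : Tet} {a b c d : E3}

theorem det_ne_zero (h : EdgeLabel P K a b c d) : det3 (c - a) (d - a) (b - a) ≠ 0 := by
  have htop : vectorSpan ℝ ({a, b, c, d} : Set E3) = ⊤ := by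
    rw [← h.verts_eq]
    exact K.independent.vectorSpan_eq_top_of_card_eq_finrank_add_one (by simp)
  rw [vectorSpan_eq_span_vsub_set_right ℝ (mem_insert a _)] at htop
  have hle : Submodule.span ℝ ((· -ᵥ a) '' ({a, b, c, d} : Set E3)) ≤
      LinearMap.range (boxLin (c - a) (d - a) (b - a)) := by
    rw [Submodule.span_le]
    rintro _ ⟨x, hx, rfl⟩
    simp only [mem_insert_iff, mem_singleton_iff] at hx
    rcases hx with rfl | rfl | rfl | rfl
    · exact ⟨0, by simp⟩
    · exact ⟨(0, 0, 1), by simp [boxLin_apply]⟩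
    · exact ⟨(1, 0, 0), by simp [boxLin_apply]⟩
    · exact ⟨(0, 1, 0), by simp [boxLin_apply]⟩
  rw [htop, top_le_iff, LinearMap.range_eq_top] at hle
  -- Write the unit vectors in terms of the three edges; if these had determinant 0, so would the
  -- unit matrix.
  choose f hf using fun i : Fin 3 => hle (EuclideanSpace.single i (1 : ℝ))
  intro h0
  have h1 := det3_boxLin (c - a) (d - a) (b - a) (f 0) (f 1) (f 2)
  rw [h0, mul_zero, hf, hf, hf, det3_eq] at h1
  simp at h1

end EdgeLabel

/-- The coordinates of a macro-element. -/
def macroMap (a b c d : E3) (y : ℝ × ℝ × ℝ) : E3 := boxMap a (c - a) (d - a) (b - a) y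

theorem macroMap_injective {a b c d : E3} (hdet : det3 (c - a) (d - a) (b - a) ≠ 0) :
    Function.Injective (macroMap a b c d) := boxMap_injective _ hdet

/-- The heights in the planes. -/
theorem gradeNode_eq (P : MacroPartition) (μ ν : ℝ) (N : ℕ) {n : ℕ} (hn : 0 < n) (a b c d : E3)
    (k : ℕ) (p : ℕ × ℕ) : gradeNode P μ ν N n a b c d k p = macroMap a b c d
      (gradeScale μ n * (latPt (gradeFun μ) p).1, gradeScale μ n * (latPt (gradeFun μ) p).2,
        gradePos P ν N a k * (1 - gradeScale μ n * (latPt (gradeFun μ) p).1 -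
          gradeScale μ n * (latPt (gradeFun μ) p).2)) := by
  rw [gradeNode, gradeScale_mul_gradeFun hn, gradeScale_mul_gradeFun hn, edgePoint, macroMap,
    boxMap]
  simp only [latPt]
  module

/-- In the coordinates of the macro-element a plane is the graph of a multiple of 1 - α - β, which
vanishes on the line through `c` and `d`, common to all planes. -/
theorem exists_of_mem_gradePlane {P : MacroPartition} {ν : ℝ} {N : ℕ} {a b c d : E3} {k : ℕ}
    {x : E3} (hx : x ∈ gradePlane P ν N a b c d k) : ∃ α β : ℝ,
      x = macroMap a b c d (α, β, gradePos P ν N a k * (1 - α - β)) := by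
  set s := edgePoint P ν N a b k with hs
  have hle : gradePlane P ν N a b c d k ≤ AffineSubspace.mk' s (Submodule.span ℝ {c - s, d - s}) := by
    refine affineSpan_le.2 ?_
    intro y hy
    simp only [mem_insert_iff, mem_singleton_iff] at hy
    rw [SetLike.mem_coe, AffineSubspace.mem_mk']
    rcases hy with rfl | rfl | rfl
    · rw [← hs]; simp
    · exact Submodule.subset_span (by simp)
    · exact Submodule.subset_span (by simp)
  have h1 := hle hx
  rw [AffineSubspace.mem_mk', Submodule.mem_span_pair] at h1
  obtain ⟨α, β, h⟩ := h1
  refine ⟨α, β, ?_⟩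
  have e : x = s + (α • (c - s) + β • (d - s)) := by rw [h]; simp
  rw [e, hs, edgePoint, macroMap, boxMap]
  simp only
  module

/-- The frame of a layer of a macro-element. -/
def layerFrame (P : MacroPartition) {μ ν : ℝ} (hμ : 0 < μ) (hν : 0 < ν) {N n : ℕ} (hN : 0 < N)
    (hn : 0 < n) {a b c d : E3} (hdet : det3 (c - a) (d - a) (b - a) ≠ 0) (k : ℕ) :
    PrismFrame (gradeFun μ) where
  n := n
  lam := gradeScale μ n
  s := a + gradePos P ν N a k • (b - a)
  P := gradeScale μ n • (c - (a + gradePos P ν N a k • (b - a)))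
  Q := gradeScale μ n • (d - (a + gradePos P ν N a k • (b - a)))
  V := (gradePos P ν N a (k + 1) - gradePos P ν N a k) • (b - a)
  lam_pos := gradeScale_pos hn
  lam_mul := gradeScale_mul hμ hn
  det_ne := by
    set t := gradePos P ν N a k
    set t' := gradePos P ν N a (k + 1)
    have : det3 (gradeScale μ n • (c - (a + t • (b - a)))) (gradeScale μ n • (d - (a + t • (b - a))))
        ((t' - t) • (b - a)) = gradeScale μ n ^ 2 * (t' - t) * det3 (c - a) (d - a) (b - a) := by
      simp only [det3_eq, PiLp.sub_apply, PiLp.add_apply, PiLp.smul_apply, smul_eq_mul]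
      ring
    rw [this]
    have h1 : 0 < t' - t := sub_pos.2 (gradePos_strictMono P hν hN a (Nat.lt_succ_self k))
    have h2 := gradeScale_pos (μ := μ) hn
    positivity

section layer

variable {P : MacroPartition} {μ ν : ℝ} (hμ : 0 < μ) (hν : 0 < ν) {N n : ℕ} (hN : 0 < N)
  (hn : 0 < n) {a b c d : E3} (hdet : det3 (c - a) (d - a) (b - a) ≠ 0)

theorem layerFrame_map (k : ℕ) (y : ℝ × ℝ × ℝ) :
    (layerFrame P hμ hν hN hn hdet k).map y = macroMap a b c d
      (gradeScale μ n * y.1, gradeScale μ n * y.2.1,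
        gradePos P ν N a k * (1 - gradeScale μ n * y.1 - gradeScale μ n * y.2.1) +
          y.2.2 * (gradePos P ν N a (k + 1) - gradePos P ν N a k)) := by
  simp only [PrismFrame.map, layerFrame, macroMap, boxMap]
  module

theorem layerFrame_height (k : ℕ) (p : ℕ × ℕ) : (layerFrame P hμ hν hN hn hdet k).height p =
    1 - gradeScale μ n * (latPt (gradeFun μ) p).1 - gradeScale μ n * (latPt (gradeFun μ) p).2 := by
  rw [PrismFrame.height_eq]
  simp only [layerFrame]
  ring

theorem layerFrame_bot (k : ℕ) (p : ℕ × ℕ) :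
    (layerFrame P hμ hν hN hn hdet k).bot p = gradeNode P μ ν N n a b c d k p := by
  rw [PrismFrame.bot, layerFrame_map, gradeNode_eq P μ ν N hn]
  simp

theorem layerFrame_top (k : ℕ) (p : ℕ × ℕ) :
    (layerFrame P hμ hν hN hn hdet k).top p = gradeNode P μ ν N n a b c d (k + 1) p := by
  rw [PrismFrame.top, layerFrame_map, gradeNode_eq P μ ν N hn, layerFrame_height]
  congr 3
  ring

theorem prismVerts_eq (k : ℕ) (τ : Finset (ℕ × ℕ)) : prismVerts P μ ν N n a b c d k τ =
    (layerFrame P hμ hν hN hn hdet k).bot '' τ ∪ (layerFrame P hμ hν hN hn hdet k).top '' τ := by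
  rw [prismVerts, funext (layerFrame_bot hμ hν hN hn hdet k),
    funext (layerFrame_top hμ hν hN hn hdet k)]

theorem prism_eq_prism {k : ℕ} {τ : Finset (ℕ × ℕ)} (hτ : IsLatticeTriangle n τ) :
    prism P μ ν N n a b c d k τ = (layerFrame P hμ hν hN hn hdet k).prism τ := by
  rw [PrismFrame.prism_eq_convexHull _ (isGrading_gradeFun hμ) hτ, prism,
    prismVerts_eq hμ hν hN hn hdet]

/-- A point is the midpoint of a degenerate edge. -/
theorem mem_of_latPt_mem {G : ℕ → ℝ} (hG : IsGrading G) {τ : Finset (ℕ × ℕ)}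
    (hτ : IsLatticeTriangle n τ) {p : ℕ × ℕ} (h : latPt G p ∈ convexHull ℝ (latPt G '' τ)) :
    p ∈ τ := by
  have h1 : IsLatticeTriangle (p.1 + p.2 + 1) (upTri p.1 p.2) :=
    isLatticeTriangle_iff.2 ⟨p.1, p.2, Or.inl ⟨le_rfl, rfl⟩⟩
  have h2 : p ∈ upTri p.1 p.2 := by rw [mem_upTri]; simp
  refine (hG.mem_of_midpoint hτ h1 h2 h2 ?_).1
  rwa [← add_smul, add_halves, one_smul]

include hμ hν hN hn hdet in
/-- The nodes in a prism are its vertices. -/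
theorem mem_of_gradeNode_mem_prism {k k' : ℕ} {τ : Finset (ℕ × ℕ)} (hτ : IsLatticeTriangle n τ)
    {p : ℕ × ℕ} (h : gradeNode P μ ν N n a b c d k' p ∈ prism P μ ν N n a b c d k τ) :
    p ∈ τ ∧ (gradeNode P μ ν N n a b c d k' p = gradeNode P μ ν N n a b c d k p ∨
      gradeNode P μ ν N n a b c d k' p = gradeNode P μ ν N n a b c d (k + 1) p) := by
  rw [prism_eq_prism hμ hν hN hn hdet hτ] at h
  obtain ⟨y, ⟨h1, h2, h3⟩, hy⟩ := h
  rw [layerFrame_map, gradeNode_eq P μ ν N hn] at hy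
  have hy' := macroMap_injective hdet hy
  simp only [Prod.mk.injEq] at hy'
  obtain ⟨e1, e2, e3⟩ := hy'
  have hlam := gradeScale_pos (μ := μ) hn
  have e1' := mul_left_cancel₀ hlam.ne' e1
  have e2' := mul_left_cancel₀ hlam.ne' e2
  have hmono := gradePos_strictMono P hν hN a
  have hd : 0 < gradePos P ν N a (k + 1) - gradePos P ν N a k :=
    sub_pos.2 (hmono (Nat.lt_succ_self k))
  have hpτ : p ∈ τ := by
    refine mem_of_latPt_mem (isGrading_gradeFun hμ) hτ ?_
    rw [e1', e2'] at h1
    exact h1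
  refine ⟨hpτ, ?_⟩
  rw [gradeNode_eq P μ ν N hn, gradeNode_eq P μ ν N hn, gradeNode_eq P μ ν N hn]
  have hh : (layerFrame P hμ hν hN hn hdet k).lam = gradeScale μ n := rfl
  rw [hh] at h3
  rw [e1, e2] at e3
  have h3' : y.2.2 ≤ 1 - gradeScale μ n * (latPt (gradeFun μ) p).1 -
      gradeScale μ n * (latPt (gradeFun μ) p).2 := by
    rw [← e1, ← e2]; linarith
  set g := 1 - gradeScale μ n * (latPt (gradeFun μ) p).1 - gradeScale μ n * (latPt (gradeFun μ) p).2
  -- If the height over `p` is zero, the point is on `cd` and all the planes have the same node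
  -- there. Otherwise strict monotonicity of the plane positions places the plane `k'` between `k`
  -- and `k + 1`.
  rcases (h2.trans h3').eq_or_lt with h0 | h0
  · left
    rw [← h0, mul_zero, mul_zero]
  · have h4 : gradePos P ν N a k ≤ gradePos P ν N a k' := by
      by_contra hc
      push Not at hc
      have := mul_lt_mul_of_pos_right hc h0
      have := mul_nonneg h2 hd.le
      linarith
    have h5 : gradePos P ν N a k' ≤ gradePos P ν N a (k + 1) := by
      by_contra hc
      push Not at hc
      have := mul_lt_mul_of_pos_right hc h0
      have := mul_le_mul_of_nonneg_right h3' hd.le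
      linarith
    rw [hmono.le_iff_le] at h4 h5
    rcases (by omega : k' = k ∨ k' = k + 1) with h | h
    · left; rw [h]
    · right; rw [h]

include hμ hn hdet in
theorem gradeNode_index_injective {k k' : ℕ} {p p' : ℕ × ℕ}
    (h : gradeNode P μ ν N n a b c d k p = gradeNode P μ ν N n a b c d k' p') : p = p' := by
  rw [gradeNode_eq P μ ν N hn, gradeNode_eq P μ ν N hn] at h
  have h' := macroMap_injective hdet h
  simp only [Prod.mk.injEq] at h'
  have hlam := gradeScale_pos (μ := μ) hn
  exact (isGrading_gradeFun hμ).latPt_injective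
    (Prod.ext (mul_left_cancel₀ hlam.ne' h'.1) (mul_left_cancel₀ hlam.ne' h'.2.1))

theorem gradeScale_mul_level (p : ℕ × ℕ) :
    1 - gradeScale μ n * (latPt (gradeFun μ) p).1 - gradeScale μ n * (latPt (gradeFun μ) p).2 =
      1 - gradeScale μ n * (gradeFun μ (p.1 + p.2) * ((p.1 + p.2 : ℕ) : ℝ)) := by
  rw [← latPt_add]; ring

include hμ hn in
theorem eq_zero_iff_level_eq (p : ℕ × ℕ) :
    1 - gradeScale μ n * (latPt (gradeFun μ) p).1 - gradeScale μ n * (latPt (gradeFun μ) p).2 = 0 ↔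
      p.1 + p.2 = n := by
  have h1 := gradeScale_mul hμ hn
  have hlam := gradeScale_pos (μ := μ) hn
  rw [gradeScale_mul_level, ← h1, sub_eq_zero]
  constructor
  · intro h
    exact ((isGrading_gradeFun hμ).mono.injective (mul_left_cancel₀ hlam.ne' h)).symm
  · rintro h; rw [h]

include hμ hn in
theorem gradeNode_of_level_eq {p : ℕ × ℕ} (h : p.1 + p.2 = n) (k k' : ℕ) :
    gradeNode P μ ν N n a b c d k p = gradeNode P μ ν N n a b c d k' p := by
  rw [gradeNode_eq P μ ν N hn, gradeNode_eq P μ ν N hn, (eq_zero_iff_level_eq hμ hn p).2 h,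
    mul_zero, mul_zero]

include hμ hν hN hn hdet in
-- Away from `cd`, where the level is `n`, different planes are disjoint.
theorem eq_of_gradeNode_mem_gradePlane {k k' : ℕ} {p : ℕ × ℕ} (hp : p.1 + p.2 ≠ n)
    (h : gradeNode P μ ν N n a b c d k p ∈ gradePlane P ν N a b c d k') : k = k' := by
  obtain ⟨α, β, h1⟩ := exists_of_mem_gradePlane h
  rw [gradeNode_eq P μ ν N hn] at h1
  have h' := macroMap_injective hdet h1
  simp only [Prod.mk.injEq] at h'
  obtain ⟨e1, e2, e3⟩ := h'
  rw [← e1, ← e2] at e3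
  exact (gradePos_strictMono P hν hN a).injective
    (mul_right_cancel₀ (mt (eq_zero_iff_level_eq hμ hn p).1 hp) e3)

include hμ hn hdet in
theorem level_eq_of_mem_segment {k : ℕ} {p : ℕ × ℕ}
    (h : gradeNode P μ ν N n a b c d k p ∈ segment ℝ c d) : p.1 + p.2 = n := by
  obtain ⟨α, β, -, -, hαβ, h1⟩ := h
  have e : α • c + β • d = macroMap a b c d (α, β, 0) := by
    obtain rfl : α = 1 - β := by linarith
    rw [macroMap, boxMap]; simp only; module
  rw [e, gradeNode_eq P μ ν N hn] at h1
  have h' := macroMap_injective hdet h1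
  simp only [Prod.mk.injEq] at h'
  rw [← eq_zero_iff_level_eq hμ hn, ← h'.1, ← h'.2.1]
  linarith

include hμ hn in
theorem gradeNode_mem_segment (k : ℕ) {p : ℕ × ℕ} (h : p.1 + p.2 = n) :
    gradeNode P μ ν N n a b c d k p ∈ segment ℝ c d := by
  have h0 := (eq_zero_iff_level_eq hμ hn p).2 h
  have hlam := gradeScale_pos (μ := μ) hn
  have h1 := (isGrading_gradeFun hμ).latPt_nonneg p
  refine ⟨gradeScale μ n * (latPt (gradeFun μ) p).1, gradeScale μ n * (latPt (gradeFun μ) p).2,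
    mul_nonneg hlam.le h1.1, mul_nonneg hlam.le h1.2, by linarith, ?_⟩
  rw [gradeNode_eq P μ ν N hn, h0, mul_zero, macroMap, boxMap]
  simp only
  generalize gradeScale μ n * (latPt (gradeFun μ) p).1 = x at h0 ⊢
  obtain h2 : gradeScale μ n * (latPt (gradeFun μ) p).2 = 1 - x := by linarith
  rw [h2]
  module

end layer

/-! ### Consequences of conformity. -/

namespace Tet

/-- The barycentric coordinate of a vertex outside `s` vanishes on `s`, hence on its convex hull. -/
theorem mem_of_coord_ne {T : Tet} {s : Set E3} (hs : s ⊆ T.verts) {x : E3}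
    (hx : x ∈ convexHull ℝ s) {i : Fin 4} (hi : T.basis.coord i x ≠ 0) : T.points i ∈ s := by
  by_contra hc
  apply hi
  have h1 : s ⊆ T.basis.coord i ⁻¹' {0} := by
    intro y hy
    obtain ⟨j, rfl⟩ := hs hy
    have hij : i ≠ j := by rintro rfl; exact hc hy
    exact T.basis.coord_apply_ne hij
  exact convexHull_min h1 ((convex_singleton 0).affine_preimage (T.basis.coord i)) hx

theorem coord_pos {T : Tet} {x : E3} (hx : x ∈ T.opened) (i : Fin 4) : 0 < T.basis.coord i x := by
  have h := T.basis.interior_convexHull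
  have e : T.opened = interior (convexHull ℝ (range T.basis)) := rfl
  rw [e, h] at hx
  exact hx i

theorem ncard_verts (T : Tet) : T.verts.ncard = 4 := by
  rw [verts, ← Set.image_univ, Set.ncard_image_of_injective _ T.independent.injective,
    Set.ncard_univ]
  simp

theorem finite_verts (T : Tet) : T.verts.Finite := finite_range _

theorem opened_nonempty (T : Tet) : T.opened.Nonempty := by
  have := (interior_convexHull_nonempty_iff_affineSpan_eq_top (s := T.verts)).2 T.basis.tot
  exact this

theorem isCompact_closed (T : Tet) : IsCompact T.closed := T.finite_verts.isCompact_convexHull ℝ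

theorem closure_opened (T : Tet) : closure T.opened = T.closed := by
  have h : Convex ℝ T.closed := convex_convexHull ℝ T.verts
  rw [opened, h.closure_interior_eq_closure_of_nonempty_interior T.opened_nonempty]
  exact T.isCompact_closed.isClosed.closure_eq

end Tet

/-- All barycentric coordinates of an interior point of `T` are positive, so conformity makes every
vertex of `T` a vertex of `S`. -/
theorem Triangulation.eq_of_mem_opened (M : Triangulation) {S T : Tet} (hS : S ∈ M.elems)
    (hT : T ∈ M.elems) {x : E3} (hx : x ∈ T.opened) (hx' : x ∈ S.closed) : S = T := by
  have h1 : x ∈ convexHull ℝ (S.verts ∩ T.verts) := by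
    rw [← M.conforming S hS T hT]
    exact ⟨hx', interior_subset hx⟩
  refine M.distinct S hS T hT (Set.eq_of_subset_of_ncard_le ?_ ?_ S.finite_verts).symm
  · rintro _ ⟨i, rfl⟩
    exact (Tet.mem_of_coord_ne inter_subset_right h1 (Tet.coord_pos hx i).ne').1
  · rw [S.ncard_verts, T.ncard_verts]

theorem midpoint_eq_combo (x y : E3) :
    midpoint ℝ x y = (1 / 2 : ℝ) • x + (1 / 2 : ℝ) • y := by
  rw [midpoint_eq_smul_add, smul_add]; simp

namespace GradedMesh

variable {P : MacroPartition} {μ ν : Tet → ℝ} (M : GradedMesh P μ ν)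

/-- An interior point of `K` belongs to no other macro-element, so the elements inside `K` cover its
interior. Their union is closed and therefore covers `K`. -/
theorem exists_elem_of_mem_closed {K : Tet} (hK : K ∈ P.elems) {x : E3} (hx : x ∈ K.closed) :
    ∃ T ∈ M.elems, T.closed ⊆ K.closed ∧ x ∈ T.closed := by
  set U : Set E3 := ⋃ T ∈ {T | T ∈ M.elems ∧ T.closed ⊆ K.closed}, T.closed with hU
  have hfin : {T | T ∈ M.elems ∧ T.closed ⊆ K.closed}.Finite :=
    M.elems.finite_toSet.subset fun T hT => hT.1
  have hclosed : IsClosed U := hfin.isClosed_biUnion fun T _ => T.isCompact_closed.isClosed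
  have hsub : K.opened ⊆ U := by
    intro y hy
    have h1 : y ∈ M.toTriangulation.region := by
      rw [M.region_eq]
      exact mem_biUnion hK (interior_subset hy)
    obtain ⟨T, hT, hyT⟩ := mem_iUnion₂.1 h1
    obtain ⟨K', hK', hTK'⟩ := M.matching T hT
    obtain rfl := P.toTriangulation.eq_of_mem_opened hK' hK hy (hTK' hyT)
    exact mem_biUnion (show T ∈ {T | T ∈ M.elems ∧ T.closed ⊆ K'.closed} from ⟨hT, hTK'⟩) hyT
  rw [← K.closure_opened] at hx
  obtain ⟨T, hT, hxT⟩ := mem_iUnion₂.1 (closure_minimal hsub hclosed hx)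
  exact ⟨T, hT.1, hT.2, hxT⟩

/-- An edge of the mesh in a macro-element is an edge of an element in the macro-element. -/
theorem exists_elem_of_edge {K : Tet} (hK : K ∈ P.elems) {T : Tet} (hT : T ∈ M.elems) {x y : E3}
    (hx : x ∈ T.verts) (hy : y ∈ T.verts) (hxy : segment ℝ x y ⊆ K.closed) :
    ∃ T' ∈ M.elems, T'.closed ⊆ K.closed ∧ x ∈ T'.verts ∧ y ∈ T'.verts := by
  obtain ⟨T', hT', hT'K, h1⟩ := M.exists_elem_of_mem_closed hK
    (hxy (midpoint_mem_segment (𝕜 := ℝ) x y))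
  refine ⟨T', hT', hT'K, ?_⟩
  -- At the midpoint the barycentric coordinates of both endpoints are positive, so both are common
  -- vertices of `T'` and `T`.
  have h2 : midpoint ℝ x y ∈ convexHull ℝ (T'.verts ∩ T.verts) := by
    rw [← M.conforming T' hT' T hT]
    refine ⟨h1, (convex_convexHull ℝ T.verts).segment_subset (subset_convexHull ℝ _ hx)
      (subset_convexHull ℝ _ hy) (midpoint_mem_segment (𝕜 := ℝ) x y)⟩
  have h3 : ∀ i : Fin 4, ∀ z z', z ∈ T.verts → T.points i = z' →
      T.basis.coord i (midpoint ℝ z' z) ≠ 0 := by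
    rintro i _ _ ⟨j, rfl⟩ rfl
    rw [AffineMap.map_midpoint, midpoint_eq_smul_add]
    have e1 : T.basis.coord i (T.points i) = 1 := T.basis.coord_apply_eq i
    have e2 : 0 ≤ T.basis.coord i (T.points j) := by
      have : T.basis.coord i (T.points j) = if i = j then 1 else 0 := T.basis.coord_apply i j
      rw [this]; split_ifs <;> norm_num
    rw [e1, smul_eq_mul]
    have : (0 : ℝ) < ⅟2 * (1 + T.basis.coord i (T.points j)) := by
      rw [invOf_eq_inv]; positivity
    exact this.ne'
  obtain ⟨i, hi⟩ := hx
  obtain ⟨j, hj⟩ := hy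
  constructor
  · have := Tet.mem_of_coord_ne inter_subset_right h2 (h3 i y x ⟨j, hj⟩ hi)
    rw [hi] at this
    exact this.1
  · rw [midpoint_comm] at h2
    have := Tet.mem_of_coord_ne inter_subset_right h2 (h3 j x y ⟨i, hi⟩ hj)
    rw [hj] at this
    exact this.1

theorem mem_nodes {T : Tet} (hT : T ∈ M.elems) {x : E3} (hx : x ∈ T.verts) : x ∈ M.nodes := by
  classical
  obtain ⟨i, rfl⟩ := hx
  unfold Triangulation.nodes
  exact Finset.mem_biUnion.2 ⟨T, hT, Finset.mem_image.2 ⟨i, Finset.mem_univ _, rfl⟩⟩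

end GradedMesh

/-! ### The combinatorial structure of the patch. -/

section patch

variable {P : MacroPartition} {μ ν : ℝ} (hμ : 0 < μ) (hν : 0 < ν) {N n : ℕ} (hN : 0 < N)
  (hn : 0 < n) {a b c d : E3} (hdet : det3 (c - a) (d - a) (b - a) ≠ 0)

theorem patchDomain_eq {k : ℕ} {B : Finset (Finset (ℕ × ℕ))}
    (hB : ∀ τ ∈ B, IsLatticeTriangle n τ) : patchDomain P μ ν N n a b c d k B =
      interior (⋃ τ ∈ B, (layerFrame P hμ hν hN hn hdet k).prism τ) := by
  rw [patchDomain]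
  congr 1
  exact iUnion₂_congr fun τ hτ => prism_eq_prism hμ hν hN hn hdet (hB τ hτ)

theorem isClosed_prism (k : ℕ) (τ : Finset (ℕ × ℕ)) : IsClosed (prism P μ ν N n a b c d k τ) := by
  have h : (prismVerts P μ ν N n a b c d k τ).Finite :=
    (τ.finite_toSet.image _).union (τ.finite_toSet.image _)
  exact (h.isCompact_convexHull ℝ).isClosed

theorem closure_patchDomain_subset (k : ℕ) (B : Finset (Finset (ℕ × ℕ))) :
    closure (patchDomain P μ ν N n a b c d k B) ⊆ ⋃ τ ∈ B, prism P μ ν N n a b c d k τ :=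
  closure_minimal interior_subset (B.finite_toSet.isClosed_biUnion fun τ _ => isClosed_prism k τ)

include hμ hν hN hn hdet in
theorem prism_subset_closure_patchDomain (hμ1 : μ ≤ 1) {k : ℕ} {B : Finset (Finset (ℕ × ℕ))}
    {τ : Finset (ℕ × ℕ)} (hτB : τ ∈ B) (hτ : IsLatticeTriangle n τ) :
    prism P μ ν N n a b c d k τ ⊆ closure (patchDomain P μ ν N n a b c d k B) := by
  have h1 := PrismFrame.closure_interior_prism (F := layerFrame P hμ hν hN hn hdet k)
    (isGrading_gradeFun hμ) (monotone_gradeFun hμ hμ1) hτ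
  rw [← prism_eq_prism hμ hν hN hn hdet hτ] at h1
  rw [← h1]
  exact closure_mono (interior_mono (subset_biUnion_of_mem
    (u := fun τ => prism P μ ν N n a b c d k τ) hτB))

include hμ hν hN hn hdet in
theorem latPt_midpoint_mem {k k' k'' : ℕ} {τ : Finset (ℕ × ℕ)} (hτ : IsLatticeTriangle n τ)
    {p q : ℕ × ℕ} (h : midpoint ℝ (gradeNode P μ ν N n a b c d k' p)
      (gradeNode P μ ν N n a b c d k'' q) ∈ prism P μ ν N n a b c d k τ) :
    (1 / 2 : ℝ) • latPt (gradeFun μ) p + (1 / 2 : ℝ) • latPt (gradeFun μ) q ∈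
      convexHull ℝ (latPt (gradeFun μ) '' τ) := by
  rw [prism_eq_prism hμ hν hN hn hdet hτ] at h
  obtain ⟨y, ⟨h1, -, -⟩, hy⟩ := h
  rw [layerFrame_map, gradeNode_eq P μ ν N hn, gradeNode_eq P μ ν N hn, midpoint_eq_combo,
    macroMap, macroMap, macroMap, ← boxMap_combo _ _ _ _ (by norm_num)] at hy
  have hy' := boxMap_injective _ hdet hy
  have hlam := gradeScale_pos (μ := μ) hn
  have e1 := congrArg (fun x : ℝ × ℝ × ℝ => x.1) hy'
  have e2 := congrArg (fun x : ℝ × ℝ × ℝ => x.2.1) hy'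
  simp only [Prod.fst_add, Prod.snd_add, Prod.smul_fst, Prod.smul_snd, smul_eq_mul] at e1 e2
  have e1' : y.1 = 1 / 2 * (latPt (gradeFun μ) p).1 + 1 / 2 * (latPt (gradeFun μ) q).1 := by
    apply mul_left_cancel₀ hlam.ne'; rw [e1]; ring
  have e2' : y.2.1 = 1 / 2 * (latPt (gradeFun μ) p).2 + 1 / 2 * (latPt (gradeFun μ) q).2 := by
    apply mul_left_cancel₀ hlam.ne'; rw [e2]; ring
  rw [e1', e2'] at h1
  exact h1

end patch

section mesh

variable {P : MacroPartition} {μ ν : Tet → ℝ} {M : GradedMesh P μ ν} {σ : E3 → E3} {K : Tet}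
  {a b c d : E3} {T : Tet} {k : ℕ} {B : Finset (Finset (ℕ × ℕ))}

/-- The vertices of an element are vertices of each prism that contains it. -/
theorem exists_index (hμ : 0 < μ K) (hν : 0 < ν K) (hl : EdgeLabel P K a b c d) (hT : T ∈ M.elems)
    (hTK : T.closed ⊆ K.closed) {τ : Finset (ℕ × ℕ)} (hτ : IsLatticeTriangle (M.layers K) τ)
    (hTτ : T.closed ⊆ prism P (μ K) (ν K) (M.strips K) (M.layers K) a b c d k τ) {x : E3}
    (hx : x ∈ T.verts) : ∃ p ∈ τ,
      x = gradeNode P (μ K) (ν K) (M.strips K) (M.layers K) a b c d k p ∨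
      x = gradeNode P (μ K) (ν K) (M.strips K) (M.layers K) a b c d (k + 1) p := by
  obtain ⟨k', -, τ', -, hv⟩ := M.graded K a b c d hl T hT hTK
  have h1 := hTτ (subset_convexHull ℝ _ hx)
  rcases hv hx with ⟨p, -, rfl⟩ | ⟨p, -, rfl⟩
  all_goals
    have h2 := mem_of_gradeNode_mem_prism hμ hν (M.strips_pos K hl.mem) (M.layers_pos K hl.mem)
      hl.det_ne_zero hτ h1
    exact ⟨p, h2⟩

/-- The edge of a node of the element joins two vertices of a prism of the patch. -/
theorem exists_index_edge (hμ : 0 < μ K) (hν : 0 < ν K) (hσ : EdgeSelection M σ)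
    (hl : EdgeLabel P K a b c d) (hT : T ∈ M.elems) (hTK : T.closed ⊆ K.closed)
    (hadm : IsAdmissiblePatch M σ K a b c d T k B) {τ : Finset (ℕ × ℕ)} (hτB : τ ∈ B)
    (hTτ : T.closed ⊆ prism P (μ K) (ν K) (M.strips K) (M.layers K) a b c d k τ) {x : E3}
    (hx : x ∈ T.verts) (hxe : x ∉ excludedNodes P) : ∃ τ' ∈ B, ∃ p ∈ τ', ∃ q ∈ τ', p ∈ τ ∧ p ≠ q ∧
      ((x = gradeNode P (μ K) (ν K) (M.strips K) (M.layers K) a b c d k p ∧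
        σ x = gradeNode P (μ K) (ν K) (M.strips K) (M.layers K) a b c d k q) ∨
      (x = gradeNode P (μ K) (ν K) (M.strips K) (M.layers K) a b c d (k + 1) p ∧
        σ x = gradeNode P (μ K) (ν K) (M.strips K) (M.layers K) a b c d (k + 1) q)) := by
  have hτ := hadm.lattice τ hτB
  have hN := M.strips_pos K hl.mem
  have hn := M.layers_pos K hl.mem
  have hdet := hl.det_ne_zero
  have hxM : x ∈ M.nodes := M.mem_nodes hT hx
  have hxK : x ∈ K.closed := hTK (subset_convexHull ℝ _ hx)
  obtain ⟨hne, T₁, hT₁, hx₁, hy₁⟩ := hσ.edge x hxM hxe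
  have hface := hσ.face x hxM hxe K hl.mem
  obtain ⟨T₂, hT₂, hT₂K, hx₂, hy₂⟩ := M.exists_elem_of_edge hl.mem hT₁ hx₁ hy₁
    (hface K.verts subset_rfl hxK)
  obtain ⟨k₂, -, τ₂, hτ₂, hv₂⟩ := M.graded K a b c d hl T₂ hT₂ hT₂K
  obtain ⟨p, hpτ, hxp⟩ := exists_index hμ hν hl hT hTK hτ hTτ hx
  obtain ⟨κ, hκ, hxκ⟩ : ∃ κ, (κ = k ∨ κ = k + 1) ∧
      x = gradeNode P (μ K) (ν K) (M.strips K) (M.layers K) a b c d κ p := by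
    rcases hxp with h | h
    · exact ⟨k, Or.inl rfl, h⟩
    · exact ⟨k + 1, Or.inr rfl, h⟩
  have hp₂ : p ∈ τ₂ := by
    rcases hv₂ hx₂ with ⟨p', hp', h⟩ | ⟨p', hp', h⟩
    all_goals
      rw [hxκ] at h
      rwa [← gradeNode_index_injective hμ hn hdet h]
  obtain ⟨κ', q, hq₂, hyq⟩ : ∃ κ', ∃ q ∈ τ₂,
      σ x = gradeNode P (μ K) (ν K) (M.strips K) (M.layers K) a b c d κ' q := by
    rcases hv₂ hy₂ with ⟨q, hq, h⟩ | ⟨q, hq, h⟩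
    · exact ⟨_, q, hq, h.symm⟩
    · exact ⟨_, q, hq, h.symm⟩
  -- `σ x` is a node of the same plane as `x`. Nodes on `cd` belong to every plane. If `x` is on
  -- `cd`, then so is `σ x`, by the condition on edges of macro-elements. Otherwise the two lie in a
  -- common plane, and away from `cd` the plane is unique.
  have hyκ : σ x = gradeNode P (μ K) (ν K) (M.strips K) (M.layers K) a b c d κ q := by
    by_cases hql : q.1 + q.2 = M.layers K
    · rw [hyq]; exact gradeNode_of_level_eq hμ hn hql _ _
    by_cases hpl : p.1 + p.2 = M.layers K
    · exfalso
      apply hql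
      have hs : ({c, d} : Set E3) ⊆ K.verts := by
        rw [hl.verts_eq]
        intro z hz
        simp only [mem_insert_iff, mem_singleton_iff] at hz ⊢
        tauto
      have h1 := hface {c, d} hs (by
        rw [convexHull_pair, hxκ]; exact gradeNode_mem_segment hμ hn κ hpl)
      rw [convexHull_pair] at h1
      have h2 := h1 (right_mem_segment ℝ x (σ x))
      rw [hyq] at h2
      exact level_eq_of_mem_segment hμ hn hdet h2
    · obtain ⟨k₃, -, h1, h2⟩ := hσ.plane x hxM hxe K a b c d hl hxK
      rw [hxκ] at h1
      rw [hyq] at h2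
      rw [hyq, eq_of_gradeNode_mem_gradePlane hμ hν hN hn hdet hpl h1,
        eq_of_gradeNode_mem_gradePlane hμ hν hN hn hdet hql h2]
  have hpq : p ≠ q := by
    rintro rfl
    exact hne (hyκ.trans hxκ.symm)
  -- The edge is only known to be covered by the union of the prisms. Its midpoint is in one of
  -- them, and a lattice edge meeting a lattice triangle in its midpoint is an edge of this
  -- triangle.
  have h3 := closure_patchDomain_subset k B
    (hadm.edges x hx hxe (midpoint_mem_segment (𝕜 := ℝ) x (σ x)))
  obtain ⟨τ', hτ', h4⟩ := mem_iUnion₂.1 h3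
  have h5 : midpoint ℝ x (σ x) = midpoint ℝ
      (gradeNode P (μ K) (ν K) (M.strips K) (M.layers K) a b c d κ p)
      (gradeNode P (μ K) (ν K) (M.strips K) (M.layers K) a b c d κ q) := by rw [← hxκ, ← hyκ]
  rw [h5] at h4
  have h6 := (isGrading_gradeFun hμ).mem_of_midpoint (hadm.lattice τ' hτ') hτ₂ hp₂ hq₂
    (latPt_midpoint_mem hμ hν hN hn hdet (hadm.lattice τ' hτ') h4)
  refine ⟨τ', hτ', p, h6.1, q, h6.2, hpτ, hpq, ?_⟩
  rcases hκ with rfl | rfl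
  · exact Or.inl ⟨hxκ, hyκ⟩
  · exact Or.inr ⟨hxκ, hyκ⟩

/-- The patch is small. -/
theorem card_patch_le (hμ : 0 < μ K) (hμ1 : μ K ≤ 1) (hν : 0 < ν K) (hσ : EdgeSelection M σ)
    (hl : EdgeLabel P K a b c d) (hT : T ∈ M.elems) (hTK : T.closed ⊆ K.closed)
    (hpatch : IsPatch M σ K a b c d T k B) : B.card ≤ 72 := by
  have hadm := hpatch.admissible
  obtain ⟨τ, hτB, hTτ⟩ := hadm.contains
  have hτ := hadm.lattice τ hτB
  obtain ⟨B', hcard, hlat, hconn, htouch⟩ := exists_small_patch hτ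
  have hne : ∃ p, p ∈ τ := by
    obtain ⟨p, hp, -⟩ := hτ.exists_level_lt
    exact ⟨p, hp⟩
  have hτB' : τ ∈ B' := htouch τ hτ (by obtain ⟨p, hp⟩ := hne; exact ⟨p, hp, hp⟩)
  -- All triangles with a vertex in `τ` form, after completion, an admissible patch. Minimality
  -- bounds the actual patch by its cardinality.
  refine (hpatch.minimal k B' ⟨hadm.strip, hlat, ⟨τ, hτB', hTτ⟩, hconn, ?_⟩).trans hcard
  intro x hx hxe
  obtain ⟨τ', hτ', p, hp, q, hq, hpτ, -, h⟩ :=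
    exists_index_edge hμ hν hσ hl hT hTK hadm hτB hTτ hx hxe
  have hτ'l := hadm.lattice τ' hτ'
  refine Subset.trans ?_ (prism_subset_closure_patchDomain hμ hν (M.strips_pos K hl.mem)
    (M.layers_pos K hl.mem) hl.det_ne_zero hμ1 (htouch τ' hτ'l ⟨p, hp, hpτ⟩) hτ'l)
  refine (convex_convexHull ℝ _).segment_subset (subset_convexHull ℝ _ ?_)
    (subset_convexHull ℝ _ ?_)
  · rcases h with h | h
    · exact Or.inl ⟨p, hp, h.1.symm⟩
    · exact Or.inr ⟨p, hp, h.1.symm⟩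
  · rcases h with h | h
    · exact Or.inl ⟨q, hq, h.2.symm⟩
    · exact Or.inr ⟨q, hq, h.2.symm⟩

/-- A patch that touches the edge contains the prism at the edge. -/
theorem corner_mem_of_touches (hμ : 0 < μ K) (hν : 0 < ν K) (hl : EdgeLabel P K a b c d)
    (hadm : IsAdmissiblePatch M σ K a b c d T k B)
    (h : (closure (patchDomain P (μ K) (ν K) (M.strips K) (M.layers K) a b c d k B) ∩
      segment ℝ a b).Nonempty) : upTri 0 0 ∈ B := by
  have hn := M.layers_pos K hl.mem
  have hdet := hl.det_ne_zero
  have hG := isGrading_gradeFun hμ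
  obtain ⟨x, hx, hxab⟩ := h
  obtain ⟨τ, hτB, hxτ⟩ := mem_iUnion₂.1 (closure_patchDomain_subset k B hx)
  have hτ := hadm.lattice τ hτB
  rw [prism_eq_prism hμ hν (M.strips_pos K hl.mem) hn hdet hτ] at hxτ
  obtain ⟨y, ⟨h1, -, -⟩, rfl⟩ := hxτ
  obtain ⟨α, β, -, -, hαβ, h2⟩ := hxab
  have e : α • a + β • b = macroMap a b c d (0, 0, β) := by
    obtain rfl : α = 1 - β := by linarith
    rw [macroMap, boxMap]; simp only; module
  rw [e, layerFrame_map] at h2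
  have h' := macroMap_injective hdet h2
  simp only [Prod.mk.injEq] at h'
  have hlam := gradeScale_pos (μ := μ K) hn
  have e1 : y.1 = 0 := by simpa [hlam.ne'] using h'.1.symm
  have e2 : y.2.1 = 0 := by simpa [hlam.ne'] using h'.2.1.symm
  -- A point of the edge `ab` projects to the origin of the lattice, which belongs to `upTri 0 0`
  -- only.
  have h0 : (0, 0) ∈ τ := by
    refine mem_of_latPt_mem hG hτ ?_
    rw [e1, e2] at h1
    simpa [latPt] using h1
  obtain ⟨i, j, ⟨h3, rfl⟩ | ⟨h3, rfl⟩⟩ := isLatticeTriangle_iff.1 hτ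
  · rw [mem_upTri] at h0
    obtain ⟨rfl, rfl⟩ : i = 0 ∧ j = 0 := by omega
    exact hτB
  · rw [mem_downTri] at h0
    omega

end mesh

/-! ### The characteristic lengths near the edge. -/

theorem Finset.exists_pos_le {ι : Type*} (s : Finset ι) (f : ι → ℝ) (hf : ∀ i ∈ s, 0 < f i) :
    ∃ g : ℝ, 0 < g ∧ ∀ i ∈ s, g ≤ f i := by
  rcases s.eq_empty_or_nonempty with rfl | hs
  · exact ⟨1, one_pos, by simp⟩
  · obtain ⟨i, hi, h⟩ := s.exists_min_image f hs
    exact ⟨f i, hf i hi, h⟩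

theorem IsGrading.exists_gap {G : ℕ → ℝ} (hG : IsGrading G) (L : ℕ) : ∃ g : ℝ, 0 < g ∧
    ∀ p q : ℕ × ℕ, p.1 + p.2 ≤ L → q.1 + q.2 ≤ L → p ≠ q →
      g ≤ |(latPt G p).1 - (latPt G q).1| + |(latPt G p).2 - (latPt G q).2| := by
  classical
  obtain ⟨g, hg, h⟩ := Finset.exists_pos_le
    ((levelBox L ×ˢ levelBox L).filter fun i => i.1 ≠ i.2)
    (fun i => |(latPt G i.1).1 - (latPt G i.2).1| + |(latPt G i.1).2 - (latPt G i.2).2|) (by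
      intro i hi
      have hne := (Finset.mem_filter.1 hi).2
      by_contra hc
      push Not at hc
      have h1 := abs_nonneg ((latPt G i.1).1 - (latPt G i.2).1)
      have h2 := abs_nonneg ((latPt G i.1).2 - (latPt G i.2).2)
      have e1 : |(latPt G i.1).1 - (latPt G i.2).1| = 0 := by linarith
      have e2 : |(latPt G i.1).2 - (latPt G i.2).2| = 0 := by linarith
      rw [abs_eq_zero, sub_eq_zero] at e1 e2
      exact hne (hG.latPt_injective (Prod.ext e1 e2)))
  refine ⟨g, hg, fun p q hp hq hpq => h (p, q) ?_⟩
  rw [Finset.mem_filter, Finset.mem_product]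
  exact ⟨⟨mem_levelBox hp, mem_levelBox hq⟩, hpq⟩

theorem exists_norm_axisProj_le (a b : E3) : ∃ A : ℝ, 0 < A ∧ ∀ v, ‖axisProj a b v‖ ≤ A * ‖v‖ := by
  refine ⟨‖LinearMap.toContinuousLinearMap (axisProj a b)‖ + 1, by positivity, fun v => ?_⟩
  have := (LinearMap.toContinuousLinearMap (axisProj a b)).le_opNorm v
  have h2 := norm_nonneg v
  rw [LinearMap.coe_toContinuousLinearMap'] at this
  linarith

theorem macroMap_sub (a b c d : E3) (y z : ℝ × ℝ × ℝ) :
    macroMap a b c d y - macroMap a b c d z =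
      (y.1 - z.1) • (c - a) + (y.2.1 - z.2.1) • (d - a) + (y.2.2 - z.2.2) • (b - a) := by
  simp only [macroMap, boxMap]
  module

section lengths

variable {P : MacroPartition} {μ : ℝ} {a b c d : E3}

open NeedleData in
/-- The characteristic lengths of an element near the edge. -/
theorem exists_length_constant (hμ : 0 < μ) (hμ1 : μ ≤ 1)
    (hdet : det3 (c - a) (d - a) (b - a) ≠ 0) (m : ℕ) : ∃ C : ℝ, 0 < C ∧
    ∀ (ν : ℝ) (N n k : ℕ) (T : Tet) (h₁ h₃ : ℝ), 0 < ν → 0 < N → 0 < n →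
    IsLengths P ν N a b c d T h₁ h₃ →
    (∀ i, ∃ p : ℕ × ℕ, p.1 + p.2 ≤ m + 1 ∧ p.1 + p.2 ≤ n ∧
      (T.points i = gradeNode P μ ν N n a b c d k p ∨
        T.points i = gradeNode P μ ν N n a b c d (k + 1) p)) →
    (gradeScale μ n ≤ C * h₁ ∧ h₁ ≤ C * gradeScale μ n) ∧
      gradePos P ν N a (k + 1) - gradePos P ν N a k ≤ C * h₃ ∧
      h₃ ≤ C * (gradePos P ν N a (k + 1) - gradePos P ν N a k) := by
  have hG := isGrading_gradeFun hμ
  have hGm := monotone_gradeFun hμ hμ1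
  have hab := ne_of_det hdet
  obtain ⟨g, hg, hgap⟩ := hG.exists_gap (m + 1)
  obtain ⟨κ, hκ, hlow⟩ := exists_edgeDist_lower hdet
  obtain ⟨A, hA, hproj⟩ := exists_norm_axisProj_le a b
  have hE := one_le_edgeBound a b c d
  have hM := one_le_coordBound hG m
  set E := edgeBound a b c d with hEdef
  set M := coordBound (gradeFun μ) m with hMdef
  have hL : 0 < ‖b - a‖ := norm_pos_iff.2 (sub_ne_zero.2 hab.symm)
  set C := A / (κ * g) + 8 * M * E + ((m + 1 : ℕ) + 1) / ‖b - a‖ + ‖b - a‖ with hC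
  refine ⟨C, by positivity, fun ν N n k T h₁ h₃ hν hN hn hlen hidx => ?_⟩
  have hlam := gradeScale_pos (μ := μ) hn
  have hmono := gradePos_strictMono P hν hN a
  have hD : 0 < gradePos P ν N a (k + 1) - gradePos P ν N a k :=
    sub_pos.2 (hmono (Nat.lt_succ_self k))
  set lam := gradeScale μ n with hlamdef
  set D := gradePos P ν N a (k + 1) - gradePos P ν N a k with hDdef
  choose f hf1 hf2 hf3 using hidx
  set Y : Fin 4 → ℝ := fun i => (latPt (gradeFun μ) (f i)).1 with hY
  set Z : Fin 4 → ℝ := fun i => (latPt (gradeFun μ) (f i)).2 with hZ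
  have hco : ∀ i, ∃ t, T.points i = macroMap a b c d (lam * Y i, lam * Z i, t) := by
    intro i
    rcases hf3 i with h | h <;> rw [h, gradeNode_eq P μ ν N hn] <;> exact ⟨_, rfl⟩
  choose t ht using hco
  have hbd : ∀ i, 0 ≤ Y i ∧ Y i ≤ M ∧ 0 ≤ Z i ∧ Z i ≤ M := fun i =>
    have h1 := hG.latPt_nonneg (f i)
    have h2 := PrismFrame.latPt_le_sum hG (mem_levelBox (hf1 i))
    ⟨h1.1, h2.1, h1.2, h2.2⟩
  -- Projected along the axis, nodes over different lattice points are at least λκg apart, with the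
  -- lattice gap `g`; the projection enlarges distances at most by the factor `A`.
  have hlower : ∀ p q, f p ≠ f q → lam * (κ * g) ≤ A * dist (T.points p) (T.points q) := by
    intro p q hpq
    rw [dist_eq_norm]
    refine le_trans ?_ (hproj _)
    rw [ht p, ht q, macroMap_sub, map_add, map_add, map_smul, map_smul, map_smul,
      axisProj_self hab, smul_zero, add_zero]
    simp only
    rw [← mul_sub, ← mul_sub, mul_smul, mul_smul, ← smul_add, norm_smul, Real.norm_of_nonneg hlam.le]
    refine mul_le_mul_of_nonneg_left (le_trans ?_ (hlow _ _)) hlam.le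
    exact mul_le_mul_of_nonneg_left (hgap _ _ (hf1 p) (hf1 q) hpq) hκ.le
  -- Within one plane the longitudinal difference is a multiple of the transversal ones. So the
  -- whole distance is of the order λ, although D may be much larger.
  have hupper : ∀ p q, (∃ k ≤ N, T.points p ∈ gradePlane P ν N a b c d k ∧
      T.points q ∈ gradePlane P ν N a b c d k) →
      dist (T.points p) (T.points q) ≤ lam * (8 * M * E) := by
    rintro p q ⟨k', hk', hp, hq⟩
    obtain ⟨α, β, h1⟩ := exists_of_mem_gradePlane hp
    obtain ⟨α', β', h2⟩ := exists_of_mem_gradePlane hq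
    have e1 := macroMap_injective hdet ((ht p).symm.trans h1)
    have e2 := macroMap_injective hdet ((ht q).symm.trans h2)
    simp only [Prod.mk.injEq] at e1 e2
    obtain ⟨e11, e12, -⟩ := e1
    obtain ⟨e21, e22, -⟩ := e2
    have htm := gradePos_mem P hν hN hk' a
    rw [dist_eq_norm, h1, h2, macroMap_sub]
    simp only
    rw [← e11, ← e12, ← e21, ← e22]
    set τ := gradePos P ν N a k'
    set y := lam * Y p - lam * Y q with hy
    set z := lam * Z p - lam * Z q with hz
    have hyb : |y| ≤ lam * (2 * M) := by
      rw [hy, ← mul_sub, abs_mul, abs_of_pos hlam]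
      refine mul_le_mul_of_nonneg_left (abs_le.2 ⟨?_, ?_⟩) hlam.le <;>
      linarith [(hbd p).1, (hbd p).2.1, (hbd q).1, (hbd q).2.1]
    have hzb : |z| ≤ lam * (2 * M) := by
      rw [hz, ← mul_sub, abs_mul, abs_of_pos hlam]
      refine mul_le_mul_of_nonneg_left (abs_le.2 ⟨?_, ?_⟩) hlam.le <;>
      linarith [(hbd p).2.2.1, (hbd p).2.2.2, (hbd q).2.2.1, (hbd q).2.2.2]
    have e : τ * (1 - lam * Y p - lam * Z p) - τ * (1 - lam * Y q - lam * Z q) =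
        -(τ * (y + z)) := by rw [hy, hz]; ring
    rw [e]
    have n1 := norm_nonneg (c - a)
    have n2 := norm_nonneg (d - a)
    have n3 := norm_nonneg (b - a)
    have n4 := norm_nonneg (axisProj a b (c - a))
    have n5 := norm_nonneg (axisProj a b (d - a))
    have hc : ‖y • (c - a)‖ ≤ lam * (2 * M) * E := by
      rw [norm_smul, Real.norm_eq_abs]
      exact mul_le_mul hyb (by rw [hEdef]; unfold edgeBound; linarith) n1 (by positivity)
    have hd : ‖z • (d - a)‖ ≤ lam * (2 * M) * E := by
      rw [norm_smul, Real.norm_eq_abs]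
      exact mul_le_mul hzb (by rw [hEdef]; unfold edgeBound; linarith) n2 (by positivity)
    have hb : ‖(-(τ * (y + z))) • (b - a)‖ ≤ lam * (4 * M) * E := by
      rw [norm_smul, Real.norm_eq_abs, abs_neg, abs_mul, abs_of_nonneg htm.1]
      refine mul_le_mul ?_ (by rw [hEdef]; unfold edgeBound; linarith) n3 (by positivity)
      refine (mul_le_of_le_one_left (abs_nonneg _) htm.2).trans ((abs_add_le _ _).trans ?_)
      linarith
    refine (norm_add₃_le).trans ?_
    linarith
  obtain ⟨i, j, p, q, p', q', hij, ⟨s, hs⟩, hh₃, hp, hqi, hqj, hp', hqi', hqj', -, hpl, hpl', hh₁⟩ :=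
    hlen
  have hfij : f j = f i := by
    rw [ht i, ht j, macroMap_sub] at hs
    have e : macroMap a b c d (lam * Y j, lam * Z j, t j) =
        macroMap a b c d (lam * Y i, lam * Z i, t i + s) := by
      rw [← sub_eq_zero, macroMap_sub]
      simp only at hs ⊢
      rw [← sub_eq_zero] at hs
      rw [← hs]; module
    have e' := macroMap_injective hdet e
    simp only [Prod.mk.injEq] at e'
    exact hG.latPt_injective
      (Prod.ext (mul_left_cancel₀ hlam.ne' e'.1) (mul_left_cancel₀ hlam.ne' e'.2.1))
  have hinj := T.independent.injective
  have hcase : (T.points i = gradeNode P μ ν N n a b c d k (f i) ∧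
      T.points j = gradeNode P μ ν N n a b c d (k + 1) (f i)) ∨
      (T.points j = gradeNode P μ ν N n a b c d k (f i) ∧
      T.points i = gradeNode P μ ν N n a b c d (k + 1) (f i)) := by
    have h1 := hf3 i
    have h2 := hf3 j
    rw [hfij] at h2
    rcases h1 with h1 | h1 <;> rcases h2 with h2 | h2
    · exact absurd (hinj (h1.trans h2.symm)) hij
    · exact Or.inl ⟨h1, h2⟩
    · exact Or.inr ⟨h2, h1⟩
    · exact absurd (hinj (h1.trans h2.symm)) hij
  -- Only two nodes of the layer lie over `f i`, and these are the vertices `i` and `j`.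
  have hne : ∀ p q, (p = i ∨ p = j) → q ≠ i → q ≠ j → f p ≠ f q := by
    intro p q hp hqi hqj hpq
    have hfp : f p = f i := by rcases hp with rfl | rfl; exacts [rfl, hfij]
    have h1 := hf3 q
    rw [← hpq, hfp] at h1
    rcases hcase with ⟨c1, c2⟩ | ⟨c1, c2⟩ <;> rcases h1 with h1 | h1
    · exact hqi (hinj (h1.trans c1.symm))
    · exact hqj (hinj (h1.trans c2.symm))
    · exact hqj (hinj (h1.trans c1.symm))
    · exact hqi (hinj (h1.trans c2.symm))
  have hheight : h₃ = D * (1 - lam * Y i - lam * Z i) * ‖b - a‖ ∧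
      0 ≤ 1 - lam * Y i - lam * Z i := by
    have hnn : 0 ≤ 1 - lam * Y i - lam * Z i := by
      have := (layerFrame P hμ hν hN hn hdet k).height_nonneg hG (hf2 i)
      rwa [layerFrame_height] at this
    refine ⟨?_, hnn⟩
    have e : gradeNode P μ ν N n a b c d (k + 1) (f i) - gradeNode P μ ν N n a b c d k (f i) =
        (D * (1 - lam * Y i - lam * Z i)) • (b - a) := by
      rw [gradeNode_eq P μ ν N hn, gradeNode_eq P μ ν N hn, macroMap_sub]
      simp only [hDdef, hY, hZ]
      module
    have e2 : dist (gradeNode P μ ν N n a b c d (k + 1) (f i)) (gradeNode P μ ν N n a b c d k (f i)) =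
        D * (1 - lam * Y i - lam * Z i) * ‖b - a‖ := by
      rw [dist_eq_norm, e, norm_smul, Real.norm_of_nonneg (mul_nonneg hD.le hnn)]
    rw [hh₃]
    rcases hcase with ⟨c1, c2⟩ | ⟨c1, c2⟩
    · rw [c1, c2, dist_comm, e2]
    · rw [c1, c2, e2]
  -- At level `n` the upper and the lower node coincide, so there would be no vertical edge. Below
  -- it the height is at least 1/(level + 1), which makes `h₃` comparable with D.
  have hlt : (f i).1 + (f i).2 < n := by
    refine (hf2 i).lt_of_ne fun h => hij (hinj ?_)
    have := gradeNode_of_level_eq (P := P) (ν := ν) (N := N) (a := a) (b := b) (c := c) (d := d)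
      hμ hn h k (k + 1)
    rcases hcase with ⟨c1, c2⟩ | ⟨c1, c2⟩
    · rw [c1, c2, this]
    · rw [c1, c2, this]
  have hhlow := (layerFrame P hμ hν hN hn hdet k).le_height hGm hlt
  have hhup := (layerFrame P hμ hν hN hn hdet k).height_le hG (f i)
  rw [layerFrame_height] at hhlow hhup
  have hkg : 0 < κ * g := by positivity
  have hdd := div_mul_cancel₀ A hkg.ne'
  have t1 : 0 ≤ A / (κ * g) := by positivity
  have t2 : 0 ≤ 8 * M * E := by positivity
  have t3 : 0 ≤ (((m + 1 : ℕ) : ℝ) + 1) / ‖b - a‖ := by positivity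
  refine ⟨⟨?_, ?_⟩, ?_, ?_⟩
  · have l1 := hlower p q (hne p q hp hqi hqj)
    have l2 := hlower p' q' (hne p' q' hp' hqi' hqj')
    have h0 : 0 ≤ h₁ := by rw [hh₁]; positivity
    have l3 : lam * (κ * g) ≤ A * h₁ := by rw [hh₁]; linarith
    have l4 : lam ≤ A / (κ * g) * h₁ := by
      rw [div_mul_eq_mul_div, le_div_iff₀ hkg]; exact l3
    refine l4.trans (mul_le_mul_of_nonneg_right ?_ h0)
    rw [hC]; linarith
  · have u1 := hupper p q hpl
    have u2 := hupper p' q' hpl'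
    have u3 : h₁ ≤ 8 * M * E * lam := by rw [hh₁]; linarith
    refine u3.trans (mul_le_mul_of_nonneg_right ?_ hlam.le)
    rw [hC]; linarith
  · have h0 : 0 ≤ h₃ := by rw [hh₃]; positivity
    have l1 : D ≤ (((m + 1 : ℕ) : ℝ) + 1) / ‖b - a‖ * h₃ := by
      rw [hheight.1]
      have e : (((m + 1 : ℕ) : ℝ) + 1) / ‖b - a‖ * (D * (1 - lam * Y i - lam * Z i) * ‖b - a‖) =
          D * ((((m + 1 : ℕ) : ℝ) + 1) * (1 - lam * Y i - lam * Z i)) := by field_simp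
      rw [e]
      refine le_mul_of_one_le_right hD.le ?_
      rw [div_le_iff₀ (by positivity)] at hhlow
      have h5 : (((f i).1 + (f i).2 : ℕ) : ℝ) ≤ ((m + 1 : ℕ) : ℝ) := by exact_mod_cast hf1 i
      have := mul_le_mul_of_nonneg_left h5 hheight.2
      simp only [hY, hZ] at this ⊢
      linarith
    refine l1.trans (mul_le_mul_of_nonneg_right ?_ h0)
    rw [hC]; linarith
  · rw [hheight.1]
    have l1 : D * (1 - lam * Y i - lam * Z i) * ‖b - a‖ ≤ D * 1 * ‖b - a‖ :=
      mul_le_mul_of_nonneg_right (mul_le_mul_of_nonneg_left hhup hD.le) hL.le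
    have l2 : ‖b - a‖ * D ≤ C * D := mul_le_mul_of_nonneg_right (by rw [hC]; linarith) hD.le
    linarith

end lengths

/-! ### The interpolant on an element, and the proof of the two estimates. -/

/-- The quasi-interpolant is affine on the elements. -/
theorem exists_affine_eq_quasiInterp {P : MacroPartition} {μ ν : Tet → ℝ} (M : GradedMesh P μ ν)
    (σ : E3 → E3) (u : E3 → ℝ) {T : Tet} (hT : T ∈ M.elems) : ∃ (l : E3) (κ : ℝ),
    (∀ x ∈ T.opened, quasiInterp M σ u x = inner ℝ l x + κ) ∧
    ∀ i, (T.points i ∈ excludedNodes P → inner ℝ l (T.points i) + κ = 0) ∧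
      (T.points i ∉ excludedNodes P →
        inner ℝ l (T.points i) + κ = edgeProj u (T.points i) (σ (T.points i))) := by
  classical
  set w : Fin 4 → ℝ := fun i =>
    if T.points i ∈ excludedNodes P then 0 else edgeProj u (T.points i) (σ (T.points i)) with hw
  set g : E3 →ᵃ[ℝ] ℝ := ∑ i, w i • T.basis.coord i with hg
  have hgx : ∀ x, g x = ∑ i, w i * T.basis.coord i x := by
    intro x
    rw [hg, Fin.sum_univ_four, Fin.sum_univ_four]
    rfl
  set l := (InnerProductSpace.toDual ℝ E3).symm (LinearMap.toContinuousLinearMap g.linear) with hl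
  have hlx : ∀ x, inner ℝ l x + g 0 = g x := by
    intro x
    rw [hl, InnerProductSpace.toDual_symm_apply, LinearMap.coe_toContinuousLinearMap']
    have := g.map_vadd 0 x
    simpa using this.symm
  have hval : ∀ i, g (T.points i) = w i := by
    intro i
    have h1 : ∀ j, T.basis.coord j (T.points i) = if j = i then 1 else 0 :=
      fun j => T.basis.coord_apply j i
    rw [hgx]
    simp [h1]
  refine ⟨l, g 0, fun x hx => ?_, fun i => ?_⟩
  · rw [hlx, hgx]
    -- At an interior point of `T` the element chosen in the definition of the nodal basis can only
    -- be `T`.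
    have hnb : ∀ n, M.toTriangulation.nodalBasis n x = T.hat n x := by
      intro n
      have h : ∃ T ∈ M.elems, x ∈ T.closed := ⟨T, hT, interior_subset hx⟩
      rw [Triangulation.nodalBasis, dif_pos h,
        M.toTriangulation.eq_of_mem_opened h.choose_spec.1 hT hx h.choose_spec.2]
    unfold quasiInterp
    simp only [hnb, Tet.hat, Finset.mul_sum]
    rw [Finset.sum_comm]
    refine Finset.sum_congr rfl fun i _ => ?_
    simp only [mul_ite, mul_zero]
    rw [Finset.sum_ite_eq]
    have hmem : T.points i ∈ M.nodes := M.mem_nodes hT (mem_range_self i)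
    by_cases he : T.points i ∈ excludedNodes P
    · simp [hw, he]
    · simp [hw, he, hmem]
  · rw [hlx, hval]
    constructor
    · intro h; simp only [hw, if_pos h]
    · intro h; simp only [hw, if_neg h]

section

/-- The patch of a needle element, in the frame of the layer. -/
theorem exists_needlePatch {P : MacroPartition} {μ ν : Tet → ℝ} {K : Tet} {a b c d : E3} (C₀ : ℝ)
    (hμ : 0 < μ K) (hμ1 : μ K ≤ 1) (hν : 0 < ν K) (hl : EdgeLabel P K a b c d) :
    ∃ C C₁ : ℝ, 0 < C ∧ ∀ (M : GradedMesh P μ ν) (σ : E3 → E3) (T : Tet) (S : Set E3) (h₁ h₃ : ℝ),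
      NeedleAtEdge M σ C₀ K a b c d T S h₁ h₃ →
      ∃ L : NeedlePatch (gradeFun (μ K)) a b c d C₁ 72, L.S = S ∧ 0 < L.D ∧
        (a ∈ closure S → L.t = 0) ∧ L.F.lam ≤ C * h₁ ∧ h₁ ≤ C * L.F.lam ∧ L.D ≤ C * h₃ ∧
        ∃ τ ∈ L.B, T.verts ⊆ L.F.bot '' τ ∪ L.F.top '' τ ∧
        ∀ x ∈ T.verts, x ∉ excludedNodes P → ∃ τ' ∈ L.B, ∃ p ∈ τ', ∃ q ∈ τ', p ≠ q ∧
          ((x = L.F.bot p ∧ σ x = L.F.bot q) ∨ (x = L.F.top p ∧ σ x = L.F.top q)) := by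
  have hG := isGrading_gradeFun hμ
  have hdet := hl.det_ne_zero
  obtain ⟨C, hC, hlen⟩ := exists_length_constant (P := P) hμ hμ1 hdet 72
  refine ⟨C, C * |C₀| * C, hC, fun M σ T S h₁ h₃ h => ?_⟩
  obtain ⟨k, B, hpatch, hS⟩ := h.patch
  have hadm := hpatch.admissible
  have hN := M.strips_pos K hl.mem
  have hn := M.layers_pos K hl.mem
  have hcard := card_patch_le hμ hμ1 hν h.selection hl h.mem h.subset hpatch
  have hcorner := corner_mem_of_touches hμ hν hl hadm (by rw [← hS]; exact h.touches)
  obtain ⟨τ, hτB, hTτ⟩ := hadm.contains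
  have hτ := hadm.lattice τ hτB
  have hlevel := level_le_of_connected hadm.lattice hcard hcorner hadm.connected
  have hidx : ∀ x ∈ T.verts, ∃ p ∈ τ,
      x = gradeNode P (μ K) (ν K) (M.strips K) (M.layers K) a b c d k p ∨
      x = gradeNode P (μ K) (ν K) (M.strips K) (M.layers K) a b c d (k + 1) p := fun x hx =>
    exists_index hμ hν hl h.mem h.subset hτ hTτ hx
  obtain ⟨⟨l1, l2⟩, l3, l4⟩ := hlen (ν K) (M.strips K) (M.layers K) k T h₁ h₃ hν hN hn h.lengths
    (fun i => by
      obtain ⟨p, hp, h⟩ := hidx (T.points i) (mem_range_self i)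
      exact ⟨p, hlevel τ hτB p hp, hτ.level_le hp, h⟩)
  have hD : 0 < gradePos P (ν K) (M.strips K) a (k + 1) - gradePos P (ν K) (M.strips K) a k :=
    sub_pos.2 (gradePos_strictMono P hν hN a (Nat.lt_succ_self k))
  set D := gradePos P (ν K) (M.strips K) a (k + 1) - gradePos P (ν K) (M.strips K) a k with hDdef
  set F := layerFrame P hμ hν hN hn hdet k with hF
  have hSF : S = interior (⋃ τ ∈ B, F.prism τ) := by
    rw [hS]; exact patchDomain_eq hμ hν hN hn hdet hadm.lattice
  -- The needle condition in terms of the frame: λ ≤ C h₁ ≤ C |C₀| h₃ ≤ C |C₀| C D.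
  have hlam : F.lam ≤ C * |C₀| * C * |D| := by
    rw [abs_of_pos hD]
    have h3 : 0 ≤ h₃ := by
      by_contra hc
      push Not at hc
      have := mul_neg_of_pos_of_neg hC hc
      linarith
    have := mul_le_mul_of_nonneg_right (le_abs_self C₀) h3
    have h5 := mul_le_mul_of_nonneg_left (h.needle.trans this) hC.le
    have h6 := mul_le_mul_of_nonneg_left l4 (by positivity : 0 ≤ C * |C₀|)
    change gradeScale (μ K) (M.layers K) ≤ _
    linarith
  refine ⟨{
    F := F
    t := gradePos P (ν K) (M.strips K) a k
    D := D
    t_mem := gradePos_mem P hν hN hadm.strip.le a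
    tD_mem := by
      rw [hDdef, add_sub_cancel]
      exact gradePos_mem P hν hN hadm.strip a
    D_ne := hD.ne'
    s_eq := rfl
    P_eq := rfl
    Q_eq := rfl
    V_eq := rfl
    lam_le := hlam
    B := B
    S := S
    lattice := hadm.lattice
    S_eq := hSF
    card_le := hcard
    corner := hcorner
    connected := hadm.connected }, rfl, hD, ?_, l1, l2, l3, τ, hτB, ?_, ?_⟩
  -- If `a` is in the closure of the patch, its longitudinal coordinate 0 is the sum of the
  -- nonnegative position of the lower plane and a nonnegative term, so the layer is the one at `a`.
  · intro ha
    rw [hS] at ha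
    obtain ⟨τ', hτ', ha'⟩ := mem_iUnion₂.1 (closure_patchDomain_subset k B ha)
    rw [prism_eq_prism hμ hν hN hn hdet (hadm.lattice τ' hτ')] at ha'
    obtain ⟨y, ⟨-, h2, -⟩, hy⟩ := ha'
    have e : a = macroMap a b c d (0, 0, 0) := by simp [macroMap, boxMap]
    rw [layerFrame_map] at hy
    have hy' := macroMap_injective hdet (hy.trans e)
    simp only [Prod.mk.injEq] at hy'
    obtain ⟨e1, e2, e3⟩ := hy'
    rw [e1, e2, sub_zero, sub_zero, mul_one, ← hDdef] at e3
    have h4 := (gradePos_mem P hν hN hadm.strip.le a).1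
    have h5 := mul_nonneg h2 hD.le
    exact le_antisymm (by linarith) h4
  · intro x hx
    obtain ⟨p, hp, h | h⟩ := hidx x hx
    · exact Or.inl ⟨p, hp, by rw [h]; exact layerFrame_bot hμ hν hN hn hdet k p⟩
    · exact Or.inr ⟨p, hp, by rw [h]; exact layerFrame_top hμ hν hN hn hdet k p⟩
  · intro x hx hxe
    obtain ⟨τ', hτ', p, hp, q, hq, -, hpq, h⟩ :=
      exists_index_edge hμ hν h.selection hl h.mem h.subset hadm hτB hTτ hx hxe
    refine ⟨τ', hτ', p, hp, q, hq, hpq, ?_⟩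
    have eb := layerFrame_bot (P := P) hμ hν hN hn hdet k
    have et := layerFrame_top (P := P) hμ hν hN hn hdet k
    simp only [hF, eb, et]
    exact h

/-- Since Rθ = r, lowering both exponents by one divides by r; the zero order term of the weighted
norm thus becomes the one in `wNorm`. -/
theorem weight_sub_one {o : E3} {e : OrthonormalBasis (Fin 3) ℝ E3} (β δ : ℝ) {x : E3}
    (hr : 0 < axisDist o e x) (hR : 0 < dist x o) :
    weight o e (β - 1) (δ - 1) x = weight o e β δ x / axisDist o e x := by
  rw [weight, weight, Real.rpow_sub_one hR.ne', Real.rpow_sub_one (div_pos hr hR).ne']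
  field_simp

theorem vNorm_eq_sInf (o : E3) (e : OrthonormalBasis (Fin 3) ℝ E3) (β δ : ℝ) (U : Set E3)
    (v : E3 → ℝ) : vNorm o e β δ U v = sInf ((fun G : E3 → E3 =>
      ((∫⁻ x in U, ‖weight o e (β - 1) (δ - 1) x * v x‖ₑ ^ 2) +
        ∫⁻ x in U, ‖weight o e β δ x • G x‖ₑ ^ 2) ^ (1 / 2 : ℝ)) ''
      {G | HasWeakGradient U v G}) := by
  rw [sInf_image]; rfl

-- The weighted norms are infima over weak gradients. The estimate for each choice of gradients
-- passes to the infima along minimising sequences, so that almost everywhere uniqueness of weak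
-- gradients is not needed.
open Filter Topology in
theorem le_sInf_combination {X₀ X₁ X₂ : Set ENNReal} (h₀ : sInf X₀ ≠ ⊤) (h₁ : sInf X₁ ≠ ⊤)
    (h₂ : sInf X₂ ≠ ⊤) {f α β : ENNReal} (hα : α ≠ ⊤) (hβ : β ≠ ⊤)
    (h : ∀ x₀ ∈ X₀, ∀ x₁ ∈ X₁, ∀ x₂ ∈ X₂, f ≤ α * (x₀ + x₁) + β * x₂) :
    f ≤ α * (sInf X₀ + sInf X₁) + β * sInf X₂ := by
  have hne : ∀ {X : Set ENNReal}, sInf X ≠ ⊤ → X.Nonempty := by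
    intro X hX
    by_contra hc
    rw [not_nonempty_iff_eq_empty] at hc
    exact hX (by rw [hc, sInf_empty])
  obtain ⟨u, -, hu, hu'⟩ := exists_seq_tendsto_sInf (hne h₀) (OrderBot.bddBelow _)
  obtain ⟨v, -, hv, hv'⟩ := exists_seq_tendsto_sInf (hne h₁) (OrderBot.bddBelow _)
  obtain ⟨w, -, hw, hw'⟩ := exists_seq_tendsto_sInf (hne h₂) (OrderBot.bddBelow _)
  refine ge_of_tendsto ((ENNReal.Tendsto.const_mul (hu.add hv) (Or.inr hα)).add
    (ENNReal.Tendsto.const_mul hw (Or.inr hβ))) (Eventually.of_forall fun n => ?_)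
  exact h _ (hu' n) _ (hv' n) _ (hw' n)

/-- For `t = 0` the frame starts at `a`, and all three of its vectors are at most a constant times
|D|, by the needle condition. -/
theorem NeedleData.dist_le {G : ℕ → ℝ} (hG : IsGrading G) {a b c d : E3} {C₀ : ℝ} {m : ℕ}
    (N : NeedleData G a b c d C₀ m) (ht : N.t = 0) {x : E3} (hx : x ∈ N.S) :
    dist x a ≤ coordBound G m * edgeBound a b c d * (3 + 2 * |C₀|) * |N.D| := by
  obtain ⟨y, ⟨h1, h2, h3⟩, rfl⟩ := N.S_subset_box hG hx
  obtain ⟨n1, n2, n3⟩ := N.norm_le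
  have hE := one_le_edgeBound a b c d
  have hM := one_le_coordBound hG m
  have hlam := N.F.lam_pos
  have hs : N.F.s = a := by rw [N.s_eq, ht]; simp
  have e : N.F.map y - a = y.1 • N.F.P + y.2.1 • N.F.Q + y.2.2 • N.F.V := by
    rw [PrismFrame.map, boxMap, hs]; abel
  have hb : ∀ {t z : ℝ} {v : E3}, t ∈ Icc 0 (coordBound G m) → ‖v‖ ≤ z →
      ‖t • v‖ ≤ coordBound G m * z := by
    intro t z v ht hv
    rw [norm_smul, Real.norm_of_nonneg ht.1]
    exact mul_le_mul ht.2 hv (norm_nonneg _) (by linarith)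
  rw [dist_eq_norm, e]
  refine (norm_add₃_le).trans ((add_le_add_three (hb h1 n1) (hb h2 n2) (hb h3 n3)).trans ?_)
  have := mul_le_mul_of_nonneg_left N.lam_le'
    (by positivity : 0 ≤ 2 * (coordBound G m * edgeBound a b c d))
  linarith

/-- The error estimate for a needle element, in terms of the sizes of the frame. -/
theorem exists_interpolation_constant {P : MacroPartition} {μ ν : Tet → ℝ} {K : Tet}
    {a b c d : E3} (C₀ : ℝ) (hμ : 0 < μ K) (hμ1 : μ K ≤ 1) (hν : 0 < ν K)
    (hl : EdgeLabel P K a b c d) {s s₃ : ℝ} (hs0 : 0 ≤ s) (hs : s < 1) (hs₃0 : 0 ≤ s₃)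
    (hs₃ : s₃ < 1) : ∃ C : ℝ, 0 < C ∧
    ∀ (M : GradedMesh P μ ν) (σ : E3 → E3) (T : Tet) (S : Set E3) (h₁ h₃ : ℝ),
      NeedleAtEdge M σ C₀ K a b c d T S h₁ h₃ → ∃ lam D : ℝ, 0 < lam ∧ 0 < D ∧ lam ≤ C * h₁ ∧
      h₁ ≤ C * lam ∧ D ≤ C * h₃ ∧ lam ≤ C * D ∧
      ∀ (o : E3) (e : OrthonormalBasis (Fin 3) ℝ E3), IsFrame P a b o e →
      ∀ (u : E3 → ℝ) (W : E3 → E3) (Z : Set E3) (β δ β₃ : ℝ),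
        (Z = ∅ ∨ (Z = {a} ∧ a ∈ closure S)) →
        ContinuousOn u (closure S \ Z) →
        (∀ x ∈ (closure S ∩ segment ℝ a b) \ Z, u x = 0) →
        HasWeakGradient S u W →
        vNorm o e β δ S (partialOf e W 0) ≠ ⊤ →
        vNorm o e β δ S (partialOf e W 1) ≠ ⊤ →
        vNorm o e β₃ 0 S (partialOf e W 2) ≠ ⊤ →
        ∀ A : ℝ, 0 ≤ A →
        (∀ x, 0 < axisDist o e x → axisDist o e x ≤ dist x o →
          (a ∈ closure S → dist x a ≤ C * D) → axisDist o e x ^ s ≤ A * weight o e β δ x) →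
        (∀ x, 0 < axisDist o e x → axisDist o e x ≤ dist x o →
          axisDist o e x ^ s₃ ≤ weight o e β₃ 0 x) →
        h1Seminorm T.opened (fun x => u x - quasiInterp M σ u x) ≤
          ENNReal.ofReal (C * (A * lam ^ (1 - s))) *
              (vNorm o e β δ S (partialOf e W 0) + vNorm o e β δ S (partialOf e W 1))
            + ENNReal.ofReal (C * (lam ^ (-s₃) * D)) * vNorm o e β₃ 0 S (partialOf e W 2) := by
  have hG := isGrading_gradeFun hμ
  have hdet := hl.det_ne_zero
  have hab := NeedleData.ne_of_det hdet
  obtain ⟨C, C₁, hC, hpatch⟩ := exists_needlePatch C₀ hμ hμ1 hν hl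
  obtain ⟨C₂, hC₂, herr⟩ := NeedleData.exists_error_constant (C₀ := C₁) (m := 72) hG
    (monotone_gradeFun hμ hμ1) hdet hs0 hs hs₃0 hs₃
  have hE := NeedleData.one_le_edgeBound a b c d
  have hM := NeedleData.one_le_coordBound hG 72
  set C₃ := NeedleData.coordBound (gradeFun (μ K)) 72 * NeedleData.edgeBound a b c d *
    (3 + 2 * |C₁|) with hC₃
  have hC₃0 : 0 ≤ C₃ := by positivity
  have hC₁ := abs_nonneg C₁
  refine ⟨C + C₂ + C₃ + (1 + |C₁|), by positivity, fun M σ T S h₁ h₃ h => ?_⟩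
  obtain ⟨L, rfl, hD, hLt, l1, l2, l3, τ, hτ, hT, hedge⟩ := hpatch M σ T S h₁ h₃ h
  have hlam := L.F.lam_pos
  have hh₁ : 0 ≤ h₁ := by
    by_contra hc
    push Not at hc
    have := mul_neg_of_pos_of_neg hC hc
    linarith
  have hh₃ : 0 ≤ h₃ := by
    by_contra hc
    push Not at hc
    have := mul_neg_of_pos_of_neg hC hc
    linarith
  refine ⟨L.F.lam, L.D, hlam, hD, ?_, ?_, ?_, ?_, ?_⟩
  · exact l1.trans (mul_le_mul_of_nonneg_right (by linarith) hh₁)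
  · exact l2.trans (mul_le_mul_of_nonneg_right (by linarith) hlam.le)
  · exact l3.trans (mul_le_mul_of_nonneg_right (by linarith) hh₃)
  · have h1 := L.lam_le
    rw [abs_of_pos hD] at h1
    exact h1.trans (mul_le_mul_of_nonneg_right (by linarith [le_abs_self C₁]) hD.le)
  intro o e hfr u W Z β δ β₃ hZ hcont hzero hW f0 f1 f2 A hA hw hw₃
  have hadist : ∀ x, axisDist o e x = edgeDist a b x := axisDist_eq hab hfr.axis hfr.origin
  rw [vNorm_eq_sInf] at f0 f1 f2 ⊢
  rw [vNorm_eq_sInf, vNorm_eq_sInf]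
  refine le_sInf_combination f0 f1 f2 ENNReal.ofReal_ne_top ENNReal.ofReal_ne_top ?_
  rintro _ ⟨H₀, hH₀, rfl⟩ _ ⟨H₁, hH₁, rfl⟩ _ ⟨H₂, hH₂, rfl⟩
  have hseg : segment ℝ L.F.s (L.F.s + L.F.V) ⊆ segment ℝ a b := by
    refine (convex_segment a b).segment_subset ?_ ?_
    · rw [segment_eq_image', L.s_eq]
      exact ⟨L.t, L.t_mem, rfl⟩
    · rw [segment_eq_image', L.s_eq, L.V_eq]
      exact ⟨L.t + L.D, L.tD_mem, by simp only; module⟩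
  set N : NeedleData (gradeFun (μ K)) a b c d C₁ 72 := {
    toNeedlePatch := L
    o := o
    e := e
    axis := hfr.axis
    origin := hfr.origin
    u := u
    W := W
    H := ![H₀, H₁, H₂]
    weak := hW
    weak' := by
      intro i
      fin_cases i
      · exact hH₀
      · exact hH₁
      · exact hH₂
    Z := Z
    Z_sub := by
      rcases hZ with rfl | ⟨rfl, ha⟩
      · exact empty_subset _
      · rw [L.s_eq, hLt ha]; simp
    cont := hcont
    zero := fun x hx => hzero x ⟨⟨hx.1.1, hseg hx.1.2⟩, hx.2⟩ } with hN
  have hr : ∀ x ∈ L.S, 0 < axisDist o e x ∧ axisDist o e x ≤ dist x o := fun x hx => by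
    rw [hadist]
    exact ⟨N.edgeDist_pos hG hdet hx, edgeDist_le_dist hab hfr.axis hfr.origin x⟩
  -- The hypotheses on the weights are needed only in the patch, where r is positive and at most R,
  -- and where R ≤ C D if the patch touches `a`.
  have hdom : N.Dominates s s₃ (weight o e β δ) (weight o e β₃ 0) A 1 := by
    refine ⟨hA, zero_le_one, fun x hx => ?_, fun x hx => ?_⟩
    · rw [← hadist]
      refine hw x (hr x hx).1 (hr x hx).2 fun ha => ?_
      have h1 := N.dist_le hG (hLt ha) hx
      rw [← hC₃] at h1
      change dist x a ≤ C₃ * |L.D| at h1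
      rw [abs_of_pos hD] at h1
      exact h1.trans (mul_le_mul_of_nonneg_right (by linarith) hD.le)
    · rw [← hadist, one_mul]
      exact hw₃ x (hr x hx).1 (hr x hx).2
  obtain ⟨l, κ, haff, hval⟩ := exists_affine_eq_quasiInterp M σ u h.mem
  have key := herr N _ _ A 1 hdom τ hτ T hT (fun x => u x - quasiInterp M σ u x) l κ
    (fun x hx => by
      change u x - quasiInterp M σ u x = u x - (inner ℝ l x + κ)
      rw [haff x hx]) (fun i => by
      by_cases hi : T.points i ∈ excludedNodes P
      · exact Or.inl ((hval i).1 hi)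
      · right
        obtain ⟨τ', hτ', p, hp, q, hq, hpq, h⟩ := hedge _ (mem_range_self i) hi
        refine ⟨τ', hτ', p, hp, q, hq, hpq, ?_⟩
        rw [(hval i).2 hi]
        rcases h with ⟨h1, h2⟩ | ⟨h1, h2⟩
        · rw [h2, h1]; exact Or.inl rfl
        · rw [h2, h1]; exact Or.inr rfl)
  refine key.trans ?_
  have hnorm : ∀ (β δ : ℝ) (i : Fin 3), N.wNorm (weight o e β δ) i =
      ((∫⁻ x in L.S, ‖weight o e (β - 1) (δ - 1) x * partialOf e W i x‖ₑ ^ 2) +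
        ∫⁻ x in L.S, ‖weight o e β δ x • N.H i x‖ₑ ^ 2) ^ (1 / 2 : ℝ) := by
    intro β δ i
    unfold NeedleData.wNorm
    congr 2
    refine setLIntegral_congr_fun N.isOpen_S.measurableSet fun x hx => ?_
    obtain ⟨h1, h2⟩ := hr x hx
    rw [weight_sub_one β δ h1 (h1.trans_le h2), hadist]
  rw [NeedleData.bound, hnorm, hnorm, hnorm, mul_add]
  rw [ofReal_mul_ofReal_mul hC₂.le, ofReal_mul_ofReal_mul hC₂.le, one_mul]
  change ENNReal.ofReal (C₂ * (A * L.F.lam ^ (1 - s))) * _ +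
    ENNReal.ofReal (C₂ * (L.F.lam ^ (-s₃) * |L.D|)) * _ ≤ _
  rw [abs_of_pos hD]
  refine add_le_add (mul_le_mul_left (ENNReal.ofReal_le_ofReal ?_) _)
    (mul_le_mul_left (ENNReal.ofReal_le_ofReal ?_) _)
  · exact mul_le_mul_of_nonneg_right (by linarith) (by positivity)
  · exact mul_le_mul_of_nonneg_right (by linarith) (by positivity)

/-- A uniform constant for finitely many estimates. -/
theorem exists_uniform_real {ι : Type*} (s : Finset ι) {p : ι → ℝ → Prop}
    (hp : ∀ i C C', C ≤ C' → p i C → p i C') (h : ∀ i ∈ s, ∃ C, 0 < C ∧ p i C) :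
    ∃ C, 0 < C ∧ ∀ i ∈ s, p i C := by
  classical
  induction s using Finset.induction_on with
  | empty => exact ⟨1, one_pos, by simp⟩
  | insert i s _ ih =>
    obtain ⟨C, hC, h1⟩ := ih fun j hj => h j (Finset.mem_insert_of_mem hj)
    obtain ⟨C', -, h2⟩ := h i (Finset.mem_insert_self i s)
    refine ⟨max C C', lt_max_of_lt_left hC, fun j hj => ?_⟩
    rcases Finset.mem_insert.1 hj with rfl | hj
    · exact hp _ _ _ (le_max_right _ _) h2
    · exact hp _ _ _ (le_max_left _ _) (h1 j hj)

/-- There are only finitely many labellings. -/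
theorem exists_uniform_label (P : MacroPartition) {p : Tet → E3 → E3 → E3 → E3 → ℝ → Prop}
    (hp : ∀ K a b c d C C', C ≤ C' → p K a b c d C → p K a b c d C')
    (h : ∀ K a b c d, EdgeLabel P K a b c d → ∃ C, 0 < C ∧ p K a b c d C) :
    ∃ C, 0 < C ∧ ∀ K a b c d, EdgeLabel P K a b c d → p K a b c d C := by
  classical
  set V := P.elems.biUnion fun T => Finset.univ.image T.points with hV
  obtain ⟨C, hC, h1⟩ := exists_uniform_real (P.elems ×ˢ V ×ˢ V ×ˢ V ×ˢ V)
    (p := fun i C => EdgeLabel P i.1 i.2.1 i.2.2.1 i.2.2.2.1 i.2.2.2.2 →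
      p i.1 i.2.1 i.2.2.1 i.2.2.2.1 i.2.2.2.2 C)
    (fun i C C' hCC h hl => hp _ _ _ _ _ C C' hCC (h hl)) (fun i _ => by
      by_cases hl : EdgeLabel P i.1 i.2.1 i.2.2.1 i.2.2.2.1 i.2.2.2.2
      · obtain ⟨C, hC, h⟩ := h _ _ _ _ _ hl
        exact ⟨C, hC, fun _ => h⟩
      · exact ⟨1, one_pos, fun h => absurd h hl⟩)
  refine ⟨C, hC, fun K a b c d hl => h1 (K, a, b, c, d) ?_ hl⟩
  have hmem : ∀ x ∈ ({a, b, c, d} : Set E3), x ∈ V := by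
    intro x hx
    rw [← hl.verts_eq] at hx
    obtain ⟨i, rfl⟩ := hx
    exact Finset.mem_biUnion.2 ⟨K, hl.mem, Finset.mem_image.2 ⟨i, Finset.mem_univ _, rfl⟩⟩
  simp only [Finset.mem_product]
  exact ⟨hl.mem, hmem a (by simp), hmem b (by simp), hmem c (by simp), hmem d (by simp)⟩

theorem IsLengths.nonneg {P : MacroPartition} {ν : ℝ} {N : ℕ} {a b c d : E3} {T : Tet} {h₁ h₃ : ℝ}
    (h : IsLengths P ν N a b c d T h₁ h₃) : 0 ≤ h₁ ∧ 0 ≤ h₃ := by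
  obtain ⟨i, j, p, q, p', q', -, -, h2, -, -, -, -, -, -, -, -, -, h1⟩ := h
  exact ⟨by rw [h1]; positivity, by rw [h2]; positivity⟩

end

/-- The estimate at an edge without singular vertex in the patch. -/
theorem exists_edge_patch_constant {P : MacroPartition} {μ ν : Tet → ℝ} {K : Tet}
    {a b c d : E3} (C₀ : ℝ) (hμ : 0 < μ K) (hμ1 : μ K ≤ 1) (hν : 0 < ν K)
    (hl : EdgeLabel P K a b c d) {δ : ℝ} (hδ0 : 0 ≤ δ) (hδ : δ < 1) : ∃ C : ℝ, 0 < C ∧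
    ∀ (M : GradedMesh P μ ν) (σ : E3 → E3) (T : Tet) (S : Set E3) (h₁ h₃ : ℝ),
      NeedleAtEdge M σ C₀ K a b c d T S h₁ h₃ →
      ∀ (o : E3) (e : OrthonormalBasis (Fin 3) ℝ E3), IsFrame P a b o e →
      ∀ (u : E3 → ℝ) (W : E3 → E3),
        ContinuousOn u (closure S) →
        (∀ x ∈ closure S ∩ segment ℝ a b, u x = 0) →
        HasWeakGradient S u W →
        vNorm o e δ δ S (partialOf e W 0) ≠ ⊤ →
        vNorm o e δ δ S (partialOf e W 1) ≠ ⊤ →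
        vNorm o e 0 0 S (partialOf e W 2) ≠ ⊤ →
        h1Seminorm T.opened (fun x => u x - quasiInterp M σ u x) ≤
          ENNReal.ofReal (C * h₁ ^ (1 - δ)) *
              (vNorm o e δ δ S (partialOf e W 0) + vNorm o e δ δ S (partialOf e W 1))
            + ENNReal.ofReal (C * h₃) * vNorm o e 0 0 S (partialOf e W 2) := by
  obtain ⟨C, hC, h⟩ := exists_interpolation_constant C₀ hμ hμ1 hν hl hδ0 hδ le_rfl one_pos
  refine ⟨C * C ^ (1 - δ) + C * C, by positivity,
    fun M σ T S h₁ h₃ hn o e hfr u W hcont hzero hW f0 f1 f2 => ?_⟩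
  obtain ⟨lam, D, hlam, hD, l1, -, l3, -, hint⟩ := h M σ T S h₁ h₃ hn
  obtain ⟨hh₁, hh₃⟩ := hn.lengths.nonneg
  -- With equal exponents the weight is R^δ θ^δ = r^δ, so s = δ and A = 1; for ∂₃u the weight is 1
  -- and s₃ = 0.
  refine (hint o e hfr u W ∅ δ δ 0 (Or.inl rfl) (by rwa [sdiff_empty]) (by rwa [sdiff_empty]) hW
    f0 f1 f2 1 zero_le_one (fun x hr hR _ => ?_) (fun x hr hR => ?_)).trans ?_
  · rw [one_mul, weight, ← Real.mul_rpow dist_nonneg (by positivity),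
      mul_div_cancel₀ _ (hr.trans_le hR).ne']
  · simp [weight]
  · refine add_le_add (mul_le_mul_left (ENNReal.ofReal_le_ofReal ?_) _)
      (mul_le_mul_left (ENNReal.ofReal_le_ofReal ?_) _)
    · have h1 := Real.rpow_le_rpow hlam.le l1 (by linarith : 0 ≤ 1 - δ)
      rw [Real.mul_rpow hC.le hh₁] at h1
      have h2 := mul_le_mul_of_nonneg_left h1 hC.le
      have h3 : 0 ≤ C * C * h₁ ^ (1 - δ) := by positivity
      linarith
    · have h2 := mul_le_mul_of_nonneg_left l3 hC.le
      have h3 : 0 ≤ C * C ^ (1 - δ) * h₃ := by positivity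
      rw [neg_zero, Real.rpow_zero, one_mul]
      linarith

/-- The estimate at the singular vertex. -/
theorem exists_vertex_patch_constant {P : MacroPartition} {μ ν : Tet → ℝ} {K : Tet}
    {a b c d : E3} (C₀ : ℝ) (hμ : 0 < μ K) (hμ1 : μ K ≤ 1) (hν : 0 < ν K)
    (hl : EdgeLabel P K a b c d) {β δ : ℝ} (hβ0 : 0 ≤ β) (hβ : β < 1) (hδ0 : 0 ≤ δ) (hδ : δ < 1)
    (hβδ : β + δ < 1) : ∃ C : ℝ, 0 < C ∧
    ∀ (M : GradedMesh P μ ν) (σ : E3 → E3) (T : Tet) (S : Set E3) (h₁ h₃ : ℝ),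
      NeedleAtEdge M σ C₀ K a b c d T S h₁ h₃ → a ∈ P.sVerts → a ∈ closure S →
      ∀ (o : E3) (e : OrthonormalBasis (Fin 3) ℝ E3), IsFrame P a b o e →
      ∀ (u : E3 → ℝ) (W : E3 → E3),
        ContinuousOn u (closure S \ {a}) →
        (∀ x ∈ (closure S ∩ segment ℝ a b) \ {a}, u x = 0) →
        HasWeakGradient S u W →
        vNorm o e β δ S (partialOf e W 0) ≠ ⊤ →
        vNorm o e β δ S (partialOf e W 1) ≠ ⊤ →
        vNorm o e β 0 S (partialOf e W 2) ≠ ⊤ →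
        h1Seminorm T.opened (fun x => u x - quasiInterp M σ u x) ≤
          ENNReal.ofReal (C * (h₁ ^ (1 - β - δ) * h₃ ^ δ)) *
              (vNorm o e β δ S (partialOf e W 0) + vNorm o e β δ S (partialOf e W 1))
            + ENNReal.ofReal (C * (h₁ ^ (-β) * h₃)) * vNorm o e β 0 S (partialOf e W 2) := by
  -- θ^δ ≥ θ^s requires s ≥ δ, and R^(s-β) ≤ (C D)^(s-β) requires s ≥ β; together they give r^s ≤ (C
  -- D)^(s-β) R^β θ^δ. Integrability requires s < 1, and the splitting of the powers of λ requires s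
  -- ≤ β + δ.
  set s := max β δ with hs
  have hs1 : s < 1 := max_lt hβ hδ
  have hsβ : β ≤ s := le_max_left _ _
  have hsδ : δ ≤ s := le_max_right _ _
  have hs2 : s ≤ β + δ := max_le (by linarith) (by linarith)
  obtain ⟨C, hC, h⟩ := exists_interpolation_constant C₀ hμ hμ1 hν hl (hβ0.trans hsβ) hs1 hβ0 hβ
  set C₁ := C * (C ^ (s - β) * C ^ (1 - β - δ) * C ^ (β + δ - s) * C ^ δ) with hC₁
  set C₂ := C * (C ^ β * C) with hC₂
  refine ⟨C₁ + C₂, by positivity,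
    fun M σ T S h₁ h₃ hn hav haS o e hfr u W hcont hzero hW f0 f1 f2 => ?_⟩
  obtain ⟨lam, D, hlam, hD, l1, l2, l3, l4, hint⟩ := h M σ T S h₁ h₃ hn
  obtain ⟨hh₁, hh₃⟩ := hn.lengths.nonneg
  obtain rfl := hfr.vertex hav
  refine (hint o e hfr u W {o} β δ β (Or.inr ⟨rfl, haS⟩) hcont hzero hW
    f0 f1 f2 ((C * D) ^ (s - β)) (by positivity) (fun x hr hR hx => ?_) (fun x hr hR => ?_)).trans ?_
  · have hR0 : 0 < dist x o := hr.trans_le hR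
    have hq : axisDist o e x / dist x o ≤ 1 := (div_le_one hR0).2 hR
    have hq0 : 0 < axisDist o e x / dist x o := div_pos hr hR0
    have h1 : dist x o ^ (s - β) ≤ (C * D) ^ (s - β) :=
      Real.rpow_le_rpow hR0.le (hx haS) (by linarith)
    have h2 := Real.rpow_le_rpow_of_exponent_ge hq0 hq hsδ
    have h3 : axisDist o e x ^ s = dist x o ^ (s - β) *
        (dist x o ^ β * (axisDist o e x / dist x o) ^ s) := by
      rw [← mul_assoc, ← Real.rpow_add hR0, sub_add_cancel, ← Real.mul_rpow hR0.le hq0.le,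
        mul_div_cancel₀ _ hR0.ne']
    rw [h3, weight]
    exact mul_le_mul h1 (mul_le_mul_of_nonneg_left h2 (by positivity)) (by positivity)
      (by positivity)
  · rw [weight, Real.rpow_zero, mul_one]
    exact Real.rpow_le_rpow hr.le hR hβ0
  · refine add_le_add (mul_le_mul_left (ENNReal.ofReal_le_ofReal ?_) _)
      (mul_le_mul_left (ENNReal.ofReal_le_ofReal ?_) _)
    -- The excess power λ^(β+δ-s) is traded for the same power of D; with A, of the order D^(s-β),
    -- it forms D^δ.
    · have e1 : lam ^ (1 - s) = lam ^ (1 - β - δ) * lam ^ (β + δ - s) := by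
        rw [← Real.rpow_add hlam]; congr 1; ring
      have h1 := Real.rpow_le_rpow hlam.le l1 (by linarith : 0 ≤ 1 - β - δ)
      rw [Real.mul_rpow hC.le hh₁] at h1
      have h2 := Real.rpow_le_rpow hlam.le l4 (by linarith : 0 ≤ β + δ - s)
      rw [Real.mul_rpow hC.le hD.le] at h2
      have h3 := Real.rpow_le_rpow hD.le l3 hδ0
      rw [Real.mul_rpow hC.le hh₃] at h3
      have e2 : D ^ (s - β) * D ^ (β + δ - s) = D ^ δ := by
        rw [← Real.rpow_add hD]; congr 1; ring
      rw [e1, Real.mul_rpow hC.le hD.le]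
      calc C * (C ^ (s - β) * D ^ (s - β) * (lam ^ (1 - β - δ) * lam ^ (β + δ - s)))
          ≤ C * (C ^ (s - β) * D ^ (s - β) * (C ^ (1 - β - δ) * h₁ ^ (1 - β - δ) *
            (C ^ (β + δ - s) * D ^ (β + δ - s)))) := by gcongr
        _ = C * (C ^ (s - β) * C ^ (1 - β - δ) * C ^ (β + δ - s)) * h₁ ^ (1 - β - δ) *
            (D ^ (s - β) * D ^ (β + δ - s)) := by ring
        _ ≤ C * (C ^ (s - β) * C ^ (1 - β - δ) * C ^ (β + δ - s)) * h₁ ^ (1 - β - δ) *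
            (C ^ δ * h₃ ^ δ) := by rw [e2]; gcongr
        _ = C₁ * (h₁ ^ (1 - β - δ) * h₃ ^ δ) := by rw [hC₁]; ring
        _ ≤ (C₁ + C₂) * (h₁ ^ (1 - β - δ) * h₃ ^ δ) := by
          refine mul_le_mul_of_nonneg_right ?_ (by positivity)
          have : 0 ≤ C₂ := by positivity
          linarith
    -- The negative power of λ calls for the reverse comparison h₁ ≤ C λ, and monotonicity of
    -- negative powers for h₁ > 0.
    · have hh₁0 : 0 < h₁ := by
        by_contra hc
        push Not at hc
        have := mul_nonpos_of_nonneg_of_nonpos hC.le hc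
        linarith
      have h1 : lam ^ (-β) ≤ C ^ β * h₁ ^ (-β) := by
        have h2 := Real.rpow_le_rpow_of_nonpos hh₁0 l2 (by linarith : -β ≤ 0)
        rw [Real.mul_rpow hC.le hlam.le] at h2
        have h3 : C ^ β * C ^ (-β) = 1 := by rw [← Real.rpow_add hC]; simp
        calc lam ^ (-β) = C ^ β * (C ^ (-β) * lam ^ (-β)) := by rw [← mul_assoc, h3, one_mul]
          _ ≤ _ := mul_le_mul_of_nonneg_left h2 (by positivity)
      calc C * (lam ^ (-β) * D) ≤ C * (C ^ β * h₁ ^ (-β) * (C * h₃)) := by gcongr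
        _ = C₂ * (h₁ ^ (-β) * h₃) := by rw [hC₂]; ring
        _ ≤ (C₁ + C₂) * (h₁ ^ (-β) * h₃) := by
          refine mul_le_mul_of_nonneg_right ?_ (by positivity)
          have : 0 ≤ C₁ := by positivity
          linarith

end

theorem mainTheorem5 (P : MacroPartition) (μ ν : Tet → ℝ)
    (hμ : ∀ K ∈ P.elems, 0 < μ K ∧ μ K ≤ 1) (hν : ∀ K ∈ P.elems, 0 < ν K ∧ ν K ≤ 1) (C₀ : ℝ) :
    (∀ δ : ℝ, 0 ≤ δ → δ < 1 → ∃ C : ℝ, 0 < C ∧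
      ∀ (M : GradedMesh P μ ν) (σ : E3 → E3) (K : Tet) (a b c d : E3) (T : Tet) (S : Set E3)
        (h₁ h₃ : ℝ), NeedleAtEdge M σ C₀ K a b c d T S h₁ h₃ →
      ∀ (o : E3) (e : OrthonormalBasis (Fin 3) ℝ E3), IsFrame P a b o e →
      ∀ (u : E3 → ℝ) (W : E3 → E3),
        ContinuousOn u (closure S) →
        (∀ x ∈ closure S ∩ segment ℝ a b, u x = 0) →
        HasWeakGradient S u W →
        vNorm o e δ δ S (partialOf e W 0) ≠ ⊤ →
        vNorm o e δ δ S (partialOf e W 1) ≠ ⊤ →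
        vNorm o e 0 0 S (partialOf e W 2) ≠ ⊤ →
        h1Seminorm T.opened (fun x => u x - quasiInterp M σ u x) ≤
          ENNReal.ofReal (C * h₁ ^ (1 - δ)) *
              (vNorm o e δ δ S (partialOf e W 0) + vNorm o e δ δ S (partialOf e W 1))
            + ENNReal.ofReal (C * h₃) * vNorm o e 0 0 S (partialOf e W 2)) ∧
    (∀ β δ : ℝ, 0 ≤ β → β < 1 → 0 ≤ δ → δ < 1 → β + δ < 1 → ∃ C : ℝ, 0 < C ∧
      ∀ (M : GradedMesh P μ ν) (σ : E3 → E3) (K : Tet) (a b c d : E3) (T : Tet) (S : Set E3)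
        (h₁ h₃ : ℝ), NeedleAtEdge M σ C₀ K a b c d T S h₁ h₃ →
      a ∈ P.sVerts → a ∈ closure S →
      ∀ (o : E3) (e : OrthonormalBasis (Fin 3) ℝ E3), IsFrame P a b o e →
      ∀ (u : E3 → ℝ) (W : E3 → E3),
        ContinuousOn u (closure S \ {a}) →
        (∀ x ∈ (closure S ∩ segment ℝ a b) \ {a}, u x = 0) →
        HasWeakGradient S u W →
        vNorm o e β δ S (partialOf e W 0) ≠ ⊤ →
        vNorm o e β δ S (partialOf e W 1) ≠ ⊤ →
        vNorm o e β 0 S (partialOf e W 2) ≠ ⊤ →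
        h1Seminorm T.opened (fun x => u x - quasiInterp M σ u x) ≤
          ENNReal.ofReal (C * (h₁ ^ (1 - β - δ) * h₃ ^ δ)) *
              (vNorm o e β δ S (partialOf e W 0) + vNorm o e β δ S (partialOf e W 1))
            + ENNReal.ofReal (C * (h₁ ^ (-β) * h₃)) * vNorm o e β 0 S (partialOf e W 2)) := by

  refine ⟨fun δ hδ0 hδ => ?_, fun β δ hβ0 hβ hδ0 hδ hβδ => ?_⟩
  -- The constants so far depend on the macro-element and its labelling; there are finitely many of
  -- them, and the estimates are monotone in the constant because `h₁` and `h₃` are nonnegative.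
  · obtain ⟨C, hC, h⟩ := exists_uniform_label P
      (fun K a b c d C C' hCC h M σ T S h₁ h₃ hn o e hfr u W hcont hzero hW f0 f1 f2 =>
        have hl := hn.lengths.nonneg
        (h M σ T S h₁ h₃ hn o e hfr u W hcont hzero hW f0 f1 f2).trans (add_le_add
          (mul_le_mul_left (ENNReal.ofReal_le_ofReal
            (mul_le_mul_of_nonneg_right hCC (Real.rpow_nonneg hl.1 _))) _)
          (mul_le_mul_left (ENNReal.ofReal_le_ofReal (mul_le_mul_of_nonneg_right hCC hl.2)) _)))
      (fun K a b c d hl => exists_edge_patch_constant C₀ (hμ K hl.mem).1 (hμ K hl.mem).2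
        (hν K hl.mem).1 hl hδ0 hδ)
    exact ⟨C, hC, fun M σ K a b c d T S h₁ h₃ hn => h K a b c d hn.label M σ T S h₁ h₃ hn⟩
  · obtain ⟨C, hC, h⟩ := exists_uniform_label P
      (fun K a b c d C C' hCC h M σ T S h₁ h₃ hn ha haS o e hfr u W hcont hzero hW f0 f1 f2 =>
        have hl := hn.lengths.nonneg
        (h M σ T S h₁ h₃ hn ha haS o e hfr u W hcont hzero hW f0 f1 f2).trans (add_le_add
          (mul_le_mul_left (ENNReal.ofReal_le_ofReal (mul_le_mul_of_nonneg_right hCC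
            (mul_nonneg (Real.rpow_nonneg hl.1 _) (Real.rpow_nonneg hl.2 _)))) _)
          (mul_le_mul_left (ENNReal.ofReal_le_ofReal (mul_le_mul_of_nonneg_right hCC
            (mul_nonneg (Real.rpow_nonneg hl.1 _) hl.2))) _)))
      (fun K a b c d hl => exists_vertex_patch_constant C₀ (hμ K hl.mem).1 (hμ K hl.mem).2
        (hν K hl.mem).1 hl hβ0 hβ hδ0 hδ hβδ)
    exact ⟨C, hC, fun M σ K a b c d T S h₁ h₃ hn => h K a b c d hn.label M σ T S h₁ h₃ hn⟩
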